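/- Let $\hat T=\{(x_1,x_2)\in\mathbb R^2:\ 0<x_1<1,\ 0<x_2<x_1\}$, with edges $\hat e_1$ (on the $x_1$-axis), $\hat e_2$ (parallel to the $x_2$-axis) and $\hat e_3$ (oblique) and outward unit normal $n$. All functions are real-valued. For $s>0$ let $H^s(\hat T)$ be the Sobolev (Sobolev–Slobodeckij) space with its usual norm, let $\|\cdot\|_{0,\hat T}$ be the norm of $L^2(\hat T)$, and let $\mathbf H(\mathrm{div},\hat T)$ be the space of fields in $L^2(\hat T)^2$ whose weak divergence is in $L^2(\hat T)$. For $0<s\le 1/2$ put $$|v|_{AH^s_1(\hat T)}^2=\int_0^1|v(\cdot,x_2)|^2_{H^s(x_2,1)}\,dx_2,\qquad |v|_{AH^s_2(\hat T)}^2=\int_0^1|v(x_1,\cdot)|^2_{H^s(0,x_1)}\,dx_1,$$ where $|\cdot|_{H^s(a,b)}$ is the Slobodeckij seminorm. For $u=(u_1,u_2)\in H^s(\hat T)^2\cap\mathbf H(\mathrm{div},\hat T)$, $s>0$, the flux over an edge $\hat e_i$ is defined by $$(u\cdot n,1)_{\hat e_i}:=(u,\nabla\varphi)_{0,\hat T}+\int_{\hat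 T}\varphi\,\mathrm{div}\,u ,$$ where $0<\varepsilon<\min(s,1/2)$, $\varphi\in H^{1-\varepsilon}(\hat T)$ has the trace $1$ on $\hat e_i$ and $0$ on the other two edges, and $(u,\nabla\varphi)_{0,\hat T}$ is the duality pairing that extends the $L^2$ inner product continuously from smooth $\varphi$. The lowest-order Raviart–Thomas interpolant $\hat\Pi_{\rm RT}u$ is the field of the form $(a,b)^\top+c\,(x_1,x_2)^\top$, $a,b,c\in\mathbb R$, with $\int_{\hat e_i}\hat\Pi_{\rm RT}u\cdot n\,ds=(u\cdot n,1)_{\hat e_i}$ for $i=1,2,3$. For every $s>0$ the interpolant $\hat\Pi_{\rm RT}u$ exists and is unique (independently of the choice of $\varepsilon$ and $\varphi$) for every $u\in H^s(\hat T)^2\cap\mathbf H(\mathrm{div},\hat T)$, and there is a constant $C$ depending only on $s$ such that for all such $u$ and for $l=1,2$ (indices modulo $2$): (i) if $s>1/2$, then $$\|(\hat\Pi_{\rm RT}u)_l\|_{0,\hat T}\le C\big(\|u_l\|_{H^s(\hat T)}+\|\mathrm{div}\,u\|_{0,\hat T}\big);$$ (ii) if $0<s\le 1/2$, then $$\|(\hat\Pi_{\rm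 RT}u)_l\|_{0,\hat T}\le C\big(\|u_l\|_{H^s(\hat T)}+|u_{l+1}|_{AH^s_{l+1}(\hat T)}+\|\mathrm{div}\,u\|_{0,\hat T}\big).$$ -/

import Mathlib

open MeasureTheory Filter Topology Set
open scoped ENNReal NNReal ContDiff

noncomputable section

namespace RTTriangle

/-! ### Points, partial derivatives, test functions

The plane is `ℝ × ℝ` with its product Lebesgue measure.  A vector field is `u : Fin 2 → ℝ × ℝ → ℝ`:
the component `u_1` is `u 0`, the component `u_2` is `u 1`, and addition of indices in `Fin 2` is
addition modulo 2. -/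

/-- The standard unit vectors of the plane. -/
def basisVec (i : Fin 2) : ℝ × ℝ := if i = 0 then (1, 0) else (0, 1)

/-- The classical partial derivative in direction `i`. -/
def pderiv (i : Fin 2) (f : ℝ × ℝ → ℝ) : ℝ × ℝ → ℝ := fun x => fderiv ℝ f x (basisVec i)

/-- The classical partial derivative with multi-index `α`. -/
def multiDeriv (α : ℕ × ℕ) (f : ℝ × ℝ → ℝ) : ℝ × ℝ → ℝ :=
  (pderiv 0)^[α.1] ((pderiv 1)^[α.2] f)

/-- Smooth functions with compact support in `Ω`. -/
def IsTest (Ω : Set (ℝ × ℝ)) (ψ : ℝ × ℝ → ℝ) : Prop :=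
  ContDiff ℝ ∞ ψ ∧ HasCompactSupport ψ ∧ tsupport ψ ⊆ Ω

/-! ### Sobolev spaces -/

/-- The square of the (Euclidean) Sobolev-Slobodeckij seminorm of order `σ ∈ (0, 1)` on a plane
set `Ω`: the double integral over `Ω × Ω` of `|f x - f y|² / |x - y|^(2 + 2σ)`. -/
def slobodeckijSq (Ω : Set (ℝ × ℝ)) (σ : ℝ) (f : ℝ × ℝ → ℝ) : ℝ≥0∞ :=
  ∫⁻ x in Ω, ∫⁻ y in Ω,
    ENNReal.ofReal ((f x - f y) ^ 2 /
      (Real.sqrt ((x.1 - y.1) ^ 2 + (x.2 - y.2) ^ 2)) ^ (2 + 2 * σ))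

/-- The square of the Sobolev-Slobodeckij seminorm of order `σ ∈ (0, 1)` on a set `I` of reals. -/
def slobodeckijSqLine (I : Set ℝ) (σ : ℝ) (g : ℝ → ℝ) : ℝ≥0∞ :=
  ∫⁻ x in I, ∫⁻ y in I, ENNReal.ofReal ((g x - g y) ^ 2 / |x - y| ^ (1 + 2 * σ))

/-- `D` is a family of square-integrable weak derivatives of `f` on `Ω` up to order `m`;
only the values `D α` with `|α| ≤ m` matter. -/
def IsWeakDerivFamily (Ω : Set (ℝ × ℝ)) (m : ℕ) (f : ℝ × ℝ → ℝ)
    (D : ℕ × ℕ → ℝ × ℝ → ℝ) : Prop :=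
  D (0, 0) = f ∧
  ∀ α : ℕ × ℕ, α.1 + α.2 ≤ m →
    MemLp (D α) 2 (volume.restrict Ω) ∧
    ∀ ψ, IsTest Ω ψ →
      ∫ x in Ω, f x * multiDeriv α ψ x = (-1) ^ (α.1 + α.2) * ∫ x in Ω, D α x * ψ x

/-- The norm of `H^s(Ω)`, `s ≥ 0`, with values in `[0, ∞]`.  With `m = ⌊s⌋` its square is the sum of
the squared `L²`-norms of all weak derivatives of order at most `m` and, if `s` is not an integer,
of the squared Slobodeckij seminorms of order `s - m` of the weak derivatives of order `m`.
(Weak derivatives are unique up to null sets, so all the values under the infimum coincide; the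
norm is `∞` if some weak derivative does not exist in `L²`.)  For `0 < s < 1` the square is just
`‖f‖² + |f|_s²` when `f` is in `L²`. -/
def sobolevNorm (Ω : Set (ℝ × ℝ)) (s : ℝ) (f : ℝ × ℝ → ℝ) : ℝ≥0∞ :=
  (⨅ (D : ℕ × ℕ → ℝ × ℝ → ℝ) (_ : IsWeakDerivFamily Ω ⌊s⌋₊ f D),
    ((∑ k ∈ Finset.range (⌊s⌋₊ + 1), ∑ α ∈ Finset.HasAntidiagonal.antidiagonal k,
        (eLpNorm (D α) 2 (volume.restrict Ω)) ^ 2) +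
      if s = ⌊s⌋₊ then 0
      else ∑ α ∈ Finset.HasAntidiagonal.antidiagonal ⌊s⌋₊, slobodeckijSq Ω (s - ⌊s⌋₊) (D α))) ^ (1 / 2 : ℝ)

/-- Membership in `H^s(Ω)`, `s ≥ 0`. -/
def MemSobolev (Ω : Set (ℝ × ℝ)) (s : ℝ) (f : ℝ × ℝ → ℝ) : Prop :=
  MemLp f 2 (volume.restrict Ω) ∧ sobolevNorm Ω s f < ⊤

/-- `u ∈ H(div, Ω)` with weak divergence `d ∈ L²(Ω)`. -/
def HasDivL2 (Ω : Set (ℝ × ℝ)) (u : Fin 2 → ℝ × ℝ → ℝ) (d : ℝ × ℝ → ℝ) : Prop :=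
  (∀ i, MemLp (u i) 2 (volume.restrict Ω)) ∧ MemLp d 2 (volume.restrict Ω) ∧
  ∀ ψ, IsTest Ω ψ →
    ∫ x in Ω, ∑ i, u i x * pderiv i ψ x = - ∫ x in Ω, d x * ψ x

/-! ### The reference triangle -/

/-- The open reference triangle `0 < x_1 < 1`, `0 < x_2 < x_1`. -/
def refTriangle : Set (ℝ × ℝ) := {x | 0 < x.1 ∧ x.1 < 1 ∧ 0 < x.2 ∧ x.2 < x.1}

/-- The anisotropic seminorms: `anisoSeminorm s 0` is `|·|_{AH_1^s}`, with slices parallel to the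
`x_1`-axis, and `anisoSeminorm s 1` is `|·|_{AH_2^s}`, with slices parallel to the `x_2`-axis. -/
def anisoSeminorm (s : ℝ) (l : Fin 2) (f : ℝ × ℝ → ℝ) : ℝ≥0∞ :=
  (if l = 0 then ∫⁻ x₂ in Ioo (0 : ℝ) 1, slobodeckijSqLine (Ioo x₂ 1) s (fun t => f (t, x₂))
   else ∫⁻ x₁ in Ioo (0 : ℝ) 1, slobodeckijSqLine (Ioo 0 x₁) s (fun t => f (x₁, t))) ^ (1 / 2 : ℝ)

/-- Affine parametrizations over `(0, 1)` of the three edges: on the `x_1`-axis, parallel to the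
`x_2`-axis, and oblique. -/
def edgePoint (e : Fin 3) (t : ℝ) : ℝ × ℝ := ![(t, 0), (1, t), (t, t)] e

/-- The lengths of the edges. -/
def edgeLength (e : Fin 3) : ℝ := ![1, 1, Real.sqrt 2] e

/-- The outward unit normals on the edges. -/
def edgeNormal (e : Fin 3) : Fin 2 → ℝ :=
  ![![0, -1], ![1, 0], ![-(1 / Real.sqrt 2), 1 / Real.sqrt 2]] e

/-- The classical flux `∫_e w · n ds` of a continuous field. -/
def edgeFlux (w : Fin 2 → ℝ × ℝ → ℝ) (e : Fin 3) : ℝ :=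
  edgeLength e * ∫ t in (0 : ℝ)..1, ∑ i, w i (edgePoint e t) * edgeNormal e i

/-- The lowest order Raviart-Thomas space `(a, b) + c (x_1, x_2)`. -/
def IsRT0 (w : Fin 2 → ℝ × ℝ → ℝ) : Prop :=
  ∃ a b c : ℝ, w = ![fun x => a + c * x.1, fun x => b + c * x.2]

/-! ### Traces, the duality pairing and the degrees of freedom -/

/-- The functions `φ n`, smooth up to the boundary, converge to `φ` in `H^r` of the triangle. -/
def SmoothApprox (r : ℝ) (φ : ℝ × ℝ → ℝ) (φn : ℕ → ℝ × ℝ → ℝ) : Prop :=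
  (∀ n, ContDiff ℝ ∞ (φn n)) ∧
  Tendsto (fun n => sobolevNorm refTriangle r (fun x => φn n x - φ x)) atTop (𝓝 0)

/-- `φ ∈ H^r`, `1/2 < r < 1`, has the trace `1` on the edge `e` and `0` on the other two edges.
The trace is the continuous extension of the restriction to the boundary, from smooth functions
with the `H^r`-norm to `L²` of the boundary. -/
def HasEdgeIndicatorTrace (r : ℝ) (φ : ℝ × ℝ → ℝ) (e : Fin 3) : Prop :=
  ∃ φn : ℕ → ℝ × ℝ → ℝ, SmoothApprox r φ φn ∧
    ∀ e' : Fin 3, Tendsto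
      (fun n => eLpNorm (fun t => φn n (edgePoint e' t) - (if e' = e then 1 else 0)) 2
        (volume.restrict (Ioo (0 : ℝ) 1))) atTop (𝓝 0)

/-- `p` is the value of the duality pairing `(u, ∇φ)` on the triangle, for `u ∈ H^s` and
`φ ∈ H^r` with `1 - s < r`, `1/2 < r < 1`: the continuous extension in `φ` of the `L²` inner
product from smooth functions to `H^r`. -/
def IsGradPairing (r : ℝ) (u : Fin 2 → ℝ × ℝ → ℝ) (φ : ℝ × ℝ → ℝ) (p : ℝ) : Prop :=
  ∀ φn : ℕ → ℝ × ℝ → ℝ, SmoothApprox r φ φn →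
    Tendsto (fun n => ∫ x in refTriangle, ∑ i, u i x * pderiv i (φn n) x) atTop (𝓝 p)

/-- `F` is the weak normal flux `(u · n, 1)` over the edge `e` of a field `u ∈ H^s` with
divergence `d ∈ L²`: `F = (u, ∇φ) + ∫ d φ` for a function `φ ∈ H^(1-ε)`, `0 < ε < min(s, 1/2)`,
whose trace is `1` on `e` and `0` on the other edges. -/
def HasNormalFlux (s : ℝ) (u : Fin 2 → ℝ × ℝ → ℝ) (d : ℝ × ℝ → ℝ) (e : Fin 3) (F : ℝ) : Prop :=
  ∃ (ε : ℝ) (φ : ℝ × ℝ → ℝ) (p : ℝ), 0 < ε ∧ ε < s ∧ ε < 1 / 2 ∧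
    MemSobolev refTriangle (1 - ε) φ ∧ HasEdgeIndicatorTrace (1 - ε) φ e ∧
    IsGradPairing (1 - ε) u φ p ∧ F = p + ∫ x in refTriangle, d x * φ x

/-- `w` is the Raviart-Thomas interpolant of `u` (with divergence `d`): it lies in the
Raviart-Thomas space and its edge fluxes are the weak normal fluxes of `u`. -/
def IsRTInterpolant (s : ℝ) (u : Fin 2 → ℝ × ℝ → ℝ) (d : ℝ × ℝ → ℝ)
    (w : Fin 2 → ℝ × ℝ → ℝ) : Prop :=
  IsRT0 w ∧ ∀ e : Fin 3, HasNormalFlux s u d e (edgeFlux w e)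

/-- `u ∈ H^s ∩ H(div)` on the reference triangle, with divergence `d`. -/
def IsAdmissible (s : ℝ) (u : Fin 2 → ℝ × ℝ → ℝ) (d : ℝ × ℝ → ℝ) : Prop :=
  (∀ i, MemSobolev refTriangle s (u i)) ∧ HasDivL2 refTriangle u d

/-- The `L²`-norm on the reference triangle. -/
def l2Norm (f : ℝ × ℝ → ℝ) : ℝ≥0∞ := eLpNorm f 2 (volume.restrict refTriangle)

end RTTriangle

end

namespace RTTriangle

/-! ### Geometry of the triangle and affine changes of variables -/

/-! The normal component of `(a + c x₁, b + c x₂)` is constant on each edge, and the three fluxes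
are `-b`, `a + c`, `b - a` (`edgeFlux_rt`). They determine `a`, `b`, `c`, so the interpolant is well
posed as soon as the weak fluxes of `u` exist and are unique. Since the fluxes of `u` add up to `∫
div u`, also `c = ∫ div u`. Hence the second component is controlled by the flux over the first edge
and by `div u`, the first component by the flux over the second edge. The symmetry `mapJ` swaps
these two edges, so only the first one has to be estimated.

Existence rests on a bilinear bound: for `1/2 < r < 1` and `r + s > 1`, the integral of `u ∂ᵢψ` is
at most a constant times the `H^s`-norm of `u` and the `H^r`-seminorm of `ψ` (`exists_pairing_le`).
It comes from iterated subdivision of the triangle into four similar ones: each generation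
contributes `2^(1-r-s)` times the previous one (`pairing_iteration`). Uniqueness holds because two
admissible `φ` differ by a function of vanishing trace. Hardy's inequality (`exists_hardySq_le`) and
boundary cut-offs make such a function an `H^r`-limit of test functions (`exists_isTest_tendsto`),
on which the pairing is given by the weak divergence (`flux_unique_aux`).

The estimates use one explicit family of `φ`, namely `(x₁ - x₂)/x₁ · (1 - x₁)/(1 - x₁ + x₂)` times a
cut-off in the height `x₂` at scale `1/κ` (`edgeBump`). It is one on the first edge up to its end
points and zero on the other edges, and the gradient of the product of the two quotients is bounded
by the inverse distances to the two end points. The flux does not depend on `κ`, which may therefore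
be chosen at will.

For `s > 1/2`, let `κ → ∞`. The derivative in `x₁` does not see the cut-off, so its contribution is
the integral of a fixed integrable function over a shrinking strip and disappears together with
`u₁`. The derivative in `x₂` is of size `κ` on a strip of height about `1/κ`, and means of `|u₂|`
over such strips are bounded by the `H^s`-norm (`exists_lintegral_strip_le`).

For `s ≤ 1/2` such strip means are not controlled, so `κ = 4` is kept fixed. The `u₂` term is
bounded by the bilinear estimate. In the `u₁` term the integral of `∂₁φ` over each horizontal slice
is zero, because `φ` vanishes at both ends of the slice. A constant may thus be subtracted from `u₁`
on each slice, and only the anisotropic seminorm remains (`exists_enorm_integral_mul_pderiv_le`).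

All this takes place at orders below one. For `s ≥ 1` the space `H^s` is embedded into `H^(3/4)` by
estimating translations (`exists_fractional_embedding`). -/

theorem measurableSet_refTriangle : MeasurableSet refTriangle := by
  unfold refTriangle
  refine (measurableSet_lt measurable_const measurable_fst).inter
    ((measurableSet_lt measurable_fst measurable_const).inter
      ((measurableSet_lt measurable_const measurable_snd).inter
        (measurableSet_lt measurable_snd measurable_fst)))

theorem isOpen_refTriangle : IsOpen refTriangle := by
  unfold refTriangle
  refine (isOpen_lt continuous_const continuous_fst).inter
    ((isOpen_lt continuous_fst continuous_const).inter
      ((isOpen_lt continuous_const continuous_snd).inter (isOpen_lt continuous_snd continuous_fst)))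

theorem refTriangle_subset : refTriangle ⊆ Ioo (0 : ℝ) 1 ×ˢ Ioo (0 : ℝ) 1 := by
  rintro ⟨x, y⟩ ⟨h1, h2, h3, h4⟩
  exact ⟨⟨h1, h2⟩, ⟨h3, h4.trans h2⟩⟩

theorem volume_refTriangle_le : volume refTriangle ≤ 1 := by
  refine (measure_mono refTriangle_subset).trans ?_
  rw [Measure.volume_eq_prod, Measure.prod_prod]
  simp

instance isFiniteMeasure_restrict_refTriangle :
    IsFiniteMeasure (volume.restrict refTriangle) :=
  ⟨by rw [Measure.restrict_apply_univ]; exact volume_refTriangle_le.trans_lt ENNReal.one_lt_top⟩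

theorem volume_refTriangle_pos : 0 < volume refTriangle :=
  isOpen_refTriangle.measure_pos _ ⟨(1 / 2, 1 / 4), by norm_num [refTriangle]⟩

theorem norm_sub_le_one {X Y : ℝ × ℝ} (hX : X ∈ refTriangle) (hY : Y ∈ refTriangle) :
    ‖X - Y‖ ≤ 1 := by
  obtain ⟨h1, h2, h3, h4⟩ := hX
  obtain ⟨k1, k2, k3, k4⟩ := hY
  rw [Prod.norm_def, max_le_iff, Real.norm_eq_abs, Real.norm_eq_abs, abs_le, abs_le]
  simp only [Prod.fst_sub, Prod.snd_sub]
  refine ⟨⟨?_, ?_⟩, ?_, ?_⟩ <;> linarith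

/-- The affine map `(x, y) ↦ (a x + b y + p, c x + d y + q)`. -/
def affMap (a b c d p q : ℝ) : ℝ × ℝ → ℝ × ℝ :=
  fun X => (a * X.1 + b * X.2 + p, c * X.1 + d * X.2 + q)

theorem contDiff_affMap (a b c d p q : ℝ) : ContDiff ℝ ∞ (affMap a b c d p q) := by
  unfold affMap; fun_prop

@[fun_prop]
theorem measurable_affMap (a b c d p q : ℝ) : Measurable (affMap a b c d p q) :=
  (contDiff_affMap a b c d p q).continuous.measurable

theorem injective_affMap {a b c d : ℝ} (p q : ℝ) (h : a * d - b * c ≠ 0) :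
    Function.Injective (affMap a b c d p q) := by
  rintro ⟨x, y⟩ ⟨x', y'⟩ hxy
  simp only [affMap, Prod.mk.injEq] at hxy ⊢
  obtain ⟨h1, h2⟩ := hxy
  constructor
  · apply mul_left_cancel₀ h; linear_combination d * h1 - b * h2
  · apply mul_left_cancel₀ h; linear_combination a * h2 - c * h1

/-- The linear part of `affMap`. -/
noncomputable def linMap (a b c d : ℝ) : ℝ × ℝ →L[ℝ] ℝ × ℝ :=
  (Matrix.toLin (.finTwoProd ℝ) (.finTwoProd ℝ) !![a, b; c, d]).toContinuousLinearMap

theorem linMap_apply (a b c d : ℝ) (X : ℝ × ℝ) :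
    linMap a b c d X = (a * X.1 + b * X.2, c * X.1 + d * X.2) := by
  simp [linMap, Matrix.toLin_finTwoProd_apply]

theorem hasFDerivAt_affMap (a b c d p q : ℝ) (X : ℝ × ℝ) :
    HasFDerivAt (affMap a b c d p q) (linMap a b c d) X := by
  have : affMap a b c d p q = fun X => linMap a b c d X + (p, q) := by
    ext X <;> simp [linMap_apply, affMap]
  rw [this]
  exact (linMap a b c d).hasFDerivAt.add_const _

theorem det_linMap (a b c d : ℝ) : (linMap a b c d).det = a * d - b * c := by
  unfold linMap
  simp only [LinearMap.det_toContinuousLinearMap, LinearMap.det_toLin, Matrix.det_fin_two_of]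

theorem lintegral_affMap_image {a b c d : ℝ} (p q : ℝ) (h : a * d - b * c ≠ 0)
    {S : Set (ℝ × ℝ)} (hS : MeasurableSet S) (f : ℝ × ℝ → ℝ≥0∞) :
    ∫⁻ x in affMap a b c d p q '' S, f x =
      ENNReal.ofReal |a * d - b * c| * ∫⁻ x in S, f (affMap a b c d p q x) := by
  rw [lintegral_image_eq_lintegral_abs_det_fderiv_mul volume hS
    (fun x _ => (hasFDerivAt_affMap a b c d p q x).hasFDerivWithinAt)
    (injective_affMap p q h).injOn, det_linMap]
  rw [lintegral_const_mul' _ _ ENNReal.ofReal_ne_top]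

theorem integral_affMap_image {a b c d : ℝ} (p q : ℝ) (h : a * d - b * c ≠ 0)
    {S : Set (ℝ × ℝ)} (hS : MeasurableSet S) (f : ℝ × ℝ → ℝ) :
    ∫ x in affMap a b c d p q '' S, f x =
      |a * d - b * c| * ∫ x in S, f (affMap a b c d p q x) := by
  rw [integral_image_eq_integral_abs_det_fderiv_smul volume hS
    (fun x _ => (hasFDerivAt_affMap a b c d p q x).hasFDerivWithinAt)
    (injective_affMap p q h).injOn, det_linMap]
  simp only [smul_eq_mul]
  rw [integral_const_mul]

/-- An affine map of determinant `±1` which permutes the triangle preserves its measure. -/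
theorem measurePreserving_affMap {a b c d p q : ℝ} (h : |a * d - b * c| = 1)
    (hT : affMap a b c d p q '' refTriangle = refTriangle) :
    MeasurePreserving (affMap a b c d p q) (volume.restrict refTriangle)
      (volume.restrict refTriangle) := by
  refine ⟨by fun_prop, ?_⟩
  have h0 : a * d - b * c ≠ 0 := by intro h0; simp [h0] at h
  ext S hS
  rw [Measure.map_apply (by fun_prop) hS]
  have e := lintegral_affMap_image p q h0 measurableSet_refTriangle (S.indicator 1)
  rw [hT, h, ENNReal.ofReal_one, one_mul, lintegral_indicator_one hS] at e
  rw [e, ← lintegral_indicator_one (measurable_affMap a b c d p q hS)]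
  rfl

/-! ### Integrals of radial kernels -/

/-- Polar coordinates for an arbitrary norm of the plane; the weight `t` is the power `dim - 1`. -/
theorem lintegral_radial_lt_top {f : ℝ → ℝ} (hf0 : ∀ t, 0 ≤ f t)
    (h : IntegrableOn (fun t => t * f t) (Ioi 0)) :
    ∫⁻ z : ℝ × ℝ, ENNReal.ofReal (f ‖z‖) < ⊤ := by
  have : Integrable (fun z : ℝ × ℝ => f ‖z‖) := by
    rw [integrable_fun_norm_addHaar volume (f := f)]
    simpa [Module.finrank_prod] using h
  have h2 := this.2
  rw [hasFiniteIntegral_iff_ofReal (Eventually.of_forall fun z => hf0 _)] at h2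
  exact h2

/-- Scaling by `r` about `Y` reduces to `r = 1`. There the radial density is `t^(1-2σ)` near zero
and `t^(-1-2σ)` near infinity, integrable exactly for `0 < σ < 1`. With `r` the distance to a
singular set this turns a bounded function with local Lipschitz constant `1/r` into the Hardy weight
`r^(-2σ)`. -/
theorem exists_lintegral_min_kernel_le {σ : ℝ} (h0 : 0 < σ) (h1 : σ < 1) :
    ∃ C : ℝ≥0, ∀ (Y : ℝ × ℝ) (r : ℝ), 0 < r →
      ∫⁻ X, ENNReal.ofReal (min 1 (‖X - Y‖ / r) ^ 2 / ‖X - Y‖ ^ (2 + 2 * σ)) ≤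
        C * ENNReal.ofReal (r ^ (-(2 * σ))) := by
  let f : ℝ → ℝ := fun t => min 1 t ^ 2 / t ^ (2 + 2 * σ)
  have hfin : ∫⁻ z : ℝ × ℝ, ENNReal.ofReal (f |‖z‖|) < ⊤ := by
    refine lintegral_radial_lt_top (f := fun t => f |t|) ?_ ?_
    · intro t; positivity
    · rw [← Ioc_union_Ioi_eq_Ioi zero_le_one]
      refine IntegrableOn.union ?_ ?_
      · have : IntegrableOn (fun t : ℝ => t ^ (1 - 2 * σ)) (Ioc 0 1) := by
          rw [← intervalIntegrable_iff_integrableOn_Ioc_of_le zero_le_one]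
          exact intervalIntegral.intervalIntegrable_rpow' (by linarith)
        refine this.congr_fun ?_ measurableSet_Ioc
        intro t ht
        simp only [f, abs_of_pos ht.1, min_eq_right ht.2]
        rw [Real.rpow_sub ht.1, Real.rpow_one, Real.rpow_add ht.1]
        have := ht.1
        have h3 : t ^ (2 * σ) ≠ 0 := by positivity
        norm_num
        field_simp
      · have : IntegrableOn (fun t : ℝ => t ^ (-1 - 2 * σ)) (Ioi 1) :=
          integrableOn_Ioi_rpow_of_lt (by linarith) one_pos
        refine this.congr_fun ?_ measurableSet_Ioi
        intro t (ht : 1 < t)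
        have ht0 : 0 < t := by linarith
        simp only [f, abs_of_pos ht0, min_eq_left ht.le]
        rw [Real.rpow_sub ht0, Real.rpow_neg_one, Real.rpow_add ht0]
        have h3 : t ^ (2 * σ) ≠ 0 := by positivity
        norm_num
        field_simp
  simp only [abs_norm] at hfin
  refine ⟨(∫⁻ z : ℝ × ℝ, ENNReal.ofReal (f ‖z‖)).toNNReal, fun Y r hr => ?_⟩
  rw [ENNReal.coe_toNNReal hfin.ne]
  have himg : affMap r 0 0 r Y.1 Y.2 '' univ = univ := by
    refine eq_univ_of_forall fun X => ⟨((X.1 - Y.1) / r, (X.2 - Y.2) / r), mem_univ _, ?_⟩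
    ext <;> simp [affMap] <;> field_simp <;> ring
  have hdet : r * r - 0 * 0 ≠ 0 := by nlinarith [mul_pos hr hr]
  rw [← setLIntegral_univ, ← himg, lintegral_affMap_image _ _ hdet MeasurableSet.univ,
    setLIntegral_univ]
  have e : ∀ z : ℝ × ℝ, ENNReal.ofReal (min 1 (‖affMap r 0 0 r Y.1 Y.2 z - Y‖ / r) ^ 2 /
      ‖affMap r 0 0 r Y.1 Y.2 z - Y‖ ^ (2 + 2 * σ)) =
      ENNReal.ofReal (r ^ (-(2 + 2 * σ))) * ENNReal.ofReal (f ‖z‖) := by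
    intro z
    have hz : affMap r 0 0 r Y.1 Y.2 z - Y = r • z := by
      ext <;> simp [affMap]
    rw [hz, norm_smul, Real.norm_eq_abs, abs_of_pos hr,
      ← ENNReal.ofReal_mul (Real.rpow_nonneg hr.le _)]
    congr 1
    simp only [f]
    rw [Real.mul_rpow hr.le (norm_nonneg _), Real.rpow_neg hr.le]
    have : r * ‖z‖ / r = ‖z‖ := by field_simp
    rw [this]
    field_simp
  simp_rw [e]
  rw [lintegral_const_mul' _ _ ENNReal.ofReal_ne_top, ← mul_assoc,
    ← ENNReal.ofReal_mul (abs_nonneg _), mul_comm]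
  gcongr
  rw [abs_of_pos (by nlinarith [mul_pos hr hr])]
  have : r ^ (-(2 * σ)) = (r * r - 0 * 0) * r ^ (-(2 + 2 * σ)) := by
    rw [show -(2 * σ) = 2 + (-(2 + 2 * σ)) by ring, Real.rpow_add hr]
    norm_num
    left; ring
  rw [this]

/-- The triangle has diameter at most one in the maximum norm, so the kernel may be cut off at
radius one; near zero the radial density `t^(1-p)` is integrable. -/
theorem exists_lintegral_kernel_le {p : ℝ} (h1 : p < 2) :
    ∃ C : ℝ≥0, ∀ Y ∈ refTriangle,
      ∫⁻ X in refTriangle, ENNReal.ofReal (‖X - Y‖ ^ (-p)) ≤ C := by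
  let f : ℝ → ℝ := (Iic 1).indicator fun t => |t| ^ (-p)
  have hfin : ∫⁻ z : ℝ × ℝ, ENNReal.ofReal (f ‖z‖) < ⊤ := by
    refine lintegral_radial_lt_top (f := f) ?_ ?_
    · intro t; exact indicator_nonneg (fun t _ => by positivity) t
    · rw [← Ioc_union_Ioi_eq_Ioi zero_le_one]
      refine IntegrableOn.union ?_ ?_
      · have : IntegrableOn (fun t : ℝ => t ^ (1 - p)) (Ioc 0 1) := by
          rw [← intervalIntegrable_iff_integrableOn_Ioc_of_le zero_le_one]
          exact intervalIntegral.intervalIntegrable_rpow' (by linarith)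
        refine this.congr_fun ?_ measurableSet_Ioc
        intro t ht
        simp only [f, indicator_of_mem (show t ∈ Iic (1 : ℝ) from ht.2), abs_of_pos ht.1]
        rw [Real.rpow_sub ht.1, Real.rpow_one, Real.rpow_neg ht.1.le, div_eq_mul_inv]
      · refine integrableOn_zero.congr_fun ?_ measurableSet_Ioi
        intro t (ht : 1 < t)
        simp only [f, indicator_of_notMem (show t ∉ Iic (1 : ℝ) from not_le.2 ht), mul_zero]
  refine ⟨(∫⁻ z : ℝ × ℝ, ENNReal.ofReal (f ‖z‖)).toNNReal, fun Y hY => ?_⟩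
  rw [ENNReal.coe_toNNReal hfin.ne]
  calc ∫⁻ X in refTriangle, ENNReal.ofReal (‖X - Y‖ ^ (-p))
      = ∫⁻ X in refTriangle, ENNReal.ofReal (f ‖X - Y‖) := by
        refine setLIntegral_congr_fun measurableSet_refTriangle fun X hX => ?_
        simp only [f]
        rw [indicator_of_mem (show ‖X - Y‖ ∈ Iic (1 : ℝ) from norm_sub_le_one hX hY), abs_norm]
    _ ≤ ∫⁻ X, ENNReal.ofReal (f ‖X - Y‖) := setLIntegral_le_lintegral _ _
    _ = ∫⁻ z, ENNReal.ofReal (f ‖z‖) :=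
        lintegral_sub_right_eq_self (fun z : ℝ × ℝ => ENNReal.ofReal (f ‖z‖)) Y

end RTTriangle

/-! ### Calculus of fractional seminorms on the triangle. -/

namespace RTTriangle

/-! ### The Gagliardo seminorm for the maximum norm -/

/-- The inner integral of the Gagliardo seminorm on the triangle, for the maximum norm. -/
noncomputable def gagliardo (σ : ℝ) (f : ℝ × ℝ → ℝ) (X : ℝ × ℝ) : ℝ≥0∞ :=
  ∫⁻ Y in refTriangle, ENNReal.ofReal ((f X - f Y) ^ 2 / ‖X - Y‖ ^ (2 + 2 * σ))

/-- The square of the Gagliardo seminorm on the triangle, for the maximum norm. -/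
noncomputable def semiSq (σ : ℝ) (f : ℝ × ℝ → ℝ) : ℝ≥0∞ :=
  ∫⁻ X in refTriangle, gagliardo σ f X

/-- The square of the `L²`-norm on the triangle. -/
noncomputable def l2Sq (f : ℝ × ℝ → ℝ) : ℝ≥0∞ :=
  ∫⁻ X in refTriangle, ENNReal.ofReal (f X ^ 2)

/-- The square of a norm equivalent to the norm of `H^σ`, `0 < σ < 1`. -/
noncomputable def enSq (σ : ℝ) (f : ℝ × ℝ → ℝ) : ℝ≥0∞ := l2Sq f + semiSq σ f

theorem measurable_gagliardo {f : ℝ × ℝ → ℝ} (hf : Measurable f) (σ : ℝ) :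
    Measurable (gagliardo σ f) := by
  unfold gagliardo
  exact Measurable.lintegral_prod_right'
    (f := fun p : (ℝ × ℝ) × (ℝ × ℝ) =>
      ENNReal.ofReal ((f p.1 - f p.2) ^ 2 / ‖p.1 - p.2‖ ^ (2 + 2 * σ))) (by fun_prop)

theorem l2Sq_congr {f g : ℝ × ℝ → ℝ} (h : f =ᵐ[volume.restrict refTriangle] g) :
    l2Sq f = l2Sq g :=
  lintegral_congr_ae (h.mono fun x hx => by simp only [hx])

theorem semiSq_congr {f g : ℝ × ℝ → ℝ} (σ : ℝ) (h : f =ᵐ[volume.restrict refTriangle] g) :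
    semiSq σ f = semiSq σ g := by
  refine lintegral_congr_ae (h.mono fun x hx => ?_)
  refine lintegral_congr_ae (h.mono fun y hy => ?_)
  simp only [hx, hy]

theorem enSq_congr {f g : ℝ × ℝ → ℝ} (σ : ℝ) (h : f =ᵐ[volume.restrict refTriangle] g) :
    enSq σ f = enSq σ g := by
  rw [enSq, enSq, l2Sq_congr h, semiSq_congr σ h]

theorem ofReal_add_sq_le (a b : ℝ) :
    ENNReal.ofReal ((a + b) ^ 2) ≤ 2 * ENNReal.ofReal (a ^ 2) + 2 * ENNReal.ofReal (b ^ 2) := by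
  rw [← ENNReal.ofReal_ofNat 2, ← ENNReal.ofReal_mul (by norm_num),
    ← ENNReal.ofReal_mul (by norm_num), ← ENNReal.ofReal_add (by positivity) (by positivity)]
  exact ENNReal.ofReal_le_ofReal (by nlinarith [sq_nonneg (a - b)])

theorem ofReal_div_eq (a b : ℝ) :
    ENNReal.ofReal (a ^ 2 / b) = ENNReal.ofReal (a ^ 2) * ENNReal.ofReal b⁻¹ := by
  rw [div_eq_mul_inv, ENNReal.ofReal_mul (sq_nonneg a)]

theorem l2Sq_add_le {f g : ℝ × ℝ → ℝ} (hf : Measurable f) :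
    l2Sq (fun x => f x + g x) ≤ 2 * l2Sq f + 2 * l2Sq g := by
  unfold l2Sq
  rw [← lintegral_const_mul' _ _ (by norm_num), ← lintegral_const_mul' _ _ (by norm_num),
    ← lintegral_add_left (by fun_prop)]
  exact lintegral_mono fun x => ofReal_add_sq_le _ _

theorem gagliardo_add_le {f g : ℝ × ℝ → ℝ} (hf : Measurable f) (σ : ℝ) (X : ℝ × ℝ) :
    gagliardo σ (fun x => f x + g x) X ≤ 2 * gagliardo σ f X + 2 * gagliardo σ g X := by
  unfold gagliardo
  rw [← lintegral_const_mul' _ _ (by norm_num), ← lintegral_const_mul' _ _ (by norm_num),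
    ← lintegral_add_left (by fun_prop)]
  refine lintegral_mono fun Y => ?_
  simp only [ofReal_div_eq]
  rw [show f X + g X - (f Y + g Y) = (f X - f Y) + (g X - g Y) by ring, ← mul_assoc, ← mul_assoc,
    ← add_mul]
  gcongr
  exact ofReal_add_sq_le _ _

theorem semiSq_add_le {f g : ℝ × ℝ → ℝ} (hf : Measurable f) (σ : ℝ) :
    semiSq σ (fun x => f x + g x) ≤ 2 * semiSq σ f + 2 * semiSq σ g := by
  unfold semiSq
  rw [← lintegral_const_mul' _ _ (by norm_num), ← lintegral_const_mul' _ _ (by norm_num),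
    ← lintegral_add_left ((measurable_gagliardo hf σ).const_mul _)]
  exact lintegral_mono fun x => gagliardo_add_le hf σ x

theorem enSq_add_le {f g : ℝ × ℝ → ℝ} (hf : Measurable f) (σ : ℝ) :
    enSq σ (fun x => f x + g x) ≤ 2 * enSq σ f + 2 * enSq σ g := by
  unfold enSq
  calc _ ≤ (2 * l2Sq f + 2 * l2Sq g) + (2 * semiSq σ f + 2 * semiSq σ g) :=
        add_le_add (l2Sq_add_le hf) (semiSq_add_le hf σ)
    _ = _ := by ring

theorem l2Sq_neg (f : ℝ × ℝ → ℝ) : l2Sq (fun x => - f x) = l2Sq f := by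
  simp only [l2Sq, neg_sq]

theorem gagliardo_neg (σ : ℝ) (f : ℝ × ℝ → ℝ) : gagliardo σ (fun x => - f x) = gagliardo σ f := by
  funext X
  simp only [gagliardo]
  congr 1; funext Y; congr 2; ring

theorem semiSq_neg (σ : ℝ) (f : ℝ × ℝ → ℝ) : semiSq σ (fun x => - f x) = semiSq σ f := by
  simp only [semiSq, gagliardo_neg]

theorem enSq_neg (σ : ℝ) (f : ℝ × ℝ → ℝ) : enSq σ (fun x => - f x) = enSq σ f := by
  rw [enSq, enSq, l2Sq_neg, semiSq_neg]

theorem enSq_sub_le {f g : ℝ × ℝ → ℝ} (hf : Measurable f) (σ : ℝ) :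
    enSq σ (fun x => f x - g x) ≤ 2 * enSq σ f + 2 * enSq σ g := by
  have := enSq_add_le (g := fun x => - g x) hf σ
  rw [enSq_neg] at this
  simpa only [sub_eq_add_neg] using this

/-- All distances are at most one, so raising the order only decreases the denominators. No constant
is lost. -/
theorem semiSq_mono {σ τ : ℝ} (h : σ ≤ τ) (f : ℝ × ℝ → ℝ) :
    semiSq σ f ≤ semiSq τ f := by
  refine setLIntegral_mono' measurableSet_refTriangle fun X hX => ?_
  refine setLIntegral_mono' measurableSet_refTriangle fun Y hY => ?_
  refine ENNReal.ofReal_le_ofReal ?_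
  rcases (norm_nonneg (X - Y)).eq_or_lt with h3 | h3
  · have : X = Y := sub_eq_zero.1 (norm_eq_zero.1 h3.symm)
    simp [this]
  · refine div_le_div_of_nonneg_left (sq_nonneg _) (by positivity) ?_
    exact Real.rpow_le_rpow_of_exponent_ge h3 (norm_sub_le_one hX hY) (by linarith)

theorem enSq_mono {σ τ : ℝ} (h : σ ≤ τ) (f : ℝ × ℝ → ℝ) :
    enSq σ f ≤ enSq τ f :=
  add_le_add le_rfl (semiSq_mono h f)

/-- The Gagliardo quotient is at most `L² ‖X - Y‖^(-2σ)`, an integrable kernel since `2σ < 2`. -/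
theorem exists_semiSq_le_of_lipschitz {σ : ℝ} (h1 : σ < 1) :
    ∃ C : ℝ≥0, ∀ (f : ℝ × ℝ → ℝ) (L : ℝ),
      (∀ X ∈ refTriangle, ∀ Y ∈ refTriangle, |f X - f Y| ≤ L * ‖X - Y‖) →
      semiSq σ f ≤ C * ENNReal.ofReal (L ^ 2) := by
  obtain ⟨C, hC⟩ := exists_lintegral_kernel_le (p := 2 * σ) (by linarith)
  refine ⟨C, fun f L hL => ?_⟩
  have key : ∀ X ∈ refTriangle, gagliardo σ f X ≤ C * ENNReal.ofReal (L ^ 2) := by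
    intro X hX
    rw [mul_comm]
    refine le_trans ?_ (mul_le_mul_right (hC X hX) _)
    rw [← lintegral_const_mul' _ _ ENNReal.ofReal_ne_top]
    refine setLIntegral_mono' measurableSet_refTriangle fun Y hY => ?_
    rw [← ENNReal.ofReal_mul (sq_nonneg _)]
    refine ENNReal.ofReal_le_ofReal ?_
    rcases (norm_nonneg (X - Y)).eq_or_lt with h3 | h3
    · have : X = Y := sub_eq_zero.1 (norm_eq_zero.1 h3.symm)
      simp only [this, sub_self, ne_eq, OfNat.ofNat_ne_zero, not_false_eq_true, zero_pow, zero_div]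
      positivity
    · rw [norm_sub_rev Y X, Real.rpow_neg h3.le, Real.rpow_add h3]
      have h4 : (f X - f Y) ^ 2 ≤ L ^ 2 * ‖X - Y‖ ^ 2 := by
        rw [← mul_pow, ← sq_abs]
        exact pow_le_pow_left₀ (abs_nonneg _) (hL X hX Y hY) 2
      rw [← div_eq_mul_inv, div_le_div_iff₀ (by positivity) (by positivity)]
      have h5 : (0 : ℝ) ≤ ‖X - Y‖ ^ (2 * σ) := by positivity
      have := mul_le_mul_of_nonneg_right h4 h5
      norm_num
      linarith
  calc semiSq σ f ≤ ∫⁻ X in refTriangle, C * ENNReal.ofReal (L ^ 2) :=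
        setLIntegral_mono' measurableSet_refTriangle key
    _ ≤ _ := by
        rw [setLIntegral_const]
        exact mul_le_of_le_one_right' volume_refTriangle_le

/-- The increment of `η f` is `η(Y) (f X - f Y) + f(X) (η X - η Y)`. The first part costs the
seminorm of `f`, the second costs `L² f(X)² ‖X - Y‖^(-2σ)`, which is integrated in `Y` first. -/
theorem exists_enSq_mul_le {σ : ℝ} (h1 : σ < 1) (K L : ℝ) :
    ∃ C : ℝ≥0, ∀ (η f : ℝ × ℝ → ℝ), Measurable f → Measurable η →
      (∀ X ∈ refTriangle, |η X| ≤ K) →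
      (∀ X ∈ refTriangle, ∀ Y ∈ refTriangle, |η X - η Y| ≤ L * ‖X - Y‖) →
      enSq σ (fun x => η x * f x) ≤ C * enSq σ f := by
  obtain ⟨C, hC⟩ := exists_lintegral_kernel_le (p := 2 * σ) (by linarith)
  let K' : ℝ≥0 := (K ^ 2).toNNReal
  let L' : ℝ≥0 := (L ^ 2).toNNReal
  refine ⟨2 * K' + 2 * L' * C, fun η f hf hη hK hL => ?_⟩
  have hK2 : ∀ X ∈ refTriangle, η X ^ 2 ≤ K ^ 2 := fun X hX => by
    rw [← sq_abs]; exact pow_le_pow_left₀ (abs_nonneg _) (hK X hX) 2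
  have hl2 : l2Sq (fun x => η x * f x) ≤ K' * l2Sq f := by
    unfold l2Sq
    rw [← lintegral_const_mul' _ _ ENNReal.coe_ne_top]
    refine setLIntegral_mono' measurableSet_refTriangle fun X hX => ?_
    change _ ≤ ENNReal.ofReal (K ^ 2) * _
    rw [← ENNReal.ofReal_mul (sq_nonneg _), mul_pow]
    exact ENNReal.ofReal_le_ofReal (mul_le_mul_of_nonneg_right (hK2 X hX) (sq_nonneg _))
  have hg : ∀ X ∈ refTriangle, gagliardo σ (fun x => η x * f x) X ≤
      2 * K' * gagliardo σ f X + 2 * L' * C * ENNReal.ofReal (f X ^ 2) := by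
    intro X hX
    calc gagliardo σ (fun x => η x * f x) X ≤ ∫⁻ Y in refTriangle,
          (2 * K' * ENNReal.ofReal ((f X - f Y) ^ 2 / ‖X - Y‖ ^ (2 + 2 * σ)) +
          2 * L' * ENNReal.ofReal (f X ^ 2) * ENNReal.ofReal (‖Y - X‖ ^ (-(2 * σ)))) := by
          refine setLIntegral_mono' measurableSet_refTriangle fun Y hY => ?_
          change _ ≤ 2 * ENNReal.ofReal (K ^ 2) * _ + 2 * ENNReal.ofReal (L ^ 2) * _ * _
          rw [← ENNReal.ofReal_ofNat 2, ← ENNReal.ofReal_mul (by norm_num),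
            ← ENNReal.ofReal_mul (by positivity), ← ENNReal.ofReal_mul (by norm_num),
            ← ENNReal.ofReal_mul (by positivity), ← ENNReal.ofReal_mul (by positivity),
            ← ENNReal.ofReal_add (by positivity) (by positivity)]
          refine ENNReal.ofReal_le_ofReal ?_
          rcases (norm_nonneg (X - Y)).eq_or_lt with h3 | h3
          · have : X = Y := sub_eq_zero.1 (norm_eq_zero.1 h3.symm)
            simp only [this, sub_self, ne_eq, OfNat.ofNat_ne_zero, not_false_eq_true, zero_pow, zero_div]
            positivity
          · rw [norm_sub_rev Y X, Real.rpow_neg h3.le]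
            have h4 : (η X * f X - η Y * f Y) ^ 2 ≤
                2 * K ^ 2 * (f X - f Y) ^ 2 + 2 * L ^ 2 * f X ^ 2 * ‖X - Y‖ ^ 2 := by
              have e1 : (η X * f X - η Y * f Y) ^ 2 ≤
                  2 * (η Y ^ 2 * (f X - f Y) ^ 2) + 2 * (f X ^ 2 * (η X - η Y) ^ 2) := by
                nlinarith [sq_nonneg (η Y * (f X - f Y) - f X * (η X - η Y))]
              have e2 : (η X - η Y) ^ 2 ≤ L ^ 2 * ‖X - Y‖ ^ 2 := by
                rw [← mul_pow, ← sq_abs]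
                exact pow_le_pow_left₀ (abs_nonneg _) (hL X hX Y hY) 2
              have e3 := mul_le_mul_of_nonneg_right (hK2 Y hY) (sq_nonneg (f X - f Y))
              have e4 := mul_le_mul_of_nonneg_left e2 (sq_nonneg (f X))
              nlinarith
            have h5 : (0 : ℝ) < ‖X - Y‖ ^ (2 * σ) := by positivity
            have h6 : ‖X - Y‖ ^ (2 + 2 * σ) = ‖X - Y‖ ^ 2 * ‖X - Y‖ ^ (2 * σ) := by
              rw [Real.rpow_add h3]; norm_num
            rw [h6, div_le_iff₀ (by positivity)]
            refine h4.trans (le_of_eq ?_)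
            field_simp
      _ ≤ _ := by
          rw [lintegral_add_left (by fun_prop), lintegral_const_mul' _ _ (by finiteness),
            lintegral_const_mul' _ _ (by finiteness)]
          refine add_le_add le_rfl ?_
          rw [mul_assoc (2 * (L' : ℝ≥0∞)) (C : ℝ≥0∞), mul_comm (C : ℝ≥0∞), ← mul_assoc]
          gcongr
          exact hC X hX
  have hs : semiSq σ (fun x => η x * f x) ≤ 2 * K' * semiSq σ f + 2 * L' * C * l2Sq f := by
    unfold semiSq l2Sq
    rw [← lintegral_const_mul' _ _ (by finiteness), ← lintegral_const_mul' _ _ (by finiteness),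
      ← lintegral_add_left ((measurable_gagliardo hf σ).const_mul _)]
    exact setLIntegral_mono' measurableSet_refTriangle hg
  calc enSq σ (fun x => η x * f x)
      ≤ K' * l2Sq f + (2 * K' * semiSq σ f + 2 * L' * C * l2Sq f) := add_le_add hl2 hs
    -- Superfluous terms are added to complete the product of the constant with `l2Sq f + semiSq σ
    -- f`.
    _ ≤ (K' * l2Sq f + (2 * K' * semiSq σ f + 2 * L' * C * l2Sq f)) +
        (K' * l2Sq f + 2 * L' * C * semiSq σ f) := le_self_add
    _ = _ := by
        unfold enSq
        push_cast
        ring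

/-- Composition with a measure preserving self-map of the triangle which is Lipschitz. -/
theorem l2Sq_comp {Φ : ℝ × ℝ → ℝ × ℝ} (hΦ : MeasurePreserving Φ (volume.restrict refTriangle)
    (volume.restrict refTriangle)) {f : ℝ × ℝ → ℝ} (hf : Measurable f) :
    l2Sq (fun x => f (Φ x)) = l2Sq f :=
  hΦ.lintegral_comp (f := fun x => ENNReal.ofReal (f x ^ 2)) (by fun_prop)

/-- After the change of variables only the denominators differ, by at most `2^(2+2σ) ≤ 2⁴ = 16`. -/
theorem semiSq_comp_le {Φ : ℝ × ℝ → ℝ × ℝ} (hΦ : MeasurePreserving Φ (volume.restrict refTriangle)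
    (volume.restrict refTriangle)) (hL : ∀ X Y, ‖Φ X - Φ Y‖ ≤ 2 * ‖X - Y‖)
    {f : ℝ × ℝ → ℝ} (hf : Measurable f) {σ : ℝ} (h0 : 0 < σ) (h1 : σ < 1) :
    semiSq σ (fun x => f (Φ x)) ≤ 16 * semiSq σ f := by
  have e : semiSq σ f = ∫⁻ X in refTriangle, gagliardo σ f (Φ X) :=
    (hΦ.lintegral_comp (measurable_gagliardo hf σ)).symm
  rw [e, ← lintegral_const_mul' _ _ (by norm_num)]
  refine lintegral_mono fun X => ?_
  have e2 : gagliardo σ f (Φ X) = ∫⁻ Y in refTriangle,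
      ENNReal.ofReal ((f (Φ X) - f (Φ Y)) ^ 2 / ‖Φ X - Φ Y‖ ^ (2 + 2 * σ)) :=
    (hΦ.lintegral_comp (f := fun Y => ENNReal.ofReal ((f (Φ X) - f Y) ^ 2 /
      ‖Φ X - Y‖ ^ (2 + 2 * σ))) (by fun_prop)).symm
  simp only
  rw [e2, gagliardo, ← lintegral_const_mul' _ _ (by norm_num)]
  refine lintegral_mono fun Y => ?_
  rw [← ENNReal.ofReal_ofNat 16, ← ENNReal.ofReal_mul (by norm_num)]
  refine ENNReal.ofReal_le_ofReal ?_
  rcases (norm_nonneg (Φ X - Φ Y)).eq_or_lt with h3 | h3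
  · have : Φ X = Φ Y := sub_eq_zero.1 (norm_eq_zero.1 h3.symm)
    simp [this]
  · have h4 : 0 < ‖X - Y‖ := by have := hL X Y; linarith
    rw [← mul_div_assoc, div_le_div_iff₀ (by positivity) (by positivity), mul_comm (16 : ℝ),
      mul_assoc]
    refine mul_le_mul_of_nonneg_left ?_ (sq_nonneg _)
    calc ‖Φ X - Φ Y‖ ^ (2 + 2 * σ) ≤ (2 * ‖X - Y‖) ^ (2 + 2 * σ) :=
          Real.rpow_le_rpow h3.le (hL X Y) (by linarith)
      _ = 2 ^ (2 + 2 * σ) * ‖X - Y‖ ^ (2 + 2 * σ) := Real.mul_rpow (by norm_num) h4.le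
      _ ≤ 16 * ‖X - Y‖ ^ (2 + 2 * σ) := by
          gcongr
          calc (2 : ℝ) ^ (2 + 2 * σ) ≤ 2 ^ (4 : ℝ) :=
                Real.rpow_le_rpow_of_exponent_le (by norm_num) (by linarith)
            _ = 16 := by norm_num

theorem enSq_comp_le {Φ : ℝ × ℝ → ℝ × ℝ} (hΦ : MeasurePreserving Φ (volume.restrict refTriangle)
    (volume.restrict refTriangle)) (hL : ∀ X Y, ‖Φ X - Φ Y‖ ≤ 2 * ‖X - Y‖)
    {f : ℝ × ℝ → ℝ} (hf : Measurable f) {σ : ℝ} (h0 : 0 < σ) (h1 : σ < 1) :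
    enSq σ (fun x => f (Φ x)) ≤ 16 * enSq σ f := by
  unfold enSq
  rw [l2Sq_comp hΦ hf, mul_add]
  refine add_le_add ?_ (semiSq_comp_le hΦ hL hf h0 h1)
  exact le_mul_of_one_le_left' (by norm_num)

/-! ### Pointwise estimates by the Gagliardo integral -/

theorem ofReal_sq_le_mul {a t r p : ℝ} (ht : 0 ≤ t) (hp : 0 < p) (htr : t ≤ r)
    (ha : t = 0 → a = 0) :
    ENNReal.ofReal (a ^ 2) ≤ ENNReal.ofReal (r ^ p) * ENNReal.ofReal (a ^ 2 / t ^ p) := by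
  rcases ht.eq_or_lt with h | h
  · simp [ha h.symm]
  · have hr : 0 < r := h.trans_le htr
    rw [← ENNReal.ofReal_mul (by positivity)]
    refine ENNReal.ofReal_le_ofReal ?_
    rw [← mul_div_assoc, le_div_iff₀ (by positivity), mul_comm]
    exact mul_le_mul_of_nonneg_right (Real.rpow_le_rpow ht htr hp.le) (sq_nonneg _)

/-- The homothetic copy of the triangle of ratio `ρ` with centre `X`. -/
noncomputable def homothety (X : ℝ × ℝ) (ρ : ℝ) : Set (ℝ × ℝ) :=
  affMap ρ 0 0 ρ ((1 - ρ) * X.1) ((1 - ρ) * X.2) '' refTriangle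

/-- A square of side `1/2` fits into the triangle; the exact area is not needed here. -/
theorem quarter_le_volume_refTriangle : (4 : ℝ≥0∞)⁻¹ ≤ volume refTriangle := by
  have h : Ioo (1 / 2 : ℝ) 1 ×ˢ Ioo (0 : ℝ) (1 / 2) ⊆ refTriangle := by
    rintro ⟨x, y⟩ ⟨⟨h1, h2⟩, h3, h4⟩
    simp only at h1 h2 h3 h4
    exact ⟨by simp only; linarith, h2, h3, by simp only; linarith⟩
  refine le_trans (le_of_eq ?_) (measure_mono h)
  rw [Measure.volume_eq_prod, Measure.prod_prod, Real.volume_Ioo, Real.volume_Ioo,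
    ← ENNReal.ofReal_mul (by norm_num), ← ENNReal.ofReal_ofNat 4,
    ← ENNReal.ofReal_inv_of_pos (by norm_num)]
  norm_num

theorem measurableSet_homothety {X : ℝ × ℝ} {ρ : ℝ} (h0 : 0 < ρ) :
    MeasurableSet (homothety X ρ) :=
  measurableSet_refTriangle.image_of_continuousOn_injOn
    (contDiff_affMap _ _ _ _ _ _).continuous.continuousOn
    (injective_affMap _ _ (by nlinarith [mul_pos h0 h0])).injOn

/-- Multiplying by this quantity replaces a constant by its integral over the small copy, divided by
an area of order `ρ²`. -/
theorem volume_homothety {X : ℝ × ℝ} {ρ : ℝ} (h0 : 0 < ρ) :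
    1 ≤ ENNReal.ofReal (4 * ρ ^ (-2 : ℝ)) * volume (homothety X ρ) := by
  have e := lintegral_affMap_image ((1 - ρ) * X.1) ((1 - ρ) * X.2)
    (show ρ * ρ - 0 * 0 ≠ 0 by nlinarith [mul_pos h0 h0]) measurableSet_refTriangle 1
  simp only [Pi.one_apply, setLIntegral_one] at e
  rw [homothety, e, ← mul_assoc, ← ENNReal.ofReal_mul (by positivity)]
  have : 4 * ρ ^ (-2 : ℝ) * |ρ * ρ - 0 * 0| = 4 := by
    rw [abs_of_pos (by nlinarith [mul_pos h0 h0]), Real.rpow_neg h0.le]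
    norm_num
    field_simp
  rw [this]
  calc (1 : ℝ≥0∞) = ENNReal.ofReal 4 * 4⁻¹ := by
        rw [ENNReal.ofReal_ofNat, ENNReal.mul_inv_cancel (by norm_num) (by norm_num)]
    _ ≤ _ := by gcongr; exact quarter_le_volume_refTriangle

/-- Convexity: the points are `(1 - ρ) X + ρ w`. Such copies replace balls, which would leave the
triangle near its boundary. -/
theorem homothety_subset {X : ℝ × ℝ} (hX : X ∈ refTriangle) {ρ : ℝ} (h0 : 0 < ρ) (h1 : ρ ≤ 1) :
    ∀ z ∈ homothety X ρ, z ∈ refTriangle ∧ ‖X - z‖ ≤ ρ := by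
  rintro _ ⟨w, hw, rfl⟩
  have hn := norm_sub_le_one hX hw
  constructor
  · obtain ⟨a1, a2, a3, a4⟩ := hX
    obtain ⟨b1, b2, b3, b4⟩ := hw
    simp only [affMap]
    refine ⟨?_, ?_, ?_, ?_⟩ <;> simp only <;> nlinarith
  · have : X - affMap ρ 0 0 ρ ((1 - ρ) * X.1) ((1 - ρ) * X.2) w = ρ • (X - w) := by
      ext <;> simp [affMap] <;> ring
    rw [this, norm_smul, Real.norm_eq_abs, abs_of_pos h0]
    nlinarith

/-- Two-point estimate: nearby values are controlled by the Gagliardo integrals. -/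
theorem ofReal_sq_sub_le_gagliardo {f : ℝ × ℝ → ℝ} (hf : Measurable f) {σ : ℝ} (hσ0 : 0 < σ)
    (hσ1 : σ < 1) {X P : ℝ × ℝ} (hX : X ∈ refTriangle) {ρ : ℝ}
    (h0 : 0 < ρ) (h1 : ρ ≤ 1) (hXP : ‖X - P‖ ≤ 2 * ρ) :
    ENNReal.ofReal ((f X - f P) ^ 2) ≤
      648 * ENNReal.ofReal (ρ ^ (2 * σ)) * (gagliardo σ f X + gagliardo σ f P) := by
  have hsub := homothety_subset hX h0 h1
  -- Average the splitting `(f X - f z) - (f P - f z)` over the copy of size `ρ` at `X`, whose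
  -- points are within `ρ` of `X` and `3ρ` of `P`. The constant is `648 = 4 · 2 · 3⁴`, with
  -- `3^(2+2σ) ≤ 3⁴`.
  calc ENNReal.ofReal ((f X - f P) ^ 2)
      ≤ ENNReal.ofReal ((f X - f P) ^ 2) *
        (ENNReal.ofReal (4 * ρ ^ (-2 : ℝ)) * volume (homothety X ρ)) :=
        le_mul_of_one_le_right' (volume_homothety h0)
    _ = ENNReal.ofReal (4 * ρ ^ (-2 : ℝ)) *
        ∫⁻ z in homothety X ρ, ENNReal.ofReal ((f X - f P) ^ 2) := by
        rw [setLIntegral_const]; ring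
    _ ≤ ENNReal.ofReal (4 * ρ ^ (-2 : ℝ)) * ∫⁻ z in homothety X ρ,
        ENNReal.ofReal (162 * ρ ^ (2 + 2 * σ)) *
          (ENNReal.ofReal ((f X - f z) ^ 2 / ‖X - z‖ ^ (2 + 2 * σ)) +
          ENNReal.ofReal ((f P - f z) ^ 2 / ‖P - z‖ ^ (2 + 2 * σ))) := by
        refine mul_le_mul_right (setLIntegral_mono' (measurableSet_homothety h0) fun z hz => ?_) _
        obtain ⟨hz1, hz2⟩ := hsub z hz
        have hz3 : ‖P - z‖ ≤ 3 * ρ := by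
          have := norm_add_le (P - X) (X - z)
          rw [norm_sub_rev P X, sub_add_sub_cancel] at this
          linarith
        have hc : (3 * ρ) ^ (2 + 2 * σ) ≤ 81 * ρ ^ (2 + 2 * σ) := by
          rw [Real.mul_rpow (by norm_num) h0.le]
          gcongr
          calc (3 : ℝ) ^ (2 + 2 * σ) ≤ 3 ^ (4 : ℝ) :=
                Real.rpow_le_rpow_of_exponent_le (by norm_num) (by linarith)
            _ = 81 := by norm_num
        have hr : ρ ≤ 3 * ρ := by linarith
        have hz : ∀ Q : ℝ × ℝ, ‖Q - z‖ ≤ 3 * ρ → ENNReal.ofReal ((f Q - f z) ^ 2) ≤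
            ENNReal.ofReal (81 * ρ ^ (2 + 2 * σ)) *
            ENNReal.ofReal ((f Q - f z) ^ 2 / ‖Q - z‖ ^ (2 + 2 * σ)) := fun Q hQ => by
          refine (ofReal_sq_le_mul (norm_nonneg _) (by linarith : (0:ℝ) < 2 + 2 * σ) hQ ?_).trans
            (mul_le_mul_left (ENNReal.ofReal_le_ofReal hc) _)
          intro h; rw [sub_eq_zero.1 (norm_eq_zero.1 h), sub_self]
        have e := ofReal_add_sq_le (f X - f z) (-(f P - f z))
        rw [show f X - f z + -(f P - f z) = f X - f P by ring, neg_sq] at e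
        refine e.trans ?_
        rw [show 162 * ρ ^ (2 + 2 * σ) = 2 * (81 * ρ ^ (2 + 2 * σ)) by ring,
          ENNReal.ofReal_mul (by norm_num : (0:ℝ) ≤ 2), ENNReal.ofReal_ofNat, mul_add, mul_assoc,
          mul_assoc]
        gcongr
        · exact hz X (hz2.trans hr)
        · exact hz P hz3
    _ ≤ ENNReal.ofReal (4 * ρ ^ (-2 : ℝ)) * (ENNReal.ofReal (162 * ρ ^ (2 + 2 * σ)) *
          (gagliardo σ f X + gagliardo σ f P)) := by
        rw [lintegral_const_mul' _ _ ENNReal.ofReal_ne_top, lintegral_add_left (by fun_prop)]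
        unfold gagliardo
        gcongr <;> exact fun z hz => (hsub z hz).1
    _ = _ := by
        rw [← mul_assoc, ← ENNReal.ofReal_mul (by positivity), ← ENNReal.ofReal_ofNat 648,
          ← ENNReal.ofReal_mul (by norm_num)]
        congr 2
        rw [Real.rpow_add h0, Real.rpow_neg h0.le]
        field_simp
        norm_num

/-- One-point estimate: a value is controlled by the Gagliardo integral and the `L²`-norm. -/
theorem ofReal_sq_le_gagliardo {f : ℝ × ℝ → ℝ} (hf : Measurable f) {σ : ℝ} (hσ0 : 0 < σ)
    {X : ℝ × ℝ} (hX : X ∈ refTriangle) {ρ : ℝ} (h0 : 0 < ρ) (h1 : ρ ≤ 1) :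
    ENNReal.ofReal (f X ^ 2) ≤ 8 * (ENNReal.ofReal (ρ ^ (2 * σ)) * gagliardo σ f X +
      ENNReal.ofReal (ρ ^ (-2 : ℝ)) * l2Sq f) := by
  have hsub := homothety_subset hX h0 h1
  -- The same average for `f X = (f X - f z) + f z`. The free radius `ρ` trades the seminorm against
  -- the `L²` part.
  calc ENNReal.ofReal (f X ^ 2)
      ≤ ENNReal.ofReal (f X ^ 2) *
        (ENNReal.ofReal (4 * ρ ^ (-2 : ℝ)) * volume (homothety X ρ)) :=
        le_mul_of_one_le_right' (volume_homothety h0)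
    _ = ENNReal.ofReal (4 * ρ ^ (-2 : ℝ)) *
        ∫⁻ z in homothety X ρ, ENNReal.ofReal (f X ^ 2) := by
        rw [setLIntegral_const]; ring
    _ ≤ ENNReal.ofReal (4 * ρ ^ (-2 : ℝ)) * ∫⁻ z in homothety X ρ,
        (2 * ENNReal.ofReal (ρ ^ (2 + 2 * σ)) *
          ENNReal.ofReal ((f X - f z) ^ 2 / ‖X - z‖ ^ (2 + 2 * σ)) +
          2 * ENNReal.ofReal (f z ^ 2)) := by
        refine mul_le_mul_right (setLIntegral_mono' (measurableSet_homothety h0) fun z hz => ?_) _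
        obtain ⟨hz1, hz2⟩ := hsub z hz
        have e := ofReal_add_sq_le (f X - f z) (f z)
        rw [sub_add_cancel] at e
        refine e.trans ?_
        rw [mul_assoc]
        gcongr
        refine ofReal_sq_le_mul (norm_nonneg _) (by linarith) hz2 ?_
        intro h; rw [sub_eq_zero.1 (norm_eq_zero.1 h), sub_self]
    _ ≤ ENNReal.ofReal (4 * ρ ^ (-2 : ℝ)) *
        (2 * ENNReal.ofReal (ρ ^ (2 + 2 * σ)) * gagliardo σ f X + 2 * l2Sq f) := by
        rw [lintegral_add_left (by fun_prop), lintegral_const_mul' _ _ (by finiteness),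
          lintegral_const_mul' _ _ (by finiteness)]
        unfold gagliardo l2Sq
        gcongr <;> exact fun z hz => (hsub z hz).1
    _ = _ := by
        rw [Real.rpow_add h0, ENNReal.ofReal_mul (by norm_num : (0:ℝ) ≤ 4),
          ENNReal.ofReal_mul (by positivity : (0:ℝ) ≤ ρ ^ (2:ℝ))]
        have : ENNReal.ofReal (ρ ^ (-2:ℝ)) * ENNReal.ofReal (ρ ^ (2:ℝ)) = 1 := by
          rw [← ENNReal.ofReal_mul (by positivity), ← Real.rpow_add h0]; norm_num
        rw [ENNReal.ofReal_ofNat]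
        calc _ = 8 * ((ENNReal.ofReal (ρ ^ (-2:ℝ)) * ENNReal.ofReal (ρ ^ (2:ℝ))) *
              (ENNReal.ofReal (ρ ^ (2 * σ)) * gagliardo σ f X) +
              ENNReal.ofReal (ρ ^ (-2:ℝ)) * l2Sq f) := by ring
          _ = _ := by rw [this, one_mul]

/-- A Poincaré inequality. -/
theorem exists_l2Sq_sub_const_le {f : ℝ × ℝ → ℝ} (hf : Measurable f) {σ : ℝ} (hσ0 : 0 < σ) :
    ∃ c : ℝ, l2Sq (fun x => f x - c) ≤ 4 * semiSq σ f := by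
  -- The constant is the value of `f` at a point whose Gagliardo integral is at most the average.
  -- Distances are at most one, so that integral dominates the `L²` distance, and the factor `4`
  -- bounds the inverse of the area.
  obtain ⟨Z, hZ, hZ2⟩ := exists_le_setLAverage (μ := volume) (s := refTriangle)
    volume_refTriangle_pos.ne' (volume_refTriangle_le.trans_lt ENNReal.one_lt_top).ne
    (f := gagliardo σ f) (measurable_gagliardo hf σ).aemeasurable
  refine ⟨f Z, ?_⟩
  have h1 : l2Sq (fun x => f x - f Z) ≤ gagliardo σ f Z := by
    refine setLIntegral_mono' measurableSet_refTriangle fun X hX => ?_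
    have := ofReal_sq_le_mul (a := f Z - f X) (norm_nonneg (Z - X))
      (by linarith : (0:ℝ) < 2 + 2 * σ) (norm_sub_le_one hZ hX)
      (fun h => by rw [sub_eq_zero.1 (norm_eq_zero.1 h), sub_self])
    rw [Real.one_rpow, ENNReal.ofReal_one, one_mul] at this
    rwa [show (f X - f Z) ^ 2 = (f Z - f X) ^ 2 by ring]
  refine h1.trans (hZ2.trans ?_)
  rw [setLAverage_eq, ENNReal.div_eq_inv_mul]
  unfold semiSq
  gcongr
  rw [ENNReal.inv_le_iff_inv_le]
  exact quarter_le_volume_refTriangle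

/-- Halving the height maps the triangle into itself with Jacobian `1/2`. -/
theorem lintegral_comp_half_le (g : ℝ × ℝ → ℝ≥0∞) :
    ∫⁻ X in refTriangle, g (X.1, X.2 / 2) ≤ 2 * ∫⁻ X in refTriangle, g X := by
  have hM : affMap 1 0 0 (1 / 2) 0 0 '' refTriangle ⊆ refTriangle := by
    rintro _ ⟨⟨x, y⟩, ⟨a1, a2, a3, a4⟩, rfl⟩
    simp only [affMap, refTriangle, mem_ofPred_eq] at *
    refine ⟨?_, ?_, ?_, ?_⟩ <;> linarith
  have hMX : ∀ X : ℝ × ℝ, affMap 1 0 0 (1 / 2) 0 0 X = (X.1, X.2 / 2) := by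
    intro X; ext
    · simp [affMap]
    · simp [affMap]; ring
  have e := lintegral_affMap_image 0 0 (show (1:ℝ) * (1 / 2) - 0 * 0 ≠ 0 by norm_num)
    measurableSet_refTriangle g
  have e3 := lintegral_mono_set (μ := volume) (f := g) hM
  rw [e] at e3
  simp only [hMX] at e3
  calc ∫⁻ X in refTriangle, g (X.1, X.2 / 2)
      = 2 * (ENNReal.ofReal |1 * (1 / 2) - 0 * 0| *
        ∫⁻ X in refTriangle, g (X.1, X.2 / 2)) := by
        rw [← mul_assoc, ← ENNReal.ofReal_ofNat 2, ← ENNReal.ofReal_mul (by norm_num)]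
        norm_num
    _ ≤ _ := by gcongr

/-- Comparison of a function with its composition with `(x, y) ↦ (x, y / 2)`. -/
theorem lintegral_sub_half_le {f : ℝ × ℝ → ℝ} (hf : Measurable f) {σ : ℝ} (hσ0 : 0 < σ)
    (hσ1 : σ < 1) :
    ∫⁻ X in refTriangle, ENNReal.ofReal ((f X - f (X.1, X.2 / 2)) ^ 2 * X.2 ^ (-(2 * σ))) ≤
      1944 * semiSq σ f := by
  have e2 : ∫⁻ X in refTriangle, gagliardo σ f (X.1, X.2 / 2) ≤ 2 * semiSq σ f :=
    lintegral_comp_half_le _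
  calc _ ≤ ∫⁻ X in refTriangle, 648 * (gagliardo σ f X + gagliardo σ f (X.1, X.2 / 2)) := by
        refine setLIntegral_mono' measurableSet_refTriangle fun X hX => ?_
        have hy : 0 < X.2 := hX.2.2.1
        have hy1 : X.2 < 1 := hX.2.2.2.trans hX.2.1
        rw [ENNReal.ofReal_mul (sq_nonneg _)]
        -- The two points are at distance `X.2 / 2 = 2ρ`, and the weight `X.2^(-2σ)` cancels the
        -- gain `ρ^(2σ)`. The final constant is `1944 = 3 · 648`.
        have := ofReal_sq_sub_le_gagliardo hf hσ0 hσ1 hX (P := (X.1, X.2 / 2)) (ρ := X.2 / 4)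
          (by linarith) (by linarith) (by
            rw [Prod.norm_def]
            simp only [Prod.fst_sub, Prod.snd_sub, sub_self, norm_zero, Real.norm_eq_abs]
            rw [max_le_iff, abs_le]
            constructor
            · linarith
            · constructor <;> linarith)
        refine (mul_le_mul_left this _).trans ?_
        rw [mul_assoc, mul_assoc, mul_comm (gagliardo σ f X + _), ← mul_assoc (ENNReal.ofReal _),
          ← ENNReal.ofReal_mul (by positivity)]
        gcongr
        refine mul_le_of_le_one_left' ?_
        rw [ENNReal.ofReal_le_one, Real.div_rpow hy.le (by norm_num), Real.rpow_neg hy.le]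
        have h4 : (1:ℝ) ≤ 4 ^ (2 * σ) := Real.one_le_rpow (by norm_num) (by linarith)
        have h5 : 0 < X.2 ^ (2 * σ) := by positivity
        rw [div_mul_eq_mul_div, mul_inv_cancel₀ h5.ne']
        rw [div_le_one (by linarith)]
        exact h4
    _ = 648 * (semiSq σ f + ∫⁻ X in refTriangle, gagliardo σ f (X.1, X.2 / 2)) := by
        rw [lintegral_const_mul' _ _ (by norm_num),
          lintegral_add_left (measurable_gagliardo hf σ)]
        rfl
    _ ≤ 648 * (semiSq σ f + 2 * semiSq σ f) := by gcongr
    _ = _ := by ring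

end RTTriangle

/-! ### Hardy's inequality at an edge for orders above one half. -/

namespace RTTriangle

/-! ### Auxiliary inequalities -/

theorem lintegral_mul_le_sqrt {α : Type*} [MeasurableSpace α] {μ : Measure α} {f g : α → ℝ≥0∞}
    (hf : AEMeasurable f μ) (hg : AEMeasurable g μ) :
    ∫⁻ a, f a * g a ∂μ ≤ (∫⁻ a, f a ^ 2 ∂μ) ^ (1 / 2 : ℝ) * (∫⁻ a, g a ^ 2 ∂μ) ^ (1 / 2 : ℝ) := by
  have := ENNReal.lintegral_mul_le_Lp_mul_Lq μ Real.HolderConjugate.two_two hf hg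
  simpa only [ENNReal.rpow_ofNat, Pi.mul_apply] using this

theorem lintegral_mul_sq_le {α : Type*} [MeasurableSpace α] {μ : Measure α} {f g : α → ℝ≥0∞}
    (hf : AEMeasurable f μ) (hg : AEMeasurable g μ) :
    (∫⁻ a, f a * g a ∂μ) ^ 2 ≤ (∫⁻ a, f a ^ 2 ∂μ) * ∫⁻ a, g a ^ 2 ∂μ := by
  refine (pow_le_pow_left₀ zero_le (lintegral_mul_le_sqrt hf hg) 2).trans (le_of_eq ?_)
  rw [mul_pow, ← ENNReal.rpow_natCast, ← ENNReal.rpow_natCast, ← ENNReal.rpow_mul,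
    ← ENNReal.rpow_mul]
  norm_num

/-- Absorption of `q N` into the left side, legitimate only because `N` is finite. -/
theorem ENNReal_le_of_le_mul_add {N B : ℝ≥0∞} {q : ℝ} (hN : N ≠ ⊤) (h0 : 0 ≤ q) (h1 : q < 1)
    (h : N ≤ ENNReal.ofReal q * N + B) : N ≤ ENNReal.ofReal (1 / (1 - q)) * B := by
  have h2 : 0 < 1 / (1 - q) := by have : 0 < 1 - q := by linarith
                                  positivity
  by_cases hB : B = ⊤
  · rw [hB, ENNReal.mul_top (by simpa using h2)]; exact le_top
  · lift N to ℝ≥0 using hN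
    lift B to ℝ≥0 using hB
    rw [← ENNReal.ofReal_coe_nnreal (p := N), ← ENNReal.ofReal_coe_nnreal (p := B)] at h ⊢
    rw [← ENNReal.ofReal_mul h0, ← ENNReal.ofReal_add (by positivity) (by positivity),
      ENNReal.ofReal_le_ofReal_iff (by positivity)] at h
    rw [← ENNReal.ofReal_mul h2.le]
    refine ENNReal.ofReal_le_ofReal ?_
    rw [one_div, inv_mul_eq_div, le_div_iff₀ (by linarith)]
    linarith

/-! ### Iterated integrals over the triangle -/

theorem lintegral_refTriangle_eq {h : ℝ × ℝ → ℝ≥0∞} (hh : Measurable h) :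
    ∫⁻ X in refTriangle, h X = ∫⁻ x in Ioo (0 : ℝ) 1, ∫⁻ y in Ioo 0 x, h (x, y) := by
  rw [← lintegral_indicator measurableSet_refTriangle, Measure.volume_eq_prod,
    lintegral_prod _ (hh.indicator measurableSet_refTriangle).aemeasurable,
    ← lintegral_indicator measurableSet_Ioo]
  congr 1; funext x
  by_cases hx : x ∈ Ioo (0 : ℝ) 1
  · rw [indicator_of_mem hx, ← lintegral_indicator measurableSet_Ioo]
    congr 1; funext y
    simp only [indicator, refTriangle, mem_ofPred_eq, mem_Ioo, hx.1, hx.2, true_and]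
  · rw [indicator_of_notMem hx]
    convert lintegral_zero with y
    rw [indicator_of_notMem]
    exact fun h => hx ⟨h.1, h.2.1⟩

theorem lintegral_refTriangle_eq_symm {h : ℝ × ℝ → ℝ≥0∞} (hh : Measurable h) :
    ∫⁻ X in refTriangle, h X = ∫⁻ y in Ioo (0 : ℝ) 1, ∫⁻ x in Ioo y 1, h (x, y) := by
  rw [← lintegral_indicator measurableSet_refTriangle, Measure.volume_eq_prod,
    lintegral_prod_symm _ (hh.indicator measurableSet_refTriangle).aemeasurable,
    ← lintegral_indicator measurableSet_Ioo]
  congr 1; funext y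
  by_cases hy : y ∈ Ioo (0 : ℝ) 1
  · rw [indicator_of_mem hy, ← lintegral_indicator measurableSet_Ioo]
    congr 1; funext x
    simp only [indicator, refTriangle, mem_ofPred_eq, mem_Ioo, hy.1, true_and]
    congr 1
    refine propext ⟨fun h => ⟨h.2.2, h.2.1⟩, fun h => ⟨hy.1.trans h.1, h.2, h.1⟩⟩
  · rw [indicator_of_notMem hy]
    convert lintegral_zero with x
    rw [indicator_of_notMem]
    exact fun h => hy ⟨h.2.2.1, h.2.2.2.trans h.2.1⟩

theorem integral_refTriangle_eq {h : ℝ × ℝ → ℝ} (hh : IntegrableOn h refTriangle) :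
    ∫ X in refTriangle, h X = ∫ x in Ioo (0 : ℝ) 1, ∫ y in Ioo 0 x, h (x, y) := by
  rw [← integral_indicator measurableSet_refTriangle, Measure.volume_eq_prod,
    integral_prod _ ((integrable_indicator_iff measurableSet_refTriangle).2 hh),
    ← integral_indicator measurableSet_Ioo]
  congr 1; funext x
  by_cases hx : x ∈ Ioo (0 : ℝ) 1
  · rw [indicator_of_mem hx, ← integral_indicator measurableSet_Ioo]
    congr 1; funext y
    simp only [indicator, refTriangle, mem_ofPred_eq, mem_Ioo, hx.1, hx.2, true_and]
  · rw [indicator_of_notMem hx]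
    exact integral_eq_zero_of_ae (Eventually.of_forall fun y =>
      indicator_of_notMem (fun h => hx ⟨h.1, h.2.1⟩) _)

theorem integral_refTriangle_eq_symm {h : ℝ × ℝ → ℝ} (hh : IntegrableOn h refTriangle) :
    ∫ X in refTriangle, h X = ∫ y in Ioo (0 : ℝ) 1, ∫ x in Ioo y 1, h (x, y) := by
  rw [← integral_indicator measurableSet_refTriangle, Measure.volume_eq_prod,
    integral_prod_symm _ ((integrable_indicator_iff measurableSet_refTriangle).2 hh),
    ← integral_indicator measurableSet_Ioo]
  congr 1; funext y
  by_cases hy : y ∈ Ioo (0 : ℝ) 1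
  · rw [indicator_of_mem hy, ← integral_indicator measurableSet_Ioo]
    congr 1; funext x
    simp only [indicator, refTriangle, mem_ofPred_eq, mem_Ioo, hy.1, true_and]
    congr 1
    refine propext ⟨fun h => ⟨h.2.2, h.2.1⟩, fun h => ⟨hy.1.trans h.1, h.2, h.1⟩⟩
  · rw [indicator_of_notMem hy]
    exact integral_eq_zero_of_ae (Eventually.of_forall fun x =>
      indicator_of_notMem (fun h => hy ⟨h.2.2.1, h.2.2.2.trans h.2.1⟩) _)

/-! ### Affine symmetries of the triangle -/

/-- The reflection of the triangle which fixes the first edge. -/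
noncomputable def mapB : ℝ × ℝ → ℝ × ℝ := affMap (-1) 1 0 1 1 0

/-- The isometry of the triangle which swaps the first two edges. -/
noncomputable def mapJ : ℝ × ℝ → ℝ × ℝ := affMap 0 (-1) (-1) 0 1 1

/-- Affine symmetries of the triangle which map the first edge to the edge `e`. -/
noncomputable def edgeMap (e : Fin 3) : ℝ × ℝ → ℝ × ℝ :=
  ![affMap 1 0 0 1 0 0, affMap 0 (-1) 1 (-1) 1 0, affMap 1 0 1 (-1) 0 0] e

/-- The barycentric coordinate which vanishes on the edge `e`. -/
def bary (e : Fin 3) (X : ℝ × ℝ) : ℝ := ![X.2, 1 - X.1, X.1 - X.2] e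

theorem edgeMap_edge (e : Fin 3) (t : ℝ) : edgeMap e (t, 0) = edgePoint e t := by
  fin_cases e <;> simp [edgeMap, edgePoint, affMap]

theorem bary_edgeMap (e : Fin 3) (X : ℝ × ℝ) : bary e (edgeMap e X) = X.2 := by
  fin_cases e <;> simp [edgeMap, bary, affMap]

theorem bary_pos {X : ℝ × ℝ} (hX : X ∈ refTriangle) (e : Fin 3) : 0 < bary e X := by
  obtain ⟨a1, a2, a3, a4⟩ := hX
  fin_cases e <;> simp [bary] <;> linarith

theorem mem_refTriangle_iff {X : ℝ × ℝ} : X ∈ refTriangle ↔ ∀ e, 0 < bary e X := by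
  refine ⟨fun h e => bary_pos h e, fun h => ?_⟩
  have h0 := h 0; have h1 := h 1; have h2 := h 2
  simp [bary] at h0 h1 h2
  refine ⟨?_, ?_, ?_, ?_⟩ <;> linarith

theorem measurePreserving_mapB :
    MeasurePreserving mapB (volume.restrict refTriangle) (volume.restrict refTriangle) := by
  refine measurePreserving_affMap (by norm_num) (Subset.antisymm ?_ ?_)
  · rintro _ ⟨X, ⟨a1, a2, a3, a4⟩, rfl⟩
    refine ⟨?_, ?_, ?_, ?_⟩ <;> simp only [affMap] <;> linarith
  · rintro X ⟨a1, a2, a3, a4⟩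
    refine ⟨(1 - X.1 + X.2, X.2), ⟨?_, ?_, ?_, ?_⟩, ?_⟩
    · simp only; linarith
    · simp only; linarith
    · simp only; linarith
    · simp only; linarith
    · ext <;> simp [affMap]

theorem measurePreserving_mapJ :
    MeasurePreserving mapJ (volume.restrict refTriangle) (volume.restrict refTriangle) := by
  refine measurePreserving_affMap (by norm_num) (Subset.antisymm ?_ ?_)
  · rintro _ ⟨X, ⟨a1, a2, a3, a4⟩, rfl⟩
    refine ⟨?_, ?_, ?_, ?_⟩ <;> simp only [affMap] <;> linarith
  · rintro X ⟨a1, a2, a3, a4⟩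
    refine ⟨(1 - X.2, 1 - X.1), ⟨?_, ?_, ?_, ?_⟩, ?_⟩
    · simp only; linarith
    · simp only; linarith
    · simp only; linarith
    · simp only; linarith
    · ext <;> simp [affMap]

theorem measurePreserving_edgeMap (e : Fin 3) :
    MeasurePreserving (edgeMap e) (volume.restrict refTriangle)
      (volume.restrict refTriangle) := by
  fin_cases e
  · refine measurePreserving_affMap (by norm_num) ?_
    have : affMap 1 0 0 1 0 0 = id := by funext X; ext <;> simp [affMap]
    rw [this, image_id]
  · refine measurePreserving_affMap (by norm_num) (Subset.antisymm ?_ ?_)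
    · rintro _ ⟨X, ⟨a1, a2, a3, a4⟩, rfl⟩
      refine ⟨?_, ?_, ?_, ?_⟩ <;> simp only [affMap] <;> linarith
    · rintro X ⟨a1, a2, a3, a4⟩
      refine ⟨(1 - X.1 + X.2, 1 - X.1), ⟨?_, ?_, ?_, ?_⟩, ?_⟩
      · simp only; linarith
      · simp only; linarith
      · simp only; linarith
      · simp only; linarith
      · ext
        · simp [affMap]
        · simp [affMap]; ring
  · refine measurePreserving_affMap (by norm_num) (Subset.antisymm ?_ ?_)
    · rintro _ ⟨X, ⟨a1, a2, a3, a4⟩, rfl⟩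
      refine ⟨?_, ?_, ?_, ?_⟩ <;> simp only [affMap] <;> linarith
    · rintro X ⟨a1, a2, a3, a4⟩
      refine ⟨(X.1, X.1 - X.2), ⟨?_, ?_, ?_, ?_⟩, ?_⟩
      · simp only; linarith
      · simp only; linarith
      · simp only; linarith
      · simp only; linarith
      · ext <;> simp [affMap]

theorem norm_affMap_sub_le {a b c d : ℝ} (p q : ℝ) (h1 : |a| + |b| ≤ 2) (h2 : |c| + |d| ≤ 2)
    (X Y : ℝ × ℝ) : ‖affMap a b c d p q X - affMap a b c d p q Y‖ ≤ 2 * ‖X - Y‖ := by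
  have hx : |X.1 - Y.1| ≤ ‖X - Y‖ := norm_fst_le (X - Y)
  have hy : |X.2 - Y.2| ≤ ‖X - Y‖ := norm_snd_le (X - Y)
  have key : ∀ a b : ℝ, |a| + |b| ≤ 2 → |a * (X.1 - Y.1) + b * (X.2 - Y.2)| ≤ 2 * ‖X - Y‖ := by
    intro a b hab
    calc |a * (X.1 - Y.1) + b * (X.2 - Y.2)| ≤ |a| * |X.1 - Y.1| + |b| * |X.2 - Y.2| := by
          rw [← abs_mul, ← abs_mul]; exact abs_add_le _ _
      _ ≤ |a| * ‖X - Y‖ + |b| * ‖X - Y‖ := by gcongr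
      _ ≤ _ := by rw [← add_mul]; gcongr
  rw [Prod.norm_def, max_le_iff]
  constructor
  · rw [Real.norm_eq_abs]
    have e : (affMap a b c d p q X - affMap a b c d p q Y).1 =
        a * (X.1 - Y.1) + b * (X.2 - Y.2) := by simp only [affMap, Prod.fst_sub]; ring
    rw [e]; exact key a b h1
  · rw [Real.norm_eq_abs]
    have e : (affMap a b c d p q X - affMap a b c d p q Y).2 =
        c * (X.1 - Y.1) + d * (X.2 - Y.2) := by simp only [affMap, Prod.snd_sub]; ring
    rw [e]; exact key c d h2

theorem norm_mapB_sub_le (X Y : ℝ × ℝ) : ‖mapB X - mapB Y‖ ≤ 2 * ‖X - Y‖ :=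
  norm_affMap_sub_le _ _ (by norm_num) (by norm_num) X Y

theorem norm_mapJ_sub_le (X Y : ℝ × ℝ) : ‖mapJ X - mapJ Y‖ ≤ 2 * ‖X - Y‖ :=
  norm_affMap_sub_le _ _ (by norm_num) (by norm_num) X Y

theorem norm_edgeMap_sub_le (e : Fin 3) (X Y : ℝ × ℝ) :
    ‖edgeMap e X - edgeMap e Y‖ ≤ 2 * ‖X - Y‖ := by
  fin_cases e
  · exact norm_affMap_sub_le _ _ (by norm_num) (by norm_num) X Y
  · exact norm_affMap_sub_le _ _ (by norm_num) (by norm_num) X Y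
  · exact norm_affMap_sub_le _ _ (by norm_num) (by norm_num) X Y

theorem contDiff_edgeMap (e : Fin 3) : ContDiff ℝ ∞ (edgeMap e) := by
  fin_cases e <;> exact contDiff_affMap _ _ _ _ _ _

theorem contDiff_mapB : ContDiff ℝ ∞ mapB := contDiff_affMap _ _ _ _ _ _

theorem contDiff_mapJ : ContDiff ℝ ∞ mapJ := contDiff_affMap _ _ _ _ _ _

/-! ### Smooth functions on the triangle -/

theorem exists_lipschitz_of_contDiff {ψ : ℝ × ℝ → ℝ} (hψ : ContDiff ℝ ∞ ψ) :
    ∃ L : ℝ, 0 ≤ L ∧ ∀ X ∈ Icc (0 : ℝ) 1 ×ˢ Icc (0 : ℝ) 1, ∀ Y ∈ Icc (0 : ℝ) 1 ×ˢ Icc (0 : ℝ) 1,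
      |ψ X - ψ Y| ≤ L * ‖X - Y‖ := by
  have hc : IsCompact (Icc (0 : ℝ) 1 ×ˢ Icc (0 : ℝ) 1) := isCompact_Icc.prod isCompact_Icc
  obtain ⟨C, hC⟩ := hc.exists_bound_of_continuousOn
    (hψ.continuous_fderiv (by simp)).continuousOn
  refine ⟨max C 0, le_max_right _ _, fun X hX Y hY => ?_⟩
  rw [← Real.norm_eq_abs]
  exact ((convex_Icc (0:ℝ) 1).prod (convex_Icc (0:ℝ) 1)).norm_image_sub_le_of_norm_fderiv_le
    (fun x _ => (hψ.differentiable (by simp)).differentiableAt)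
    (fun x hx => (hC x hx).trans (le_max_left _ _)) hY hX

theorem refTriangle_subset_Icc : refTriangle ⊆ Icc (0 : ℝ) 1 ×ˢ Icc (0 : ℝ) 1 :=
  refTriangle_subset.trans (prod_mono Ioo_subset_Icc_self Ioo_subset_Icc_self)

/-! ### Hardy's inequality -/

/-- The weighted integral on the left side of Hardy's inequality. -/
noncomputable def hardySq (r : ℝ) (ψ : ℝ × ℝ → ℝ) : ℝ≥0∞ :=
  ∫⁻ X in refTriangle, ENNReal.ofReal ((ψ X - ψ (X.1, 0)) ^ 2 * X.2 ^ (-(2 * r)))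

/-- Compare `ψ` at height `x₂` with `ψ` at height `x₂ / 2`, which costs the seminorm, and then with
the trace. Rescaling the height reproduces the left side with the factor `2 · 2^(-2r) = 2^(1-2r)`,
less than one precisely when `r > 1/2`. Its square root is `q`: one factor `q` is spent on the
weight `q⁻¹` in the splitting of the square, and the other one is the coefficient that is absorbed.
The smoothness of `ψ` guarantees that the left side is finite beforehand. -/
theorem exists_hardySq_le {r : ℝ} (h0 : 1 / 2 < r) (h1 : r < 1) :
    ∃ C : ℝ≥0, ∀ ψ : ℝ × ℝ → ℝ, ContDiff ℝ ∞ ψ → hardySq r ψ ≤ C * semiSq r ψ := by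
  let q : ℝ := 2 ^ (1 / 2 - r)
  have hq0 : 0 < q := by positivity
  have hq1 : q < 1 := Real.rpow_lt_one_of_one_lt_of_neg (by norm_num) (by linarith)
  -- the constants in `(a + b)² ≤ K a² + q⁻¹ b²`
  let K : ℝ := 1 / (1 - q)
  have hK0 : 0 < K := by have : 0 < 1 - q := by linarith
                         positivity
  refine ⟨(K).toNNReal * ((K).toNNReal * 1944), fun ψ hψ => ?_⟩
  have hmeas : Measurable ψ := hψ.continuous.measurable
  have hfin : hardySq r ψ ≠ ⊤ := by
    obtain ⟨L, hL0, hL⟩ := exists_lipschitz_of_contDiff hψ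
    refine ne_of_lt ((?_ : hardySq r ψ ≤ ∫⁻ X in refTriangle, ENNReal.ofReal (L ^ 2)).trans_lt ?_)
    · refine setLIntegral_mono' measurableSet_refTriangle fun X hX => ?_
      have hXc := refTriangle_subset_Icc hX
      have := hL X hXc (X.1, 0) ⟨hXc.1, by simp⟩
      have hy : 0 < X.2 := hX.2.2.1
      have hy1 : X.2 ≤ 1 := hXc.2.2
      have hn : ‖X - (X.1, 0)‖ = X.2 := by
        rw [Prod.norm_def]; simp [abs_of_pos hy, hy.le]
      rw [hn] at this
      refine ENNReal.ofReal_le_ofReal ?_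
      calc (ψ X - ψ (X.1, 0)) ^ 2 * X.2 ^ (-(2 * r))
          ≤ (L * X.2) ^ 2 * X.2 ^ (-(2 * r)) := by
            rw [← sq_abs]; gcongr
        _ = L ^ 2 * X.2 ^ (2 - 2 * r) := by
            rw [mul_pow, mul_assoc, Real.rpow_sub hy, Real.rpow_neg hy.le, div_eq_mul_inv]
            norm_num
        _ ≤ L ^ 2 * 1 := by
            gcongr
            exact Real.rpow_le_one hy.le hy1 (by linarith)
        _ = L ^ 2 := mul_one _
    · rw [setLIntegral_const]
      exact ENNReal.mul_lt_top ENNReal.ofReal_lt_top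
        (volume_refTriangle_le.trans_lt ENNReal.one_lt_top)
  have hstep : hardySq r ψ ≤ ENNReal.ofReal q * hardySq r ψ +
      ENNReal.ofReal K * (1944 * semiSq r ψ) := by
    have e1 : hardySq r ψ ≤ ∫⁻ X in refTriangle,
        (ENNReal.ofReal K * ENNReal.ofReal ((ψ X - ψ (X.1, X.2 / 2)) ^ 2 * X.2 ^ (-(2 * r))) +
        ENNReal.ofReal (q⁻¹ * 2 ^ (-(2 * r))) *
          ENNReal.ofReal ((ψ (X.1, X.2 / 2) - ψ (X.1, 0)) ^ 2 * (X.2 / 2) ^ (-(2 * r)))) := by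
      refine setLIntegral_mono' measurableSet_refTriangle fun X hX => ?_
      have hy : 0 < X.2 := hX.2.2.1
      rw [← ENNReal.ofReal_mul hK0.le, ← ENNReal.ofReal_mul (by positivity),
        ← ENNReal.ofReal_add (by positivity) (by positivity)]
      refine ENNReal.ofReal_le_ofReal ?_
      have hw : (2:ℝ) ^ (-(2 * r)) * (X.2 / 2) ^ (-(2 * r)) = X.2 ^ (-(2 * r)) := by
        rw [← Real.mul_rpow (by norm_num) (by positivity)]; congr 1; ring
      have hab : ∀ a b : ℝ, (a + b) ^ 2 ≤ K * a ^ 2 + q⁻¹ * b ^ 2 := by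
        intro a b
        have hq1' : 0 < 1 - q := by linarith
        rw [← sub_nonneg]
        have : K * a ^ 2 + q⁻¹ * b ^ 2 - (a + b) ^ 2 =
            (q * a - (1 - q) * b) ^ 2 / (q * (1 - q)) := by
          simp only [K]; field_simp; ring
        rw [this]; positivity
      have h3 := hab (ψ X - ψ (X.1, X.2 / 2)) (ψ (X.1, X.2 / 2) - ψ (X.1, 0))
      rw [sub_add_sub_cancel] at h3
      have h4 := mul_le_mul_of_nonneg_right h3 (by positivity : 0 ≤ X.2 ^ (-(2 * r)))
      refine h4.trans (le_of_eq ?_)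
      rw [← hw]; ring
    have hm : Measurable fun X : ℝ × ℝ => ENNReal.ofReal K *
        ENNReal.ofReal ((ψ X - ψ (X.1, X.2 / 2)) ^ 2 * X.2 ^ (-(2 * r))) := by fun_prop
    rw [lintegral_add_left hm, lintegral_const_mul' _ _ ENNReal.ofReal_ne_top,
      lintegral_const_mul' _ _ ENNReal.ofReal_ne_top] at e1
    refine e1.trans ?_
    rw [add_comm]
    refine add_le_add ?_ (mul_le_mul_right (lintegral_sub_half_le hmeas (by linarith) h1) _)
    have e2 := lintegral_comp_half_le
      (fun X => ENNReal.ofReal ((ψ X - ψ (X.1, 0)) ^ 2 * X.2 ^ (-(2 * r))))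
    refine (mul_le_mul_right e2 _).trans (le_of_eq ?_)
    rw [← mul_assoc, ← ENNReal.ofReal_ofNat 2, ← ENNReal.ofReal_mul (by positivity)]
    have hc : q⁻¹ * 2 ^ (-(2 * r)) * 2 = q := by
      simp only [q]
      rw [← Real.rpow_neg (by norm_num), ← Real.rpow_add (by norm_num),
        ← Real.rpow_add_one (by norm_num)]
      congr 1; ring
    exact congrArg (fun t => ENNReal.ofReal t * hardySq r ψ) hc
  have := ENNReal_le_of_le_mul_add hfin hq0.le hq1 hstep
  refine this.trans (le_of_eq ?_)
  simp only [ENNReal.coe_mul, K]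
  rw [ENNReal.ofReal]
  push_cast
  ring

end RTTriangle

/-! ### Edge traces, integrals of derivatives and averages near an edge. -/

namespace RTTriangle

/-! ### Traces of smooth functions -/

theorem ofReal_sq_eq_enorm_sq (a : ℝ) : ENNReal.ofReal (a ^ 2) = ‖a‖ₑ ^ 2 := by
  rw [Real.enorm_eq_ofReal_abs, ← ENNReal.ofReal_pow (abs_nonneg _), sq_abs]

/-- The weight `x` is the length of the vertical slice over `x`: the trace is extended constantly in
the height and compared with `ψ` over the triangle, where the Hardy weight is at least one. -/
theorem lintegral_weighted_trace_le {ψ : ℝ × ℝ → ℝ} (hψ : Measurable ψ) {r : ℝ} (h0 : 0 ≤ r)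
    (c : ℝ) :
    ∫⁻ x in Ioo (0 : ℝ) 1, ENNReal.ofReal x * ENNReal.ofReal ((ψ (x, 0) - c) ^ 2) ≤
      2 * hardySq r ψ + 2 * l2Sq (fun X => ψ X - c) := by
  have e1 := lintegral_refTriangle_eq (h := fun X => ENNReal.ofReal ((ψ (X.1, 0) - c) ^ 2))
    (by fun_prop)
  have e2 : ∫⁻ x in Ioo (0 : ℝ) 1, ENNReal.ofReal x * ENNReal.ofReal ((ψ (x, 0) - c) ^ 2) =
      ∫⁻ X in refTriangle, ENNReal.ofReal ((ψ (X.1, 0) - c) ^ 2) := by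
    rw [e1]
    refine lintegral_congr fun x => ?_
    simp only
    rw [setLIntegral_const, Real.volume_Ioo, sub_zero, mul_comm]
  rw [e2]
  unfold hardySq l2Sq
  rw [← lintegral_const_mul' _ _ (by norm_num), ← lintegral_const_mul' _ _ (by norm_num),
    ← lintegral_add_left (by fun_prop)]
  refine setLIntegral_mono' measurableSet_refTriangle fun X hX => ?_
  have e := ofReal_add_sq_le (-(ψ X - ψ (X.1, 0))) (ψ X - c)
  rw [show -(ψ X - ψ (X.1, 0)) + (ψ X - c) = ψ (X.1, 0) - c by ring, neg_sq] at e
  refine e.trans ?_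
  gcongr
  refine le_mul_of_one_le_right (sq_nonneg _) ?_
  exact Real.one_le_rpow_of_pos_of_le_one_of_nonpos hX.2.2.1 (hX.2.2.2.trans hX.2.1).le
    (by linarith)

theorem lintegral_Ioo_reflect (g : ℝ → ℝ≥0∞) :
    ∫⁻ x in Ioo (0 : ℝ) 1, g (1 - x) = ∫⁻ x in Ioo (0 : ℝ) 1, g x := by
  rw [← lintegral_indicator measurableSet_Ioo, ← lintegral_indicator measurableSet_Ioo,
    ← lintegral_sub_left_eq_self ((Ioo (0 : ℝ) 1).indicator fun x => g (1 - x)) (1 : ℝ)]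
  refine lintegral_congr fun x => ?_
  by_cases hx : x ∈ Ioo (0 : ℝ) 1
  · have hx' : 1 - x ∈ Ioo (0 : ℝ) 1 := ⟨by linarith [hx.2], by linarith [hx.1]⟩
    rw [indicator_of_mem hx', indicator_of_mem hx, sub_sub_cancel]
  · have hx' : 1 - x ∉ Ioo (0 : ℝ) 1 := fun h => hx ⟨by linarith [h.2], by linarith [h.1]⟩
    rw [indicator_of_notMem hx', indicator_of_notMem hx]

/-- The weight `x` degenerates at the origin, but the reflection `mapB` gives the same bound with
the weight `1 - x`, and the two weights add up to one. The maps `edgeMap` carry the bound to the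
other edges. The constant `c` stays free for a later use of Poincaré's inequality. -/
theorem exists_lintegral_edge_le {r : ℝ} (h0 : 1 / 2 < r) (h1 : r < 1) :
    ∃ C : ℝ≥0, ∀ ψ : ℝ × ℝ → ℝ, ContDiff ℝ ∞ ψ → ∀ (c : ℝ) (e : Fin 3),
      ∫⁻ t in Ioo (0 : ℝ) 1, ENNReal.ofReal ((ψ (edgePoint e t) - c) ^ 2) ≤
        C * (semiSq r ψ + l2Sq (fun X => ψ X - c)) := by
  obtain ⟨C, hC⟩ := exists_hardySq_le h0 h1
  have step1 : ∀ ψ : ℝ × ℝ → ℝ, ContDiff ℝ ∞ ψ → ∀ c : ℝ,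
      ∫⁻ x in Ioo (0 : ℝ) 1, ENNReal.ofReal x * ENNReal.ofReal ((ψ (x, 0) - c) ^ 2) ≤
        (2 * C + 2) * (semiSq r ψ + l2Sq (fun X => ψ X - c)) := by
    intro ψ hψ c
    refine (lintegral_weighted_trace_le hψ.continuous.measurable (by linarith : 0 ≤ r) c).trans ?_
    calc _ ≤ 2 * (C * semiSq r ψ) + 2 * l2Sq (fun X => ψ X - c) := by
          gcongr; exact hC ψ hψ
      _ ≤ (2 * (C * semiSq r ψ) + 2 * l2Sq (fun X => ψ X - c)) +
          (2 * semiSq r ψ + 2 * C * l2Sq (fun X => ψ X - c)) := le_self_add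
      _ = _ := by ring
  have step2 : ∀ ψ : ℝ × ℝ → ℝ, ContDiff ℝ ∞ ψ → ∀ c : ℝ,
      ∫⁻ x in Ioo (0 : ℝ) 1, ENNReal.ofReal ((ψ (x, 0) - c) ^ 2) ≤
        17 * (2 * C + 2) * (semiSq r ψ + l2Sq (fun X => ψ X - c)) := by
    intro ψ hψ c
    have hm : Measurable ψ := hψ.continuous.measurable
    have e1 := step1 ψ hψ c
    have e2 := step1 (fun X => ψ (mapB X)) (hψ.comp contDiff_mapB) c
    have e3 : ∀ x : ℝ, mapB (x, 0) = (1 - x, 0) := by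
      intro x; ext
      · simp [mapB, affMap]; ring
      · simp [mapB, affMap]
    simp only [e3] at e2
    have e4 := lintegral_Ioo_reflect
      (fun x => ENNReal.ofReal (1 - x) * ENNReal.ofReal ((ψ (x, 0) - c) ^ 2))
    simp only [sub_sub_cancel] at e4
    rw [e4] at e2
    have e5 : semiSq r (fun X => ψ (mapB X)) ≤ 16 * semiSq r ψ :=
      semiSq_comp_le measurePreserving_mapB norm_mapB_sub_le hm (by linarith) h1
    have e6 : l2Sq (fun X => ψ (mapB X) - c) = l2Sq (fun X => ψ X - c) :=
      l2Sq_comp (f := fun X => ψ X - c) measurePreserving_mapB (by fun_prop)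
    rw [e6] at e2
    calc ∫⁻ x in Ioo (0 : ℝ) 1, ENNReal.ofReal ((ψ (x, 0) - c) ^ 2)
        = ∫⁻ x in Ioo (0 : ℝ) 1, (ENNReal.ofReal x * ENNReal.ofReal ((ψ (x, 0) - c) ^ 2) +
          ENNReal.ofReal (1 - x) * ENNReal.ofReal ((ψ (x, 0) - c) ^ 2)) := by
          refine setLIntegral_congr_fun measurableSet_Ioo fun x hx => ?_
          rw [← add_mul, ← ENNReal.ofReal_add hx.1.le (by linarith [hx.2])]
          simp
      _ ≤ (2 * C + 2) * (semiSq r ψ + l2Sq (fun X => ψ X - c)) +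
          (2 * C + 2) * (16 * semiSq r ψ + l2Sq (fun X => ψ X - c)) := by
          rw [lintegral_add_left (by fun_prop)]
          refine add_le_add e1 (e2.trans ?_)
          gcongr
      _ ≤ (2 * C + 2) * (semiSq r ψ + l2Sq (fun X => ψ X - c)) +
          (2 * C + 2) * (16 * semiSq r ψ + l2Sq (fun X => ψ X - c)) +
          (2 * C + 2) * (15 * l2Sq (fun X => ψ X - c)) := le_self_add
      _ = _ := by ring
  refine ⟨16 * (17 * (2 * C + 2)), fun ψ hψ c e => ?_⟩
  have hm : Measurable ψ := hψ.continuous.measurable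
  have e1 := step2 (fun X => ψ (edgeMap e X)) (hψ.comp (contDiff_edgeMap e)) c
  simp only [edgeMap_edge] at e1
  have e5 : semiSq r (fun X => ψ (edgeMap e X)) ≤ 16 * semiSq r ψ :=
    semiSq_comp_le (measurePreserving_edgeMap e) (norm_edgeMap_sub_le e) hm (by linarith) h1
  have e6 : l2Sq (fun X => ψ (edgeMap e X) - c) = l2Sq (fun X => ψ X - c) :=
    l2Sq_comp (f := fun X => ψ X - c) (measurePreserving_edgeMap e) (by fun_prop)
  rw [e6] at e1
  push_cast
  refine e1.trans ?_
  calc _ ≤ 17 * (2 * (C : ℝ≥0∞) + 2) * (16 * semiSq r ψ + 16 * l2Sq (fun X => ψ X - c)) := by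
        gcongr
        exact le_mul_of_one_le_left' (by norm_num)
    _ = _ := by ring

theorem exists_bound_pderiv {ψ : ℝ × ℝ → ℝ} (hψ : ContDiff ℝ ∞ ψ) :
    ∃ Λ : ℝ, 0 ≤ Λ ∧ ∀ i, ∀ X ∈ Icc (0 : ℝ) 1 ×ˢ Icc (0 : ℝ) 1, |pderiv i ψ X| ≤ Λ := by
  have hc : IsCompact (Icc (0 : ℝ) 1 ×ˢ Icc (0 : ℝ) 1) := isCompact_Icc.prod isCompact_Icc
  have hcont : ∀ i, Continuous (pderiv i ψ) := fun i =>
    (hψ.continuous_fderiv (by simp)).clm_apply continuous_const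
  obtain ⟨C0, hC0⟩ := hc.exists_bound_of_continuousOn (hcont 0).continuousOn
  obtain ⟨C1, hC1⟩ := hc.exists_bound_of_continuousOn (hcont 1).continuousOn
  refine ⟨max (max C0 C1) 0, le_max_right _ _, fun i X hX => ?_⟩
  fin_cases i
  · exact (hC0 X hX).trans ((le_max_left _ _).trans (le_max_left _ _))
  · exact (hC1 X hX).trans ((le_max_right _ _).trans (le_max_left _ _))

theorem continuous_pderiv {ψ : ℝ × ℝ → ℝ} (hψ : ContDiff ℝ ∞ ψ) (i : Fin 2) :
    Continuous (pderiv i ψ) :=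
  (hψ.continuous_fderiv (by simp)).clm_apply continuous_const

theorem memLp_of_bound {g : ℝ × ℝ → ℝ} (hg : Measurable g) {K : ℝ}
    (hK : ∀ X ∈ refTriangle, |g X| ≤ K) (p : ℝ≥0∞) : MemLp g p (volume.restrict refTriangle) :=
  MemLp.of_bound hg.aestronglyMeasurable K
    ((ae_restrict_iff' measurableSet_refTriangle).2 (Eventually.of_forall hK))

theorem memLp_pderiv {ψ : ℝ × ℝ → ℝ} (hψ : ContDiff ℝ ∞ ψ) (i : Fin 2) (p : ℝ≥0∞) :
    MemLp (pderiv i ψ) p (volume.restrict refTriangle) := by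
  obtain ⟨Λ, -, hΛ⟩ := exists_bound_pderiv hψ
  exact memLp_of_bound (continuous_pderiv hψ i).measurable
    (fun X hX => hΛ i X (refTriangle_subset_Icc hX)) p

theorem hasDerivAt_fst {ψ : ℝ × ℝ → ℝ} (hψ : ContDiff ℝ ∞ ψ) (x y : ℝ) :
    HasDerivAt (fun t => ψ (t, y)) (pderiv 0 ψ (x, y)) x := by
  have h1 := ((hψ.differentiable (by simp)).differentiableAt (x := (x, y))).hasFDerivAt
  have h2 : HasDerivAt (fun t : ℝ => (t, y)) ((1 : ℝ), (0 : ℝ)) x :=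
    (hasDerivAt_id x).prodMk (hasDerivAt_const x y)
  exact h1.comp_hasDerivAt x h2

theorem hasDerivAt_snd {ψ : ℝ × ℝ → ℝ} (hψ : ContDiff ℝ ∞ ψ) (x y : ℝ) :
    HasDerivAt (fun t => ψ (x, t)) (pderiv 1 ψ (x, y)) y := by
  have h1 := ((hψ.differentiable (by simp)).differentiableAt (x := (x, y))).hasFDerivAt
  have h2 : HasDerivAt (fun t : ℝ => (x, t)) ((0 : ℝ), (1 : ℝ)) y :=
    (hasDerivAt_const y x).prodMk (hasDerivAt_id y)
  exact h1.comp_hasDerivAt y h2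

theorem setIntegral_pderiv_fst {ψ : ℝ × ℝ → ℝ} (hψ : ContDiff ℝ ∞ ψ) {y a b : ℝ} (hab : a ≤ b) :
    ∫ x in Ioo a b, pderiv 0 ψ (x, y) = ψ (b, y) - ψ (a, y) := by
  rw [← integral_Ioc_eq_integral_Ioo, ← intervalIntegral.integral_of_le hab]
  refine intervalIntegral.integral_eq_sub_of_hasDerivAt (fun x _ => hasDerivAt_fst hψ x y) ?_
  exact ((continuous_pderiv hψ 0).comp (by fun_prop)).intervalIntegrable _ _

theorem setIntegral_pderiv_snd {ψ : ℝ × ℝ → ℝ} (hψ : ContDiff ℝ ∞ ψ) {x a b : ℝ} (hab : a ≤ b) :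
    ∫ y in Ioo a b, pderiv 1 ψ (x, y) = ψ (x, b) - ψ (x, a) := by
  rw [← integral_Ioc_eq_integral_Ioo, ← intervalIntegral.integral_of_le hab]
  refine intervalIntegral.integral_eq_sub_of_hasDerivAt (fun y _ => hasDerivAt_snd hψ x y) ?_
  exact ((continuous_pderiv hψ 1).comp (by fun_prop)).intervalIntegrable _ _

/-- Slices parallel to a coordinate axis run from one edge to another, with the same parameter in
`(0, 1)` at both ends. -/
theorem integral_pderiv_eq {ψ : ℝ × ℝ → ℝ} (hψ : ContDiff ℝ ∞ ψ) (i : Fin 2) :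
    ∃ e e' : Fin 3, ∫ X in refTriangle, pderiv i ψ X =
      ∫ t in Ioo (0 : ℝ) 1, (ψ (edgePoint e t) - ψ (edgePoint e' t)) := by
  have hint : IntegrableOn (pderiv i ψ) refTriangle :=
    (memLp_pderiv hψ i 1).integrable le_rfl
  fin_cases i
  · refine ⟨1, 2, ?_⟩
    rw [integral_refTriangle_eq_symm hint]
    refine setIntegral_congr_fun measurableSet_Ioo fun y hy => ?_
    exact setIntegral_pderiv_fst hψ hy.2.le
  · refine ⟨2, 0, ?_⟩
    rw [integral_refTriangle_eq hint]
    refine setIntegral_congr_fun measurableSet_Ioo fun x hx => ?_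
    exact setIntegral_pderiv_snd hψ hx.1.le

theorem ofReal_integral_sq_le {α : Type*} [MeasurableSpace α] {μ : Measure α} (hμ : μ univ ≤ 1)
    {g : α → ℝ} (hg : AEMeasurable g μ) :
    ENNReal.ofReal ((∫ x, g x ∂μ) ^ 2) ≤ ∫⁻ x, ENNReal.ofReal (g x ^ 2) ∂μ := by
  simp only [ofReal_sq_eq_enorm_sq]
  have h1 := enorm_integral_le_lintegral_enorm (μ := μ) g
  have h2 := lintegral_mul_sq_le (f := fun x => ‖g x‖ₑ) (g := fun _ => 1) hg.enorm
    (aemeasurable_const (μ := μ))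
  simp only [mul_one, one_pow, lintegral_one] at h2
  exact (pow_le_pow_left₀ zero_le h1 2).trans (h2.trans (mul_le_of_le_one_right' hμ))

theorem continuous_edgePoint (e : Fin 3) : Continuous (edgePoint e) := by
  fin_cases e
  · exact (by fun_prop : Continuous fun t : ℝ => (t, (0 : ℝ)))
  · exact (by fun_prop : Continuous fun t : ℝ => ((1 : ℝ), t))
  · exact (by fun_prop : Continuous fun t : ℝ => (t, t))

/-- A difference of two traces does not change when the same constant is subtracted from both, so
the trace bound and Poincaré's inequality leave the seminorm alone. This is needed in the
subdivision argument, where only the seminorm scales. -/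
theorem exists_integral_pderiv_sq_le {r : ℝ} (h0 : 1 / 2 < r) (h1 : r < 1) :
    ∃ C : ℝ≥0, ∀ ψ : ℝ × ℝ → ℝ, ContDiff ℝ ∞ ψ → ∀ i : Fin 2,
      ENNReal.ofReal ((∫ X in refTriangle, pderiv i ψ X) ^ 2) ≤ C * semiSq r ψ := by
  obtain ⟨C, hC⟩ := exists_lintegral_edge_le h0 h1
  refine ⟨20 * C, fun ψ hψ i => ?_⟩
  obtain ⟨e, e', he⟩ := integral_pderiv_eq hψ i
  have hcont : ∀ e : Fin 3, Continuous fun t => ψ (edgePoint e t) := by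
    intro e
    exact hψ.continuous.comp (continuous_edgePoint e)
  obtain ⟨c, hc⟩ := exists_l2Sq_sub_const_le hψ.continuous.measurable (by linarith : 0 < r)
  have hE : ∀ e : Fin 3, ∫⁻ t in Ioo (0 : ℝ) 1, ENNReal.ofReal ((ψ (edgePoint e t) - c) ^ 2) ≤
      C * (5 * semiSq r ψ) := by
    intro e
    refine (hC ψ hψ c e).trans ?_
    gcongr
    calc _ ≤ semiSq r ψ + 4 * semiSq r ψ := by gcongr
      _ = _ := by ring
  rw [he]
  have hcm := (hcont e).measurable
  have hcm' := (hcont e').measurable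
  refine (ofReal_integral_sq_le (by simp) (hcm.sub hcm').aemeasurable).trans ?_
  calc _ ≤ ∫⁻ t in Ioo (0 : ℝ) 1, (2 * ENNReal.ofReal ((ψ (edgePoint e t) - c) ^ 2) +
        2 * ENNReal.ofReal ((ψ (edgePoint e' t) - c) ^ 2)) := by
        refine lintegral_mono fun t => ?_
        have e := ofReal_add_sq_le (ψ (edgePoint e t) - c) (-(ψ (edgePoint e' t) - c))
        rw [neg_sq] at e
        refine le_trans (le_of_eq ?_) e
        simp only [Pi.sub_apply]
        congr 2; ring
    _ ≤ 2 * (C * (5 * semiSq r ψ)) + 2 * (C * (5 * semiSq r ψ)) := by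
        rw [lintegral_add_left
          (((hcm.sub_const c).pow_const 2).ennreal_ofReal.const_mul 2),
          lintegral_const_mul' _ _ (by norm_num), lintegral_const_mul' _ _ (by norm_num)]
        gcongr
        · exact hE e
        · exact hE e'
    _ = _ := by push_cast; ring

/-! ### Averages over thin strips along the first edge -/

/-- A substitute for the trace: means of `|f|` over strips of height `2^(-(K+1))` remain bounded.
Passing to half the height changes the mean by at most a constant times `q^K` with `q = 2^(1/2-s)`,
and these changes are summable exactly because `s > 1/2`. -/
theorem exists_lintegral_strip_le {s : ℝ} (h0 : 1 / 2 < s) (h1 : s < 1) :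
    ∃ C : ℝ≥0, ∀ f : ℝ × ℝ → ℝ, Measurable f → ∀ K : ℕ,
      2 ^ K * ∫⁻ X in refTriangle ∩ {X | X.2 < 2⁻¹ ^ (K + 1)}, ‖f X‖ₑ ≤
        C * enSq s f ^ (1 / 2 : ℝ) := by
  let q : ℝ := 2 ^ (1 / 2 - s)
  have hq0 : 0 < q := by positivity
  have hq1 : q < 1 := Real.rpow_lt_one_of_one_lt_of_neg (by norm_num) (by linarith)
  -- Over the right half of the edge the strips can be taken as rectangles inside the triangle, and
  -- halving the height maps each one onto the next.
  let R : ℕ → Set (ℝ × ℝ) := fun K => Ioo (1 / 2 : ℝ) 1 ×ˢ Ioo (0 : ℝ) (2⁻¹ ^ (K + 1))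
  have hRm : ∀ K, MeasurableSet (R K) := fun K => measurableSet_Ioo.prod measurableSet_Ioo
  have hpow : ∀ K : ℕ, (2⁻¹ : ℝ) ^ (K + 1) ≤ 1 / 2 := fun K => by
    rw [pow_succ]
    have : (2⁻¹ : ℝ) ^ K ≤ 1 := pow_le_one₀ (by norm_num) (by norm_num)
    linarith
  have hRT : ∀ K, R K ⊆ refTriangle := by
    rintro K ⟨x, y⟩ ⟨⟨a1, a2⟩, a3, a4⟩
    simp only at a1 a2 a3 a4
    have := hpow K
    refine ⟨?_, ?_, ?_, ?_⟩ <;> simp only <;> linarith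
  have hvol : ∀ K, volume (R K) ≤ ENNReal.ofReal (2⁻¹ ^ (K + 1)) := by
    intro K
    rw [Measure.volume_eq_prod, Measure.prod_prod, Real.volume_Ioo, Real.volume_Ioo, sub_zero]
    refine mul_le_of_le_one_left' ?_
    rw [ENNReal.ofReal_le_one]; norm_num
  let A : (ℝ × ℝ → ℝ) → ℝ≥0∞ := fun f => (1944 * semiSq s f) ^ (1 / 2 : ℝ)
  -- one step of the recursion
  have step : ∀ f : ℝ × ℝ → ℝ, Measurable f → ∀ K : ℕ,
      2 ^ (K + 1) * ∫⁻ X in R (K + 1), ‖f X‖ₑ ≤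
        2 ^ K * (∫⁻ X in R K, ‖f X‖ₑ) + ENNReal.ofReal (q ^ K) * A f := by
    intro f hf K
    have himg : affMap 1 0 0 (1 / 2) 0 0 '' R K = R (K + 1) := by
      refine Subset.antisymm ?_ ?_
      · rintro _ ⟨X, ⟨⟨a1, a2⟩, a3, a4⟩, rfl⟩
        refine ⟨⟨?_, ?_⟩, ?_, ?_⟩
        · simp only [affMap]; linarith
        · simp only [affMap]; linarith
        · simp only [affMap]; linarith
        · simp only [affMap]; rw [pow_succ]; linarith
      · rintro X ⟨⟨a1, a2⟩, a3, a4⟩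
        refine ⟨(X.1, 2 * X.2), ⟨⟨a1, a2⟩, ?_, ?_⟩, ?_⟩
        · simp only; linarith
        · simp only; rw [pow_succ] at a4; linarith
        · ext <;> simp [affMap]
    have hMX : ∀ X : ℝ × ℝ, affMap 1 0 0 (1 / 2) 0 0 X = (X.1, X.2 / 2) := by
      intro X; ext
      · simp [affMap]
      · simp [affMap]; ring
    have e := lintegral_affMap_image 0 0 (show (1:ℝ) * (1 / 2) - 0 * 0 ≠ 0 by norm_num)
      (hRm K) (fun X => ‖f X‖ₑ)
    rw [himg] at e
    simp only [hMX] at e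
    have hhalf : (2 : ℝ≥0∞) * ENNReal.ofReal |1 * (1 / 2) - 0 * 0| = 1 := by
      rw [← ENNReal.ofReal_ofNat 2, ← ENNReal.ofReal_mul (by norm_num)]; norm_num
    rw [e, pow_succ, mul_assoc, ← mul_assoc 2, hhalf, one_mul]
    have e1 : ∫⁻ X in R K, ‖f (X.1, X.2 / 2)‖ₑ ≤
        (∫⁻ X in R K, ‖f X‖ₑ) + ∫⁻ X in R K, ‖f X - f (X.1, X.2 / 2)‖ₑ := by
      rw [← lintegral_add_left (by fun_prop)]
      refine lintegral_mono fun X => ?_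
      have := enorm_sub_le (E := ℝ) (a := f X) (b := f X - f (X.1, X.2 / 2))
      rwa [sub_sub_cancel] at this
    -- Cauchy-Schwarz with the weights `X.2^(-s)` and `X.2^s`. On the rectangle of height `δ` the
    -- second factor is at most `δ^(1/2+s)`, and `2^K δ^(1/2+s) ≤ q^K`.
    have e2 : ∫⁻ X in R K, ‖f X - f (X.1, X.2 / 2)‖ₑ ≤
        A f * ENNReal.ofReal ((2⁻¹ ^ (K + 1) : ℝ) ^ (1 / 2 + s)) := by
      calc ∫⁻ X in R K, ‖f X - f (X.1, X.2 / 2)‖ₑ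
          = ∫⁻ X in R K, (‖f X - f (X.1, X.2 / 2)‖ₑ * ENNReal.ofReal (X.2 ^ (-s))) *
            ENNReal.ofReal (X.2 ^ s) := by
            refine setLIntegral_congr_fun (hRm K) fun X hX => ?_
            have hy : 0 < X.2 := hX.2.1
            rw [mul_assoc, ← ENNReal.ofReal_mul (by positivity), ← Real.rpow_add hy]
            simp
        _ ≤ _ := by
            refine (lintegral_mul_le_sqrt (by fun_prop) (by fun_prop)).trans ?_
            refine mul_le_mul' ?_ ?_
            · refine ENNReal.rpow_le_rpow ?_ (by norm_num)
              refine le_trans (lintegral_mono_set (hRT K)) (le_trans (le_of_eq ?_)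
                (lintegral_sub_half_le hf (by linarith) h1))
              refine setLIntegral_congr_fun measurableSet_refTriangle fun X hX => ?_
              have hy : 0 < X.2 := hX.2.2.1
              rw [mul_pow, ← ofReal_sq_eq_enorm_sq, ← ENNReal.ofReal_pow (by positivity),
                ← ENNReal.ofReal_mul (by positivity), ← Real.rpow_natCast, ← Real.rpow_natCast,
                ← Real.rpow_mul hy.le]
              congr 3; push_cast; ring
            · have hδ : (0:ℝ) < 2⁻¹ ^ (K + 1) := by positivity
              have e3 : ∫⁻ X in R K, ENNReal.ofReal (X.2 ^ s) ^ 2 ≤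
                  ENNReal.ofReal ((2⁻¹ ^ (K + 1) : ℝ) ^ (1 + 2 * s)) := by
                have hδ : (0:ℝ) < 2⁻¹ ^ (K + 1) := by positivity
                calc _ ≤ ∫⁻ X in R K, ENNReal.ofReal ((2⁻¹ ^ (K + 1) : ℝ) ^ (2 * s)) := by
                      refine setLIntegral_mono' (hRm K) fun X hX => ?_
                      have hy : 0 < X.2 := hX.2.1
                      rw [← ENNReal.ofReal_pow (by positivity), ← Real.rpow_natCast,
                        ← Real.rpow_mul hy.le, mul_comm]
                      refine ENNReal.ofReal_le_ofReal ?_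
                      exact Real.rpow_le_rpow hy.le hX.2.2.le (by norm_num; linarith)
                  _ ≤ _ := by
                      rw [setLIntegral_const, Real.rpow_add hδ, mul_comm,
                        ENNReal.ofReal_mul (by positivity), Real.rpow_one]
                      gcongr
                      exact hvol K
              refine (ENNReal.rpow_le_rpow e3 (by norm_num)).trans (le_of_eq ?_)
              rw [ENNReal.ofReal_rpow_of_nonneg (by positivity) (by norm_num),
                ← Real.rpow_mul hδ.le]
              congr 2; ring
    have e4 : 2 ^ K * (A f * ENNReal.ofReal ((2⁻¹ ^ (K + 1) : ℝ) ^ (1 / 2 + s))) ≤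
        ENNReal.ofReal (q ^ K) * A f := by
      rw [mul_left_comm, mul_comm]
      gcongr
      rw [← ENNReal.ofReal_ofNat 2, ← ENNReal.ofReal_pow (by norm_num),
        ← ENNReal.ofReal_mul (by positivity)]
      refine ENNReal.ofReal_le_ofReal ?_
      simp only [q]
      rw [← Real.rpow_natCast, ← Real.rpow_natCast, ← Real.rpow_natCast,
        ← Real.rpow_mul (by norm_num), ← Real.rpow_mul (by norm_num),
        Real.inv_rpow (by norm_num), ← Real.rpow_neg (by norm_num)]
      change (2:ℝ) ^ (K:ℝ) * _ ≤ _
      rw [← Real.rpow_add (by norm_num)]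
      refine Real.rpow_le_rpow_of_exponent_le (by norm_num) ?_
      push_cast
      nlinarith
    calc 2 ^ K * ∫⁻ X in R K, ‖f (X.1, X.2 / 2)‖ₑ
        ≤ 2 ^ K * ((∫⁻ X in R K, ‖f X‖ₑ) +
          A f * ENNReal.ofReal ((2⁻¹ ^ (K + 1) : ℝ) ^ (1 / 2 + s))) := by
          gcongr
          exact e1.trans (by gcongr)
      _ ≤ _ := by
          rw [mul_add]
          gcongr
  have hsum : ∀ f : ℝ × ℝ → ℝ, Measurable f → ∀ K : ℕ,
      2 ^ K * ∫⁻ X in R K, ‖f X‖ₑ ≤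
        (∫⁻ X in R 0, ‖f X‖ₑ) + ENNReal.ofReal (∑ k ∈ Finset.range K, q ^ k) * A f := by
    intro f hf K
    induction K with
    | zero => simp
    | succ K ih =>
      refine (step f hf K).trans ((add_le_add_left ih _).trans (le_of_eq ?_))
      rw [Finset.sum_range_succ, ENNReal.ofReal_add (Finset.sum_nonneg fun _ _ => by positivity)
        (by positivity), add_mul, add_assoc]
  let D : ℝ≥0 := 1 + (1 / (1 - q)).toNNReal * 1944
  have hD : ∀ f : ℝ × ℝ → ℝ, Measurable f → ∀ K : ℕ,
      2 ^ K * ∫⁻ X in R K, ‖f X‖ₑ ≤ D * enSq s f ^ (1 / 2 : ℝ) := by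
    intro f hf K
    refine (hsum f hf K).trans ?_
    have b1 : ∫⁻ X in R 0, ‖f X‖ₑ ≤ enSq s f ^ (1 / 2 : ℝ) := by
      have := lintegral_mul_le_sqrt (μ := volume.restrict (R 0)) (f := fun X => ‖f X‖ₑ)
        (g := fun _ => 1) (by fun_prop) (by fun_prop)
      simp only [mul_one, one_pow, lintegral_one, Measure.restrict_apply_univ] at this
      refine this.trans (le_trans (mul_le_of_le_one_right' ?_)
        (ENNReal.rpow_le_rpow ?_ (by norm_num)))
      · refine ENNReal.rpow_le_one ?_ (by norm_num)
        refine (hvol 0).trans ?_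
        rw [ENNReal.ofReal_le_one]; norm_num
      · refine (lintegral_mono_set (hRT 0)).trans (le_trans (le_of_eq ?_) le_self_add)
        simp only [l2Sq, ofReal_sq_eq_enorm_sq]
    have b2 : A f ≤ 1944 * enSq s f ^ (1 / 2 : ℝ) := by
      simp only [A]
      rw [ENNReal.mul_rpow_of_nonneg _ _ (by norm_num)]
      refine mul_le_mul' ?_ (ENNReal.rpow_le_rpow le_add_self (by norm_num))
      calc (1944 : ℝ≥0∞) ^ (1 / 2 : ℝ) ≤ 1944 ^ (1 : ℝ) :=
            ENNReal.rpow_le_rpow_of_exponent_le (by norm_num) (by norm_num)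
        _ = 1944 := ENNReal.rpow_one _
    have b3 : ∑ k ∈ Finset.range K, q ^ k ≤ 1 / (1 - q) := by
      rw [geom_sum_eq hq1.ne, one_div, ← neg_div_neg_eq, inv_eq_one_div]
      rw [neg_sub, neg_sub]
      have : 0 < 1 - q := by linarith
      gcongr
      have : 0 < q ^ K := by positivity
      linarith
    calc _ ≤ enSq s f ^ (1 / 2 : ℝ) +
          ENNReal.ofReal (1 / (1 - q)) * (1944 * enSq s f ^ (1 / 2 : ℝ)) := by gcongr
      _ = _ := by
          simp only [D]
          rw [ENNReal.ofReal]
          push_cast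
          ring
  refine ⟨17 * D, fun f hf K => ?_⟩
  have hS : MeasurableSet {X : ℝ × ℝ | X.2 < 2⁻¹ ^ (K + 1) ∧ X.1 ≤ 1 / 2} :=
    (measurableSet_lt measurable_snd measurable_const).inter
      (measurableSet_le measurable_fst measurable_const)
  have hB : Measurable mapB := measurePreserving_mapB.measurable
  have c1 : ∫⁻ X in refTriangle ∩ {X | X.2 < 2⁻¹ ^ (K + 1)}, ‖f X‖ₑ ≤
      (∫⁻ X in R K, ‖f X‖ₑ) + ∫⁻ X in R K, ‖f (mapB X)‖ₑ := by
    have hsub : refTriangle ∩ {X : ℝ × ℝ | X.2 < 2⁻¹ ^ (K + 1)} ⊆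
        R K ∪ (refTriangle ∩ {X : ℝ × ℝ | X.2 < 2⁻¹ ^ (K + 1) ∧ X.1 ≤ 1 / 2}) := by
      rintro X ⟨hX, hX2⟩
      by_cases hx : X.1 ≤ 1 / 2
      · exact Or.inr ⟨hX, hX2, hx⟩
      · exact Or.inl ⟨⟨not_le.1 hx, hX.2.1⟩, hX.2.2.1, hX2⟩
    refine (lintegral_mono_set hsub).trans ((lintegral_union_le _ _ _).trans ?_)
    refine add_le_add le_rfl ?_
    -- The left half of the strip is pulled back by `mapB`: the abscissa `1 - x₁ + x₂` of `mapB X`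
    -- is at most `1/2` only if `x₁ > 1/2`, so `X` lies in the rectangle.
    rw [inter_comm, ← Measure.restrict_restrict hS, ← lintegral_indicator hS,
      ← measurePreserving_mapB.lintegral_comp (hf.enorm.indicator hS),
      ← lintegral_indicator measurableSet_refTriangle, ← lintegral_indicator (hRm K)]
    refine lintegral_mono fun X => ?_
    by_cases hX : X ∈ refTriangle
    · rw [indicator_of_mem hX]
      by_cases hX2 : mapB X ∈ {X : ℝ × ℝ | X.2 < 2⁻¹ ^ (K + 1) ∧ X.1 ≤ 1 / 2}
      · have : X ∈ R K := by
          obtain ⟨b1, b2⟩ := hX2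
          have := hX.2.2.1
          simp only [mapB, affMap] at b1 b2
          refine ⟨⟨by linarith, hX.2.1⟩, hX.2.2.1, by linarith⟩
        rw [indicator_of_mem hX2, indicator_of_mem this]
      · rw [indicator_of_notMem hX2]; exact zero_le
    · rw [indicator_of_notMem hX]; exact zero_le
  have c2 : enSq s (fun X => f (mapB X)) ^ (1 / 2 : ℝ) ≤ 16 * enSq s f ^ (1 / 2 : ℝ) := by
    refine (ENNReal.rpow_le_rpow (enSq_comp_le measurePreserving_mapB norm_mapB_sub_le hf
      (by linarith) h1) (by norm_num)).trans ?_
    rw [ENNReal.mul_rpow_of_nonneg _ _ (by norm_num)]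
    gcongr
    calc (16 : ℝ≥0∞) ^ (1 / 2 : ℝ) ≤ 16 ^ (1 : ℝ) :=
          ENNReal.rpow_le_rpow_of_exponent_le (by norm_num) (by norm_num)
      _ = 16 := ENNReal.rpow_one _
  calc _ ≤ 2 ^ K * ((∫⁻ X in R K, ‖f X‖ₑ) + ∫⁻ X in R K, ‖f (mapB X)‖ₑ) := by gcongr
    _ ≤ D * enSq s f ^ (1 / 2 : ℝ) + D * (16 * enSq s f ^ (1 / 2 : ℝ)) := by
        rw [mul_add]
        refine add_le_add (hD f hf K) ((hD _ (hf.comp hB) K).trans ?_)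
        exact mul_le_mul_right c2 _
    _ = _ := by push_cast; ring

end RTTriangle

/-! ### Functions of vanishing trace as limits of test functions. -/

namespace RTTriangle

/-! ### Hardy's inequality for functions with vanishing trace -/

/-- At heights above `δ` the weight is bounded. There `χ` is decomposed into `χ - ψ n`, the
difference of `ψ n` and its trace, and the trace of `ψ n`. For fixed `δ` the first and the last part
disappear as `n → ∞`, while Hardy's inequality bounds the middle one by a constant that depends on
neither `n` nor `δ`. Monotone convergence then lets `δ` tend to zero. -/
theorem hardy_of_zero_trace_fst {r : ℝ} (h0 : 1 / 2 < r) (h1 : r < 1) {χ : ℝ × ℝ → ℝ}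
    (hχ : Measurable χ) (hfin : semiSq r χ ≠ ⊤) {ψ : ℕ → ℝ × ℝ → ℝ}
    (hψ : ∀ n, ContDiff ℝ ∞ (ψ n))
    (hlim : Tendsto (fun n => enSq r (fun x => ψ n x - χ x)) atTop (𝓝 0))
    (htr : Tendsto (fun n => ∫⁻ t in Ioo (0 : ℝ) 1, ENNReal.ofReal (ψ n (t, 0) ^ 2)) atTop
      (𝓝 0)) :
    ∫⁻ X in refTriangle, ENNReal.ofReal (χ X ^ 2 * X.2 ^ (-(2 * r))) < ⊤ := by
  obtain ⟨C, hC⟩ := exists_hardySq_le h0 h1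
  have hψm : ∀ n, Measurable (ψ n) := fun n => (hψ n).continuous.measurable
  have hsing : Measurable fun X : ℝ × ℝ => (X.1, (0 : ℝ)) := by fun_prop
  have bound : ∀ δ : ℝ, 0 < δ → ∫⁻ X in refTriangle ∩ {X | δ < X.2},
      ENNReal.ofReal (χ X ^ 2 * X.2 ^ (-(2 * r))) ≤ 8 * C * semiSq r χ := by
    intro δ hδ
    let D : ℝ≥0∞ := ENNReal.ofReal (δ ^ (-(2 * r)))
    have hset : MeasurableSet (refTriangle ∩ {X : ℝ × ℝ | δ < X.2}) :=
      measurableSet_refTriangle.inter (measurableSet_lt measurable_const measurable_snd)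
    have key : ∀ n, ∫⁻ X in refTriangle ∩ {X | δ < X.2},
        ENNReal.ofReal (χ X ^ 2 * X.2 ^ (-(2 * r))) ≤
        8 * C * semiSq r χ + ((2 * D + 8 * C) * enSq r (fun x => ψ n x - χ x) +
          4 * D * ∫⁻ t in Ioo (0 : ℝ) 1, ENNReal.ofReal (ψ n (t, 0) ^ 2)) := by
      intro n
      have e1 : ∫⁻ X in refTriangle ∩ {X | δ < X.2},
          ENNReal.ofReal (χ X ^ 2 * X.2 ^ (-(2 * r))) ≤
          ∫⁻ X in refTriangle, (2 * D * ENNReal.ofReal ((ψ n X - χ X) ^ 2) +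
            (4 * ENNReal.ofReal ((ψ n X - ψ n (X.1, 0)) ^ 2 * X.2 ^ (-(2 * r))) +
            4 * D * ENNReal.ofReal (ψ n (X.1, 0) ^ 2))) := by
        refine le_trans (setLIntegral_mono' hset fun X hX => ?_)
          (lintegral_mono_set inter_subset_left)
        have hy : 0 < X.2 := hX.1.2.2.1
        have hw : X.2 ^ (-(2 * r)) ≤ δ ^ (-(2 * r)) :=
          Real.rpow_le_rpow_of_nonpos hδ (le_of_lt hX.2) (by linarith)
        have hw0 : 0 < X.2 ^ (-(2 * r)) := by positivity
        simp only [D]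
        rw [← ENNReal.ofReal_ofNat 2, ← ENNReal.ofReal_ofNat 4, ← ENNReal.ofReal_mul (by norm_num),
          ← ENNReal.ofReal_mul (by positivity), ← ENNReal.ofReal_mul (by norm_num),
          ← ENNReal.ofReal_mul (by norm_num), ← ENNReal.ofReal_mul (by positivity),
          ← ENNReal.ofReal_add (by positivity) (by positivity),
          ← ENNReal.ofReal_add (by positivity) (by positivity)]
        refine ENNReal.ofReal_le_ofReal ?_
        have h3 : ∀ a b c : ℝ, (c - a) ^ 2 ≤ 2 * (a) ^ 2 + (4 * (c - b) ^ 2 + 4 * b ^ 2) := by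
          intro a b c
          nlinarith [sq_nonneg (c + a), sq_nonneg (c - b - b)]
        have h4 := h3 (ψ n X - χ X) (ψ n (X.1, 0)) (ψ n X)
        rw [sub_sub_cancel] at h4
        calc χ X ^ 2 * X.2 ^ (-(2 * r)) ≤ _ := mul_le_mul_of_nonneg_right h4 hw0.le
          _ = 2 * X.2 ^ (-(2 * r)) * (ψ n X - χ X) ^ 2 +
              (4 * ((ψ n X - ψ n (X.1, 0)) ^ 2 * X.2 ^ (-(2 * r))) +
              4 * X.2 ^ (-(2 * r)) * ψ n (X.1, 0) ^ 2) := by ring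
          _ ≤ _ := by gcongr
      have e2 : ∫⁻ X in refTriangle, ENNReal.ofReal (ψ n (X.1, 0) ^ 2) ≤
          ∫⁻ t in Ioo (0 : ℝ) 1, ENNReal.ofReal (ψ n (t, 0) ^ 2) := by
        rw [lintegral_refTriangle_eq (h := fun X => ENNReal.ofReal (ψ n (X.1, 0) ^ 2))
          (((hψm n).comp hsing).pow_const 2).ennreal_ofReal]
        refine setLIntegral_mono' measurableSet_Ioo fun x hx => ?_
        simp only
        rw [setLIntegral_const, Real.volume_Ioo, sub_zero]
        refine mul_le_of_le_one_right' ?_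
        rw [ENNReal.ofReal_le_one]; exact hx.2.le
      have e3 : semiSq r (ψ n) ≤ 2 * semiSq r (fun x => ψ n x - χ x) + 2 * semiSq r χ := by
        have := semiSq_add_le (f := fun x => ψ n x - χ x) (g := χ) ((hψm n).sub hχ) r
        simpa only [sub_add_cancel] using this
      have m1 : Measurable fun X => 2 * D * ENNReal.ofReal ((ψ n X - χ X) ^ 2) :=
        (((hψm n).sub hχ).pow_const 2).ennreal_ofReal.const_mul _
      have m2 : Measurable fun X : ℝ × ℝ => 4 * ENNReal.ofReal ((ψ n X - ψ n (X.1, 0)) ^ 2 *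
          X.2 ^ (-(2 * r))) := by
        have := ((hψm n).comp hsing)
        have h6 := (hψm n).sub this
        exact ((h6.pow_const 2).mul (by fun_prop)).ennreal_ofReal.const_mul _
      refine e1.trans ?_
      rw [lintegral_add_left m1, lintegral_add_left m2,
        lintegral_const_mul' _ _ (by finiteness), lintegral_const_mul' _ _ (by finiteness),
        lintegral_const_mul' _ _ (by finiteness)]
      calc 2 * D * (∫⁻ X in refTriangle, ENNReal.ofReal ((ψ n X - χ X) ^ 2)) +
            (4 * hardySq r (ψ n) +
            4 * D * ∫⁻ X in refTriangle, ENNReal.ofReal (ψ n (X.1, 0) ^ 2))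
          ≤ 2 * D * enSq r (fun x => ψ n x - χ x) +
            (4 * (C * (2 * enSq r (fun x => ψ n x - χ x) + 2 * semiSq r χ)) +
            4 * D * ∫⁻ t in Ioo (0 : ℝ) 1, ENNReal.ofReal (ψ n (t, 0) ^ 2)) := by
            gcongr
            · exact le_self_add
            · refine (hC _ (hψ n)).trans (mul_le_mul_right (e3.trans ?_) _)
              gcongr
              exact le_add_self
        _ = _ := by ring
    have hl : Tendsto (fun n => 8 * C * semiSq r χ +
        ((2 * D + 8 * C) * enSq r (fun x => ψ n x - χ x) +
          4 * D * ∫⁻ t in Ioo (0 : ℝ) 1, ENNReal.ofReal (ψ n (t, 0) ^ 2))) atTop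
        (𝓝 (8 * C * semiSq r χ + ((2 * D + 8 * C) * 0 + 4 * D * 0))) := by
      refine tendsto_const_nhds.add (Tendsto.add ?_ ?_)
      · exact ENNReal.Tendsto.const_mul hlim (Or.inr (by finiteness))
      · exact ENNReal.Tendsto.const_mul htr (Or.inr (by finiteness))
    simp only [mul_zero, add_zero] at hl
    exact ge_of_tendsto hl (Eventually.of_forall key)
  have hU : refTriangle = ⋃ k : ℕ, refTriangle ∩ {X : ℝ × ℝ | 1 / ((k : ℝ) + 1) < X.2} := by
    rw [← inter_iUnion]
    refine (inter_eq_left.2 fun X hX => mem_iUnion.2 ?_).symm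
    exact exists_nat_one_div_lt hX.2.2.1
  rw [hU, setLIntegral_iUnion_of_directed]
  · refine lt_of_le_of_lt (iSup_le fun k => bound _ (by positivity)) ?_
    exact ENNReal.mul_lt_top (by finiteness) hfin.lt_top
  · refine Monotone.directed_le fun i j hij => ?_
    refine inter_subset_inter_right _ fun X hX => ?_
    refine lt_of_le_of_lt ?_ (show 1 / ((i : ℝ) + 1) < X.2 from hX)
    have : (i : ℝ) ≤ j := by exact_mod_cast hij
    gcongr

theorem hardy_of_zero_trace {r : ℝ} (h0 : 1 / 2 < r) (h1 : r < 1) {χ : ℝ × ℝ → ℝ}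
    (hχ : Measurable χ) (hfin : semiSq r χ ≠ ⊤) {ψ : ℕ → ℝ × ℝ → ℝ}
    (hψ : ∀ n, ContDiff ℝ ∞ (ψ n))
    (hlim : Tendsto (fun n => enSq r (fun x => ψ n x - χ x)) atTop (𝓝 0)) (e : Fin 3)
    (htr : Tendsto (fun n => ∫⁻ t in Ioo (0 : ℝ) 1, ENNReal.ofReal (ψ n (edgePoint e t) ^ 2)) atTop
      (𝓝 0)) :
    ∫⁻ X in refTriangle, ENNReal.ofReal (χ X ^ 2 * bary e X ^ (-(2 * r))) < ⊤ := by
  have hΦ := measurePreserving_edgeMap e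
  have hL := norm_edgeMap_sub_le e
  have hbary : Measurable (bary e) := by
    fin_cases e
    · exact measurable_snd
    · exact measurable_const.sub measurable_fst
    · exact measurable_fst.sub measurable_snd
  have := hardy_of_zero_trace_fst h0 h1 (χ := fun X => χ (edgeMap e X))
    (ψ := fun n X => ψ n (edgeMap e X)) (hχ.comp hΦ.measurable)
    (ne_top_of_le_ne_top (by finiteness)
      (semiSq_comp_le hΦ hL hχ (by linarith) h1))
    (fun n => (hψ n).comp (contDiff_edgeMap e))
    (by
      have hb : Tendsto (fun n => 16 * enSq r (fun x => ψ n x - χ x)) atTop (𝓝 (16 * 0)) :=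
        ENNReal.Tendsto.const_mul hlim (Or.inr (by norm_num))
      rw [mul_zero] at hb
      refine tendsto_of_tendsto_of_tendsto_of_le_of_le tendsto_const_nhds hb
        (fun n => zero_le) fun n => ?_
      exact enSq_comp_le (f := fun x => ψ n x - χ x) hΦ hL ((hψ n).continuous.measurable.sub hχ)
        (by linarith) h1)
    (by simpa only [edgeMap_edge] using htr)
  rw [← hΦ.lintegral_comp (f := fun X => ENNReal.ofReal (χ X ^ 2 * bary e X ^ (-(2 * r))))
    (((hχ.pow_const 2).mul (hbary.pow_const _)).ennreal_ofReal)]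
  simpa only [bary_edgeMap] using this

/-! ### Cut-off functions -/

/-- A smooth transition from `0` on `(-∞, 1]` to `1` on `[2, ∞)`. -/
noncomputable def step (t : ℝ) : ℝ := Real.smoothTransition (t - 1)

theorem contDiff_smoothTransition : ContDiff ℝ ∞ Real.smoothTransition :=
  Real.smoothTransition.contDiff

theorem contDiff_step : ContDiff ℝ ∞ step :=
  contDiff_smoothTransition.comp (contDiff_id.sub contDiff_const)

theorem step_nonneg (t : ℝ) : 0 ≤ step t := Real.smoothTransition.nonneg _

theorem step_le_one (t : ℝ) : step t ≤ 1 := Real.smoothTransition.le_one _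

theorem step_eq_zero {t : ℝ} (h : t ≤ 1) : step t = 0 :=
  Real.smoothTransition.zero_of_nonpos (by linarith)

theorem step_eq_one {t : ℝ} (h : 2 ≤ t) : step t = 1 :=
  Real.smoothTransition.one_of_one_le (by linarith)

theorem exists_lipschitz_step : ∃ L : ℝ, 1 ≤ L ∧ ∀ a b, |step a - step b| ≤ L * |a - b| := by
  obtain ⟨C, hC⟩ := (isCompact_Icc (a := (0 : ℝ)) (b := 1)).exists_bound_of_continuousOn
    (contDiff_smoothTransition.continuous_deriv (by simp)).continuousOn
  refine ⟨max C 1, le_max_right _ _, fun a b => ?_⟩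
  have key : ∀ x ∈ Icc (0 : ℝ) 1, ∀ y ∈ Icc (0 : ℝ) 1,
      |Real.smoothTransition x - Real.smoothTransition y| ≤ max C 1 * |x - y| := by
    intro x hx y hy
    simp only [← Real.norm_eq_abs]
    refine (convex_Icc (0:ℝ) 1).norm_image_sub_le_of_norm_deriv_le (fun z _ =>
      (contDiff_smoothTransition.differentiable (by simp)).differentiableAt)
      (fun z hz => (hC z hz).trans (le_max_left _ _)) hy hx
  unfold step
  rw [← Real.smoothTransition.projIcc (x := a - 1), ← Real.smoothTransition.projIcc (x := b - 1)]
  refine (key _ (Subtype.mem _) _ (Subtype.mem _)).trans ?_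
  have h2 : |(projIcc (0:ℝ) 1 zero_le_one (a - 1) : ℝ) - projIcc (0:ℝ) 1 zero_le_one (b - 1)| ≤
      |a - b| := by
    have := abs_projIcc_sub_projIcc (zero_le_one (α := ℝ)) (c := a - 1) (d := b - 1)
    rwa [sub_sub_sub_cancel_right] at this
  gcongr

/-- The bound is uniform in the scale `k`. If `k b ≤ 4`, the Lipschitz constant `k` is at most `4 /
b`. If `k b > 4`, either both values are one, or `k a < 2`, so that `a ≤ b / 2` and the right side
is bounded below. -/
theorem exists_abs_step_sub_le : ∃ L : ℝ, 0 ≤ L ∧ ∀ k a b : ℝ, 0 ≤ k → 0 < a → 0 < b →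
    |step (k * a) - step (k * b)| ≤ L * min 1 (|a - b| / b) := by
  obtain ⟨L, hL1, hL⟩ := exists_lipschitz_step
  refine ⟨4 * L, by linarith, fun k a b hk ha hb => ?_⟩
  have hle1 : |step (k * a) - step (k * b)| ≤ 1 := by
    rw [abs_le]
    constructor <;> linarith [step_nonneg (k * a), step_le_one (k * a), step_nonneg (k * b),
      step_le_one (k * b)]
  rcases le_or_gt (k * b) 4 with h | h
  · have h1 := hL (k * a) (k * b)
    rw [← mul_sub, abs_mul, abs_of_nonneg hk] at h1
    rcases min_choice 1 (|a - b| / b) with h2 | h2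
    · rw [h2]; linarith
    · rw [h2]
      refine h1.trans ?_
      rw [mul_div_assoc', le_div_iff₀ hb]
      have := abs_nonneg (a - b)
      nlinarith [mul_nonneg (by linarith : (0:ℝ) ≤ L) this]
  · rcases le_or_gt 2 (k * a) with h3 | h3
    · rw [step_eq_one h3, step_eq_one (by linarith), sub_self, abs_zero]
      positivity
    · refine hle1.trans ?_
      have h4 : 1 / 2 ≤ min 1 (|a - b| / b) := by
        refine le_min (by norm_num) ?_
        rw [le_div_iff₀ hb]
        have h5 : a ≤ b / 2 := by
          by_contra h6
          push Not at h6
          have : 0 < k := by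
            rcases hk.eq_or_lt with h7 | h7
            · rw [← h7] at h; linarith
            · exact h7
          nlinarith
        rw [abs_sub_comm, abs_of_nonneg (by linarith)]
        linarith
      nlinarith

/-- Cut-off functions which vanish near the boundary of the triangle. -/
noncomputable def cutoff (k : ℕ) (X : ℝ × ℝ) : ℝ := ∏ e : Fin 3, step (k * bary e X)

theorem contDiff_bary (e : Fin 3) : ContDiff ℝ ∞ (bary e) := by
  fin_cases e
  · exact contDiff_snd
  · exact contDiff_const.sub contDiff_fst
  · exact contDiff_fst.sub contDiff_snd

theorem contDiff_cutoff (k : ℕ) : ContDiff ℝ ∞ (cutoff k) :=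
  contDiff_prod fun e _ => contDiff_step.comp (contDiff_const.mul (contDiff_bary e))

theorem cutoff_nonneg (k : ℕ) (X : ℝ × ℝ) : 0 ≤ cutoff k X :=
  Finset.prod_nonneg fun _ _ => step_nonneg _

theorem cutoff_le_one (k : ℕ) (X : ℝ × ℝ) : cutoff k X ≤ 1 :=
  Finset.prod_le_one (fun _ _ => step_nonneg _) fun _ _ => step_le_one _

theorem abs_bary_sub_le (e : Fin 3) (X Y : ℝ × ℝ) : |bary e X - bary e Y| ≤ 2 * ‖X - Y‖ := by
  have hx : |X.1 - Y.1| ≤ ‖X - Y‖ := norm_fst_le (X - Y)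
  have hy : |X.2 - Y.2| ≤ ‖X - Y‖ := norm_snd_le (X - Y)
  rw [abs_le] at *
  fin_cases e <;> simp [bary] <;> constructor <;> linarith

/-- Independence of `k` is the point: it provides one majorant for all cut-offs. The differences are
taken in reversed order so that the distances to the edges are those of `X`. -/
theorem exists_abs_cutoff_sub_le : ∃ L : ℝ, 0 ≤ L ∧ ∀ k : ℕ, ∀ X ∈ refTriangle, ∀ Y ∈ refTriangle,
    |cutoff k X - cutoff k Y| ≤ L * ∑ e, min 1 (‖X - Y‖ / bary e X) := by
  obtain ⟨L, hL0, hL⟩ := exists_abs_step_sub_le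
  refine ⟨2 * L, by positivity, fun k X hX Y hY => ?_⟩
  have h1 : |cutoff k X - cutoff k Y| ≤ ∑ e, |step (k * bary e Y) - step (k * bary e X)| := by
    unfold cutoff
    simp only [Fin.prod_univ_three, Fin.sum_univ_three]
    have habs : ∀ a, |step a| ≤ 1 := fun a => by
      rw [abs_of_nonneg (step_nonneg a)]; exact step_le_one a
    generalize (k * bary 0 X : ℝ) = a0
    generalize (k * bary 1 X : ℝ) = a1
    generalize (k * bary 2 X : ℝ) = a2
    generalize (k * bary 0 Y : ℝ) = b0
    generalize (k * bary 1 Y : ℝ) = b1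
    generalize (k * bary 2 Y : ℝ) = b2
    have e : step a0 * step a1 * step a2 - step b0 * step b1 * step b2 =
        -(step b0 - step a0) * (step a1 * step a2) + -(step b1 - step a1) * (step b0 * step a2) +
        -(step b2 - step a2) * (step b0 * step b1) := by ring
    rw [e]
    have h : ∀ t a b : ℝ, |-(t) * (step a * step b)| ≤ |t| := by
      intro t a b
      rw [abs_mul, abs_neg, abs_mul]
      exact mul_le_of_le_one_right (abs_nonneg _)
        (mul_le_one₀ (habs a) (abs_nonneg _) (habs b))
    exact (abs_add_three _ _ _).trans (add_le_add_three (h _ _ _) (h _ _ _) (h _ _ _))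
  refine h1.trans ?_
  rw [Finset.mul_sum]
  refine Finset.sum_le_sum fun e _ => ?_
  have hb := bary_pos hX e
  refine (hL k _ _ (by positivity) (bary_pos hY e) hb).trans ?_
  rw [mul_comm 2 L, mul_assoc]
  refine mul_le_mul_of_nonneg_left ?_ hL0
  have h3 : |bary e Y - bary e X| ≤ 2 * ‖X - Y‖ := by
    rw [abs_sub_comm]; exact abs_bary_sub_le e X Y
  rw [mul_min_of_nonneg _ _ (by norm_num : (0:ℝ) ≤ 2)]
  refine min_le_min (by norm_num) ?_
  rw [mul_div_assoc']
  gcongr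

theorem eventually_cutoff_eq_one {X : ℝ × ℝ} (hX : X ∈ refTriangle) :
    ∀ᶠ k : ℕ in atTop, cutoff k X = 1 := by
  have : ∀ e : Fin 3, ∀ᶠ k : ℕ in atTop, 2 ≤ (k : ℝ) * bary e X := fun e =>
    (tendsto_natCast_atTop_atTop.atTop_mul_const (bary_pos hX e)).eventually_ge_atTop 2
  filter_upwards [eventually_all.2 this] with k hk
  exact Finset.prod_eq_one fun e _ => step_eq_one (hk e)

theorem isTest_cutoff_mul (k : ℕ) {ψ : ℝ × ℝ → ℝ} (hψ : ContDiff ℝ ∞ ψ) :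
    IsTest refTriangle (fun X => cutoff k X * ψ X) := by
  let S : Set (ℝ × ℝ) := ⋂ e : Fin 3, {X | 1 ≤ (k : ℝ) * bary e X}
  have hSc : IsClosed S := isClosed_iInter fun e =>
    isClosed_le continuous_const (continuous_const.mul (contDiff_bary e).continuous)
  have hST : S ⊆ refTriangle := by
    intro X hX
    rw [mem_refTriangle_iff]
    intro e
    have h1 : 1 ≤ (k : ℝ) * bary e X := mem_iInter.1 hX e
    by_contra h2
    push Not at h2
    have := mul_nonpos_of_nonneg_of_nonpos (Nat.cast_nonneg k (α := ℝ)) h2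
    linarith
  have hcomp : IsCompact S := (isCompact_Icc.prod isCompact_Icc).of_isClosed_subset hSc
    (hST.trans refTriangle_subset_Icc)
  have hsupp : Function.support (fun X => cutoff k X * ψ X) ⊆ S := by
    intro X hX
    refine mem_iInter.2 fun e => ?_
    by_contra h
    simp only [mem_ofPred_eq, not_le] at h
    apply hX
    simp only [cutoff]
    rw [Finset.prod_eq_zero (Finset.mem_univ e) (step_eq_zero h.le), zero_mul]
  exact ⟨(contDiff_cutoff k).mul hψ, HasCompactSupport.of_support_subset_isCompact hcomp hsupp,
    (closure_minimal hsupp hSc).trans hST⟩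

theorem semiSq_eq_lintegral_prod {f : ℝ × ℝ → ℝ} (hf : Measurable f) (σ : ℝ) :
    semiSq σ f = ∫⁻ p, ENNReal.ofReal ((f p.1 - f p.2) ^ 2 / ‖p.1 - p.2‖ ^ (2 + 2 * σ))
      ∂((volume.restrict refTriangle).prod (volume.restrict refTriangle)) := by
  rw [lintegral_prod _ (by fun_prop)]
  rfl

theorem ae_prod_mem_refTriangle : ∀ᵐ p ∂((volume.restrict refTriangle).prod
    (volume.restrict refTriangle)), p.1 ∈ refTriangle ∧ p.2 ∈ refTriangle := by
  rw [Measure.prod_restrict]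
  exact (ae_restrict_iff' (measurableSet_refTriangle.prod measurableSet_refTriangle)).2
    (Eventually.of_forall fun p hp => hp)

/-- Dominated convergence, also for the seminorm, viewed as an integral over pairs of points. The
increment of `(cutoff k - 1) χ` is split by the product rule; the part with the increment of the
cut-off is dominated by `χ(X)²` times the truncated kernel. Integration in `Y` turns that kernel
into `bary e X ^ (-(2r))`, and the remaining integral is the assumed Hardy integral. -/
theorem tendsto_cutoff_mul {r : ℝ} (h0 : 0 < r) (h1 : r < 1) {χ : ℝ × ℝ → ℝ}
    (hχ : Measurable χ) (hfin : enSq r χ ≠ ⊤)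
    (hardy : ∀ e, ∫⁻ X in refTriangle, ENNReal.ofReal (χ X ^ 2 * bary e X ^ (-(2 * r))) < ⊤) :
    Tendsto (fun k => enSq r (fun X => cutoff k X * χ X - χ X)) atTop (𝓝 0) := by
  obtain ⟨L, hL0, hL⟩ := exists_abs_cutoff_sub_le
  obtain ⟨C, hC⟩ := exists_lintegral_min_kernel_le h0 h1
  have hcm : ∀ k, Measurable (cutoff k) := fun k => (contDiff_cutoff k).continuous.measurable
  have hbm : ∀ e, Measurable (bary e) := fun e => (contDiff_bary e).continuous.measurable
  have hmeas : ∀ k, Measurable fun X => cutoff k X * χ X - χ X := fun k =>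
    ((hcm k).mul hχ).sub hχ
  have hl2 : l2Sq χ ≠ ⊤ := ne_top_of_le_ne_top hfin le_self_add
  have hs : semiSq r χ ≠ ⊤ := ne_top_of_le_ne_top hfin le_add_self
  have hκ : ∀ k X, |cutoff k X - 1| ≤ 1 := fun k X => by
    rw [abs_le]; constructor <;> linarith [cutoff_nonneg k X, cutoff_le_one k X]
  have t1 : Tendsto (fun k => l2Sq (fun X => cutoff k X * χ X - χ X)) atTop (𝓝 0) := by
    have : Tendsto (fun k => l2Sq (fun X => cutoff k X * χ X - χ X)) atTop
        (𝓝 (∫⁻ X in refTriangle, 0)) := by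
      unfold l2Sq
      refine tendsto_lintegral_of_dominated_convergence (fun X => ENNReal.ofReal (χ X ^ 2))
        (fun k => ((hmeas k).pow_const 2).ennreal_ofReal) (fun k => ?_) hl2 ?_
      · refine Eventually.of_forall fun X => ENNReal.ofReal_le_ofReal ?_
        beta_reduce
        rw [show cutoff k X * χ X - χ X = (cutoff k X - 1) * χ X by ring, mul_pow]
        refine mul_le_of_le_one_left (sq_nonneg _) ?_
        rw [← sq_abs]
        exact pow_le_one₀ (abs_nonneg _) (hκ k X)
      · refine (ae_restrict_iff' measurableSet_refTriangle).2 (Eventually.of_forall fun X hX => ?_)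
        refine tendsto_const_nhds.congr' ?_
        filter_upwards [eventually_cutoff_eq_one hX] with k hk
        simp [hk]
    simpa using this
  have t2 : Tendsto (fun k => semiSq r (fun X => cutoff k X * χ X - χ X)) atTop (𝓝 0) := by
    let ker : Fin 3 → (ℝ × ℝ) × (ℝ × ℝ) → ℝ≥0∞ := fun e p =>
      ENNReal.ofReal (χ p.1 ^ 2) *
        ENNReal.ofReal (min 1 (‖p.2 - p.1‖ / bary e p.1) ^ 2 / ‖p.2 - p.1‖ ^ (2 + 2 * r))
    have hker : ∀ e, Measurable (ker e) := fun e => by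
      have := hbm e
      fun_prop
    let bd : (ℝ × ℝ) × (ℝ × ℝ) → ℝ≥0∞ := fun p =>
      2 * ENNReal.ofReal ((χ p.1 - χ p.2) ^ 2 / ‖p.1 - p.2‖ ^ (2 + 2 * r)) +
        ENNReal.ofReal (6 * L ^ 2) * ∑ e, ker e p
    have hbd : ∫⁻ p, bd p ∂((volume.restrict refTriangle).prod (volume.restrict refTriangle)) ≠
        ⊤ := by
      simp only [bd]
      rw [lintegral_add_left (by fun_prop), lintegral_const_mul' _ _ (by norm_num),
        lintegral_const_mul' _ _ ENNReal.ofReal_ne_top, ← semiSq_eq_lintegral_prod hχ,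
        lintegral_finsetSum _ (fun e _ => hker e)]
      refine ENNReal.add_ne_top.2 ⟨by finiteness, ENNReal.mul_ne_top ENNReal.ofReal_ne_top ?_⟩
      refine ENNReal.sum_ne_top.2 fun e _ => ?_
      rw [lintegral_prod _ (hker e).aemeasurable]
      refine ne_top_of_le_ne_top (b := C * ∫⁻ X in refTriangle,
        ENNReal.ofReal (χ X ^ 2 * bary e X ^ (-(2 * r)))) ?_ ?_
      · exact ENNReal.mul_ne_top (by finiteness) (hardy e).ne
      rw [← lintegral_const_mul' _ _ (by finiteness)]
      refine setLIntegral_mono' measurableSet_refTriangle fun X hX => ?_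
      simp only [ker]
      rw [lintegral_const_mul' _ _ ENNReal.ofReal_ne_top, ENNReal.ofReal_mul (sq_nonneg _),
        mul_left_comm]
      gcongr
      exact (setLIntegral_le_lintegral _ _).trans (hC X _ (bary_pos hX e))
    have : Tendsto (fun k => semiSq r (fun X => cutoff k X * χ X - χ X)) atTop
        (𝓝 (∫⁻ p, 0 ∂((volume.restrict refTriangle).prod (volume.restrict refTriangle)))) := by
      have e : ∀ k, semiSq r (fun X => cutoff k X * χ X - χ X) = _ := fun k =>
        semiSq_eq_lintegral_prod (hmeas k) r
      simp only [e]
      refine tendsto_lintegral_of_dominated_convergence bd (fun k => ?_) (fun k => ?_) hbd ?_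
      · have := hmeas k
        have a1 : Measurable fun p : (ℝ × ℝ) × (ℝ × ℝ) => cutoff k p.1 * χ p.1 - χ p.1 :=
          this.comp measurable_fst
        have a2 : Measurable fun p : (ℝ × ℝ) × (ℝ × ℝ) => cutoff k p.2 * χ p.2 - χ p.2 :=
          this.comp measurable_snd
        exact (((a1.sub a2).pow_const 2).div (by fun_prop)).ennreal_ofReal
      · filter_upwards [ae_prod_mem_refTriangle] with p hp
        obtain ⟨X, Y⟩ := p
        obtain ⟨hX, hY⟩ := hp
        simp only at hX hY
        simp only [bd, ker]
        have h3 : (cutoff k X * χ X - χ X - (cutoff k Y * χ Y - χ Y)) ^ 2 ≤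
            2 * (χ X - χ Y) ^ 2 +
            6 * L ^ 2 * ∑ e, χ X ^ 2 * min 1 (‖Y - X‖ / bary e X) ^ 2 := by
          have b1 : (cutoff k Y - 1) ^ 2 ≤ 1 := by
            rw [← sq_abs]; exact pow_le_one₀ (abs_nonneg _) (hκ k Y)
          have b2 : (cutoff k X - cutoff k Y) ^ 2 ≤
              L ^ 2 * (3 * ∑ e, min 1 (‖Y - X‖ / bary e X) ^ 2) := by
            have := hL k X hX Y hY
            rw [norm_sub_rev] at this
            rw [← sq_abs]
            refine (pow_le_pow_left₀ (abs_nonneg _) this 2).trans ?_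
            rw [mul_pow]
            gcongr
            have := sq_sum_le_card_mul_sum_sq (s := (Finset.univ : Finset (Fin 3)))
              (f := fun e => min 1 (‖Y - X‖ / bary e X))
            simpa using this
          calc _ = ((cutoff k Y - 1) * (χ X - χ Y) + χ X * (cutoff k X - cutoff k Y)) ^ 2 := by
                ring
            _ ≤ 2 * ((cutoff k Y - 1) ^ 2 * (χ X - χ Y) ^ 2) +
                2 * (χ X ^ 2 * (cutoff k X - cutoff k Y) ^ 2) := by
                nlinarith [sq_nonneg ((cutoff k Y - 1) * (χ X - χ Y) -
                  χ X * (cutoff k X - cutoff k Y))]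
            _ ≤ 2 * (1 * (χ X - χ Y) ^ 2) +
                2 * (χ X ^ 2 * (L ^ 2 * (3 * ∑ e, min 1 (‖Y - X‖ / bary e X) ^ 2))) := by
                gcongr
            _ = _ := by rw [← Finset.mul_sum]; ring
        have hP : (0:ℝ) ≤ ‖X - Y‖ ^ (2 + 2 * r) := by positivity
        have hsum : ∑ e : Fin 3, ENNReal.ofReal (χ X ^ 2) *
            ENNReal.ofReal (min 1 (‖Y - X‖ / bary e X) ^ 2 / ‖Y - X‖ ^ (2 + 2 * r)) =
            ENNReal.ofReal (∑ e : Fin 3, χ X ^ 2 * min 1 (‖Y - X‖ / bary e X) ^ 2 /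
              ‖X - Y‖ ^ (2 + 2 * r)) := by
          rw [ENNReal.ofReal_sum_of_nonneg fun e _ => by positivity]
          refine Finset.sum_congr rfl fun e _ => ?_
          rw [← ENNReal.ofReal_mul (sq_nonneg _), norm_sub_rev X Y, mul_div_assoc]
        rw [hsum, ← ENNReal.ofReal_ofNat 2, ← ENNReal.ofReal_mul (by norm_num),
          ← ENNReal.ofReal_mul (by positivity), ← ENNReal.ofReal_add (by positivity)
          (mul_nonneg (by positivity) (Finset.sum_nonneg fun e _ => by positivity))]
        refine ENNReal.ofReal_le_ofReal ?_
        refine (div_le_div_of_nonneg_right h3 hP).trans (le_of_eq ?_)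
        rw [← Finset.sum_div]
        ring
      · filter_upwards [ae_prod_mem_refTriangle] with p hp
        refine tendsto_const_nhds.congr' ?_
        filter_upwards [eventually_cutoff_eq_one hp.1, eventually_cutoff_eq_one hp.2] with k hk hk'
        simp [hk, hk']
    simpa using this
  have := t1.add t2
  rw [add_zero] at this
  exact this

/-- Functions with vanishing trace are limits of test functions. -/
theorem exists_isTest_tendsto {r : ℝ} (h0 : 1 / 2 < r) (h1 : r < 1) {χ : ℝ × ℝ → ℝ}
    (hχ : Measurable χ) (hfin : enSq r χ ≠ ⊤) {ψ : ℕ → ℝ × ℝ → ℝ}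
    (hψ : ∀ n, ContDiff ℝ ∞ (ψ n))
    (hlim : Tendsto (fun n => enSq r (fun x => ψ n x - χ x)) atTop (𝓝 0))
    (htr : ∀ e, Tendsto (fun n => ∫⁻ t in Ioo (0 : ℝ) 1, ENNReal.ofReal (ψ n (edgePoint e t) ^ 2))
      atTop (𝓝 0)) :
    ∃ ζ : ℕ → ℝ × ℝ → ℝ, (∀ n, IsTest refTriangle (ζ n)) ∧
      Tendsto (fun n => enSq r (fun x => ζ n x - χ x)) atTop (𝓝 0) := by
  have hs : semiSq r χ ≠ ⊤ := ne_top_of_le_ne_top hfin le_add_self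
  have hcut := tendsto_cutoff_mul (by linarith : 0 < r) h1 hχ hfin
    (fun e => hardy_of_zero_trace h0 h1 hχ hs hψ hlim e (htr e))
  -- Multiplication by `cutoff k` is bounded on `H^r` with a norm that may grow with `k`, so the
  -- smooth approximation is chosen after `k`.
  have hchoose : ∀ k : ℕ, ∃ n, enSq r (fun X => cutoff k X * (ψ n X - χ X)) ≤
      ENNReal.ofReal (1 / ((k : ℝ) + 1)) := by
    intro k
    obtain ⟨L, -, hL⟩ := exists_lipschitz_of_contDiff (contDiff_cutoff k)
    obtain ⟨C, hC⟩ := exists_enSq_mul_le h1 1 L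
    have ht : Tendsto (fun n => C * enSq r (fun x => ψ n x - χ x)) atTop (𝓝 (C * 0)) :=
      ENNReal.Tendsto.const_mul hlim (Or.inr (by finiteness))
    rw [mul_zero] at ht
    have hpos : 0 < ENNReal.ofReal (1 / ((k : ℝ) + 1)) := by
      rw [ENNReal.ofReal_pos]; positivity
    obtain ⟨n, hn⟩ := (ht.eventually_lt_const hpos).exists
    refine ⟨n, (hC (cutoff k) (fun x => ψ n x - χ x) ((hψ n).continuous.measurable.sub hχ)
      (contDiff_cutoff k).continuous.measurable (fun X _ => ?_) (fun X hX Y hY => ?_)).trans hn.le⟩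
    · rw [abs_of_nonneg (cutoff_nonneg k X)]; exact cutoff_le_one k X
    · exact hL X (refTriangle_subset_Icc hX) Y (refTriangle_subset_Icc hY)
  choose N hN using hchoose
  refine ⟨fun k X => cutoff k X * ψ (N k) X, fun k => isTest_cutoff_mul k (hψ _), ?_⟩
  have hb : Tendsto (fun k : ℕ => 2 * ENNReal.ofReal (1 / ((k : ℝ) + 1)) +
      2 * enSq r (fun X => cutoff k X * χ X - χ X)) atTop (𝓝 (2 * ENNReal.ofReal 0 + 2 * 0)) := by
    refine Tendsto.add (ENNReal.Tendsto.const_mul ?_ (Or.inr (by norm_num)))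
      (ENNReal.Tendsto.const_mul hcut (Or.inr (by norm_num)))
    exact ENNReal.tendsto_ofReal tendsto_one_div_add_atTop_nhds_zero_nat
  simp only [ENNReal.ofReal_zero, mul_zero, add_zero] at hb
  refine tendsto_of_tendsto_of_tendsto_of_le_of_le tendsto_const_nhds hb (fun _ => zero_le)
    fun k => ?_
  have := enSq_add_le (f := fun X => cutoff k X * (ψ (N k) X - χ X))
    (g := fun X => cutoff k X * χ X - χ X)
    ((contDiff_cutoff k).continuous.measurable.mul ((hψ _).continuous.measurable.sub hχ)) r
  refine le_trans (le_of_eq ?_) (this.trans (add_le_add (mul_le_mul_right (hN k) 2) le_rfl))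
  congr 1; funext X; ring

end RTTriangle

/-! ### The weak flux does not depend on the auxiliary function. -/

namespace RTTriangle

/-! ### Comparison with the Sobolev norm -/

theorem lintegral_ofReal_sq_eq_eLpNorm_sq {α : Type*} [MeasurableSpace α] (μ : Measure α)
    (f : α → ℝ) : ∫⁻ x, ENNReal.ofReal (f x ^ 2) ∂μ = eLpNorm f 2 μ ^ 2 := by
  have := eLpNorm_nnreal_pow_eq_lintegral (f := f) (μ := μ) (p := 2) (by norm_num)
  simp only [ofReal_sq_eq_enorm_sq]
  norm_num at this
  exact this.symm

theorem l2Sq_eq (f : ℝ × ℝ → ℝ) : l2Sq f = eLpNorm f 2 (volume.restrict refTriangle) ^ 2 :=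
  lintegral_ofReal_sq_eq_eLpNorm_sq _ f

theorem l2Sq_ne_top {f : ℝ × ℝ → ℝ} (hf : MemLp f 2 (volume.restrict refTriangle)) :
    l2Sq f ≠ ⊤ := by
  rw [l2Sq_eq]; exact ENNReal.pow_ne_top hf.2.ne

theorem norm_le_sqrt (X : ℝ × ℝ) : ‖X‖ ≤ Real.sqrt (X.1 ^ 2 + X.2 ^ 2) := by
  rw [Prod.norm_def, max_le_iff]
  constructor
  · exact Real.abs_le_sqrt (by nlinarith [sq_nonneg X.2])
  · exact Real.abs_le_sqrt (by nlinarith [sq_nonneg X.1])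

theorem sqrt_le_norm (X : ℝ × ℝ) : Real.sqrt (X.1 ^ 2 + X.2 ^ 2) ≤ Real.sqrt 2 * ‖X‖ := by
  have h1 : |X.1| ≤ ‖X‖ := norm_fst_le X
  have h2 : |X.2| ≤ ‖X‖ := norm_snd_le X
  rw [← Real.sqrt_sq (norm_nonneg X), ← Real.sqrt_mul (by norm_num)]
  refine Real.sqrt_le_sqrt ?_
  have h3 := pow_le_pow_left₀ (abs_nonneg _) h1 2
  have h4 := pow_le_pow_left₀ (abs_nonneg _) h2 2
  rw [sq_abs] at h3 h4
  linarith

theorem slobodeckijSq_le_semiSq {σ : ℝ} (h0 : 0 < σ) (f : ℝ × ℝ → ℝ) :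
    slobodeckijSq refTriangle σ f ≤ semiSq σ f := by
  refine lintegral_mono fun X => lintegral_mono fun Y => ENNReal.ofReal_le_ofReal ?_
  have h := norm_le_sqrt (X - Y)
  rcases (norm_nonneg (X - Y)).eq_or_lt with h3 | h3
  · have : X = Y := sub_eq_zero.1 (norm_eq_zero.1 h3.symm)
    simp [this]
  · refine div_le_div_of_nonneg_left (sq_nonneg _) (by positivity) ?_
    exact Real.rpow_le_rpow h3.le h (by linarith)

theorem semiSq_le_slobodeckijSq {σ : ℝ} (h0 : 0 < σ) (h1 : σ < 1) (f : ℝ × ℝ → ℝ) :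
    semiSq σ f ≤ 4 * slobodeckijSq refTriangle σ f := by
  unfold slobodeckijSq semiSq
  rw [← lintegral_const_mul' _ _ (by norm_num)]
  refine lintegral_mono fun X => ?_
  simp only [gagliardo]
  rw [← lintegral_const_mul' _ _ (by norm_num)]
  refine lintegral_mono fun Y => ?_
  rw [← ENNReal.ofReal_ofNat 4, ← ENNReal.ofReal_mul (by norm_num)]
  refine ENNReal.ofReal_le_ofReal ?_
  have h := sqrt_le_norm (X - Y)
  have h' := norm_le_sqrt (X - Y)
  simp only [Prod.fst_sub, Prod.snd_sub] at h h'
  rcases (norm_nonneg (X - Y)).eq_or_lt with h3 | h3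
  · have : X = Y := sub_eq_zero.1 (norm_eq_zero.1 h3.symm)
    simp [this]
  · have h4 : 0 < Real.sqrt ((X.1 - Y.1) ^ 2 + (X.2 - Y.2) ^ 2) := h3.trans_le h'
    rw [← mul_div_assoc, div_le_div_iff₀ (by positivity) (by positivity), mul_comm (4 : ℝ),
      mul_assoc]
    refine mul_le_mul_of_nonneg_left ?_ (sq_nonneg _)
    calc _ ≤ (Real.sqrt 2 * ‖X - Y‖) ^ (2 + 2 * σ) := Real.rpow_le_rpow h4.le h (by linarith)
      _ = Real.sqrt 2 ^ (2 + 2 * σ) * ‖X - Y‖ ^ (2 + 2 * σ) :=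
          Real.mul_rpow (by positivity) h3.le
      _ ≤ 4 * ‖X - Y‖ ^ (2 + 2 * σ) := by
          gcongr
          calc Real.sqrt 2 ^ (2 + 2 * σ) ≤ Real.sqrt 2 ^ (4 : ℝ) :=
                Real.rpow_le_rpow_of_exponent_le
                  (by rw [Real.one_le_sqrt]; norm_num) (by linarith)
            _ = (Real.sqrt 2 ^ 2) ^ 2 := by
                rw [← pow_mul]; norm_num
            _ = 4 := by rw [Real.sq_sqrt (by norm_num)]; norm_num

/-- Every admissible family contains `f` itself at order zero; outside `L²` the infimum is over an
empty set. -/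
theorem memLp_of_sobolevNorm_ne_top {s : ℝ} {f : ℝ × ℝ → ℝ}
    (h : sobolevNorm refTriangle s f ≠ ⊤) : MemLp f 2 (volume.restrict refTriangle) := by
  by_contra hf
  apply h
  unfold sobolevNorm
  have : ∀ D, ¬ IsWeakDerivFamily refTriangle ⌊s⌋₊ f D := by
    intro D hD
    have := (hD.2 (0, 0) (by simp)).1
    rw [hD.1] at this
    exact hf this
  simp only [this, iInf_false, iInf_top]
  exact ENNReal.top_rpow_of_pos (by norm_num)

theorem sobolevNorm_eq {σ : ℝ} (h0 : 0 < σ) (h1 : σ < 1) {f : ℝ × ℝ → ℝ}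
    (hf : MemLp f 2 (volume.restrict refTriangle)) :
    sobolevNorm refTriangle σ f =
      (l2Sq f + slobodeckijSq refTriangle σ f) ^ (1 / 2 : ℝ) := by
  have hfl : ⌊σ⌋₊ = 0 := Nat.floor_eq_zero.2 h1
  unfold sobolevNorm
  rw [hfl]
  congr 1
  have hval : ∀ D : ℕ × ℕ → ℝ × ℝ → ℝ, D (0, 0) = f →
      ((∑ k ∈ Finset.range (0 + 1), ∑ α ∈ Finset.HasAntidiagonal.antidiagonal k,
        (eLpNorm (D α) 2 (volume.restrict refTriangle)) ^ 2) +
      if σ = ((0 : ℕ) : ℝ) then 0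
      else ∑ α ∈ Finset.HasAntidiagonal.antidiagonal 0,
        slobodeckijSq refTriangle (σ - ((0 : ℕ) : ℝ)) (D α)) =
      l2Sq f + slobodeckijSq refTriangle σ f := by
    intro D hD
    rw [l2Sq_eq]
    simp [hD, h0.ne']
  refine le_antisymm ?_ ?_
  -- At order zero only `α = (0, 0)` is tested, so the constant family is admissible.
  · refine iInf₂_le_of_le (fun _ => f) ⟨rfl, fun α hα => ⟨hf, fun ψ _ => ?_⟩⟩
      (hval _ rfl).le
    have h1 : α.1 = 0 := by omega
    have h2 : α.2 = 0 := by omega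
    simp [multiDeriv, h1, h2]
  · exact le_iInf₂ fun D hD => (hval D hD.1).ge

theorem enSq_le_sobolevNorm_sq {σ : ℝ} (h0 : 0 < σ) (h1 : σ < 1) (f : ℝ × ℝ → ℝ) :
    enSq σ f ≤ 4 * sobolevNorm refTriangle σ f ^ 2 := by
  by_cases hf : MemLp f 2 (volume.restrict refTriangle)
  · rw [sobolevNorm_eq h0 h1 hf, ← ENNReal.rpow_natCast, ← ENNReal.rpow_mul]
    norm_num
    rw [mul_add]
    exact add_le_add (le_mul_of_one_le_left' (by norm_num)) (semiSq_le_slobodeckijSq h0 h1 f)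
  · have : sobolevNorm refTriangle σ f = ⊤ := by
      by_contra h; exact hf (memLp_of_sobolevNorm_ne_top h)
    rw [this]; simp

theorem sobolevNorm_le_enSq {σ : ℝ} (h0 : 0 < σ) (h1 : σ < 1) {f : ℝ × ℝ → ℝ}
    (hf : MemLp f 2 (volume.restrict refTriangle)) :
    sobolevNorm refTriangle σ f ≤ enSq σ f ^ (1 / 2 : ℝ) := by
  rw [sobolevNorm_eq h0 h1 hf]
  exact ENNReal.rpow_le_rpow (add_le_add le_rfl (slobodeckijSq_le_semiSq h0 f)) (by norm_num)

theorem SmoothApprox.tendsto_enSq {r : ℝ} (h0 : 0 < r) (h1 : r < 1) {φ : ℝ × ℝ → ℝ}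
    {φn : ℕ → ℝ × ℝ → ℝ} (h : SmoothApprox r φ φn) :
    Tendsto (fun n => enSq r (fun x => φn n x - φ x)) atTop (𝓝 0) := by
  have hb : Tendsto (fun n => 4 * sobolevNorm refTriangle r (fun x => φn n x - φ x) ^ 2) atTop
      (𝓝 (4 * 0 ^ 2)) :=
    ENNReal.Tendsto.const_mul (ENNReal.Tendsto.pow (n := 2) h.2) (Or.inr (by norm_num))
  norm_num at hb
  exact tendsto_of_tendsto_of_tendsto_of_le_of_le tendsto_const_nhds hb (fun _ => zero_le)
    fun n => enSq_le_sobolevNorm_sq h0 h1 _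

theorem memLp_contDiff {ψ : ℝ × ℝ → ℝ} (hψ : ContDiff ℝ ∞ ψ) (p : ℝ≥0∞) :
    MemLp ψ p (volume.restrict refTriangle) := by
  obtain ⟨C, hC⟩ := (isCompact_Icc.prod isCompact_Icc :
    IsCompact (Icc (0 : ℝ) 1 ×ˢ Icc (0 : ℝ) 1)).exists_bound_of_continuousOn
    hψ.continuous.continuousOn
  exact memLp_of_bound hψ.continuous.measurable (fun X hX => hC X (refTriangle_subset_Icc hX)) p

theorem smoothApprox_of_tendsto {r : ℝ} (h0 : 0 < r) (h1 : r < 1) {φ : ℝ × ℝ → ℝ}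
    (hφ : MemLp φ 2 (volume.restrict refTriangle)) {φn : ℕ → ℝ × ℝ → ℝ}
    (hs : ∀ n, ContDiff ℝ ∞ (φn n))
    (h : Tendsto (fun n => enSq r (fun x => φn n x - φ x)) atTop (𝓝 0)) :
    SmoothApprox r φ φn := by
  refine ⟨hs, ?_⟩
  have hb : Tendsto (fun n => enSq r (fun x => φn n x - φ x) ^ (1 / 2 : ℝ)) atTop
      (𝓝 (0 ^ (1 / 2 : ℝ))) := h.ennrpow_const _
  rw [ENNReal.zero_rpow_of_pos (by norm_num)] at hb
  exact tendsto_of_tendsto_of_tendsto_of_le_of_le tendsto_const_nhds hb (fun _ => zero_le)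
    fun n => sobolevNorm_le_enSq h0 h1 ((memLp_contDiff (hs n) 2).sub hφ)

theorem enSq_ne_top {σ : ℝ} (h0 : 0 < σ) (h1 : σ < 1) {f : ℝ × ℝ → ℝ}
    (hf : MemSobolev refTriangle σ f) : enSq σ f ≠ ⊤ := by
  refine ne_top_of_le_ne_top ?_ (enSq_le_sobolevNorm_sq h0 h1 f)
  exact ENNReal.mul_ne_top (by norm_num) (ENNReal.pow_ne_top hf.2.ne)

theorem memSobolev_of_enSq_ne_top {σ : ℝ} (h0 : 0 < σ) (h1 : σ < 1) {f : ℝ × ℝ → ℝ}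
    (hf : MemLp f 2 (volume.restrict refTriangle)) (h : enSq σ f ≠ ⊤) :
    MemSobolev refTriangle σ f :=
  ⟨hf, (sobolevNorm_le_enSq h0 h1 hf).trans_lt
    (ENNReal.rpow_lt_top_of_nonneg (by norm_num) h)⟩

/-! ### The functional `ψ ↦ ∫ u · ∇ψ` on smooth functions -/

/-- The integral of `u · ∇ψ`. -/
noncomputable def gradInt (u : Fin 2 → ℝ × ℝ → ℝ) (ψ : ℝ × ℝ → ℝ) : ℝ :=
  ∫ x in refTriangle, ∑ i, u i x * pderiv i ψ x

theorem pderiv_add {f g : ℝ × ℝ → ℝ} (hf : ContDiff ℝ ∞ f) (hg : ContDiff ℝ ∞ g) (i : Fin 2)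
    (x : ℝ × ℝ) : pderiv i (fun x => f x + g x) x = pderiv i f x + pderiv i g x := by
  unfold pderiv
  rw [fderiv_fun_add (hf.differentiable (by simp)).differentiableAt
    (hg.differentiable (by simp)).differentiableAt]
  rfl

theorem pderiv_sub {f g : ℝ × ℝ → ℝ} (hf : ContDiff ℝ ∞ f) (hg : ContDiff ℝ ∞ g) (i : Fin 2)
    (x : ℝ × ℝ) : pderiv i (fun x => f x - g x) x = pderiv i f x - pderiv i g x := by
  unfold pderiv
  rw [fderiv_fun_sub (hf.differentiable (by simp)).differentiableAt
    (hg.differentiable (by simp)).differentiableAt]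
  rfl

theorem integrable_mul_pderiv {v : ℝ × ℝ → ℝ} (hv : MemLp v 2 (volume.restrict refTriangle))
    {ψ : ℝ × ℝ → ℝ} (hψ : ContDiff ℝ ∞ ψ) (i : Fin 2) :
    Integrable (fun x => v x * pderiv i ψ x) (volume.restrict refTriangle) :=
  hv.integrable_mul (memLp_pderiv hψ i 2)

theorem gradInt_eq_sum {u : Fin 2 → ℝ × ℝ → ℝ}
    (hu : ∀ i, MemLp (u i) 2 (volume.restrict refTriangle)) {ψ : ℝ × ℝ → ℝ}
    (hψ : ContDiff ℝ ∞ ψ) :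
    gradInt u ψ = ∑ i, ∫ x in refTriangle, u i x * pderiv i ψ x :=
  integral_finsetSum _ fun i _ => integrable_mul_pderiv (hu i) hψ i

theorem gradInt_add {u : Fin 2 → ℝ × ℝ → ℝ}
    (hu : ∀ i, MemLp (u i) 2 (volume.restrict refTriangle)) {f g : ℝ × ℝ → ℝ}
    (hf : ContDiff ℝ ∞ f) (hg : ContDiff ℝ ∞ g) :
    gradInt u (fun x => f x + g x) = gradInt u f + gradInt u g := by
  rw [gradInt_eq_sum hu (hf.add hg), gradInt_eq_sum hu hf, gradInt_eq_sum hu hg,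
    ← Finset.sum_add_distrib]
  refine Finset.sum_congr rfl fun i _ => ?_
  rw [← integral_add (integrable_mul_pderiv (hu i) hf i) (integrable_mul_pderiv (hu i) hg i)]
  congr 1; funext x
  rw [pderiv_add hf hg, mul_add]

theorem gradInt_sub {u : Fin 2 → ℝ × ℝ → ℝ}
    (hu : ∀ i, MemLp (u i) 2 (volume.restrict refTriangle)) {f g : ℝ × ℝ → ℝ}
    (hf : ContDiff ℝ ∞ f) (hg : ContDiff ℝ ∞ g) :
    gradInt u (fun x => f x - g x) = gradInt u f - gradInt u g := by
  rw [gradInt_eq_sum hu (hf.sub hg), gradInt_eq_sum hu hf, gradInt_eq_sum hu hg,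
    ← Finset.sum_sub_distrib]
  refine Finset.sum_congr rfl fun i _ => ?_
  rw [← integral_sub (integrable_mul_pderiv (hu i) hf i) (integrable_mul_pderiv (hu i) hg i)]
  congr 1; funext x
  rw [pderiv_sub hf hg, mul_sub]

theorem gradInt_const (u : Fin 2 → ℝ × ℝ → ℝ) (c : ℝ) : gradInt u (fun _ => c) = 0 := by
  simp [gradInt, pderiv]

theorem ofReal_integral_mul_sq_le {α : Type*} [MeasurableSpace α] {μ : Measure α} {f g : α → ℝ}
    (hf : AEStronglyMeasurable f μ) (hg : AEStronglyMeasurable g μ) :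
    ENNReal.ofReal ((∫ x, f x * g x ∂μ) ^ 2) ≤
      (∫⁻ x, ENNReal.ofReal (f x ^ 2) ∂μ) * ∫⁻ x, ENNReal.ofReal (g x ^ 2) ∂μ := by
  simp only [ofReal_sq_eq_enorm_sq]
  have h1 := enorm_integral_le_lintegral_enorm (μ := μ) fun x => f x * g x
  simp only [enorm_mul] at h1
  exact (pow_le_pow_left₀ zero_le h1 2).trans (lintegral_mul_sq_le hf.enorm hg.enorm)

theorem tendsto_zero_of_ofReal_sq {a : ℕ → ℝ}
    (h : Tendsto (fun n => ENNReal.ofReal (a n ^ 2)) atTop (𝓝 0)) : Tendsto a atTop (𝓝 0) := by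
  simp only [ofReal_sq_eq_enorm_sq] at h
  have h2 := h.ennrpow_const (1 / 2 : ℝ)
  rw [ENNReal.zero_rpow_of_pos (by norm_num)] at h2
  have h3 : ∀ n, (‖a n‖ₑ ^ 2) ^ (1 / 2 : ℝ) = ‖a n‖ₑ := fun n => by
    rw [← ENNReal.rpow_natCast, ← ENNReal.rpow_mul]; norm_num
  simp only [h3] at h2
  exact tendsto_zero_iff_enorm_tendsto_zero.2 h2

theorem integral_mul_sub {d f g : ℝ × ℝ → ℝ} (hd : MemLp d 2 (volume.restrict refTriangle))
    (hf : MemLp f 2 (volume.restrict refTriangle)) (hg : MemLp g 2 (volume.restrict refTriangle)) :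
    ∫ x in refTriangle, d x * (f x - g x) =
      (∫ x in refTriangle, d x * f x) - ∫ x in refTriangle, d x * g x := by
  simp only [mul_sub]
  exact integral_sub (hd.integrable_mul hf) (hd.integrable_mul hg)

theorem tendsto_integral_mul {d : ℝ × ℝ → ℝ} (hd : MemLp d 2 (volume.restrict refTriangle))
    {r : ℝ} {φ : ℝ × ℝ → ℝ} (hφ : MemLp φ 2 (volume.restrict refTriangle))
    {φn : ℕ → ℝ × ℝ → ℝ} (hs : ∀ n, ContDiff ℝ ∞ (φn n))
    (h : Tendsto (fun n => enSq r (fun x => φn n x - φ x)) atTop (𝓝 0)) :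
    Tendsto (fun n => ∫ x in refTriangle, d x * φn n x) atTop
      (𝓝 (∫ x in refTriangle, d x * φ x)) := by
  rw [tendsto_iff_norm_sub_tendsto_zero, ← tendsto_zero_iff_norm_tendsto_zero]
  refine tendsto_zero_of_ofReal_sq ?_
  have hb : Tendsto (fun n => l2Sq d * enSq r (fun x => φn n x - φ x)) atTop (𝓝 (l2Sq d * 0)) :=
    ENNReal.Tendsto.const_mul h (Or.inr (l2Sq_ne_top hd))
  rw [mul_zero] at hb
  refine tendsto_of_tendsto_of_tendsto_of_le_of_le tendsto_const_nhds hb (fun _ => zero_le)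
    fun n => ?_
  have hφn := memLp_contDiff (hs n) 2
  simp only
  rw [← integral_mul_sub hd hφn hφ]
  exact (ofReal_integral_mul_sq_le hd.1 (hφn.1.sub hφ.1)).trans (mul_le_mul_right le_self_add _)

/-! ### Uniqueness of the normal flux -/

theorem tendsto_edge_sub {e : Fin 3} {φ1 φ2 : ℕ → ℝ × ℝ → ℝ} (hs1 : ∀ n, ContDiff ℝ ∞ (φ1 n))
    (c : ℝ)
    (h1 : Tendsto (fun n => eLpNorm (fun t => φ1 n (edgePoint e t) - c) 2
      (volume.restrict (Ioo (0 : ℝ) 1))) atTop (𝓝 0))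
    (h2 : Tendsto (fun n => eLpNorm (fun t => φ2 n (edgePoint e t) - c) 2
      (volume.restrict (Ioo (0 : ℝ) 1))) atTop (𝓝 0)) :
    Tendsto (fun n => ∫⁻ t in Ioo (0 : ℝ) 1,
      ENNReal.ofReal ((φ1 n (edgePoint e t) - φ2 n (edgePoint e t)) ^ 2)) atTop (𝓝 0) := by
  have hb := (ENNReal.Tendsto.const_mul (a := 2) (ENNReal.Tendsto.pow (n := 2) h1) (Or.inr (by norm_num))).add
    (ENNReal.Tendsto.const_mul (a := 2) (ENNReal.Tendsto.pow (n := 2) h2) (Or.inr (by norm_num)))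
  norm_num at hb
  refine tendsto_of_tendsto_of_tendsto_of_le_of_le tendsto_const_nhds hb (fun _ => zero_le)
    fun n => ?_
  simp only
  have hm : Measurable fun t => φ1 n (edgePoint e t) - c :=
    ((hs1 n).continuous.comp (continuous_edgePoint e)).measurable.sub_const c
  rw [← lintegral_ofReal_sq_eq_eLpNorm_sq, ← lintegral_ofReal_sq_eq_eLpNorm_sq,
    ← lintegral_const_mul' _ _ (by norm_num), ← lintegral_const_mul' _ _ (by norm_num),
    ← lintegral_add_left ((hm.pow_const 2).ennreal_ofReal.const_mul 2)]
  refine lintegral_mono fun t => ?_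
  have e := ofReal_add_sq_le (φ1 n (edgePoint e t) - c) (-(φ2 n (edgePoint e t) - c))
  rw [neg_sq] at e
  refine le_trans (le_of_eq ?_) e
  congr 2; ring

/-- The difference of the two functions has vanishing trace and is the `H^r1`-limit of test
functions `ζ n`; the smaller order `r1` is used for both. On `ζ n` the pairing equals `-∫ d ζ n`, so
the change of the pairing cancels the change of the divergence term. -/
theorem flux_unique_aux {u : Fin 2 → ℝ × ℝ → ℝ} {d : ℝ × ℝ → ℝ} (hu : HasDivL2 refTriangle u d)
    {e : Fin 3} {r1 r2 : ℝ} (h1 : 1 / 2 < r1) (h12 : r1 ≤ r2) (h2 : r2 < 1)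
    {φ1 φ2 : ℝ × ℝ → ℝ} {p1 p2 : ℝ} (hφ1 : MemSobolev refTriangle r1 φ1)
    (hφ2 : MemSobolev refTriangle r2 φ2) (ht1 : HasEdgeIndicatorTrace r1 φ1 e)
    (ht2 : HasEdgeIndicatorTrace r2 φ2 e) (hp1 : IsGradPairing r1 u φ1 p1)
    (hp2 : IsGradPairing r2 u φ2 p2) :
    p1 + ∫ x in refTriangle, d x * φ1 x = p2 + ∫ x in refTriangle, d x * φ2 x := by
  obtain ⟨φ1n, hs1, htr1⟩ := ht1
  obtain ⟨φ2n, hs2, htr2⟩ := ht2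
  obtain ⟨huL, hdL, hdiv⟩ := hu
  have hr1 : r1 < 1 := h12.trans_lt h2
  obtain ⟨χ1, hχ1, hχ1e⟩ := hφ1.1.1.aemeasurable
  obtain ⟨χ2, hχ2, hχ2e⟩ := hφ2.1.1.aemeasurable
  have hL1 : MemLp χ1 2 (volume.restrict refTriangle) := hφ1.1.ae_eq hχ1e
  have hL2 : MemLp χ2 2 (volume.restrict refTriangle) := hφ2.1.ae_eq hχ2e
  have hm1 : ∀ n, Measurable (φ1n n) := fun n => (hs1.1 n).continuous.measurable
  have hm2 : ∀ n, Measurable (φ2n n) := fun n => (hs2.1 n).continuous.measurable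
  have t1 : Tendsto (fun n => enSq r1 (fun x => φ1n n x - χ1 x)) atTop (𝓝 0) := by
    refine (hs1.tendsto_enSq (by linarith) hr1).congr fun n => enSq_congr _ ?_
    filter_upwards [hχ1e] with x hx; rw [hx]
  have t2 : Tendsto (fun n => enSq r1 (fun x => φ2n n x - χ2 x)) atTop (𝓝 0) := by
    refine tendsto_of_tendsto_of_tendsto_of_le_of_le tendsto_const_nhds
      (hs2.tendsto_enSq (by linarith) h2) (fun _ => zero_le) fun n => ?_
    refine le_trans (le_of_eq (enSq_congr _ ?_)) (enSq_mono h12 _)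
    filter_upwards [hχ2e] with x hx; rw [hx]
  have tsum : ∀ {a b : ℕ → ℝ≥0∞}, Tendsto a atTop (𝓝 0) → Tendsto b atTop (𝓝 0) →
      Tendsto (fun n => 2 * a n + 2 * b n) atTop (𝓝 0) := by
    intro a b ha hb
    have := (ENNReal.Tendsto.const_mul (a := 2) ha (Or.inr (by norm_num))).add
      (ENNReal.Tendsto.const_mul (a := 2) hb (Or.inr (by norm_num)))
    simpa using this
  have f1 : enSq r1 χ1 ≠ ⊤ := by
    rw [← enSq_congr r1 hχ1e]; exact enSq_ne_top (by linarith) hr1 hφ1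
  have f2 : enSq r1 χ2 ≠ ⊤ := by
    rw [← enSq_congr r1 hχ2e]
    exact ne_top_of_le_ne_top (enSq_ne_top (by linarith) h2 hφ2) (enSq_mono h12 _)
  obtain ⟨ζ, hζ, hζt⟩ := exists_isTest_tendsto h1 hr1 (χ := fun x => χ1 x - χ2 x)
    (hχ1.sub hχ2) (ne_top_of_le_ne_top (by finiteness) (enSq_sub_le hχ1 r1))
    (ψ := fun n x => φ1n n x - φ2n n x) (fun n => (hs1.1 n).sub (hs2.1 n))
    (by
      refine tendsto_of_tendsto_of_tendsto_of_le_of_le tendsto_const_nhds (tsum t1 t2)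
        (fun _ => zero_le) fun n => ?_
      refine le_trans (le_of_eq ?_) (enSq_sub_le (f := fun x => φ1n n x - χ1 x)
        (g := fun x => φ2n n x - χ2 x) ((hm1 n).sub hχ1) r1)
      congr 1; funext x; ring)
    (fun e' => tendsto_edge_sub hs1.1 _ (htr1 e') (htr2 e'))
  -- `IsGradPairing` speaks of all smooth approximations, so `p1` can be computed along this one,
  -- which differs from the one for `φ2` by test functions only.
  have happ : SmoothApprox r1 φ1 (fun n x => φ2n n x + ζ n x) := by
    refine smoothApprox_of_tendsto (by linarith) hr1 hφ1.1 (fun n => (hs2.1 n).add (hζ n).1) ?_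
    refine tendsto_of_tendsto_of_tendsto_of_le_of_le tendsto_const_nhds (tsum t2 hζt)
      (fun _ => zero_le) fun n => ?_
    refine le_trans (le_of_eq (enSq_congr r1 ?_)) (enSq_add_le (f := fun x => φ2n n x - χ2 x)
      (g := fun x => ζ n x - (χ1 x - χ2 x)) ((hm2 n).sub hχ2) r1)
    filter_upwards [hχ1e] with x hx
    rw [hx]; ring
  have l1 : Tendsto (fun n => gradInt u (fun x => φ2n n x + ζ n x)) atTop (𝓝 p1) := hp1 _ happ
  have l2 : Tendsto (fun n => gradInt u (φ2n n)) atTop (𝓝 p2) := hp2 _ hs2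
  have l3 := l1.sub l2
  have e3 : ∀ n, gradInt u (fun x => φ2n n x + ζ n x) - gradInt u (φ2n n) =
      - ∫ x in refTriangle, d x * ζ n x := by
    intro n
    rw [gradInt_add huL (hs2.1 n) (hζ n).1, add_sub_cancel_left]
    exact hdiv _ (hζ n)
  simp only [e3] at l3
  have l4 := (tendsto_integral_mul hdL (hL1.sub hL2) (fun n => (hζ n).1) hζt).neg
  have l5 := tendsto_nhds_unique l3 l4
  have e4 : ∫ x in refTriangle, d x * (χ1 - χ2) x =
      (∫ x in refTriangle, d x * φ1 x) - ∫ x in refTriangle, d x * φ2 x := by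
    rw [← integral_mul_sub hdL hφ1.1 hφ2.1]
    refine integral_congr_ae ?_
    filter_upwards [hχ1e, hχ2e] with x hx1 hx2
    rw [hx1, hx2, Pi.sub_apply]
  rw [e4] at l5
  linarith

theorem HasNormalFlux.unique {u : Fin 2 → ℝ × ℝ → ℝ} {d : ℝ × ℝ → ℝ}
    (hu : HasDivL2 refTriangle u d) {e : Fin 3} {s F F' : ℝ} (h : HasNormalFlux s u d e F)
    (h' : HasNormalFlux s u d e F') : F = F' := by
  obtain ⟨ε, φ, p, h0, -, h2, hφ, ht, hp, rfl⟩ := h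
  obtain ⟨ε', φ', p', h0', -, h2', hφ', ht', hp', rfl⟩ := h'
  rcases le_total ε ε' with h | h
  · exact (flux_unique_aux hu (by linarith) (by linarith) (by linarith) hφ' hφ ht' ht hp' hp).symm
  · exact flux_unique_aux hu (by linarith) (by linarith) (by linarith) hφ hφ' ht ht' hp hp'

end RTTriangle

/-! ### The bilinear bound for `∫ u ∂ψ`. -/

namespace RTTriangle

/-! ### Subdivision of the triangle into four congruent triangles -/

/-- The orientation of the four subtriangles. -/
def childSign (j : Fin 4) : ℝ := ![1, 1, 1, -1] j

/-- The similarities from the triangle onto its four congruent subtriangles. -/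
noncomputable def childMap (j : Fin 4) : ℝ × ℝ → ℝ × ℝ :=
  affMap (childSign j / 2) 0 0 (childSign j / 2) (![0, 1 / 2, 1 / 2, 1] j)
    (![0, 0, 1 / 2, 1 / 2] j)

theorem childSign_sq (j : Fin 4) : childSign j * childSign j = 1 := by
  fin_cases j <;> simp [childSign]

theorem abs_childSign (j : Fin 4) : |childSign j| = 1 := by
  fin_cases j <;> simp [childSign]

theorem childMap_det (j : Fin 4) :
    childSign j / 2 * (childSign j / 2) - 0 * 0 = 1 / 4 := by
  have := childSign_sq j
  linarith

theorem measurable_childMap (j : Fin 4) : Measurable (childMap j) := measurable_affMap _ _ _ _ _ _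

theorem contDiff_childMap (j : Fin 4) : ContDiff ℝ ∞ (childMap j) := contDiff_affMap _ _ _ _ _ _

theorem childMap_mem (j : Fin 4) {X : ℝ × ℝ} (hX : X ∈ refTriangle) :
    childMap j X ∈ refTriangle := by
  obtain ⟨a1, a2, a3, a4⟩ := hX
  refine ⟨?_, ?_, ?_, ?_⟩ <;> fin_cases j <;> simp [childMap, affMap, childSign] <;> linarith

theorem childMap_image_subset (j : Fin 4) : childMap j '' refTriangle ⊆ refTriangle := by
  rintro _ ⟨X, hX, rfl⟩
  exact childMap_mem j hX

theorem measurableSet_childMap_image (j : Fin 4) : MeasurableSet (childMap j '' refTriangle) :=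
  measurableSet_refTriangle.image_of_continuousOn_injOn
    (contDiff_childMap j).continuous.continuousOn
    (injective_affMap _ _ (by rw [childMap_det]; norm_num)).injOn

theorem lintegral_childMap_image (j : Fin 4) (f : ℝ × ℝ → ℝ≥0∞) :
    ∫⁻ x in childMap j '' refTriangle, f x =
      4⁻¹ * ∫⁻ x in refTriangle, f (childMap j x) := by
  unfold childMap
  rw [lintegral_affMap_image _ _ (by rw [childMap_det]; norm_num) measurableSet_refTriangle,
    childMap_det, abs_of_pos (by norm_num), one_div, ENNReal.ofReal_inv_of_pos (by norm_num),
    ENNReal.ofReal_ofNat]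

theorem integral_childMap_image (j : Fin 4) (f : ℝ × ℝ → ℝ) :
    ∫ x in childMap j '' refTriangle, f x =
      1 / 4 * ∫ x in refTriangle, f (childMap j x) := by
  unfold childMap
  rw [integral_affMap_image _ _ (by rw [childMap_det]; norm_num) measurableSet_refTriangle,
    childMap_det, abs_of_pos (by norm_num)]

theorem pairwise_disjoint_childMap_image :
    Pairwise (Function.onFun Disjoint fun j : Fin 4 => childMap j '' refTriangle) := by
  have h0 : ∀ X ∈ childMap 0 '' refTriangle, X.1 < 1 / 2 := by
    rintro _ ⟨X, ⟨a1, a2, a3, a4⟩, rfl⟩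
    simp [childMap, affMap, childSign]; linarith
  have h1 : ∀ X ∈ childMap 1 '' refTriangle, 1 / 2 < X.1 - X.2 := by
    rintro _ ⟨X, ⟨a1, a2, a3, a4⟩, rfl⟩
    simp [childMap, affMap, childSign]; linarith
  have h2 : ∀ X ∈ childMap 2 '' refTriangle, 1 / 2 < X.2 := by
    rintro _ ⟨X, ⟨a1, a2, a3, a4⟩, rfl⟩
    simp [childMap, affMap, childSign]; linarith
  have h3 : ∀ X ∈ childMap 3 '' refTriangle, 1 / 2 < X.1 ∧ X.2 < 1 / 2 ∧ X.1 - X.2 < 1 / 2 := by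
    rintro _ ⟨X, ⟨a1, a2, a3, a4⟩, rfl⟩
    simp [childMap, affMap, childSign]
    refine ⟨?_, ?_, ?_⟩ <;> linarith
  have hT := fun j => childMap_image_subset j
  intro i j hij
  rw [Function.onFun, disjoint_left]
  intro X hi hj
  obtain ⟨a1, a2, a3, a4⟩ := hT i hi
  fin_cases i <;> fin_cases j <;> first
    | exact absurd rfl hij
    | (simp only [Fin.zero_eta, Fin.mk_one, Fin.reduceFinMk] at hi hj
       first
        | linarith [h0 X hi, h1 X hj]
        | linarith [h0 X hi, h2 X hj]
        | linarith [h0 X hi, (h3 X hj).1]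
        | linarith [h1 X hi, h0 X hj]
        | linarith [h1 X hi, h2 X hj]
        | linarith [h1 X hi, (h3 X hj).2.2]
        | linarith [h2 X hi, h0 X hj]
        | linarith [h2 X hi, h1 X hj]
        | linarith [h2 X hi, (h3 X hj).2.1]
        | linarith [(h3 X hi).1, h0 X hj]
        | linarith [(h3 X hi).2.2, h1 X hj]
        | linarith [(h3 X hi).2.1, h2 X hj])

/-- Counting areas: four disjoint subsets, each of a quarter of the area, exhaust the triangle up to
a null set. -/
theorem iUnion_childMap_image_ae_eq :
    (⋃ j, childMap j '' refTriangle) =ᵐ[volume] refTriangle := by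
  refine ae_eq_of_subset_of_measure_ge (iUnion_subset childMap_image_subset) ?_
    (MeasurableSet.iUnion measurableSet_childMap_image).nullMeasurableSet
    (volume_refTriangle_le.trans_lt ENNReal.one_lt_top).ne
  rw [measure_iUnion pairwise_disjoint_childMap_image measurableSet_childMap_image,
    tsum_fintype]
  have : ∀ j, volume (childMap j '' refTriangle) = 4⁻¹ * volume refTriangle := by
    intro j
    have := lintegral_childMap_image j 1
    simpa using this
  simp only [this, Finset.sum_const, Finset.card_univ, Fintype.card_fin, nsmul_eq_mul]
  rw [← mul_assoc, Nat.cast_ofNat, ENNReal.mul_inv_cancel (by norm_num) (by norm_num), one_mul]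

theorem integral_eq_sum_childMap {f : ℝ × ℝ → ℝ} (hf : IntegrableOn f refTriangle) :
    ∫ x in refTriangle, f x = ∑ j, 1 / 4 * ∫ x in refTriangle, f (childMap j x) := by
  rw [← setIntegral_congr_set iUnion_childMap_image_ae_eq, integral_iUnion
    measurableSet_childMap_image pairwise_disjoint_childMap_image
    (hf.mono_set (iUnion_subset childMap_image_subset)), tsum_fintype]
  exact Finset.sum_congr rfl fun j _ => integral_childMap_image j f

theorem norm_childMap_sub (j : Fin 4) (X Y : ℝ × ℝ) :
    ‖childMap j X - childMap j Y‖ = ‖X - Y‖ / 2 := by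
  have : childMap j X - childMap j Y = (childSign j / 2) • (X - Y) := by
    ext
    · simp [childMap, affMap]; ring
    · simp [childMap, affMap]; ring
  rw [this, norm_smul, Real.norm_eq_abs, abs_div, abs_childSign, abs_of_pos (by norm_num)]
  ring

/-- Rescaling a subtriangle gives `4 · 4 · 2^(-(2+2σ)) = 2^(2-2σ)`; pairs of points in different
subtriangles are dropped. -/
theorem sum_semiSq_childMap_le (σ : ℝ) (f : ℝ × ℝ → ℝ) :
    ∑ j, semiSq σ (fun X => f (childMap j X)) ≤
      ENNReal.ofReal (2 ^ (2 - 2 * σ)) * semiSq σ f := by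
  have h1 : ∀ j, semiSq σ (fun X => f (childMap j X)) =
      ENNReal.ofReal (2 ^ (2 - 2 * σ)) * ∫⁻ X in childMap j '' refTriangle,
        ∫⁻ Y in childMap j '' refTriangle,
          ENNReal.ofReal ((f X - f Y) ^ 2 / ‖X - Y‖ ^ (2 + 2 * σ)) := by
    intro j
    rw [lintegral_childMap_image j]
    simp only [lintegral_childMap_image j, norm_childMap_sub]
    rw [lintegral_const_mul' _ _ (by norm_num)]
    have e : ∀ X Y : ℝ × ℝ, ENNReal.ofReal ((f (childMap j X) - f (childMap j Y)) ^ 2 /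
        (‖X - Y‖ / 2) ^ (2 + 2 * σ)) = ENNReal.ofReal (2 ^ (2 + 2 * σ)) *
        ENNReal.ofReal ((f (childMap j X) - f (childMap j Y)) ^ 2 / ‖X - Y‖ ^ (2 + 2 * σ)) := by
      intro X Y
      rw [← ENNReal.ofReal_mul (by positivity), Real.div_rpow (norm_nonneg _) (by norm_num)]
      congr 1
      rw [div_div_eq_mul_div, mul_comm, mul_div_assoc]
    simp only [e]
    simp only [lintegral_const_mul' _ _ ENNReal.ofReal_ne_top]
    rw [← mul_assoc, ← mul_assoc, ← mul_assoc]
    have : ENNReal.ofReal (2 ^ (2 - 2 * σ)) * 4⁻¹ * 4⁻¹ * ENNReal.ofReal (2 ^ (2 + 2 * σ)) = 1 := by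
      rw [← ENNReal.ofReal_ofNat 4, ← ENNReal.ofReal_inv_of_pos (by norm_num),
        ← ENNReal.ofReal_mul (by positivity), ← ENNReal.ofReal_mul (by positivity),
        ← ENNReal.ofReal_mul (by positivity), ← ENNReal.ofReal_one]
      congr 1
      rw [Real.rpow_sub (by norm_num), Real.rpow_add (by norm_num)]
      have : (2:ℝ) ^ (2 * σ) ≠ 0 := by positivity
      norm_num
      field_simp
    rw [this, one_mul]
    rfl
  simp only [h1]
  rw [← Finset.mul_sum]
  gcongr
  calc _ ≤ ∑ j, ∫⁻ X in childMap j '' refTriangle, gagliardo σ f X := by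
        refine Finset.sum_le_sum fun j _ => lintegral_mono fun X => ?_
        exact lintegral_mono_set (childMap_image_subset j)
    _ = ∫⁻ X in ⋃ j, childMap j '' refTriangle, gagliardo σ f X := by
        rw [lintegral_iUnion measurableSet_childMap_image pairwise_disjoint_childMap_image,
          tsum_fintype]
    _ ≤ _ := lintegral_mono_set (iUnion_subset childMap_image_subset)

theorem pderiv_comp_affMap {ψ : ℝ × ℝ → ℝ} (hψ : ContDiff ℝ ∞ ψ) (a b c d p q : ℝ) (i : Fin 2)
    (X : ℝ × ℝ) : pderiv i (fun X => ψ (affMap a b c d p q X)) X =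
      fderiv ℝ ψ (affMap a b c d p q X) (linMap a b c d (basisVec i)) := by
  have h1 := ((hψ.differentiable (by simp)).differentiableAt
    (x := affMap a b c d p q X)).hasFDerivAt
  have h2 := h1.comp X (hasFDerivAt_affMap a b c d p q X)
  unfold pderiv
  change fderiv ℝ (ψ ∘ affMap a b c d p q) X (basisVec i) = _
  rw [h2.fderiv]
  rfl

theorem pderiv_comp_childMap {ψ : ℝ × ℝ → ℝ} (hψ : ContDiff ℝ ∞ ψ) (j : Fin 4) (i : Fin 2)
    (X : ℝ × ℝ) : pderiv i (fun X => ψ (childMap j X)) X =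
      childSign j / 2 * pderiv i ψ (childMap j X) := by
  have := pderiv_comp_affMap hψ (childSign j / 2) 0 0 (childSign j / 2) (![0, 1 / 2, 1 / 2, 1] j)
    (![0, 0, 1 / 2, 1 / 2] j) i X
  refine this.trans ?_
  have e : linMap (childSign j / 2) 0 0 (childSign j / 2) (basisVec i) =
      (childSign j / 2) • basisVec i := by
    rw [linMap_apply]; ext <;> simp
  rw [e, map_smul]
  rfl

/-! ### The pairing of a fractional Sobolev function with a gradient -/

theorem sqrt_toReal_sq_le {a : ℝ} {A : ℝ≥0∞} (hA : A ≠ ⊤) (h : ENNReal.ofReal (a ^ 2) ≤ A) :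
    |a| ≤ Real.sqrt A.toReal := by
  refine Real.abs_le_sqrt ?_
  exact (ENNReal.ofReal_le_iff_le_toReal hA).1 h

theorem abs_integral_mul_le_of_bound {v g : ℝ × ℝ → ℝ} (hv : Measurable v) (hg : Measurable g)
    {Λ : ℝ} (hΛ : ∀ X ∈ refTriangle, |g X| ≤ Λ) (hfin : l2Sq v ≠ ⊤) :
    |∫ X in refTriangle, v X * g X| ≤ Real.sqrt (l2Sq v).toReal * |Λ| := by
  have h1 := ofReal_integral_mul_sq_le (μ := volume.restrict refTriangle)
    hv.aestronglyMeasurable hg.aestronglyMeasurable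
  have h2 : ∫⁻ X in refTriangle, ENNReal.ofReal (g X ^ 2) ≤ ENNReal.ofReal (Λ ^ 2) := by
    calc _ ≤ ∫⁻ X in refTriangle, ENNReal.ofReal (Λ ^ 2) := by
          refine setLIntegral_mono' measurableSet_refTriangle fun X hX => ?_
          refine ENNReal.ofReal_le_ofReal ?_
          rw [← sq_abs]; exact pow_le_pow_left₀ (abs_nonneg _) (hΛ X hX) 2
      _ ≤ _ := by
          rw [setLIntegral_const]; exact mul_le_of_le_one_right' volume_refTriangle_le
  have h3 := h1.trans (mul_le_mul_right h2 _)
  refine (sqrt_toReal_sq_le (ENNReal.mul_ne_top hfin ENNReal.ofReal_ne_top) h3).trans ?_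
  rw [ENNReal.toReal_mul, ENNReal.toReal_ofReal (sq_nonneg _), Real.sqrt_mul ENNReal.toReal_nonneg,
    Real.sqrt_sq_eq_abs]

theorem l2Sq_comp_childMap_le (j : Fin 4) (f : ℝ × ℝ → ℝ) :
    l2Sq (fun X => f (childMap j X)) ≤ 4 * l2Sq f := by
  have h := lintegral_childMap_image j fun X => ENNReal.ofReal (f X ^ 2)
  have h2 : ∫⁻ X in childMap j '' refTriangle, ENNReal.ofReal (f X ^ 2) ≤ l2Sq f :=
    lintegral_mono_set (childMap_image_subset j)
  rw [h] at h2
  calc l2Sq (fun X => f (childMap j X))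
      = 4 * (4⁻¹ * ∫⁻ X in refTriangle, ENNReal.ofReal (f (childMap j X) ^ 2)) := by
        rw [← mul_assoc, ENNReal.mul_inv_cancel (by norm_num) (by norm_num), one_mul]; rfl
    _ ≤ _ := by gcongr

theorem ofReal_sq_le_four_l2Sq (c : ℝ) : ENNReal.ofReal (c ^ 2) ≤ 4 * l2Sq fun _ => c := by
  unfold l2Sq
  rw [setLIntegral_const, mul_left_comm]
  refine le_mul_of_one_le_right' ?_
  calc (1 : ℝ≥0∞) = 4 * 4⁻¹ := (ENNReal.mul_inv_cancel (by norm_num) (by norm_num)).symm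
    _ ≤ _ := by gcongr; exact quarter_le_volume_refTriangle

theorem semiSq_ne_top_of_contDiff {σ : ℝ} (h1 : σ < 1) {ψ : ℝ × ℝ → ℝ} (hψ : ContDiff ℝ ∞ ψ) :
    semiSq σ ψ ≠ ⊤ := by
  obtain ⟨C, hC⟩ := exists_semiSq_le_of_lipschitz h1
  obtain ⟨L, -, hL⟩ := exists_lipschitz_of_contDiff hψ
  refine ne_top_of_le_ne_top ?_ (hC ψ L fun X hX Y hY => hL X (refTriangle_subset_Icc hX) Y
    (refTriangle_subset_Icc hY))
  finiteness

set_option maxHeartbeats 1000000 in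
-- On each subtriangle `u - c` is split into `u - cj` and `cj - c`. The second part meets only the
-- integral of the derivative, bounded by the seminorm of `ψ`; the first part is again of the
-- original form. The derivative and the Jacobian give a factor `1/2`, and Cauchy-Schwarz over the
-- four pieces gives `2^(1-s) · 2^(1-r)`, so a generation contributes `2^(1-r-s)` times the
-- preceding one. The remainder after `n` generations is bounded crudely by the supremum of the
-- derivative and decays like `2^(-s n)`.
theorem pairing_iteration {s r : ℝ} (hs0 : 0 < s) (hr0 : 1 / 2 < r) (hr1 : r < 1) :
    ∃ K : ℝ, 0 ≤ K ∧ ∀ (n : ℕ) (u ψ : ℝ × ℝ → ℝ), Measurable u → l2Sq u ≠ ⊤ → semiSq s u ≠ ⊤ →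
      ContDiff ℝ ∞ ψ → ∀ (i : Fin 2) (Λ : ℝ), 0 ≤ Λ → (∀ X ∈ refTriangle, |pderiv i ψ X| ≤ Λ) →
      ∀ c : ℝ, l2Sq (fun X => u X - c) ≤ 4 * semiSq s u →
      |∫ X in refTriangle, (u X - c) * pderiv i ψ X| ≤
        K * (∑ k ∈ Finset.range n, (2 ^ (1 - r - s) : ℝ) ^ k) *
          (Real.sqrt (semiSq s u).toReal * Real.sqrt (semiSq r ψ).toReal) +
        2 * (2 ^ (-s) : ℝ) ^ n * Real.sqrt (semiSq s u).toReal * Λ := by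
  obtain ⟨C, hC⟩ := exists_integral_pderiv_sq_le hr0 hr1
  -- Per generation: four pieces, the factor `1/2`, `16` from the difference of constants and `2`
  -- from the seminorm of `ψ` on a piece.
  refine ⟨64 * Real.sqrt C, by positivity, fun n => ?_⟩
  induction n with
  | zero =>
    intro u ψ hu hul hus hψ i Λ hΛ0 hΛ c hc
    simp only [Finset.range_zero, Finset.sum_empty, mul_zero, zero_mul, pow_zero, mul_one, zero_add]
    have h1 := abs_integral_mul_le_of_bound (hu.sub_const c) (continuous_pderiv hψ i).measurable hΛ
      (ne_top_of_le_ne_top (by finiteness) hc)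
    refine h1.trans ?_
    rw [abs_of_nonneg hΛ0]
    gcongr
    have h2 := ENNReal.toReal_mono (by finiteness) hc
    rw [ENNReal.toReal_mul] at h2
    calc _ ≤ Real.sqrt (2 ^ 2 * (semiSq s u).toReal) := by
          refine Real.sqrt_le_sqrt (h2.trans (le_of_eq ?_)); norm_num
      _ = _ := by rw [Real.sqrt_mul (by norm_num), Real.sqrt_sq (by norm_num)]
  | succ n ih =>
    intro u ψ hu hul hus hψ i Λ hΛ0 hΛ c hc
    set U := Real.sqrt (semiSq s u).toReal with hU
    set Ψ := Real.sqrt (semiSq r ψ).toReal with hΨ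
    have hψs := semiSq_ne_top_of_contDiff hr1 hψ
    have hum : ∀ j, Measurable fun X => u (childMap j X) := fun j => hu.comp (measurable_childMap j)
    have hψc : ∀ j, ContDiff ℝ ∞ fun X => ψ (childMap j X) := fun j =>
      hψ.comp (contDiff_childMap j)
    have sumfin : ∀ {σ : ℝ} {f : ℝ × ℝ → ℝ}, semiSq σ f ≠ ⊤ → ∀ j,
        semiSq σ (fun X => f (childMap j X)) ≠ ⊤ := by
      intro σ f hf j
      refine ne_top_of_le_ne_top ?_ ((Finset.single_le_sum
        (f := fun j => semiSq σ fun X => f (childMap j X)) (fun _ _ => zero_le)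
        (Finset.mem_univ j)).trans (sum_semiSq_childMap_le σ f))
      finiteness
    have sumreal : ∀ {σ : ℝ} {f : ℝ × ℝ → ℝ}, semiSq σ f ≠ ⊤ →
        ∑ j, (semiSq σ (fun X => f (childMap j X))).toReal ≤
          (2 ^ (1 - σ) : ℝ) ^ 2 * (semiSq σ f).toReal := by
      intro σ f hf
      rw [← ENNReal.toReal_sum fun j _ => sumfin hf j]
      have := ENNReal.toReal_mono (by finiteness) (sum_semiSq_childMap_le σ f)
      rw [ENNReal.toReal_mul, ENNReal.toReal_ofReal (by positivity)] at this
      refine this.trans (le_of_eq ?_)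
      congr 1
      rw [← Real.rpow_natCast, ← Real.rpow_mul (by norm_num)]
      congr 1; push_cast; ring
    let Uj : Fin 4 → ℝ := fun j => Real.sqrt (semiSq s fun X => u (childMap j X)).toReal
    let Ψj : Fin 4 → ℝ := fun j => Real.sqrt (semiSq r fun X => ψ (childMap j X)).toReal
    have hUj : Real.sqrt (∑ j, Uj j ^ 2) ≤ 2 ^ (1 - s) * U := by
      simp only [Uj, Real.sq_sqrt ENNReal.toReal_nonneg]
      refine (Real.sqrt_le_sqrt (sumreal hus)).trans (le_of_eq ?_)
      rw [Real.sqrt_mul (by positivity), Real.sqrt_sq (by positivity)]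
    have hΨj : Real.sqrt (∑ j, Ψj j ^ 2) ≤ 2 ^ (1 - r) * Ψ := by
      simp only [Ψj, Real.sq_sqrt ENNReal.toReal_nonneg]
      refine (Real.sqrt_le_sqrt (sumreal hψs)).trans (le_of_eq ?_)
      rw [Real.sqrt_mul (by positivity), Real.sqrt_sq (by positivity)]
    have hU0 : 0 ≤ U := Real.sqrt_nonneg _
    have hΨ0 : 0 ≤ Ψ := Real.sqrt_nonneg _
    have hUj0 : ∀ j, 0 ≤ Uj j := fun j => Real.sqrt_nonneg _
    have hΨj0 : ∀ j, 0 ≤ Ψj j := fun j => Real.sqrt_nonneg _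
    have h2s : (2:ℝ) ^ (1 - s) ≤ 2 := by
      calc (2:ℝ) ^ (1 - s) ≤ 2 ^ (1:ℝ) :=
            Real.rpow_le_rpow_of_exponent_le (by norm_num) (by linarith)
        _ = 2 := by norm_num
    have h2r : (2:ℝ) ^ (1 - r) ≤ 2 := by
      calc (2:ℝ) ^ (1 - r) ≤ 2 ^ (1:ℝ) :=
            Real.rpow_le_rpow_of_exponent_le (by norm_num) (by linarith)
        _ = 2 := by norm_num
    have hUU : ∀ j, Uj j ≤ 2 * U := fun j => by
      have : Uj j ≤ Real.sqrt (∑ j, Uj j ^ 2) := Real.le_sqrt_of_sq_le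
        (Finset.single_le_sum (f := fun j => Uj j ^ 2) (fun _ _ => sq_nonneg _)
          (Finset.mem_univ j))
      exact this.trans (hUj.trans (by gcongr))
    have hΨΨ : ∀ j, Ψj j ≤ 2 * Ψ := fun j => by
      have : Ψj j ≤ Real.sqrt (∑ j, Ψj j ^ 2) := Real.le_sqrt_of_sq_le
        (Finset.single_le_sum (f := fun j => Ψj j ^ 2) (fun _ _ => sq_nonneg _)
          (Finset.mem_univ j))
      exact this.trans (hΨj.trans (by gcongr))
    have hsumUΨ : ∑ j, Uj j * Ψj j ≤ (2 ^ (1 - s) * U) * (2 ^ (1 - r) * Ψ) :=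
      (Real.sum_mul_le_sqrt_mul_sqrt _ _ _).trans (mul_le_mul hUj hΨj (Real.sqrt_nonneg _)
        (by positivity))
    have hsumU : ∑ j, Uj j ≤ 2 * (2 ^ (1 - s) * U) := by
      have := Real.sum_mul_le_sqrt_mul_sqrt Finset.univ Uj fun _ => 1
      simp only [mul_one, one_pow, Finset.sum_const, Finset.card_univ, Fintype.card_fin,
        nsmul_eq_mul, Nat.cast_ofNat] at this
      rw [show (4:ℝ) = 2 ^ 2 by norm_num, Real.sqrt_sq (by norm_num)] at this
      linarith
    have hcj : ∀ j, ∃ cj : ℝ, l2Sq (fun X => u (childMap j X) - cj) ≤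
        4 * semiSq s fun X => u (childMap j X) := fun j => exists_l2Sq_sub_const_le (hum j) hs0
    choose cj hcj using hcj
    -- A constant is measured by its `L²`-norm over the triangle, where both constants are close to
    -- `u ∘ childMap j`.
    have hdiff : ∀ j, |cj j - c| ≤ 16 * U := by
      intro j
      have e1 := l2Sq_add_le (f := fun X => u (childMap j X) - c)
        (g := fun X => -(u (childMap j X) - cj j)) ((hum j).sub_const c)
      rw [l2Sq_neg] at e1
      have e2 : (fun X => u (childMap j X) - c + -(u (childMap j X) - cj j)) =
          fun _ => cj j - c := by funext X; ring
      rw [e2] at e1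
      have e3 := l2Sq_comp_childMap_le j fun X => u X - c
      have e4 : semiSq s (fun X => u (childMap j X)) ≤ 4 * semiSq s u := by
        refine ((Finset.single_le_sum (f := fun j => semiSq s fun X => u (childMap j X))
          (fun _ _ => zero_le) (Finset.mem_univ j)).trans (sum_semiSq_childMap_le s u)).trans ?_
        gcongr
        rw [← ENNReal.ofReal_ofNat]
        refine ENNReal.ofReal_le_ofReal ?_
        calc (2:ℝ) ^ (2 - 2 * s) ≤ 2 ^ (2:ℝ) :=
              Real.rpow_le_rpow_of_exponent_le (by norm_num) (by linarith)
          _ = 4 := by norm_num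
      have e5 : ENNReal.ofReal ((cj j - c) ^ 2) ≤ 256 * semiSq s u := by
        refine (ofReal_sq_le_four_l2Sq _).trans ?_
        calc _ ≤ 4 * (2 * (4 * (4 * semiSq s u)) + 2 * (4 * (4 * semiSq s u))) := by
              gcongr
              refine e1.trans ?_
              gcongr
              · exact e3.trans (by gcongr)
              · exact (hcj j).trans (by gcongr)
          _ = _ := by ring
      refine (sqrt_toReal_sq_le (by finiteness) e5).trans (le_of_eq ?_)
      rw [ENNReal.toReal_mul, show ((256 : ℝ≥0∞).toReal) = 16 ^ 2 by norm_num,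
        Real.sqrt_mul (by positivity), Real.sqrt_sq (by norm_num)]
    have hmean : ∀ j, |∫ X in refTriangle, pderiv i (fun X => ψ (childMap j X)) X| ≤
        Real.sqrt C * (2 * Ψ) := by
      intro j
      refine (sqrt_toReal_sq_le (ENNReal.mul_ne_top ENNReal.coe_ne_top (sumfin hψs j))
        (hC _ (hψc j) i)).trans ?_
      rw [ENNReal.toReal_mul, Real.sqrt_mul ENNReal.toReal_nonneg]
      exact mul_le_mul_of_nonneg_left (hΨΨ j) (Real.sqrt_nonneg _)
    have hΛj : ∀ j, ∀ X ∈ refTriangle, |pderiv i (fun X => ψ (childMap j X)) X| ≤ Λ / 2 := by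
      intro j X hX
      rw [pderiv_comp_childMap hψ, abs_mul, abs_div, abs_childSign, abs_of_pos (by norm_num)]
      have := hΛ _ (childMap_mem j hX)
      linarith
    have hl2j : ∀ j, l2Sq (fun X => u (childMap j X)) ≠ ⊤ := fun j =>
      ne_top_of_le_ne_top (by finiteness) (l2Sq_comp_childMap_le j u)
    have memU : ∀ {v : ℝ × ℝ → ℝ}, Measurable v → l2Sq v ≠ ⊤ →
        MemLp v 2 (volume.restrict refTriangle) := by
      intro v hv hvl
      refine ⟨hv.aestronglyMeasurable, ?_⟩
      rw [l2Sq_eq] at hvl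
      by_contra h
      simp only [not_lt, top_le_iff] at h
      rw [h] at hvl
      simp at hvl
    have hsplit : ∫ X in refTriangle, (u X - c) * pderiv i ψ X =
        ∑ j, childSign j / 2 *
          ((∫ X in refTriangle, (u (childMap j X) - cj j) *
            pderiv i (fun X => ψ (childMap j X)) X) +
          (cj j - c) * ∫ X in refTriangle, pderiv i (fun X => ψ (childMap j X)) X) := by
      have hI : IntegrableOn (fun X => (u X - c) * pderiv i ψ X) refTriangle :=
        integrable_mul_pderiv ((memU hu hul).sub (memLp_const c)) hψ i
      rw [integral_eq_sum_childMap hI]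
      refine Finset.sum_congr rfl fun j _ => ?_
      have hIj : IntegrableOn (fun X => (u (childMap j X) - cj j) *
          pderiv i (fun X => ψ (childMap j X)) X) refTriangle :=
        integrable_mul_pderiv ((memU (hum j) (hl2j j)).sub (memLp_const (cj j))) (hψc j) i
      rw [← integral_const_mul (cj j - c), ← integral_add hIj
        (((memLp_pderiv (hψc j) i 1).integrable le_rfl).const_mul _),
        ← integral_const_mul, ← integral_const_mul]
      congr 1; funext X
      rw [pderiv_comp_childMap hψ]
      -- The Jacobian `1/4` is the square of `childSign j / 2`: one factor belongs to the derivative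
      -- of `ψ ∘ childMap j`, the other stays in front.
      linear_combination (-(1 / 4) * (u (childMap j X) - c) * pderiv i ψ (childMap j X)) *
        childSign_sq j
    rw [hsplit]
    set G := ∑ k ∈ Finset.range n, (2 ^ (1 - r - s) : ℝ) ^ k with hG
    have hG0 : 0 ≤ G := Finset.sum_nonneg fun _ _ => by positivity
    have hterm : ∀ j, |childSign j / 2 *
          ((∫ X in refTriangle, (u (childMap j X) - cj j) *
            pderiv i (fun X => ψ (childMap j X)) X) +
          (cj j - c) * ∫ X in refTriangle, pderiv i (fun X => ψ (childMap j X)) X)| ≤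
        1 / 2 * ((64 * Real.sqrt C * G * (Uj j * Ψj j) +
          2 * (2 ^ (-s) : ℝ) ^ n * Uj j * (Λ / 2)) + 16 * U * (Real.sqrt C * (2 * Ψ))) := by
      intro j
      rw [abs_mul, abs_div, abs_childSign, abs_of_pos (by norm_num : (0:ℝ) < 2)]
      refine mul_le_mul_of_nonneg_left ((abs_add_le _ _).trans (add_le_add ?_ ?_)) (by norm_num)
      · exact ih _ _ (hum j) (hl2j j) (sumfin hus j) (hψc j) i (Λ / 2) (by positivity) (hΛj j) _
          (hcj j)
      · rw [abs_mul]
        exact mul_le_mul (hdiff j) (hmean j) (abs_nonneg _) (by positivity)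
    refine (Finset.abs_sum_le_sum_abs _ _).trans ((Finset.sum_le_sum fun j _ => hterm j).trans ?_)
    rw [← Finset.mul_sum, Finset.sum_add_distrib, Finset.sum_add_distrib, ← Finset.mul_sum,
      ← Finset.sum_mul, ← Finset.mul_sum, Finset.sum_const, Finset.card_univ, Fintype.card_fin,
      geom_sum_succ, ← hG]
    have hq : (2:ℝ) ^ (1 - s) * 2 ^ (1 - r) = 2 * 2 ^ (1 - r - s) := by
      rw [← Real.rpow_add (by norm_num), show 1 - s + (1 - r) = 1 + (1 - r - s) by ring,
        Real.rpow_add (by norm_num), Real.rpow_one]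
    have ha : (2:ℝ) ^ (1 - s) = 2 * 2 ^ (-s) := by
      rw [sub_eq_add_neg, Real.rpow_add (by norm_num), Real.rpow_one]
    have hS : 0 ≤ Real.sqrt C := Real.sqrt_nonneg _
    have f1 : 64 * Real.sqrt C * G * ∑ j, Uj j * Ψj j ≤
        64 * Real.sqrt C * G * (2 * 2 ^ (1 - r - s) * (U * Ψ)) := by
      rw [← hq]
      refine mul_le_mul_of_nonneg_left (hsumUΨ.trans (le_of_eq (by ring))) (by positivity)
    have f2 : 2 * ((2:ℝ) ^ (-s)) ^ n * (∑ j, Uj j) * (Λ / 2) ≤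
        2 * ((2:ℝ) ^ (-s)) ^ n * (2 * (2 * 2 ^ (-s) * U)) * (Λ / 2) := by
      rw [← ha]
      gcongr
    rw [pow_succ]
    simp only [nsmul_eq_mul, Nat.cast_ofNat]
    linear_combination (1 / 2) * f1 + (1 / 2) * f2

/-- For `r + s > 1` the geometric series in `pairing_iteration` converges and the remainder vanishes
as `n → ∞`, so the bound on the derivative of `ψ` disappears. The constant part of `u` is treated
once more by `exists_integral_pderiv_sq_le`. -/
theorem exists_pairing_le {s r : ℝ} (hs0 : 0 < s) (hr0 : 1 / 2 < r) (hr1 : r < 1)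
    (hrs : 1 - s < r) :
    ∃ C : ℝ≥0, ∀ (u ψ : ℝ × ℝ → ℝ), MemLp u 2 (volume.restrict refTriangle) → enSq s u ≠ ⊤ →
      ContDiff ℝ ∞ ψ → ∀ i : Fin 2,
      ENNReal.ofReal ((∫ X in refTriangle, u X * pderiv i ψ X) ^ 2) ≤
        C * (enSq s u * semiSq r ψ) := by
  obtain ⟨K, hK0, hK⟩ := pairing_iteration hs0 hr0 hr1
  obtain ⟨C, hC⟩ := exists_integral_pderiv_sq_le hr0 hr1
  set q : ℝ := 2 ^ (1 - r - s) with hq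
  have hq0 : 0 < q := by positivity
  have hq1 : q < 1 := Real.rpow_lt_one_of_one_lt_of_neg (by norm_num) (by linarith)
  obtain ⟨K', hK'⟩ : ∃ K' : ℝ, K' = K * (1 / (1 - q)) := ⟨_, rfl⟩
  have hq1' : 0 < 1 - q := by linarith
  have main : ∀ (u ψ : ℝ × ℝ → ℝ), Measurable u → enSq s u ≠ ⊤ → ContDiff ℝ ∞ ψ → ∀ i : Fin 2,
      ∀ c : ℝ, l2Sq (fun X => u X - c) ≤ 4 * semiSq s u →
      |∫ X in refTriangle, (u X - c) * pderiv i ψ X| ≤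
        K' * (Real.sqrt (semiSq s u).toReal * Real.sqrt (semiSq r ψ).toReal) := by
    intro u ψ hu hfin hψ i c hc
    obtain ⟨Λ, hΛ0, hΛ⟩ := exists_bound_pderiv hψ
    have hl : l2Sq u ≠ ⊤ := ne_top_of_le_ne_top hfin le_self_add
    have hs : semiSq s u ≠ ⊤ := ne_top_of_le_ne_top hfin le_add_self
    have hb : ∀ n : ℕ, |∫ X in refTriangle, (u X - c) * pderiv i ψ X| ≤
        K' * (Real.sqrt (semiSq s u).toReal * Real.sqrt (semiSq r ψ).toReal) +
        2 * (2 ^ (-s) : ℝ) ^ n * Real.sqrt (semiSq s u).toReal * Λ := by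
      intro n
      refine (hK n u ψ hu hl hs hψ i Λ hΛ0 (fun X hX => hΛ i X (refTriangle_subset_Icc hX)) c
        hc).trans ?_
      have : ∑ k ∈ Finset.range n, q ^ k ≤ 1 / (1 - q) := by
        rw [geom_sum_eq hq1.ne, one_div, ← neg_div_neg_eq, inv_eq_one_div, neg_sub, neg_sub]
        gcongr
        have : 0 < q ^ n := by positivity
        linarith
      rw [hK']
      gcongr
    have hlim : Tendsto (fun n : ℕ => K' * (Real.sqrt (semiSq s u).toReal *
        Real.sqrt (semiSq r ψ).toReal) +
        2 * (2 ^ (-s) : ℝ) ^ n * Real.sqrt (semiSq s u).toReal * Λ) atTop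
        (𝓝 (K' * (Real.sqrt (semiSq s u).toReal * Real.sqrt (semiSq r ψ).toReal) +
        2 * 0 * Real.sqrt (semiSq s u).toReal * Λ)) := by
      refine tendsto_const_nhds.add (((Tendsto.const_mul 2 ?_).mul_const _).mul_const _)
      exact tendsto_pow_atTop_nhds_zero_of_lt_one (by positivity)
        (Real.rpow_lt_one_of_one_lt_of_neg (by norm_num) (by linarith))
    simp only [mul_zero, zero_mul, add_zero] at hlim
    exact ge_of_tendsto hlim (Eventually.of_forall hb)
  -- The oscillating and the constant part each carry a factor `2` from squaring a sum; `80 = 2 ·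
  -- 40`, where `40 = 4 (2 + 2 · 4)` bounds `c²` by the energy.
  refine ⟨Real.toNNReal (2 * K' ^ 2) + 80 * C, fun u ψ hu hfin hψ i => ?_⟩
  obtain ⟨v, hv, hve⟩ := hu.1.aemeasurable
  have hvL : MemLp v 2 (volume.restrict refTriangle) := hu.ae_eq hve
  rw [enSq_congr s hve] at hfin ⊢
  have e0 : ∫ X in refTriangle, u X * pderiv i ψ X = ∫ X in refTriangle, v X * pderiv i ψ X := by
    refine integral_congr_ae ?_
    filter_upwards [hve] with x hx; rw [hx]
  rw [e0]
  have hs : semiSq s v ≠ ⊤ := ne_top_of_le_ne_top hfin le_add_self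
  have hψs := semiSq_ne_top_of_contDiff hr1 hψ
  obtain ⟨c, hc⟩ := exists_l2Sq_sub_const_le hv hs0
  have h1 := main v ψ hv hfin hψ i c hc
  have e1 : ∫ X in refTriangle, v X * pderiv i ψ X =
      (∫ X in refTriangle, (v X - c) * pderiv i ψ X) +
        c * ∫ X in refTriangle, pderiv i ψ X := by
    have hI : IntegrableOn (fun X => (v X - c) * pderiv i ψ X) refTriangle :=
      integrable_mul_pderiv (hvL.sub (memLp_const c)) hψ i
    rw [← integral_const_mul, ← integral_add hI
      (((memLp_pderiv hψ i 1).integrable le_rfl).const_mul _)]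
    congr 1; funext X
    ring
  rw [e1]
  refine (ofReal_add_sq_le _ _).trans ?_
  have b1 : ENNReal.ofReal ((∫ X in refTriangle, (v X - c) * pderiv i ψ X) ^ 2) ≤
      ENNReal.ofReal (K' ^ 2) * (enSq s v * semiSq r ψ) := by
    have h2 := pow_le_pow_left₀ (abs_nonneg _) h1 2
    rw [sq_abs, mul_pow, mul_pow, Real.sq_sqrt ENNReal.toReal_nonneg,
      Real.sq_sqrt ENNReal.toReal_nonneg] at h2
    refine (ENNReal.ofReal_le_ofReal h2).trans ?_
    rw [ENNReal.ofReal_mul (by positivity), ENNReal.ofReal_mul ENNReal.toReal_nonneg,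
      ENNReal.ofReal_toReal hs, ENNReal.ofReal_toReal hψs]
    gcongr
    exact le_add_self
  have b2 : ENNReal.ofReal ((c * ∫ X in refTriangle, pderiv i ψ X) ^ 2) ≤
      40 * (C * (enSq s v * semiSq r ψ)) := by
    rw [mul_pow, ENNReal.ofReal_mul (sq_nonneg _)]
    have b3 : ENNReal.ofReal (c ^ 2) ≤ 40 * enSq s v := by
      have e1 := l2Sq_add_le (f := v) (g := fun X => -(v X - c)) hv
      rw [l2Sq_neg] at e1
      have e2 : (fun X => v X + -(v X - c)) = fun _ => c := by funext X; ring
      rw [e2] at e1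
      refine (ofReal_sq_le_four_l2Sq _).trans ?_
      calc _ ≤ 4 * (2 * enSq s v + 2 * (4 * enSq s v)) := by
            gcongr
            refine e1.trans ?_
            gcongr
            · exact le_self_add
            · exact hc.trans (by gcongr; exact le_add_self)
        _ = _ := by ring
    calc _ ≤ (40 * enSq s v) * (C * semiSq r ψ) := by gcongr; exact hC ψ hψ i
      _ = _ := by ring
  calc _ ≤ 2 * (ENNReal.ofReal (K' ^ 2) * (enSq s v * semiSq r ψ)) +
        2 * (40 * (C * (enSq s v * semiSq r ψ))) := by gcongr
    _ = _ := by
        push_cast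
        rw [show ((Real.toNNReal (2 * K' ^ 2) : ℝ≥0) : ℝ≥0∞) = ENNReal.ofReal (2 * K' ^ 2) from rfl,
          ENNReal.ofReal_mul (by norm_num), ENNReal.ofReal_ofNat]
        ring

end RTTriangle

/-! ### An explicit function with indicator trace on the first edge. -/

namespace RTTriangle

/-! ### Explicit functions with trace one on the first edge and zero on the others -/

/-- A regularization of `(x₁ - x₂) / x₁`. -/
noncomputable def vfac (δ : ℝ) (X : ℝ × ℝ) : ℝ := (X.1 - X.2) / Real.sqrt (X.1 ^ 2 + δ ^ 2)

/-- Regularizations of a function which is one on the first edge and zero on the others. -/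
noncomputable def vprod (δ : ℝ) (X : ℝ × ℝ) : ℝ := vfac δ X * vfac δ (mapB X)

/-- The product of `vprod` with a cutoff function in the height above the first edge. -/
noncomputable def edgeBump (κ δ : ℝ) (X : ℝ × ℝ) : ℝ := vprod δ X * (1 - step (κ * X.2))

/-- The reciprocal distance to the end points of the first edge. -/
noncomputable def wt (X : ℝ × ℝ) : ℝ := 1 / X.1 + 1 / (mapB X).1

theorem mapB_apply (X : ℝ × ℝ) : mapB X = (1 - X.1 + X.2, X.2) := by
  unfold mapB affMap; ext <;> simp; ring

theorem mapJ_apply (X : ℝ × ℝ) : mapJ X = (1 - X.2, 1 - X.1) := by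
  unfold mapJ affMap; ext <;> simp <;> ring

theorem mapB_mem {X : ℝ × ℝ} (hX : X ∈ refTriangle) : mapB X ∈ refTriangle := by
  obtain ⟨a1, a2, a3, a4⟩ := hX
  rw [mapB_apply]
  refine ⟨?_, ?_, ?_, ?_⟩ <;> simp only <;> linarith

theorem one_le_wt {X : ℝ × ℝ} (hX : X ∈ refTriangle) : 1 ≤ wt X := by
  have hB := mapB_mem hX
  have h1 : 1 ≤ 1 / X.1 := (one_le_div hX.1).2 hX.2.1.le
  have h2 : 0 < 1 / (mapB X).1 := one_div_pos.2 hB.1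
  unfold wt; linarith

theorem one_div_fst_le_wt {X : ℝ × ℝ} (hX : X ∈ refTriangle) : 1 / X.1 ≤ wt X := by
  have h2 : 0 < 1 / (mapB X).1 := one_div_pos.2 (mapB_mem hX).1
  unfold wt; linarith

theorem one_div_mapB_fst_le_wt {X : ℝ × ℝ} (hX : X ∈ refTriangle) : 1 / (mapB X).1 ≤ wt X := by
  have h2 : 0 < 1 / X.1 := one_div_pos.2 hX.1
  unfold wt; linarith

theorem measurable_wt : Measurable wt := by
  have := contDiff_mapB.continuous.measurable
  unfold wt; fun_prop

theorem abs_fst_le_sqrt (x δ : ℝ) : |x| ≤ Real.sqrt (x ^ 2 + δ ^ 2) :=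
  Real.abs_le_sqrt (by nlinarith [sq_nonneg δ])

theorem vfac_nonneg (δ : ℝ) {X : ℝ × ℝ} (h : X.2 ≤ X.1) : 0 ≤ vfac δ X :=
  div_nonneg (by linarith) (Real.sqrt_nonneg _)

theorem vfac_le_one (δ : ℝ) {X : ℝ × ℝ} (h : 0 ≤ X.2) : vfac δ X ≤ 1 :=
  div_le_one_of_le₀ ((le_abs_self _ |>.trans' (by linarith)).trans (abs_fst_le_sqrt X.1 δ))
    (Real.sqrt_nonneg _)

/-- At `δ = 0` the function is homogeneous of degree zero, with Lipschitz constant of order `1 /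
x₁`. The regularized denominator is only larger and is itself 1-Lipschitz in `x₁`, so the bound is
uniform in `δ`. Truncation at one is free because the values lie in `[0, 1]`. -/
theorem abs_vfac_sub_le (δ : ℝ) {X Y : ℝ × ℝ} (hX : X ∈ refTriangle) (hY : Y ∈ refTriangle) :
    |vfac δ X - vfac δ Y| ≤ 3 * min 1 (‖X - Y‖ / X.1) := by
  have a1 := vfac_nonneg δ hX.2.2.2.le
  have a2 := vfac_nonneg δ hY.2.2.2.le
  have b1 := vfac_le_one δ hX.2.2.1.le
  have b2 := vfac_le_one δ hY.2.2.1.le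
  rw [mul_min_of_nonneg _ _ (by norm_num)]
  refine le_min (by rw [abs_le]; constructor <;> linarith) ?_
  have n1 : |X.1 - Y.1| ≤ ‖X - Y‖ := norm_fst_le (X - Y)
  have n2 : |X.2 - Y.2| ≤ ‖X - Y‖ := norm_snd_le (X - Y)
  set h := Real.sqrt (X.1 ^ 2 + δ ^ 2) with hh
  set k := Real.sqrt (Y.1 ^ 2 + δ ^ 2) with hk
  have hX1 : X.1 ≤ h := (le_abs_self _).trans (abs_fst_le_sqrt X.1 δ)
  have hY1 : Y.1 ≤ k := (le_abs_self _).trans (abs_fst_le_sqrt Y.1 δ)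
  have h0 : 0 < h := hX.1.trans_le hX1
  have k0 : 0 < k := hY.1.trans_le hY1
  have hkh : |k - h| ≤ |X.1 - Y.1| := by
    have e : (k - h) * (k + h) = (Y.1 - X.1) * (Y.1 + X.1) := by
      have e1 : h ^ 2 = X.1 ^ 2 + δ ^ 2 := Real.sq_sqrt (by positivity)
      have e2 : k ^ 2 = Y.1 ^ 2 + δ ^ 2 := Real.sq_sqrt (by positivity)
      linear_combination e2 - e1
    have e' := congrArg abs e
    rw [abs_mul, abs_mul, abs_of_pos (show 0 < k + h by linarith),
      abs_of_pos (show 0 < Y.1 + X.1 by linarith [hX.1, hY.1]), abs_sub_comm Y.1] at e'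
    by_contra! hlt
    nlinarith [abs_nonneg (X.1 - Y.1), hX.1, hY.1]
  have e : vfac δ X - vfac δ Y =
      ((X.1 - Y.1) - (X.2 - Y.2) + vfac δ Y * (k - h)) / h := by
    have : vfac δ Y * k = Y.1 - Y.2 := div_mul_cancel₀ _ k0.ne'
    have : vfac δ X = (X.1 - X.2) / h := rfl
    rw [this]
    field_simp
    linarith
  rw [e, abs_div, abs_of_pos h0]
  have num : |(X.1 - Y.1) - (X.2 - Y.2) + vfac δ Y * (k - h)| ≤ 3 * ‖X - Y‖ := by
    refine (abs_add_le _ _).trans ?_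
    have := abs_sub (X.1 - Y.1) (X.2 - Y.2)
    have c : |vfac δ Y * (k - h)| ≤ 1 * ‖X - Y‖ := by
      rw [abs_mul, abs_of_nonneg a2]
      exact mul_le_mul b2 (hkh.trans n1) (abs_nonneg _) zero_le_one
    linarith
  calc _ ≤ 3 * ‖X - Y‖ / h := by gcongr
    _ ≤ 3 * ‖X - Y‖ / X.1 := div_le_div_of_nonneg_left (by positivity) hX.1 hX1
    _ = _ := mul_div_assoc _ _ _

theorem vprod_nonneg (δ : ℝ) {X : ℝ × ℝ} (h : X.2 ≤ X.1) (h' : X.1 ≤ 1) : 0 ≤ vprod δ X :=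
  mul_nonneg (vfac_nonneg δ h) (vfac_nonneg δ (by rw [mapB_apply]; simp only; linarith))

theorem vprod_le_one (δ : ℝ) {X : ℝ × ℝ} (h' : X.1 ≤ 1) (h0 : 0 ≤ X.2) :
    vprod δ X ≤ 1 :=
  mul_le_one₀ (vfac_le_one δ h0) (vfac_nonneg δ (by rw [mapB_apply]; simp only; linarith))
    (vfac_le_one δ (by rw [mapB_apply]; simpa only))

theorem abs_vprod_sub_le (δ : ℝ) {X Y : ℝ × ℝ} (hX : X ∈ refTriangle) (hY : Y ∈ refTriangle) :
    |vprod δ X - vprod δ Y| ≤ 9 * min 1 (‖X - Y‖ * wt X) := by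
  have hX' := mapB_mem hX
  have hY' := mapB_mem hY
  have e : vprod δ X - vprod δ Y = (vfac δ X - vfac δ Y) * vfac δ (mapB X) +
      vfac δ Y * (vfac δ (mapB X) - vfac δ (mapB Y)) := by unfold vprod; ring
  have w1 : min 1 (‖X - Y‖ / X.1) ≤ min 1 (‖X - Y‖ * wt X) := by
    refine min_le_min le_rfl ?_
    rw [div_eq_mul_one_div]
    exact mul_le_mul_of_nonneg_left (one_div_fst_le_wt hX) (norm_nonneg _)
  have w2 : min 1 (‖mapB X - mapB Y‖ / (mapB X).1) ≤ 2 * min 1 (‖X - Y‖ * wt X) := by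
    rw [mul_min_of_nonneg _ _ (by norm_num)]
    refine min_le_min (by norm_num) ?_
    rw [div_eq_mul_one_div, ← mul_assoc]
    exact mul_le_mul (norm_mapB_sub_le X Y) (one_div_mapB_fst_le_wt hX)
      (one_div_pos.2 hX'.1).le (by positivity)
  have m0 : 0 ≤ min 1 (‖X - Y‖ * wt X) :=
    le_min zero_le_one (mul_nonneg (norm_nonneg _) (zero_le_one.trans (one_le_wt hX)))
  have t1 : |(vfac δ X - vfac δ Y) * vfac δ (mapB X)| ≤ 3 * min 1 (‖X - Y‖ * wt X) * 1 := by
    rw [abs_mul, abs_of_nonneg (vfac_nonneg δ hX'.2.2.2.le)]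
    exact mul_le_mul ((abs_vfac_sub_le δ hX hY).trans (by linarith))
      (vfac_le_one δ hX'.2.2.1.le) (vfac_nonneg δ hX'.2.2.2.le) (by positivity)
  have t2 : |vfac δ Y * (vfac δ (mapB X) - vfac δ (mapB Y))| ≤
      1 * (6 * min 1 (‖X - Y‖ * wt X)) := by
    rw [abs_mul, abs_of_nonneg (vfac_nonneg δ hY.2.2.2.le)]
    exact mul_le_mul (vfac_le_one δ hY.2.2.1.le)
      ((abs_vfac_sub_le δ hX' hY').trans (by linarith)) (abs_nonneg _) zero_le_one
  rw [e]
  refine (abs_add_le _ _).trans ?_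
  linarith

/-- Independent of `δ`, including `δ = 0`: this is the majorant for removing the regularization. -/
theorem exists_abs_edgeBump_sub_le : ∃ L : ℝ, 1 ≤ L ∧ ∀ κ δ : ℝ, 0 ≤ κ →
    ∀ X ∈ refTriangle, ∀ Y ∈ refTriangle,
    |edgeBump κ δ X - edgeBump κ δ Y| ≤ (9 + L * κ) * min 1 (‖X - Y‖ * wt X) := by
  obtain ⟨L, hL1, hL⟩ := exists_lipschitz_step
  refine ⟨L, hL1, fun κ δ hκ X hX Y hY => ?_⟩
  have e : edgeBump κ δ X - edgeBump κ δ Y = (vprod δ X - vprod δ Y) * (1 - step (κ * X.2)) +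
      vprod δ Y * (step (κ * Y.2) - step (κ * X.2)) := by unfold edgeBump; ring
  have n1 := norm_sub_le_one hX hY
  have n2 : |X.2 - Y.2| ≤ ‖X - Y‖ := norm_snd_le (X - Y)
  have hw : ‖X - Y‖ ≤ min 1 (‖X - Y‖ * wt X) :=
    le_min n1 (le_mul_of_one_le_right (norm_nonneg _) (one_le_wt hX))
  have t1 : |(vprod δ X - vprod δ Y) * (1 - step (κ * X.2))| ≤
      9 * min 1 (‖X - Y‖ * wt X) * 1 := by
    rw [abs_mul]
    refine mul_le_mul (abs_vprod_sub_le δ hX hY) ?_ (abs_nonneg _)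
      (by linarith [norm_nonneg (X - Y)])
    rw [abs_le]; constructor <;> linarith [step_nonneg (κ * X.2), step_le_one (κ * X.2)]
  have t2 : |vprod δ Y * (step (κ * Y.2) - step (κ * X.2))| ≤
      1 * (L * κ * min 1 (‖X - Y‖ * wt X)) := by
    rw [abs_mul, abs_of_nonneg (vprod_nonneg δ hY.2.2.2.le hY.2.1.le)]
    refine mul_le_mul (vprod_le_one δ hY.2.1.le hY.2.2.1.le)
      ((hL _ _).trans ?_) (abs_nonneg _) zero_le_one
    rw [← mul_sub, abs_mul, abs_of_nonneg hκ, abs_sub_comm, mul_assoc]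
    gcongr
    exact n2.trans hw
  rw [e]
  refine (abs_add_le _ _).trans ?_
  linarith

theorem edgeBump_mem_Icc (κ δ : ℝ) {X : ℝ × ℝ} (h : X.2 ≤ X.1) (h' : X.1 ≤ 1) (h0 : 0 ≤ X.2) :
    edgeBump κ δ X ∈ Icc (0 : ℝ) 1 :=
  ⟨mul_nonneg (vprod_nonneg δ h h') (by linarith [step_le_one (κ * X.2)]),
    mul_le_one₀ (vprod_le_one δ h' h0) (by linarith [step_le_one (κ * X.2)])
      (by linarith [step_nonneg (κ * X.2)])⟩

theorem measurable_vfac (δ : ℝ) : Measurable (vfac δ) := by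
  unfold vfac; fun_prop

theorem measurable_edgeBump (κ δ : ℝ) : Measurable (edgeBump κ δ) := by
  have h1 := measurable_vfac δ
  have h2 := contDiff_mapB.continuous.measurable
  have h3 := contDiff_step.continuous.measurable
  unfold edgeBump vprod; fun_prop

theorem contDiff_vfac {δ : ℝ} (hδ : δ ≠ 0) : ContDiff ℝ ∞ (vfac δ) := by
  unfold vfac
  have hp : ∀ X : ℝ × ℝ, X.1 ^ 2 + δ ^ 2 ≠ 0 := fun X => by positivity
  refine (contDiff_fst.sub contDiff_snd).div ?_ fun X => (Real.sqrt_pos.2 (by positivity)).ne'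
  exact ((contDiff_fst.pow 2).add contDiff_const).sqrt hp

theorem contDiff_vprod {δ : ℝ} (hδ : δ ≠ 0) : ContDiff ℝ ∞ (vprod δ) :=
  (contDiff_vfac hδ).mul ((contDiff_vfac hδ).comp contDiff_mapB)

theorem contDiff_heightCut (κ : ℝ) : ContDiff ℝ ∞ fun X : ℝ × ℝ => 1 - step (κ * X.2) :=
  contDiff_const.sub (contDiff_step.comp (contDiff_const.mul contDiff_snd))

theorem contDiff_edgeBump (κ : ℝ) {δ : ℝ} (hδ : δ ≠ 0) : ContDiff ℝ ∞ (edgeBump κ δ) :=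
  (contDiff_vprod hδ).mul (contDiff_heightCut κ)

theorem tendsto_vfac {X : ℝ × ℝ} (hX : 0 < X.1) {δ : ℕ → ℝ} (hδ : Tendsto δ atTop (𝓝 0)) :
    Tendsto (fun n => vfac (δ n) X) atTop (𝓝 (vfac 0 X)) := by
  unfold vfac
  have hc : ContinuousAt (fun δ : ℝ => (X.1 - X.2) / Real.sqrt (X.1 ^ 2 + δ ^ 2)) 0 :=
    ContinuousAt.div (by fun_prop) (by fun_prop) (Real.sqrt_pos.2 (by positivity)).ne'
  exact hc.tendsto.comp hδ

theorem tendsto_edgeBump (κ : ℝ) {X : ℝ × ℝ} (hX : 0 < X.1) (hX' : 0 < (mapB X).1) {δ : ℕ → ℝ}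
    (hδ : Tendsto δ atTop (𝓝 0)) :
    Tendsto (fun n => edgeBump κ (δ n) X) atTop (𝓝 (edgeBump κ 0 X)) :=
  ((tendsto_vfac hX hδ).mul (tendsto_vfac hX' hδ)).mul_const _

theorem lintegral_comp_mapB {g : ℝ × ℝ → ℝ≥0∞} (hg : Measurable g) :
    ∫⁻ X in refTriangle, g (mapB X) = ∫⁻ X in refTriangle, g X :=
  measurePreserving_mapB.lintegral_comp hg

/-- The slice over `x` has length `x`, which contributes one power and moves the threshold from one
to two. -/
theorem lintegral_fst_rpow_lt_top {p : ℝ} (hp : p < 2) :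
    ∫⁻ X in refTriangle, ENNReal.ofReal (X.1 ^ (-p)) < ⊤ := by
  rw [lintegral_refTriangle_eq (by fun_prop)]
  have h : ∀ x ∈ Ioo (0 : ℝ) 1, ∫⁻ _y in Ioo 0 x, ENNReal.ofReal (x ^ (-p)) =
      ENNReal.ofReal (x ^ (1 - p)) := by
    intro x hx
    rw [setLIntegral_const, Real.volume_Ioo, sub_zero, ← ENNReal.ofReal_mul
      (Real.rpow_nonneg hx.1.le _), sub_eq_add_neg, add_comm, Real.rpow_add_one hx.1.ne']
  rw [setLIntegral_congr_fun measurableSet_Ioo h]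
  have hi := (intervalIntegral.intervalIntegrable_rpow' (a := 0) (b := 1)
    (show -1 < 1 - p by linarith)).1
  refine lt_of_le_of_lt (lintegral_mono_set Ioo_subset_Ioc_self) ?_
  exact hi.lintegral_lt_top

theorem lintegral_wt_rpow_lt_top {p : ℝ} (h0 : 0 ≤ p) (hp : p < 2) :
    ∫⁻ X in refTriangle, ENNReal.ofReal (wt X ^ p) < ⊤ := by
  have hm : Measurable fun X : ℝ × ℝ => ENNReal.ofReal (X.1 ^ (-p)) := by fun_prop
  have h2 := lintegral_comp_mapB hm
  calc _ ≤ ∫⁻ X in refTriangle, (ENNReal.ofReal (2 ^ p) * ENNReal.ofReal (X.1 ^ (-p)) +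
        ENNReal.ofReal (2 ^ p) * ENNReal.ofReal ((mapB X).1 ^ (-p))) := by
        refine setLIntegral_mono' measurableSet_refTriangle fun X hX => ?_
        have x1 := hX.1
        have x2 := (mapB_mem hX).1
        rw [← ENNReal.ofReal_mul (by positivity), ← ENNReal.ofReal_mul (by positivity),
          ← ENNReal.ofReal_add (by positivity) (by positivity)]
        refine ENNReal.ofReal_le_ofReal ?_
        have key : ∀ a b : ℝ, 0 < a → 0 < b → a ≤ b →
            (1 / a + 1 / b) ^ p ≤ 2 ^ p * a ^ (-p) := by
          intro a b ha hb hab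
          have : 1 / b ≤ 1 / a := one_div_le_one_div_of_le ha hab
          calc (1 / a + 1 / b) ^ p ≤ (2 * a⁻¹) ^ p := by
                refine Real.rpow_le_rpow (by positivity) ?_ h0
                rw [← one_div]; linarith
            _ = _ := by
                rw [Real.mul_rpow (by norm_num) (by positivity), Real.rpow_neg ha.le,
                  Real.inv_rpow ha.le]
        have p1 : 0 ≤ 2 ^ p * X.1 ^ (-p) := by positivity
        have p2 : 0 ≤ 2 ^ p * (mapB X).1 ^ (-p) := by positivity
        rcases le_total X.1 (mapB X).1 with h | h
        · exact (key _ _ x1 x2 h).trans (by linarith)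
        · unfold wt
          rw [add_comm (1 / X.1)]
          exact (key _ _ x2 x1 h).trans (by linarith)
    _ = ENNReal.ofReal (2 ^ p) * (∫⁻ X in refTriangle, ENNReal.ofReal (X.1 ^ (-p))) +
        ENNReal.ofReal (2 ^ p) * ∫⁻ X in refTriangle, ENNReal.ofReal (X.1 ^ (-p)) := by
        rw [lintegral_add_left (by fun_prop), lintegral_const_mul' _ _ ENNReal.ofReal_ne_top,
          lintegral_const_mul' _ _ ENNReal.ofReal_ne_top, h2]
    _ < ⊤ := by
        have := lintegral_fst_rpow_lt_top hp
        finiteness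

/-- The truncated kernel at scale `1 / wt` integrates to `wt^(2r)`, and inverse powers of the
distance to a vertex are integrable up to order two, here `2r < 2`. -/
theorem exists_lintegral_wt_kernel_le {r : ℝ} (h0 : 0 < r) (h1 : r < 1) :
    ∫⁻ p, ENNReal.ofReal (min 1 (‖p.1 - p.2‖ * wt p.1) ^ 2 / ‖p.1 - p.2‖ ^ (2 + 2 * r))
      ∂((volume.restrict refTriangle).prod (volume.restrict refTriangle)) < ⊤ := by
  obtain ⟨C, hC⟩ := exists_lintegral_min_kernel_le h0 h1
  have hw := measurable_wt
  rw [lintegral_prod _ (by fun_prop)]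
  refine lt_of_le_of_lt (b := C * ∫⁻ X in refTriangle, ENNReal.ofReal (wt X ^ (2 * r))) ?_
    (ENNReal.mul_lt_top (by finiteness) (lintegral_wt_rpow_lt_top (by linarith) (by linarith)))
  rw [← lintegral_const_mul' _ _ (by finiteness)]
  refine setLIntegral_mono' measurableSet_refTriangle fun X hX => ?_
  have w0 : 0 < wt X := zero_lt_one.trans_le (one_le_wt hX)
  have := (setLIntegral_le_lintegral refTriangle _).trans (hC X (wt X)⁻¹ (by positivity))
  rw [Real.inv_rpow w0.le, Real.rpow_neg w0.le, inv_inv] at this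
  simpa only [div_inv_eq_mul, norm_sub_rev] using this

/-- Dominated convergence with the Lipschitz majorant of `exists_abs_edgeBump_sub_le`. Every order
`r < 1` is reached, although the limit is discontinuous at two vertices. -/
theorem tendsto_enSq_edgeBump {r : ℝ} (h0 : 0 < r) (h1 : r < 1) {κ : ℝ} (hκ : 0 ≤ κ) {δ : ℕ → ℝ}
    (hδ : Tendsto δ atTop (𝓝 0)) :
    Tendsto (fun n => enSq r (fun X => edgeBump κ (δ n) X - edgeBump κ 0 X)) atTop (𝓝 0) := by
  obtain ⟨L, hL1, hL⟩ := exists_abs_edgeBump_sub_le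
  have hmeas : ∀ n, Measurable fun X => edgeBump κ (δ n) X - edgeBump κ 0 X := fun n =>
    (measurable_edgeBump κ _).sub (measurable_edgeBump κ 0)
  have hlim : ∀ X ∈ refTriangle, Tendsto (fun n => edgeBump κ (δ n) X - edgeBump κ 0 X) atTop
      (𝓝 0) := by
    intro X hX
    have := (tendsto_edgeBump κ hX.1 (mapB_mem hX).1 hδ).sub_const (edgeBump κ 0 X)
    rwa [sub_self] at this
  have hI : ∀ δ', ∀ X ∈ refTriangle, edgeBump κ δ' X ∈ Icc (0 : ℝ) 1 := fun δ' X hX =>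
    edgeBump_mem_Icc κ δ' hX.2.2.2.le hX.2.1.le hX.2.2.1.le
  have t1 : Tendsto (fun n => l2Sq (fun X => edgeBump κ (δ n) X - edgeBump κ 0 X)) atTop (𝓝 0) := by
    have : Tendsto (fun n => l2Sq (fun X => edgeBump κ (δ n) X - edgeBump κ 0 X)) atTop
        (𝓝 (∫⁻ X in refTriangle, 0)) := by
      unfold l2Sq
      refine tendsto_lintegral_of_dominated_convergence (fun _ => 1)
        (fun k => ((hmeas k).pow_const 2).ennreal_ofReal) (fun k => ?_) ?_ ?_
      · refine (ae_restrict_iff' measurableSet_refTriangle).2 (Eventually.of_forall fun X hX => ?_)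
        rw [← ENNReal.ofReal_one]
        refine ENNReal.ofReal_le_ofReal ?_
        obtain ⟨a1, a2⟩ := hI (δ k) X hX
        obtain ⟨b1, b2⟩ := hI 0 X hX
        nlinarith
      · rw [setLIntegral_const, one_mul]
        exact (volume_refTriangle_le.trans_lt ENNReal.one_lt_top).ne
      · refine (ae_restrict_iff' measurableSet_refTriangle).2 (Eventually.of_forall fun X hX => ?_)
        have := ENNReal.tendsto_ofReal ((hlim X hX).pow 2)
        simpa using this
    simpa using this
  have t2 : Tendsto (fun n => semiSq r (fun X => edgeBump κ (δ n) X - edgeBump κ 0 X)) atTop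
      (𝓝 0) := by
    have : Tendsto (fun n => semiSq r (fun X => edgeBump κ (δ n) X - edgeBump κ 0 X)) atTop
        (𝓝 (∫⁻ p, 0 ∂((volume.restrict refTriangle).prod (volume.restrict refTriangle)))) := by
      have e : ∀ k, semiSq r (fun X => edgeBump κ (δ k) X - edgeBump κ 0 X) = _ := fun k =>
        semiSq_eq_lintegral_prod (hmeas k) r
      simp only [e]
      refine tendsto_lintegral_of_dominated_convergence
        (fun p => ENNReal.ofReal (4 * (9 + L * κ) ^ 2) * ENNReal.ofReal
          (min 1 (‖p.1 - p.2‖ * wt p.1) ^ 2 / ‖p.1 - p.2‖ ^ (2 + 2 * r)))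
        (fun k => ?_) (fun k => ?_) ?_ ?_
      · have := hmeas k
        have a1 : Measurable fun p : (ℝ × ℝ) × (ℝ × ℝ) =>
          edgeBump κ (δ k) p.1 - edgeBump κ 0 p.1 := this.comp measurable_fst
        have a2 : Measurable fun p : (ℝ × ℝ) × (ℝ × ℝ) =>
          edgeBump κ (δ k) p.2 - edgeBump κ 0 p.2 := this.comp measurable_snd
        exact (((a1.sub a2).pow_const 2).div (by fun_prop)).ennreal_ofReal
      · filter_upwards [ae_prod_mem_refTriangle] with p hp
        obtain ⟨X, Y⟩ := p
        obtain ⟨hX, hY⟩ := hp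
        simp only at hX hY ⊢
        rw [← ENNReal.ofReal_mul (by positivity), ← mul_div_assoc]
        refine ENNReal.ofReal_le_ofReal (div_le_div_of_nonneg_right ?_ (by positivity))
        have b1 := hL κ (δ k) hκ X hX Y hY
        have b2 := hL κ 0 hκ X hX Y hY
        have b3 : |edgeBump κ (δ k) X - edgeBump κ 0 X - (edgeBump κ (δ k) Y - edgeBump κ 0 Y)| ≤
            2 * ((9 + L * κ) * min 1 (‖X - Y‖ * wt X)) := by
          rw [show edgeBump κ (δ k) X - edgeBump κ 0 X - (edgeBump κ (δ k) Y - edgeBump κ 0 Y) =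
            (edgeBump κ (δ k) X - edgeBump κ (δ k) Y) - (edgeBump κ 0 X - edgeBump κ 0 Y) by ring]
          exact (abs_sub _ _).trans (by linarith)
        rw [← sq_abs]
        refine (pow_le_pow_left₀ (abs_nonneg _) b3 2).trans (le_of_eq (by ring))
      · rw [lintegral_const_mul' _ _ ENNReal.ofReal_ne_top]
        exact ENNReal.mul_ne_top ENNReal.ofReal_ne_top (exists_lintegral_wt_kernel_le h0 h1).ne
      · filter_upwards [ae_prod_mem_refTriangle] with p hp
        have := ENNReal.tendsto_ofReal ((((hlim _ hp.1).sub (hlim _ hp.2)).pow 2).div_const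
          (‖p.1 - p.2‖ ^ (2 + 2 * r)))
        simpa using this
    simpa using this
  have := t1.add t2
  rw [add_zero] at this
  exact this

theorem enSq_edgeBump_ne_top {r : ℝ} (h0 : 0 < r) (h1 : r < 1) {κ : ℝ} (hκ : 0 ≤ κ) :
    enSq r (edgeBump κ 0) ≠ ⊤ := by
  -- The limit is at finite distance from one of its smooth regularizations.
  have ht := tendsto_enSq_edgeBump h0 h1 hκ tendsto_one_div_add_atTop_nhds_zero_nat
  obtain ⟨n, hn⟩ := (ht.eventually_lt_const (ENNReal.zero_lt_top)).exists
  have hδ : (1 / ((n : ℝ) + 1)) ≠ 0 := by positivity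
  have hc := contDiff_edgeBump κ hδ
  have hb : enSq r (edgeBump κ (1 / ((n : ℝ) + 1))) ≠ ⊤ :=
    ENNReal.add_ne_top.2 ⟨l2Sq_ne_top (memLp_contDiff hc 2), semiSq_ne_top_of_contDiff h1 hc⟩
  have := enSq_sub_le (f := edgeBump κ (1 / ((n : ℝ) + 1)))
    (g := fun X => edgeBump κ (1 / ((n : ℝ) + 1)) X - edgeBump κ 0 X) (measurable_edgeBump κ _) r
  simp only [sub_sub_cancel] at this
  exact ne_top_of_le_ne_top (ENNReal.add_ne_top.2 ⟨by finiteness,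
    ENNReal.mul_ne_top (by norm_num) hn.ne⟩) this

end RTTriangle

/-! ### Existence of the weak fluxes and of the interpolant. -/

namespace RTTriangle

/-! ### Existence of the weak fluxes -/

theorem exists_gradInt_sq_le {σ r : ℝ} (hσ0 : 0 < σ) (hr0 : 1 / 2 < r) (hr1 : r < 1)
    (hr : 1 - σ < r) {u : Fin 2 → ℝ × ℝ → ℝ}
    (hu : ∀ i, MemLp (u i) 2 (volume.restrict refTriangle)) (hfin : ∀ i, enSq σ (u i) ≠ ⊤) :
    ∃ C : ℝ≥0∞, C ≠ ⊤ ∧ ∀ ψ : ℝ × ℝ → ℝ, ContDiff ℝ ∞ ψ →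
      ENNReal.ofReal (gradInt u ψ ^ 2) ≤ C * semiSq r ψ := by
  obtain ⟨C, hC⟩ := exists_pairing_le hσ0 hr0 hr1 hr
  refine ⟨2 * (C * enSq σ (u 0)) + 2 * (C * enSq σ (u 1)), ?_, fun ψ hψ => ?_⟩
  · have := hfin 0
    have := hfin 1
    finiteness
  · rw [gradInt_eq_sum hu hψ, Fin.sum_univ_two]
    refine (ofReal_add_sq_le _ _).trans ?_
    refine (add_le_add (mul_le_mul_right (hC _ ψ (hu 0) (hfin 0) hψ 0) 2)
      (mul_le_mul_right (hC _ ψ (hu 1) (hfin 1) hψ 1) 2)).trans (le_of_eq ?_)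
    ring

/-- The bilinear bound makes the integrals along one approximating sequence Cauchy, and the
integrals along any other sequence have the same limit. -/
theorem exists_isGradPairing {σ r : ℝ} (hσ0 : 0 < σ) (hr0 : 1 / 2 < r) (hr1 : r < 1)
    (hr : 1 - σ < r) {u : Fin 2 → ℝ × ℝ → ℝ}
    (hu : ∀ i, MemLp (u i) 2 (volume.restrict refTriangle)) (hfin : ∀ i, enSq σ (u i) ≠ ⊤)
    {φ : ℝ × ℝ → ℝ} (hφ : Measurable φ) {φn : ℕ → ℝ × ℝ → ℝ} (hs : ∀ n, ContDiff ℝ ∞ (φn n))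
    (h : Tendsto (fun n => enSq r (fun x => φn n x - φ x)) atTop (𝓝 0)) :
    ∃ p, IsGradPairing r u φ p ∧ Tendsto (fun n => gradInt u (φn n)) atTop (𝓝 p) := by
  obtain ⟨C, hCt, hC⟩ := exists_gradInt_sq_le hσ0 hr0 hr1 hr hu hfin
  have key : ∀ f g : ℝ × ℝ → ℝ, ContDiff ℝ ∞ f → ContDiff ℝ ∞ g →
      ENNReal.ofReal ((gradInt u f - gradInt u g) ^ 2) ≤
        2 * C * enSq r (fun x => f x - φ x) + 2 * C * enSq r (fun x => g x - φ x) := by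
    intro f g hf hg
    rw [← gradInt_sub hu hf hg]
    refine (hC _ (hf.sub hg)).trans ?_
    have e1 := semiSq_add_le (f := fun x => f x - φ x) (g := fun x => -(g x - φ x))
      (hf.continuous.measurable.sub hφ) r
    rw [semiSq_neg] at e1
    have e2 : (fun x => f x - φ x + -(g x - φ x)) = fun x => f x - g x := by funext x; ring
    rw [e2] at e1
    calc _ ≤ C * (2 * enSq r (fun x => f x - φ x) + 2 * enSq r (fun x => g x - φ x)) := by
          gcongr
          exact e1.trans (by gcongr <;> exact le_add_self)
      _ = _ := by ring
  have hlim : ∀ {ψ : ℕ → ℝ × ℝ → ℝ}, Tendsto (fun n => enSq r (fun x => ψ n x - φ x)) atTop (𝓝 0) →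
      Tendsto (fun n => 2 * C * enSq r (fun x => ψ n x - φ x)) atTop (𝓝 0) := by
    intro ψ hψ
    have := ENNReal.Tendsto.const_mul (a := 2 * C) hψ (Or.inr (by finiteness))
    rwa [mul_zero] at this
  have hcauchy : CauchySeq fun n => gradInt u (φn n) := by
    rw [Metric.cauchySeq_iff]
    intro ε hε
    have hpos : 0 < ENNReal.ofReal (ε ^ 2 / 4) := ENNReal.ofReal_pos.2 (by positivity)
    obtain ⟨N, hN⟩ := eventually_atTop.1 ((hlim h).eventually_lt_const hpos)
    refine ⟨N, fun m hm n hn => ?_⟩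
    have h1 := (key _ _ (hs m) (hs n)).trans (add_le_add (hN m hm).le (hN n hn).le)
    rw [← ENNReal.ofReal_add (by positivity) (by positivity),
      ENNReal.ofReal_le_ofReal_iff (by positivity)] at h1
    rw [Real.dist_eq]
    refine abs_lt_of_sq_lt_sq (h1.trans_lt ?_) hε.le
    nlinarith [sq_pos_of_pos hε]
  obtain ⟨p, hp⟩ := cauchySeq_tendsto_of_complete hcauchy
  refine ⟨p, fun ψ hψ => ?_, hp⟩
  have hψ2 := hψ.tendsto_enSq (by linarith) hr1
  have hd : Tendsto (fun n => gradInt u (ψ n) - gradInt u (φn n)) atTop (𝓝 0) := by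
    refine tendsto_zero_of_ofReal_sq ?_
    have := (hlim hψ2).add (hlim h)
    rw [add_zero] at this
    exact tendsto_of_tendsto_of_tendsto_of_le_of_le tendsto_const_nhds this (fun _ => zero_le)
      fun n => key _ _ (hψ.1 n) (hs n)
  have := hd.add hp
  simp only [sub_add_cancel, zero_add] at this
  exact this

/-- The classical counterpart of the weak flux tested with `ψ`. -/
noncomputable def fluxInt (u : Fin 2 → ℝ × ℝ → ℝ) (d ψ : ℝ × ℝ → ℝ) : ℝ :=
  gradInt u ψ + ∫ X in refTriangle, d X * ψ X

/-- Smooth functions which converge in `H^r` and whose traces converge to the indicator of an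
edge. -/
structure EdgeApprox (r : ℝ) (e : Fin 3) (φ : ℝ × ℝ → ℝ) (φn : ℕ → ℝ × ℝ → ℝ) : Prop where
  measurable : Measurable φ
  memLp : MemLp φ 2 (volume.restrict refTriangle)
  fin : enSq r φ ≠ ⊤
  smooth : ∀ n, ContDiff ℝ ∞ (φn n)
  lim : Tendsto (fun n => enSq r (fun x => φn n x - φ x)) atTop (𝓝 0)
  trace : ∀ e' : Fin 3, Tendsto
      (fun n => eLpNorm (fun t => φn n (edgePoint e' t) - (if e' = e then 1 else 0)) 2
        (volume.restrict (Ioo (0 : ℝ) 1))) atTop (𝓝 0)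

/-- Two orders occur: `s` belongs to the definition of the flux, while `σ ≤ s` is the order at which
the energy of `u` is known to be finite. The condition `ε < σ` serves both. -/
theorem EdgeApprox.exists_hasNormalFlux {σ s ε : ℝ} (hσ0 : 0 < σ) (hσs : σ ≤ s) (hε0 : 0 < ε)
    (hεσ : ε < σ) (hε : ε < 1 / 2) {u : Fin 2 → ℝ × ℝ → ℝ} {d : ℝ × ℝ → ℝ}
    (hu : ∀ i, MemLp (u i) 2 (volume.restrict refTriangle)) (hfin : ∀ i, enSq σ (u i) ≠ ⊤)
    (hd : MemLp d 2 (volume.restrict refTriangle)) {e : Fin 3} {φ : ℝ × ℝ → ℝ}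
    {φn : ℕ → ℝ × ℝ → ℝ} (h : EdgeApprox (1 - ε) e φ φn) :
    ∃ F, HasNormalFlux s u d e F ∧ Tendsto (fun n => fluxInt u d (φn n)) atTop (𝓝 F) := by
  have hr0 : 1 / 2 < 1 - ε := by linarith
  have hr1 : 1 - ε < 1 := by linarith
  obtain ⟨p, hp, hlim⟩ := exists_isGradPairing hσ0 hr0 hr1 (by linarith) hu hfin h.measurable
    h.smooth h.lim
  refine ⟨p + ∫ X in refTriangle, d X * φ X, ⟨ε, φ, p, hε0, hεσ.trans_le hσs, hε,
    memSobolev_of_enSq_ne_top (by linarith) hr1 h.memLp h.fin, ⟨φn, smoothApprox_of_tendsto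
      (by linarith) hr1 h.memLp h.smooth h.lim, h.trace⟩, hp, rfl⟩, ?_⟩
  exact hlim.add (tendsto_integral_mul hd h.memLp h.smooth h.lim)

theorem tendsto_eLpNorm_of_lintegral_sq {α : Type*} [MeasurableSpace α] {μ : Measure α}
    {f : ℕ → α → ℝ} (h : Tendsto (fun n => ∫⁻ x, ENNReal.ofReal (f n x ^ 2) ∂μ) atTop (𝓝 0)) :
    Tendsto (fun n => eLpNorm (f n) 2 μ) atTop (𝓝 0) := by
  simp only [lintegral_ofReal_sq_eq_eLpNorm_sq] at h
  have h2 := h.ennrpow_const (1 / 2)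
  rw [ENNReal.zero_rpow_of_pos (by norm_num)] at h2
  refine h2.congr fun n => ?_
  rw [← ENNReal.rpow_natCast, ← ENNReal.rpow_mul]
  norm_num

theorem tendsto_lintegral_edgeBump_trace (κ : ℝ) {δ : ℕ → ℝ} (hδ : Tendsto δ atTop (𝓝 0)) :
    Tendsto (fun n => ∫⁻ t in Ioo (0 : ℝ) 1, ENNReal.ofReal ((edgeBump κ (δ n) (t, 0) - 1) ^ 2))
      atTop (𝓝 0) := by
  have : Tendsto (fun n => ∫⁻ t in Ioo (0 : ℝ) 1,
      ENNReal.ofReal ((edgeBump κ (δ n) (t, 0) - 1) ^ 2)) atTop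
      (𝓝 (∫⁻ t in Ioo (0 : ℝ) 1, 0)) := by
    refine tendsto_lintegral_of_dominated_convergence (fun _ => 1)
      (fun k => ?_) (fun k => ?_) ?_ ?_
    · have := measurable_edgeBump κ (δ k)
      fun_prop
    · refine (ae_restrict_iff' measurableSet_Ioo).2 (Eventually.of_forall fun t ht => ?_)
      rw [← ENNReal.ofReal_one]
      refine ENNReal.ofReal_le_ofReal ?_
      obtain ⟨a1, a2⟩ := edgeBump_mem_Icc κ (δ k) (X := (t, 0)) ht.1.le ht.2.le le_rfl
      nlinarith
    · simp
    · refine (ae_restrict_iff' measurableSet_Ioo).2 (Eventually.of_forall fun t ht => ?_)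
      have h0 := tendsto_edgeBump κ (X := (t, 0)) ht.1 (by
        rw [mapB_apply]; simp only; linarith [ht.2]) hδ
      have h1 : edgeBump κ 0 (t, 0) = 1 := by
        have ht0 := ht.1.ne'
        have ht1 : 1 - t ≠ 0 := by linarith [ht.2]
        simp only [edgeBump, vprod, vfac, mapB_apply, mul_zero, step_eq_zero zero_le_one, sub_zero,
          add_zero, mul_one, ne_eq, OfNat.ofNat_ne_zero, not_false_eq_true, zero_pow]
        rw [Real.sqrt_sq ht.1.le, Real.sqrt_sq (by linarith [ht.2]), div_self ht0, div_self ht1,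
          one_mul]
      rw [h1] at h0
      have := ENNReal.tendsto_ofReal ((h0.sub_const 1).pow 2)
      simpa using this
  simpa using this

theorem edgeBump_edge_one (κ δ t : ℝ) : edgeBump κ δ (1, t) = 0 := by
  simp [edgeBump, vprod, vfac, mapB_apply]

theorem edgeBump_edge_two (κ δ t : ℝ) : edgeBump κ δ (t, t) = 0 := by
  simp [edgeBump, vprod, vfac, mapB_apply]

theorem edgeApprox_edgeBump {r : ℝ} (h0 : 0 < r) (h1 : r < 1) {κ : ℝ} (hκ : 0 ≤ κ) :
    EdgeApprox r 0 (edgeBump κ 0) fun n => edgeBump κ (1 / ((n : ℝ) + 1)) where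
  measurable := measurable_edgeBump κ 0
  memLp := memLp_of_bound (measurable_edgeBump κ 0) (K := 1) (fun X hX => by
    obtain ⟨a1, a2⟩ := edgeBump_mem_Icc κ 0 hX.2.2.2.le hX.2.1.le hX.2.2.1.le
    rwa [abs_of_nonneg a1]) 2
  fin := enSq_edgeBump_ne_top h0 h1 hκ
  smooth n := contDiff_edgeBump κ (by positivity)
  lim := tendsto_enSq_edgeBump h0 h1 hκ tendsto_one_div_add_atTop_nhds_zero_nat
  trace e' := by
    fin_cases e'
    · refine tendsto_eLpNorm_of_lintegral_sq ?_
      simpa [edgePoint] using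
        tendsto_lintegral_edgeBump_trace κ tendsto_one_div_add_atTop_nhds_zero_nat
    · simp [edgePoint, edgeBump_edge_one]
    · simp [edgePoint, edgeBump_edge_two]

theorem edgeApprox_edgeBump_mapJ {r : ℝ} (h0 : 0 < r) (h1 : r < 1) {κ : ℝ} (hκ : 0 ≤ κ) :
    EdgeApprox r 1 (fun X => edgeBump κ 0 (mapJ X))
      fun n X => edgeBump κ (1 / ((n : ℝ) + 1)) (mapJ X) where
  measurable := (measurable_edgeBump κ 0).comp contDiff_mapJ.continuous.measurable
  memLp := (edgeApprox_edgeBump h0 h1 hκ).memLp.comp_measurePreserving measurePreserving_mapJ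
  fin := ne_top_of_le_ne_top (ENNReal.mul_ne_top (by norm_num) (enSq_edgeBump_ne_top h0 h1 hκ))
    (enSq_comp_le measurePreserving_mapJ norm_mapJ_sub_le (measurable_edgeBump κ 0) h0 h1)
  smooth n := (contDiff_edgeBump κ (by positivity)).comp contDiff_mapJ
  lim := by
    have := ENNReal.Tendsto.const_mul (a := 16)
      (tendsto_enSq_edgeBump h0 h1 hκ tendsto_one_div_add_atTop_nhds_zero_nat)
      (Or.inr (by norm_num))
    rw [mul_zero] at this
    refine tendsto_of_tendsto_of_tendsto_of_le_of_le tendsto_const_nhds this (fun _ => zero_le)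
      fun n => ?_
    exact enSq_comp_le (f := fun X => edgeBump κ (1 / ((n : ℝ) + 1)) X - edgeBump κ 0 X)
      measurePreserving_mapJ norm_mapJ_sub_le
      ((measurable_edgeBump κ _).sub (measurable_edgeBump κ 0)) h0 h1
  trace e' := by
    fin_cases e'
    · simp [edgePoint, mapJ_apply, edgeBump_edge_one]
    · refine tendsto_eLpNorm_of_lintegral_sq ?_
      have := tendsto_lintegral_edgeBump_trace κ tendsto_one_div_add_atTop_nhds_zero_nat
      have e : ∀ n : ℕ, _ := fun n => lintegral_Ioo_reflect fun t =>
        ENNReal.ofReal ((edgeBump κ (1 / ((n : ℝ) + 1)) (t, 0) - 1) ^ 2)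
      simp only [← e] at this
      simpa [edgePoint, mapJ_apply] using this
    · simp [edgePoint, mapJ_apply, edgeBump_edge_two]

/-- The third function completes the other two to a partition of unity. Since the constant one has
zero gradient, the three fluxes then add up to the integral of the divergence. -/
theorem EdgeApprox.complement {r : ℝ} {φ0 φ1 : ℝ × ℝ → ℝ}
    {ψ0 ψ1 : ℕ → ℝ × ℝ → ℝ} (h0 : EdgeApprox r 0 φ0 ψ0) (h1 : EdgeApprox r 1 φ1 ψ1) :
    EdgeApprox r 2 (fun X => 1 - (φ0 X + φ1 X)) fun n X => 1 - (ψ0 n X + ψ1 n X) where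
  measurable := measurable_const.sub (h0.measurable.add h1.measurable)
  memLp := (memLp_const 1).sub (h0.memLp.add h1.memLp)
  fin := by
    refine ne_top_of_le_ne_top ?_ (enSq_sub_le measurable_const r)
    have e : enSq r (fun _ => (1:ℝ)) ≠ ⊤ :=
      ENNReal.add_ne_top.2 ⟨l2Sq_ne_top (memLp_const 1), by simp [semiSq, gagliardo]⟩
    have e2 : enSq r (fun X => φ0 X + φ1 X) ≠ ⊤ := by
      refine ne_top_of_le_ne_top ?_ (enSq_add_le h0.measurable r)
      have := h0.fin
      have := h1.fin
      finiteness
    finiteness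
  smooth n := contDiff_const.sub ((h0.smooth n).add (h1.smooth n))
  lim := by
    have := (ENNReal.Tendsto.const_mul (a := 2) h0.lim (Or.inr (by norm_num))).add
      (ENNReal.Tendsto.const_mul (a := 2) h1.lim (Or.inr (by norm_num)))
    simp only [mul_zero, add_zero] at this
    refine tendsto_of_tendsto_of_tendsto_of_le_of_le tendsto_const_nhds this (fun _ => zero_le)
      fun n => ?_
    have e := enSq_add_le (f := fun X => ψ0 n X - φ0 X) (g := fun X => ψ1 n X - φ1 X)
      ((h0.smooth n).continuous.measurable.sub h0.measurable) r
    rw [← enSq_neg] at e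
    refine le_trans (le_of_eq ?_) e
    congr 1; funext X; ring
  trace e' := by
    have := (h0.trace e').add (h1.trace e')
    rw [add_zero] at this
    refine tendsto_of_tendsto_of_tendsto_of_le_of_le tendsto_const_nhds this (fun _ => zero_le)
      fun n => ?_
    have m0 := ((h0.smooth n).continuous.comp (continuous_edgePoint e')).aestronglyMeasurable
      (μ := volume.restrict (Ioo (0:ℝ) 1))
    have m1 := ((h1.smooth n).continuous.comp (continuous_edgePoint e')).aestronglyMeasurable
      (μ := volume.restrict (Ioo (0:ℝ) 1))
    refine le_trans (le_of_eq ?_) (eLpNorm_add_le (m0.sub aestronglyMeasurable_const)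
      (m1.sub aestronglyMeasurable_const) (by norm_num))
    rw [← eLpNorm_neg]
    congr 1; funext t
    simp only [Pi.neg_apply, Pi.add_apply]
    fin_cases e' <;> simp <;> ring

theorem fluxInt_complement {u : Fin 2 → ℝ × ℝ → ℝ} {d : ℝ × ℝ → ℝ}
    (hu : ∀ i, MemLp (u i) 2 (volume.restrict refTriangle))
    (hd : MemLp d 2 (volume.restrict refTriangle)) {f g : ℝ × ℝ → ℝ}
    (hf : ContDiff ℝ ∞ f) (hg : ContDiff ℝ ∞ g) :
    fluxInt u d (fun X => 1 - (f X + g X)) =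
      (∫ X in refTriangle, d X) - (fluxInt u d f + fluxInt u d g) := by
  have hf2 := memLp_contDiff hf 2
  have hg2 := memLp_contDiff hg 2
  unfold fluxInt
  rw [gradInt_sub hu contDiff_const (hf.add hg), gradInt_const, gradInt_add hu hf hg]
  have e0 := integral_mul_sub hd (memLp_const 1) (hf2.add hg2)
  simp only [Pi.add_apply, mul_one] at e0
  rw [e0]
  have e : ∫ x in refTriangle, d x * (f x + g x) =
      (∫ x in refTriangle, d x * f x) + ∫ x in refTriangle, d x * g x := by
    refine Eq.trans ?_ (integral_add (hd.integrable_mul hf2) (hd.integrable_mul hg2))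
    congr 1; funext x; exact mul_add _ _ _
  rw [e]
  ring

/-- The normal component is constant on each edge: on the two legs one coordinate is constant, and
on the oblique edge the `c` terms cancel. -/
theorem edgeFlux_rt (a b c : ℝ) (e : Fin 3) :
    edgeFlux ![fun x => a + c * x.1, fun x => b + c * x.2] e = ![-b, a + c, b - a] e := by
  have h2 : Real.sqrt 2 ≠ 0 := by positivity
  fin_cases e
  · simp [edgeFlux, edgeLength, edgePoint, edgeNormal]
  · simp [edgeFlux, edgeLength, edgePoint, edgeNormal]
  · simp only [edgeFlux, edgeLength, edgePoint, edgeNormal, Fin.sum_univ_two]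
    simp
    have : ∀ t : ℝ, -((a + c * t) * (Real.sqrt 2)⁻¹) + (b + c * t) * (Real.sqrt 2)⁻¹ =
      (b - a) * (Real.sqrt 2)⁻¹ := fun t => by ring
    simp only [this, intervalIntegral.integral_const]
    field_simp
    simp
    field_simp

/-- The weak fluxes of a field and the approximations by means of which they are estimated. -/
theorem exists_fluxes {σ s : ℝ} (hσ0 : 0 < σ) (hσs : σ ≤ s)
    {u : Fin 2 → ℝ × ℝ → ℝ} {d : ℝ × ℝ → ℝ}
    (hu : ∀ i, MemLp (u i) 2 (volume.restrict refTriangle)) (hfin : ∀ i, enSq σ (u i) ≠ ⊤)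
    (hd : MemLp d 2 (volume.restrict refTriangle)) {κ : ℝ} (hκ : 0 ≤ κ) :
    ∃ F : Fin 3 → ℝ, (∀ e, HasNormalFlux s u d e (F e)) ∧ F 0 + F 1 + F 2 = ∫ X in refTriangle, d X ∧
      Tendsto (fun n : ℕ => fluxInt u d (edgeBump κ (1 / ((n : ℝ) + 1)))) atTop (𝓝 (F 0)) ∧
      Tendsto (fun n : ℕ => fluxInt u d fun X => edgeBump κ (1 / ((n : ℝ) + 1)) (mapJ X)) atTop
        (𝓝 (F 1)) := by
  -- Any positive number below both `σ` and `1/2` would do.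
  set ε : ℝ := min σ (1 / 2) / 2 with hε
  have hm : 0 < min σ (1 / 2) := lt_min hσ0 (by norm_num)
  have hε0 : 0 < ε := by positivity
  have hεσ : ε < σ := by have := min_le_left σ (1 / 2); linarith
  have hε2 : ε < 1 / 2 := by have := min_le_right σ (1 / 2); linarith
  have a0 := edgeApprox_edgeBump (r := 1 - ε) (by linarith) (by linarith) hκ
  have a1 := edgeApprox_edgeBump_mapJ (r := 1 - ε) (by linarith) (by linarith) hκ
  have a2 := a0.complement a1
  obtain ⟨F0, f0, t0⟩ := a0.exists_hasNormalFlux hσ0 hσs hε0 hεσ hε2 hu hfin hd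
  obtain ⟨F1, f1, t1⟩ := a1.exists_hasNormalFlux hσ0 hσs hε0 hεσ hε2 hu hfin hd
  obtain ⟨F2, f2, t2⟩ := a2.exists_hasNormalFlux hσ0 hσs hε0 hεσ hε2 hu hfin hd
  refine ⟨![F0, F1, F2], fun e => ?_, ?_, t0, t1⟩
  · fin_cases e
    · exact f0
    · exact f1
    · exact f2
  · have e : ∀ n, _ := fun n => fluxInt_complement hu hd (a0.smooth n) (a1.smooth n)
    simp only [e] at t2
    have := tendsto_nhds_unique t2 (tendsto_const_nhds.sub (t0.add t1))
    simp only [Matrix.cons_val]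
    linarith

theorem existsUnique_isRTInterpolant {σ s : ℝ} (hσ0 : 0 < σ) (hσs : σ ≤ s)
    {u : Fin 2 → ℝ × ℝ → ℝ} {d : ℝ × ℝ → ℝ} (hu : HasDivL2 refTriangle u d)
    (hfin : ∀ i, enSq σ (u i) ≠ ⊤) : ∃! w, IsRTInterpolant s u d w := by
  obtain ⟨F, hF, -, -, -⟩ := exists_fluxes hσ0 hσs hu.1 hfin hu.2.1 zero_le_one
  -- The solution of `-b = F 0`, `a + c = F 1`, `b - a = F 2`.
  refine ⟨![fun x => (-F 0 - F 2) + (F 0 + F 1 + F 2) * x.1,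
    fun x => -F 0 + (F 0 + F 1 + F 2) * x.2], ⟨⟨_, _, _, rfl⟩, fun e => ?_⟩, ?_⟩
  · rw [edgeFlux_rt]
    convert hF e using 1
    fin_cases e <;> simp
  · rintro w ⟨⟨a, b, c, rfl⟩, hw⟩
    have h : ∀ e, ![-b, a + c, b - a] e = F e := fun e => by
      rw [← edgeFlux_rt]
      exact (hw e).unique hu (hF e)
    have h0 : -b = F 0 := h 0
    have h1 : a + c = F 1 := h 1
    have h2 : b - a = F 2 := h 2
    rw [← h0, ← h1, ← h2]
    congr 1
    · funext x; ring
    · congr 1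
      funext x; ring

end RTTriangle

/-! ### The flux over the first edge when the order exceeds one half. -/

namespace RTTriangle

/-! ### Bounds for the explicit functions -/

theorem norm_basisVec_le (i : Fin 2) : ‖basisVec i‖ ≤ 1 := by
  fin_cases i <;> simp [basisVec, Prod.norm_def]

theorem abs_pderiv_le_of_lipschitz {f : ℝ × ℝ → ℝ} (hf : ContDiff ℝ ∞ f) {X : ℝ × ℝ}
    (hX : X ∈ refTriangle) {L : ℝ} (hL0 : 0 ≤ L)
    (hL : ∀ Y ∈ refTriangle, |f X - f Y| ≤ L * ‖X - Y‖) (i : Fin 2) : |pderiv i f X| ≤ L := by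
  have h1 : ‖fderiv ℝ f X‖ ≤ L := by
    refine ((hf.differentiable (by simp)).differentiableAt (x := X)).hasFDerivAt.le_of_lip' hL0 ?_
    filter_upwards [isOpen_refTriangle.mem_nhds hX] with Y hY
    rw [norm_sub_rev, norm_sub_rev Y]
    exact hL Y hY
  calc |pderiv i f X| ≤ ‖fderiv ℝ f X‖ * ‖basisVec i‖ := (fderiv ℝ f X).le_opNorm _
    _ ≤ L * 1 := mul_le_mul h1 (norm_basisVec_le i) (norm_nonneg _) hL0
    _ = L := mul_one L

theorem pderiv_mul {f g : ℝ × ℝ → ℝ} (hf : ContDiff ℝ ∞ f) (hg : ContDiff ℝ ∞ g) (i : Fin 2)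
    (X : ℝ × ℝ) : pderiv i (fun x => f x * g x) X = f X * pderiv i g X + g X * pderiv i f X := by
  unfold pderiv
  rw [fderiv_fun_mul (hf.differentiable (by simp)).differentiableAt
    (hg.differentiable (by simp)).differentiableAt]
  simp

theorem abs_pderiv_vprod_le {δ : ℝ} (hδ : δ ≠ 0) {X : ℝ × ℝ} (hX : X ∈ refTriangle) (i : Fin 2) :
    |pderiv i (vprod δ) X| ≤ 9 * wt X := by
  have hw := one_le_wt hX
  refine abs_pderiv_le_of_lipschitz (contDiff_vprod hδ) hX (by linarith) (fun Y hY => ?_) i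
  refine (abs_vprod_sub_le δ hX hY).trans ?_
  rw [mul_assoc, mul_comm (wt X)]
  gcongr
  exact min_le_right _ _

/-- The cut-off depends on the height only, so `κ` enters the derivative in `x₂` but not the one in
`x₁`. This asymmetry is what separates the two components of the field. -/
theorem exists_abs_pderiv_edgeBump_le : ∃ L : ℝ, 0 ≤ L ∧ ∀ κ δ : ℝ, 0 ≤ κ → δ ≠ 0 →
    ∀ X ∈ refTriangle, |pderiv 0 (edgeBump κ δ) X| ≤ 9 * wt X ∧
      |pderiv 1 (edgeBump κ δ) X| ≤ 9 * wt X + L * κ ∧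
      (2 < κ * X.2 → ∀ i, pderiv i (edgeBump κ δ) X = 0) := by
  obtain ⟨L, hL1, hL⟩ := exists_lipschitz_step
  refine ⟨L, by linarith, fun κ δ hκ hδ X hX => ?_⟩
  have hh := contDiff_heightCut κ
  have hv := contDiff_vprod hδ
  have e : ∀ i, pderiv i (edgeBump κ δ) X = vprod δ X * pderiv i (fun X => 1 - step (κ * X.2)) X +
      (1 - step (κ * X.2)) * pderiv i (vprod δ) X := fun i => pderiv_mul hv hh i X
  have v0 := vprod_nonneg δ hX.2.2.2.le hX.2.1.le
  have v1 := vprod_le_one δ hX.2.1.le hX.2.2.1.le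
  have s0 : 0 ≤ 1 - step (κ * X.2) := by linarith [step_le_one (κ * X.2)]
  have s1 : 1 - step (κ * X.2) ≤ 1 := by linarith [step_nonneg (κ * X.2)]
  have hw := one_le_wt hX
  have hb : ∀ i, |(1 - step (κ * X.2)) * pderiv i (vprod δ) X| ≤ 9 * wt X := fun i => by
    rw [abs_mul, abs_of_nonneg s0]
    exact (mul_le_of_le_one_left (abs_nonneg _) s1).trans (abs_pderiv_vprod_le hδ hX i)
  have hp0 : pderiv 0 (fun X : ℝ × ℝ => 1 - step (κ * X.2)) X = 0 := by
    have h1 := hasDerivAt_fst hh X.1 X.2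
    exact h1.unique (hasDerivAt_const X.1 (1 - step (κ * X.2)))
  have hp1 : |pderiv 1 (fun X : ℝ × ℝ => 1 - step (κ * X.2)) X| ≤ L * κ := by
    refine abs_pderiv_le_of_lipschitz hh hX (by positivity) (fun Y hY => ?_) 1
    rw [show 1 - step (κ * X.2) - (1 - step (κ * Y.2)) = step (κ * Y.2) - step (κ * X.2) by ring]
    refine (hL _ _).trans ?_
    rw [← mul_sub, abs_mul, abs_of_nonneg hκ, abs_sub_comm, mul_assoc]
    gcongr
    exact norm_snd_le (X - Y)
  refine ⟨?_, ?_, fun hlt i => ?_⟩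
  · rw [e, hp0, mul_zero, zero_add]; exact hb 0
  · rw [e]
    refine (abs_add_le _ _).trans ?_
    rw [add_comm]
    refine add_le_add (hb 1) ?_
    rw [abs_mul, abs_of_nonneg v0]
    exact (mul_le_of_le_one_left (abs_nonneg _) v1).trans hp1
  · have hz : edgeBump κ δ =ᶠ[𝓝 X] fun _ => 0 := by
      have hc : ContinuousAt (fun Y : ℝ × ℝ => κ * Y.2) X := by fun_prop
      filter_upwards [hc.eventually_const_lt hlt] with Y hY
      simp [edgeBump, step_eq_one hY.le]
    unfold pderiv
    rw [hz.fderiv_eq]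
    simp

theorem exists_semiSq_edgeBump_le {r : ℝ} (h0 : 0 < r) (h1 : r < 1) {κ : ℝ} (hκ : 0 ≤ κ) :
    ∃ C : ℝ≥0, ∀ δ, semiSq r (edgeBump κ δ) ≤ C := by
  obtain ⟨L, hL1, hL⟩ := exists_abs_edgeBump_sub_le
  have hK := (exists_lintegral_wt_kernel_le h0 h1).ne
  refine ⟨(ENNReal.ofReal ((9 + L * κ) ^ 2) * ∫⁻ p, ENNReal.ofReal
    (min 1 (‖p.1 - p.2‖ * wt p.1) ^ 2 / ‖p.1 - p.2‖ ^ (2 + 2 * r))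
      ∂((volume.restrict refTriangle).prod (volume.restrict refTriangle))).toNNReal, fun δ => ?_⟩
  rw [ENNReal.coe_toNNReal (ENNReal.mul_ne_top ENNReal.ofReal_ne_top hK),
    semiSq_eq_lintegral_prod (measurable_edgeBump κ δ),
    ← lintegral_const_mul' _ _ ENNReal.ofReal_ne_top]
  refine lintegral_mono_ae ?_
  filter_upwards [ae_prod_mem_refTriangle] with p hp
  rw [← ENNReal.ofReal_mul (by positivity), ← mul_div_assoc]
  refine ENNReal.ofReal_le_ofReal (div_le_div_of_nonneg_right ?_ (by positivity))
  rw [← sq_abs, ← mul_pow]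
  exact pow_le_pow_left₀ (abs_nonneg _) (hL κ δ hκ _ hp.1 _ hp.2) 2

theorem lintegral_enorm_le_l2Norm {d : ℝ × ℝ → ℝ} (hd : MemLp d 2 (volume.restrict refTriangle)) :
    ∫⁻ X in refTriangle, ‖d X‖ₑ ≤ l2Norm d := by
  rw [← eLpNorm_one_eq_lintegral_enorm]
  refine (eLpNorm_le_eLpNorm_mul_rpow_measure_univ (p := 1) (q := 2) (by norm_num)
    hd.aestronglyMeasurable).trans ?_
  refine mul_le_of_le_one_right' (ENNReal.rpow_le_one ?_ (by norm_num))
  rw [Measure.restrict_apply_univ]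
  exact volume_refTriangle_le

theorem fluxInt_congr {u v : Fin 2 → ℝ × ℝ → ℝ} (d ψ : ℝ × ℝ → ℝ)
    (h : ∀ i, u i =ᵐ[volume.restrict refTriangle] v i) : fluxInt u d ψ = fluxInt v d ψ := by
  unfold fluxInt gradInt
  congr 1
  refine integral_congr_ae ?_
  filter_upwards [h 0, h 1] with X h0 h1
  simp [Fin.sum_univ_two, h0, h1]

theorem enorm_fluxInt_le {u : Fin 2 → ℝ × ℝ → ℝ} {d : ℝ × ℝ → ℝ}
    (hu : ∀ i, MemLp (u i) 2 (volume.restrict refTriangle))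
    (hd : MemLp d 2 (volume.restrict refTriangle)) (κ : ℝ) {δ : ℝ} (hδ : δ ≠ 0) :
    ‖fluxInt u d (edgeBump κ δ)‖ₑ ≤ ‖∫ X in refTriangle, u 0 X * pderiv 0 (edgeBump κ δ) X‖ₑ +
      ‖∫ X in refTriangle, u 1 X * pderiv 1 (edgeBump κ δ) X‖ₑ + l2Norm d := by
  unfold fluxInt
  rw [gradInt_eq_sum hu (contDiff_edgeBump κ hδ), Fin.sum_univ_two]
  refine (enorm_add_le _ _).trans (add_le_add (enorm_add_le _ _) ?_)
  refine (enorm_integral_le_lintegral_enorm _).trans (le_trans ?_ (lintegral_enorm_le_l2Norm hd))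
  refine setLIntegral_mono' measurableSet_refTriangle fun X hX => ?_
  rw [enorm_mul]
  refine mul_le_of_le_one_right' ?_
  obtain ⟨a1, a2⟩ := edgeBump_mem_Icc κ δ hX.2.2.2.le hX.2.1.le hX.2.2.1.le
  rw [Real.enorm_eq_ofReal a1, ← ENNReal.ofReal_one]
  exact ENNReal.ofReal_le_ofReal a2

/-! ### The flux estimate for smoothness above one half -/

/-- The one-point estimate with `ρ = x₁^(1/2)`: the weight cancels `ρ^(2s) = x₁^s`, and `ρ^(-2)
x₁^(-s) = x₁^(-(s+1))` is integrable because `s + 1 < 2`. -/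
theorem lintegral_sq_mul_fst_rpow_lt_top {s : ℝ} (h0 : 0 < s) (h1 : s < 1) {f : ℝ × ℝ → ℝ}
    (hf : Measurable f) (hfin : enSq s f ≠ ⊤) :
    ∫⁻ X in refTriangle, ENNReal.ofReal (f X ^ 2 * X.1 ^ (-s)) < ⊤ := by
  have hl2 : l2Sq f ≠ ⊤ := ne_top_of_le_ne_top hfin le_self_add
  have hs : semiSq s f ≠ ⊤ := ne_top_of_le_ne_top hfin le_add_self
  have hg := measurable_gagliardo hf s
  have hw := lintegral_fst_rpow_lt_top (p := s + 1) (by linarith)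
  refine lt_of_le_of_lt (b := ∫⁻ X in refTriangle, (8 * gagliardo s f X +
    8 * l2Sq f * ENNReal.ofReal (X.1 ^ (-(s + 1))))) ?_ ?_
  · refine setLIntegral_mono' measurableSet_refTriangle fun X hX => ?_
    have x0 := hX.1
    have h := ofReal_sq_le_gagliardo hf h0 hX (ρ := X.1 ^ (1 / 2 : ℝ)) (by positivity)
      (Real.rpow_le_one x0.le hX.2.1.le (by norm_num))
    rw [← Real.rpow_mul x0.le, ← Real.rpow_mul x0.le] at h
    rw [ENNReal.ofReal_mul (sq_nonneg _)]
    refine (mul_le_mul_left h _).trans (le_of_eq ?_)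
    have e1 : ENNReal.ofReal (X.1 ^ (1 / 2 * (2 * s))) * ENNReal.ofReal (X.1 ^ (-s)) = 1 := by
      rw [← ENNReal.ofReal_mul (by positivity), ← Real.rpow_add x0, ← ENNReal.ofReal_one]
      congr 1
      rw [show 1 / 2 * (2 * s) + -s = 0 by ring, Real.rpow_zero]
    have e2 : ENNReal.ofReal (X.1 ^ (1 / 2 * (-2 : ℝ))) * ENNReal.ofReal (X.1 ^ (-s)) =
        ENNReal.ofReal (X.1 ^ (-(s + 1))) := by
      rw [← ENNReal.ofReal_mul (by positivity), ← Real.rpow_add x0]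
      congr 2; ring
    calc _ = 8 * ((ENNReal.ofReal (X.1 ^ (1 / 2 * (2 * s))) * ENNReal.ofReal (X.1 ^ (-s))) *
          gagliardo s f X) + 8 * l2Sq f *
          (ENNReal.ofReal (X.1 ^ (1 / 2 * (-2 : ℝ))) * ENNReal.ofReal (X.1 ^ (-s))) := by ring
      _ = _ := by rw [e1, e2, one_mul]
  · rw [lintegral_add_left (hg.const_mul _), lintegral_const_mul' _ _ (by norm_num),
      lintegral_const_mul' _ _ (by finiteness)]
    change 8 * semiSq s f + _ < ⊤
    finiteness

/-- Square integrability alone just fails, since `x₁^(-2)` is the borderline non-integrable power. A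
little smoothness allows the splitting `x₁^(-s/2) · x₁^(s/2-1)` in Cauchy-Schwarz, with `x₁^(s-2)`
integrable. -/
theorem lintegral_enorm_div_fst_lt_top {s : ℝ} (h0 : 0 < s) (h1 : s < 1) {f : ℝ × ℝ → ℝ}
    (hf : Measurable f) (hfin : enSq s f ≠ ⊤) :
    ∫⁻ X in refTriangle, ‖f X‖ₑ * ENNReal.ofReal (1 / X.1) < ⊤ := by
  have hA := lintegral_sq_mul_fst_rpow_lt_top h0 h1 hf hfin
  have hB := lintegral_fst_rpow_lt_top (p := 2 - s) (by linarith)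
  have h := lintegral_mul_le_sqrt (μ := volume.restrict refTriangle)
    (f := fun X => ‖f X‖ₑ * ENNReal.ofReal (X.1 ^ (-(s / 2))))
    (g := fun X => ENNReal.ofReal (X.1 ^ (s / 2 - 1))) (by fun_prop) (by fun_prop)
  have e1 : ∫⁻ X in refTriangle, (‖f X‖ₑ * ENNReal.ofReal (X.1 ^ (-(s / 2)))) ^ 2 =
      ∫⁻ X in refTriangle, ENNReal.ofReal (f X ^ 2 * X.1 ^ (-s)) := by
    refine setLIntegral_congr_fun measurableSet_refTriangle fun X hX => ?_
    have x0 := hX.1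
    rw [mul_pow, ← ofReal_sq_eq_enorm_sq, ENNReal.ofReal_mul (sq_nonneg _),
      ← ENNReal.ofReal_pow (by positivity), ← Real.rpow_natCast (X.1 ^ (-(s / 2))),
      ← Real.rpow_mul x0.le]
    congr 3; push_cast; ring
  have e2 : ∫⁻ X in refTriangle, ENNReal.ofReal (X.1 ^ (s / 2 - 1)) ^ 2 =
      ∫⁻ X in refTriangle, ENNReal.ofReal (X.1 ^ (-(2 - s))) := by
    refine setLIntegral_congr_fun measurableSet_refTriangle fun X hX => ?_
    have x0 := hX.1
    rw [← ENNReal.ofReal_pow (by positivity), ← Real.rpow_natCast, ← Real.rpow_mul x0.le]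
    congr 2; push_cast; ring
  rw [e1, e2] at h
  refine lt_of_le_of_lt (le_of_eq ?_) (h.trans_lt (ENNReal.mul_lt_top
    (ENNReal.rpow_lt_top_of_nonneg (by norm_num) hA.ne)
    (ENNReal.rpow_lt_top_of_nonneg (by norm_num) hB.ne)))
  refine setLIntegral_congr_fun measurableSet_refTriangle fun X hX => ?_
  have x0 := hX.1
  rw [mul_assoc, ← ENNReal.ofReal_mul (by positivity), ← Real.rpow_add x0,
    show -(s / 2) + (s / 2 - 1) = -1 by ring, Real.rpow_neg_one, one_div]

theorem lintegral_enorm_mul_wt_lt_top {s : ℝ} (h0 : 0 < s) (h1 : s < 1) {f : ℝ × ℝ → ℝ}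
    (hf : Measurable f) (hfin : enSq s f ≠ ⊤) :
    ∫⁻ X in refTriangle, ‖f X‖ₑ * ENNReal.ofReal (9 * wt X) < ⊤ := by
  have hB := contDiff_mapB.continuous.measurable
  have hfB : Measurable fun X => f (mapB X) := hf.comp hB
  have hA := lintegral_enorm_div_fst_lt_top h0 h1 hf hfin
  have hA' := lintegral_enorm_div_fst_lt_top h0 h1 hfB (ne_top_of_le_ne_top (by finiteness)
    (enSq_comp_le measurePreserving_mapB norm_mapB_sub_le hf h0 h1))
  have hm : Measurable fun X : ℝ × ℝ => ‖f (mapB X)‖ₑ * ENNReal.ofReal (1 / X.1) := by fun_prop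
  rw [← lintegral_comp_mapB hm] at hA'
  have e : ∀ X ∈ refTriangle, ‖f X‖ₑ * ENNReal.ofReal (9 * wt X) =
      9 * (‖f X‖ₑ * ENNReal.ofReal (1 / X.1)) +
      9 * (‖f (mapB (mapB X))‖ₑ * ENNReal.ofReal (1 / (mapB X).1)) := by
    intro X hX
    have hBB : mapB (mapB X) = X := by
      simp only [mapB_apply]; ext <;> simp only; ring
    have x0 := hX.1
    have x1 := (mapB_mem hX).1
    rw [hBB, wt, ENNReal.ofReal_mul (by norm_num), ENNReal.ofReal_add (by positivity)
      (by positivity), ENNReal.ofReal_ofNat]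
    ring
  rw [setLIntegral_congr_fun measurableSet_refTriangle e, lintegral_add_left (by fun_prop),
    lintegral_const_mul' _ _ (by norm_num), lintegral_const_mul' _ _ (by norm_num)]
  finiteness

theorem tendsto_lintegral_strip {g : ℝ × ℝ → ℝ≥0∞} (hg : ∫⁻ X in refTriangle, g X ≠ ⊤) :
    Tendsto (fun K : ℕ => ∫⁻ X in refTriangle ∩ {X | X.2 < 2⁻¹ ^ (K + 1)}, g X) atTop (𝓝 0) := by
  have hS : ∀ K : ℕ, MeasurableSet {X : ℝ × ℝ | X.2 < 2⁻¹ ^ (K + 1)} := fun K =>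
    measurableSet_lt measurable_snd measurable_const
  have hv : Tendsto (fun K : ℕ => (volume.restrict refTriangle) {X : ℝ × ℝ | X.2 < 2⁻¹ ^ (K + 1)})
      atTop (𝓝 0) := by
    have h2 : Tendsto (fun K : ℕ => ENNReal.ofReal (2⁻¹ ^ (K + 1))) atTop (𝓝 0) := by
      have := ENNReal.tendsto_ofReal ((tendsto_add_atTop_iff_nat 1).2
        (tendsto_pow_atTop_nhds_zero_of_lt_one (r := (2⁻¹ : ℝ)) (by norm_num) (by norm_num)))
      simpa using this
    refine tendsto_of_tendsto_of_tendsto_of_le_of_le tendsto_const_nhds h2 (fun _ => zero_le)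
      fun K => ?_
    rw [Measure.restrict_apply (hS K)]
    have hsub : {X : ℝ × ℝ | X.2 < 2⁻¹ ^ (K + 1)} ∩ refTriangle ⊆
        Ioo (0 : ℝ) 1 ×ˢ Ioo (0 : ℝ) (2⁻¹ ^ (K + 1)) := fun X hX =>
      ⟨⟨hX.2.1, hX.2.2.1⟩, hX.2.2.2.1, hX.1⟩
    refine (measure_mono hsub).trans (le_of_eq ?_)
    rw [Measure.volume_eq_prod, Measure.prod_prod, Real.volume_Ioo, Real.volume_Ioo]
    simp
  have := tendsto_setLIntegral_zero hg hv
  refine this.congr fun K => ?_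
  rw [Measure.restrict_restrict (hS K), inter_comm]

theorem lintegral_mul_pderiv_le_strip {v g : ℝ × ℝ → ℝ} {K : ℕ} {D : ℝ × ℝ → ℝ≥0∞}
    (h1 : ∀ X ∈ refTriangle, ‖g X‖ₑ ≤ D X)
    (h2 : ∀ X ∈ refTriangle, 2⁻¹ ^ (K + 1) ≤ X.2 → g X = 0) :
    ‖∫ X in refTriangle, v X * g X‖ₑ ≤
      ∫⁻ X in refTriangle ∩ {X | X.2 < 2⁻¹ ^ (K + 1)}, ‖v X‖ₑ * D X := by
  have hS : MeasurableSet {X : ℝ × ℝ | X.2 < 2⁻¹ ^ (K + 1)} :=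
    measurableSet_lt measurable_snd measurable_const
  refine (enorm_integral_le_lintegral_enorm _).trans ?_
  rw [← lintegral_inter_add_sdiff _ refTriangle hS]
  have hz : ∫⁻ X in refTriangle \ {X | X.2 < 2⁻¹ ^ (K + 1)}, ‖v X * g X‖ₑ = 0 := by
    rw [setLIntegral_congr_fun (g := fun _ => 0) (measurableSet_refTriangle.diff hS) fun X hX => ?_]
    · simp
    · simp only [h2 X hX.1 (not_lt.1 hX.2), mul_zero, enorm_zero]
  rw [hz, add_zero]
  refine setLIntegral_mono' (measurableSet_refTriangle.inter hS) fun X hX => ?_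
  rw [enorm_mul]
  exact mul_le_mul_right (h1 X hX.1) _

/-- The bump is supported near the edge at height scale `2^(-K)`. The parts of its gradient bounded
by `9 * wt` are integrated against `u` over shrinking strips and vanish as `K → ∞`. What survives is
the part of size `2^K` in the derivative in `x₂`, tested with `u 1`, and it is a strip average.
Hence `u 0` leaves no trace in the bound. -/
theorem exists_enorm_flux_le_of_half_lt {s : ℝ} (h0 : 1 / 2 < s) (h1 : s < 1) :
    ∃ C : ℝ≥0, ∀ (u : Fin 2 → ℝ × ℝ → ℝ) (d : ℝ × ℝ → ℝ) (F : ℝ),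
      (∀ i, MemLp (u i) 2 (volume.restrict refTriangle)) →
      MemLp d 2 (volume.restrict refTriangle) → (∀ i, enSq s (u i) ≠ ⊤) →
      (∀ K : ℕ, Tendsto (fun n : ℕ => fluxInt u d (edgeBump (2 ^ (K + 3)) (1 / ((n : ℝ) + 1))))
        atTop (𝓝 F)) →
      ‖F‖ₑ ≤ C * enSq s (u 1) ^ (1 / 2 : ℝ) + l2Norm d := by
  obtain ⟨L, hL0, hL⟩ := exists_abs_pderiv_edgeBump_le
  obtain ⟨C, hC⟩ := exists_lintegral_strip_le h0 h1
  refine ⟨Real.toNNReal (8 * L) * C, fun u d F hu hd hfin hF => ?_⟩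
  choose v hv hve using fun i => (hu i).1.aemeasurable
  have hvL : ∀ i, MemLp (v i) 2 (volume.restrict refTriangle) := fun i => (hu i).ae_eq (hve i)
  have hvf : ∀ i, enSq s (v i) ≠ ⊤ := fun i => enSq_congr s (hve i) ▸ hfin i
  have hflux : ∀ ψ, fluxInt u d ψ = fluxInt v d ψ := fun ψ => fluxInt_congr d ψ hve
  simp only [hflux] at hF
  rw [enSq_congr s (hve 1)]
  have hW := fun i => lintegral_enorm_mul_wt_lt_top (by linarith) h1 (hv i) (hvf i)
  have hstep : ∀ K : ℕ, ‖F‖ₑ ≤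
      (∫⁻ X in refTriangle ∩ {X | X.2 < 2⁻¹ ^ (K + 1)}, ‖v 0 X‖ₑ * ENNReal.ofReal (9 * wt X)) +
      ((∫⁻ X in refTriangle ∩ {X | X.2 < 2⁻¹ ^ (K + 1)}, ‖v 1 X‖ₑ * ENNReal.ofReal (9 * wt X)) +
        ENNReal.ofReal (8 * L) * (C * enSq s (v 1) ^ (1 / 2 : ℝ))) + l2Norm d := by
    intro K
    refine le_of_tendsto (hF K).enorm (Eventually.of_forall fun n => ?_)
    have hδ : (1 / ((n : ℝ) + 1)) ≠ 0 := by positivity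
    have hκ : (0:ℝ) ≤ 2 ^ (K + 3) := by positivity
    have hz : ∀ X ∈ refTriangle, (2⁻¹ : ℝ) ^ (K + 1) ≤ X.2 →
        ∀ i, pderiv i (edgeBump (2 ^ (K + 3)) (1 / ((n : ℝ) + 1))) X = 0 := by
      intro X hX hle
      refine (hL _ _ hκ hδ X hX).2.2 ?_
      -- The bump vanishes where `κ x₂ > 2`; the exponent `K + 3` makes this strict at the top of
      -- the strip.
      have e : (2:ℝ) ^ (K + 3) * 2⁻¹ ^ (K + 1) = 4 := by
        rw [inv_pow, show K + 3 = (K + 1) + 2 by ring, pow_add _ (K + 1)]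
        field_simp; norm_num
      have := mul_le_mul_of_nonneg_left hle hκ
      linarith
    refine (enorm_fluxInt_le hvL hd _ hδ).trans (add_le_add (add_le_add ?_ ?_) le_rfl)
    · refine lintegral_mul_pderiv_le_strip (fun X hX => ?_) fun X hX hle => hz X hX hle 0
      rw [← ofReal_norm]
      exact ENNReal.ofReal_le_ofReal (hL _ _ hκ hδ X hX).1
    · refine (lintegral_mul_pderiv_le_strip (D := fun X => ENNReal.ofReal (9 * wt X) +
        ENNReal.ofReal (8 * L) * 2 ^ K) (fun X hX => ?_) fun X hX hle => hz X hX hle 1).trans ?_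
      · rw [← ofReal_norm]
        refine (ENNReal.ofReal_le_ofReal (hL _ _ hκ hδ X hX).2.1).trans ?_
        refine ENNReal.ofReal_add_le.trans (add_le_add le_rfl (le_of_eq ?_))
        rw [show L * 2 ^ (K + 3) = 8 * L * 2 ^ K by ring, ENNReal.ofReal_mul (by positivity),
          ENNReal.ofReal_pow (by norm_num), ENNReal.ofReal_ofNat]
      · simp only [mul_add]
        have hv1 := hv 1
        have hw := measurable_wt
        rw [lintegral_add_left (by fun_prop), lintegral_mul_const' _ _ (by finiteness)]
        refine add_le_add le_rfl ?_
        calc _ = ENNReal.ofReal (8 * L) *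
              (2 ^ K * ∫⁻ X in refTriangle ∩ {X | X.2 < 2⁻¹ ^ (K + 1)}, ‖v 1 X‖ₑ) := by ring
          _ ≤ _ := mul_le_mul_right (hC _ hv1 K) _
  have hlim := ((tendsto_lintegral_strip (hW 0).ne).add ((tendsto_lintegral_strip (hW 1).ne).add_const
    (ENNReal.ofReal (8 * L) * (C * enSq s (v 1) ^ (1 / 2 : ℝ))))).add_const (l2Norm d)
  refine (ge_of_tendsto hlim (Eventually.of_forall hstep)).trans (le_of_eq ?_)
  rw [zero_add, zero_add, ENNReal.coe_mul, mul_assoc]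
  rfl

end RTTriangle

/-! ### The flux over the first edge when the order is at most one half. -/

namespace RTTriangle

/-! ### Estimates on slices -/

theorem lintegral_Ioo_reflect_add (a b : ℝ) (g : ℝ → ℝ≥0∞) :
    ∫⁻ x in Ioo a b, g (a + b - x) = ∫⁻ x in Ioo a b, g x := by
  rw [← lintegral_indicator measurableSet_Ioo, ← lintegral_indicator measurableSet_Ioo,
    ← lintegral_sub_left_eq_self ((Ioo a b).indicator fun x => g (a + b - x)) (a + b)]
  refine lintegral_congr fun x => ?_
  by_cases hx : x ∈ Ioo a b
  · have hx' : a + b - x ∈ Ioo a b := ⟨by linarith [hx.2], by linarith [hx.1]⟩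
    rw [indicator_of_mem hx', indicator_of_mem hx, sub_sub_cancel]
  · have hx' : a + b - x ∉ Ioo a b := fun h => hx ⟨by linarith [h.2], by linarith [h.1]⟩
    rw [indicator_of_notMem hx', indicator_of_notMem hx]

theorem slobodeckijSqLine_reflect (a b s : ℝ) (v : ℝ → ℝ) :
    slobodeckijSqLine (Ioo a b) s (fun x => v (a + b - x)) = slobodeckijSqLine (Ioo a b) s v := by
  unfold slobodeckijSqLine
  rw [← lintegral_Ioo_reflect_add a b fun x => ∫⁻ t in Ioo a b,
    ENNReal.ofReal ((v x - v t) ^ 2 / |x - t| ^ (1 + 2 * s))]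
  refine lintegral_congr fun x => ?_
  rw [← lintegral_Ioo_reflect_add a b fun t =>
    ENNReal.ofReal ((v (a + b - x) - v t) ^ 2 / |a + b - x - t| ^ (1 + 2 * s))]
  refine lintegral_congr fun t => ?_
  rw [show a + b - x - (a + b - t) = t - x by ring, abs_sub_comm]

theorem slobodeckijSqLine_congr {I : Set ℝ} {s : ℝ} {v w : ℝ → ℝ}
    (h : v =ᵐ[volume.restrict I] w) : slobodeckijSqLine I s v = slobodeckijSqLine I s w := by
  refine lintegral_congr_ae ?_
  filter_upwards [h] with x hx
  refine lintegral_congr_ae ?_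
  filter_upwards [h] with t ht
  rw [hx, ht]

/-- The inner integral of the one-dimensional Slobodeckij seminorm. -/
noncomputable def lineGag (I : Set ℝ) (s : ℝ) (v : ℝ → ℝ) (x : ℝ) : ℝ≥0∞ :=
  ∫⁻ t in I, ENNReal.ofReal ((v x - v t) ^ 2 / |x - t| ^ (1 + 2 * s))

theorem measurable_lineGag (I : Set ℝ) (s : ℝ) {v : ℝ → ℝ} (hv : Measurable v) :
    Measurable (lineGag I s v) := by
  unfold lineGag
  refine Measurable.lintegral_prod_right' (f := fun p : ℝ × ℝ =>
    ENNReal.ofReal ((v p.1 - v p.2) ^ 2 / |p.1 - p.2| ^ (1 + 2 * s))) ?_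
  fun_prop

/-- Poincaré's inequality on a slice, by the mean-value choice used for the triangle. The condition
`y ≤ 1/2` keeps the slice longer than one half, so the constant does not depend on `y`. -/
theorem exists_lintegral_sub_const_le {y s : ℝ} (hy0 : 0 < y) (hy : y ≤ 1 / 2) (hs : 0 < s)
    {v : ℝ → ℝ} (hv : Measurable v) :
    ∃ m : ℝ, ∫⁻ x in Ioo y 1, ENNReal.ofReal ((v x - m) ^ 2) ≤
      2 * slobodeckijSqLine (Ioo y 1) s v := by
  have hvol : (2 : ℝ≥0∞)⁻¹ ≤ volume (Ioo y 1) := by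
    rw [Real.volume_Ioo, ← ENNReal.ofReal_ofNat 2, ← ENNReal.ofReal_inv_of_pos (by norm_num)]
    exact ENNReal.ofReal_le_ofReal (by linarith)
  obtain ⟨z, hz, hz2⟩ := exists_le_setLAverage (μ := volume) (s := Ioo y 1)
    (by rw [Real.volume_Ioo]; exact (ENNReal.ofReal_pos.2 (by linarith)).ne') (by simp)
    (f := lineGag (Ioo y 1) s v) (measurable_lineGag _ s hv).aemeasurable
  refine ⟨v z, ?_⟩
  have h1 : ∫⁻ x in Ioo y 1, ENNReal.ofReal ((v x - v z) ^ 2) ≤ lineGag (Ioo y 1) s v z := by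
    refine setLIntegral_mono' measurableSet_Ioo fun x hx => ?_
    have := ofReal_sq_le_mul (a := v z - v x) (abs_nonneg (z - x))
      (by linarith : (0:ℝ) < 1 + 2 * s)
      (show |z - x| ≤ 1 by rw [abs_le]; constructor <;> linarith [hx.1, hx.2, hz.1, hz.2])
      (fun h => by rw [sub_eq_zero.1 (abs_eq_zero.1 h), sub_self])
    rw [Real.one_rpow, ENNReal.ofReal_one, one_mul] at this
    rwa [show (v x - v z) ^ 2 = (v z - v x) ^ 2 by ring]
  refine h1.trans (hz2.trans ?_)
  rw [setLAverage_eq, ENNReal.div_eq_inv_mul]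
  unfold slobodeckijSqLine
  refine mul_le_mul' ?_ le_rfl
  rw [ENNReal.inv_le_iff_inv_le]
  exact hvol

/-- One-dimensional form of the one-point estimate: the average is over the homothetic copy of the
slice of ratio `ρ` centred at `x`, of length at least `ρ / 2`. -/
theorem ofReal_sq_le_lineGag {y s : ℝ} (hy0 : 0 < y) (hy : y ≤ 1 / 2) (hs : 0 < s) {v : ℝ → ℝ}
    (hv : Measurable v) (m : ℝ) {x ρ : ℝ} (hx : x ∈ Ioo y 1) (h0 : 0 < ρ) (h1 : ρ ≤ 1) :
    ENNReal.ofReal ((v x - m) ^ 2) ≤ 4 * ENNReal.ofReal (ρ ^ (2 * s)) * lineGag (Ioo y 1) s v x +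
      4 * ENNReal.ofReal ρ⁻¹ * ∫⁻ t in Ioo y 1, ENNReal.ofReal ((v t - m) ^ 2) := by
  set W := Ioo ((1 - ρ) * x + ρ * y) ((1 - ρ) * x + ρ) with hW
  have hWI : W ⊆ Ioo y 1 := fun t ht =>
    ⟨by nlinarith [ht.1, hx.1], by nlinarith [ht.2, hx.2]⟩
  have hpt : ∀ t ∈ W, ENNReal.ofReal ((v x - m) ^ 2) ≤
      2 * (ENNReal.ofReal (ρ ^ (1 + 2 * s)) *
        ENNReal.ofReal ((v x - v t) ^ 2 / |x - t| ^ (1 + 2 * s))) +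
      2 * ENNReal.ofReal ((v t - m) ^ 2) := by
    intro t ht
    have e := ofReal_add_sq_le (v x - v t) (v t - m)
    rw [sub_add_sub_cancel] at e
    refine e.trans (add_le_add (mul_le_mul_right ?_ 2) le_rfl)
    refine ofReal_sq_le_mul (abs_nonneg _) (by linarith) ?_
      (fun h => by rw [sub_eq_zero.1 (abs_eq_zero.1 h), sub_self])
    have b1 := ht.1
    have b2 := ht.2
    have b3 := hx.1
    have b4 := hx.2
    have b5 : 0 < ρ * (1 - x + y) := mul_pos h0 (by linarith)
    have b6 : 0 < ρ * x := mul_pos h0 (by linarith)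
    rw [abs_le]
    constructor <;> nlinarith
  have hint : ENNReal.ofReal (ρ / 2) * ENNReal.ofReal ((v x - m) ^ 2) ≤
      2 * (ENNReal.ofReal (ρ ^ (1 + 2 * s)) * lineGag (Ioo y 1) s v x) +
      2 * ∫⁻ t in Ioo y 1, ENNReal.ofReal ((v t - m) ^ 2) := by
    calc _ ≤ volume W * ENNReal.ofReal ((v x - m) ^ 2) := by
          gcongr
          rw [hW, Real.volume_Ioo]
          exact ENNReal.ofReal_le_ofReal (by nlinarith)
      _ = ∫⁻ _t in W, ENNReal.ofReal ((v x - m) ^ 2) := by rw [setLIntegral_const, mul_comm]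
      _ ≤ ∫⁻ t in W, (2 * (ENNReal.ofReal (ρ ^ (1 + 2 * s)) *
          ENNReal.ofReal ((v x - v t) ^ 2 / |x - t| ^ (1 + 2 * s))) +
          2 * ENNReal.ofReal ((v t - m) ^ 2)) := setLIntegral_mono' measurableSet_Ioo hpt
      _ ≤ ∫⁻ t in Ioo y 1, (2 * (ENNReal.ofReal (ρ ^ (1 + 2 * s)) *
          ENNReal.ofReal ((v x - v t) ^ 2 / |x - t| ^ (1 + 2 * s))) +
          2 * ENNReal.ofReal ((v t - m) ^ 2)) := lintegral_mono_set hWI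
      _ = _ := by
          rw [lintegral_add_left (by fun_prop), lintegral_const_mul' _ _ (by norm_num),
            lintegral_const_mul' _ _ ENNReal.ofReal_ne_top,
            lintegral_const_mul' _ _ (by norm_num)]
          rfl
  have e1 : ENNReal.ofReal (2 * ρ⁻¹) * ENNReal.ofReal (ρ / 2) = 1 := by
    rw [← ENNReal.ofReal_mul (by positivity), ← ENNReal.ofReal_one]
    congr 1; field_simp
  have e2 : ENNReal.ofReal ρ⁻¹ * ENNReal.ofReal (ρ ^ (1 + 2 * s)) =
      ENNReal.ofReal (ρ ^ (2 * s)) := by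
    rw [← ENNReal.ofReal_mul (by positivity), Real.rpow_add h0, Real.rpow_one]
    congr 1; field_simp
  have e3 : ENNReal.ofReal (2 * ρ⁻¹) = 2 * ENNReal.ofReal ρ⁻¹ := by
    rw [ENNReal.ofReal_mul (by norm_num), ENNReal.ofReal_ofNat]
  calc ENNReal.ofReal ((v x - m) ^ 2)
      = ENNReal.ofReal (2 * ρ⁻¹) * (ENNReal.ofReal (ρ / 2) * ENNReal.ofReal ((v x - m) ^ 2)) := by
        rw [← mul_assoc, e1, one_mul]
    _ ≤ ENNReal.ofReal (2 * ρ⁻¹) * (2 * (ENNReal.ofReal (ρ ^ (1 + 2 * s)) *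
        lineGag (Ioo y 1) s v x) + 2 * ∫⁻ t in Ioo y 1, ENNReal.ofReal ((v t - m) ^ 2)) := by
        gcongr
    _ = 4 * (ENNReal.ofReal ρ⁻¹ * ENNReal.ofReal (ρ ^ (1 + 2 * s))) * lineGag (Ioo y 1) s v x +
        4 * ENNReal.ofReal ρ⁻¹ * ∫⁻ t in Ioo y 1, ENNReal.ofReal ((v t - m) ^ 2) := by
        rw [e3]; ring
    _ = _ := by rw [e2]

/-- Again `ρ = x^(1/2)`. The weight leaves `x^(s/2) ≤ 1` on the seminorm part and `x^(-(1+s)/2)` on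
the `L²` part; the latter is integrable on all of `(0, 1)`, so the constant is uniform in `y`. -/
theorem exists_lintegral_sq_mul_rpow_le {s : ℝ} (h0 : 0 < s) (h1 : s < 1) :
    ∃ C : ℝ≥0, ∀ (y m : ℝ) (v : ℝ → ℝ), 0 < y → y ≤ 1 / 2 → Measurable v →
      ∫⁻ x in Ioo y 1, ENNReal.ofReal ((v x - m) ^ 2) ≤ 2 * slobodeckijSqLine (Ioo y 1) s v →
      ∫⁻ x in Ioo y 1, ENNReal.ofReal ((v x - m) ^ 2) * ENNReal.ofReal (x ^ (-(s / 2))) ≤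
        C * slobodeckijSqLine (Ioo y 1) s v := by
  have hi := (intervalIntegral.intervalIntegrable_rpow' (a := 0) (b := 1)
    (show -1 < -((1 + s) / 2) by linarith)).1.lintegral_lt_top
  set A := ∫⁻ x in Ioc (0 : ℝ) 1, ENNReal.ofReal (x ^ (-((1 + s) / 2))) with hA
  refine ⟨4 + 8 * A.toNNReal, fun y m v hy0 hy hv hm => ?_⟩
  set V := slobodeckijSqLine (Ioo y 1) s v with hV
  set M := ∫⁻ x in Ioo y 1, ENNReal.ofReal ((v x - m) ^ 2) with hM
  have hpt : ∀ x ∈ Ioo y 1,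
      ENNReal.ofReal ((v x - m) ^ 2) * ENNReal.ofReal (x ^ (-(s / 2))) ≤
      4 * lineGag (Ioo y 1) s v x + ENNReal.ofReal (x ^ (-((1 + s) / 2))) * (4 * M) := by
    intro x hx
    have x0 : 0 < x := hy0.trans hx.1
    have h := ofReal_sq_le_lineGag hy0 hy h0 hv m hx (ρ := x ^ (1 / 2 : ℝ)) (by positivity)
      (Real.rpow_le_one x0.le hx.2.le (by norm_num))
    rw [← Real.rpow_mul x0.le, ← Real.rpow_neg x0.le] at h
    have e1 : ENNReal.ofReal (x ^ (1 / 2 * (2 * s))) * ENNReal.ofReal (x ^ (-(s / 2))) ≤ 1 := by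
      rw [← ENNReal.ofReal_mul (by positivity), ← Real.rpow_add x0, ← ENNReal.ofReal_one]
      exact ENNReal.ofReal_le_ofReal (Real.rpow_le_one x0.le hx.2.le (by linarith))
    have e2 : ENNReal.ofReal (x ^ (-(1 / 2) : ℝ)) * ENNReal.ofReal (x ^ (-(s / 2))) =
        ENNReal.ofReal (x ^ (-((1 + s) / 2))) := by
      rw [← ENNReal.ofReal_mul (by positivity), ← Real.rpow_add x0]
      congr 2; ring
    refine (mul_le_mul_left h _).trans ?_
    calc _ = 4 * ((ENNReal.ofReal (x ^ (1 / 2 * (2 * s))) * ENNReal.ofReal (x ^ (-(s / 2)))) *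
          lineGag (Ioo y 1) s v x) +
          (ENNReal.ofReal (x ^ (-(1 / 2) : ℝ)) * ENNReal.ofReal (x ^ (-(s / 2)))) * (4 * M) := by
          ring
      _ ≤ _ := by
          rw [e2]
          gcongr
          exact mul_le_of_le_one_left' e1
  calc _ ≤ ∫⁻ x in Ioo y 1, (4 * lineGag (Ioo y 1) s v x +
        ENNReal.ofReal (x ^ (-((1 + s) / 2))) * (4 * M)) :=
        setLIntegral_mono' measurableSet_Ioo hpt
    _ = 4 * V + (∫⁻ x in Ioo y 1, ENNReal.ofReal (x ^ (-((1 + s) / 2)))) * (4 * M) := by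
        have hg := measurable_lineGag (Ioo y 1) s hv
        rw [lintegral_add_left (by fun_prop), lintegral_const_mul' _ _ (by norm_num),
          lintegral_mul_const _ (by fun_prop)]
        rfl
    _ ≤ 4 * V + A * (4 * (2 * V)) := by
        gcongr
        exact lintegral_mono_set fun x hx => ⟨hy0.trans hx.1, hx.2.le⟩
    _ = _ := by
        push_cast
        rw [ENNReal.coe_toNNReal hi.ne]
        ring

/-- Cauchy-Schwarz with `1/x = x^(-s/4) · x^(s/4-1)`. The last factor is not bounded uniformly in
`y` and is kept as it stands: integrated over all slices it becomes a finite integral over the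
triangle. -/
theorem exists_lintegral_enorm_sub_div_le {s : ℝ} (h0 : 0 < s) (h1 : s < 1) :
    ∃ C : ℝ≥0, ∀ (y m : ℝ) (v : ℝ → ℝ), 0 < y → y ≤ 1 / 2 → Measurable v →
      ∫⁻ x in Ioo y 1, ENNReal.ofReal ((v x - m) ^ 2) ≤ 2 * slobodeckijSqLine (Ioo y 1) s v →
      ∫⁻ x in Ioo y 1, ‖v x - m‖ₑ * ENNReal.ofReal (1 / x) ≤
        C * (slobodeckijSqLine (Ioo y 1) s v ^ (1 / 2 : ℝ) *
          (∫⁻ x in Ioo y 1, ENNReal.ofReal (x ^ (-(2 - s / 2)))) ^ (1 / 2 : ℝ)) := by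
  obtain ⟨C, hC⟩ := exists_lintegral_sq_mul_rpow_le h0 h1
  refine ⟨NNReal.sqrt C, fun y m v hy0 hy hv hm => ?_⟩
  have h := lintegral_mul_le_sqrt (μ := volume.restrict (Ioo y 1))
    (f := fun x => ‖v x - m‖ₑ * ENNReal.ofReal (x ^ (-(s / 4))))
    (g := fun x => ENNReal.ofReal (x ^ (s / 4 - 1))) (by fun_prop) (by fun_prop)
  have e1 : ∫⁻ x in Ioo y 1, (‖v x - m‖ₑ * ENNReal.ofReal (x ^ (-(s / 4)))) ^ 2 =
      ∫⁻ x in Ioo y 1, ENNReal.ofReal ((v x - m) ^ 2) * ENNReal.ofReal (x ^ (-(s / 2))) := by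
    refine setLIntegral_congr_fun measurableSet_Ioo fun x hx => ?_
    have x0 : 0 < x := hy0.trans hx.1
    rw [mul_pow, ← ofReal_sq_eq_enorm_sq, ← ENNReal.ofReal_pow (by positivity),
      ← Real.rpow_natCast (x ^ (-(s / 4))), ← Real.rpow_mul x0.le]
    congr 3; push_cast; ring
  have e2 : ∫⁻ x in Ioo y 1, ENNReal.ofReal (x ^ (s / 4 - 1)) ^ 2 =
      ∫⁻ x in Ioo y 1, ENNReal.ofReal (x ^ (-(2 - s / 2))) := by
    refine setLIntegral_congr_fun measurableSet_Ioo fun x hx => ?_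
    have x0 : 0 < x := hy0.trans hx.1
    rw [← ENNReal.ofReal_pow (by positivity), ← Real.rpow_natCast, ← Real.rpow_mul x0.le]
    congr 2; push_cast; ring
  rw [e1, e2] at h
  calc _ = ∫⁻ x in Ioo y 1, ‖v x - m‖ₑ * ENNReal.ofReal (x ^ (-(s / 4))) *
        ENNReal.ofReal (x ^ (s / 4 - 1)) := by
        refine setLIntegral_congr_fun measurableSet_Ioo fun x hx => ?_
        have x0 : 0 < x := hy0.trans hx.1
        rw [mul_assoc, ← ENNReal.ofReal_mul (by positivity), ← Real.rpow_add x0,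
          show -(s / 4) + (s / 4 - 1) = -1 by ring, Real.rpow_neg_one, one_div]
    _ ≤ _ := h
    _ ≤ (C * slobodeckijSqLine (Ioo y 1) s v) ^ (1 / 2 : ℝ) *
        (∫⁻ x in Ioo y 1, ENNReal.ofReal (x ^ (-(2 - s / 2)))) ^ (1 / 2 : ℝ) := by
        gcongr
        exact hC y m v hy0 hy hv hm
    _ = _ := by
        rw [ENNReal.mul_rpow_of_nonneg _ _ (by norm_num), mul_assoc, NNReal.sqrt_eq_rpow,
          ENNReal.coe_rpow_of_nonneg _ (by norm_num)]

/-- Since `g` has mean zero, `v` may be replaced by `v - m`, and only the seminorm of the slice is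
left. The two singular terms of `wt` are exchanged by the reflection of the slice, which preserves
the seminorm. -/
theorem exists_enorm_integral_slice_le {s : ℝ} (h0 : 0 < s) (h1 : s < 1) :
    ∃ C : ℝ≥0, ∀ (y : ℝ) (v g : ℝ → ℝ), 0 < y → y ≤ 1 / 2 → Measurable v →
      IntegrableOn g (Ioo y 1) → ∫ x in Ioo y 1, g x = 0 →
      (∀ x ∈ Ioo y 1, |g x| ≤ 9 * wt (x, y)) →
      ‖∫ x in Ioo y 1, v x * g x‖ₑ ≤ C * (slobodeckijSqLine (Ioo y 1) s v ^ (1 / 2 : ℝ) *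
          (∫⁻ x in Ioo y 1, ENNReal.ofReal (x ^ (-(2 - s / 2)))) ^ (1 / 2 : ℝ)) := by
  obtain ⟨C, hC⟩ := exists_lintegral_enorm_sub_div_le h0 h1
  refine ⟨18 * C, fun y v g hy0 hy hv hg hg0 hgb => ?_⟩
  -- If the product is not integrable, its integral is zero by convention.
  by_cases hvg : IntegrableOn (fun x => v x * g x) (Ioo y 1)
  swap
  · rw [integral_undef hvg, enorm_zero]; exact zero_le
  obtain ⟨m, hm⟩ := exists_lintegral_sub_const_le hy0 hy h0 hv
  have e : ∫ x in Ioo y 1, v x * g x = ∫ x in Ioo y 1, (v x - m) * g x := by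
    simp only [sub_mul]
    rw [integral_sub hvg (hg.const_mul m), integral_const_mul, hg0, mul_zero, sub_zero]
  have b1 := hC y m v hy0 hy hv hm
  have b2 := hC y m (fun x => v (y + 1 - x)) hy0 hy (by fun_prop) (by
    rw [slobodeckijSqLine_reflect]
    rwa [lintegral_Ioo_reflect_add y 1 fun x => ENNReal.ofReal ((v x - m) ^ 2)])
  rw [slobodeckijSqLine_reflect] at b2
  have e2 := lintegral_Ioo_reflect_add y 1 fun x =>
    ‖v x - m‖ₑ * ENNReal.ofReal (1 / (y + 1 - x))
  simp only [sub_sub_cancel] at e2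
  rw [e2] at b2
  rw [e]
  refine (enorm_integral_le_lintegral_enorm _).trans ?_
  calc _ ≤ ∫⁻ x in Ioo y 1, (9 * (‖v x - m‖ₑ * ENNReal.ofReal (1 / x)) +
        9 * (‖v x - m‖ₑ * ENNReal.ofReal (1 / (y + 1 - x)))) := by
        refine setLIntegral_mono' measurableSet_Ioo fun x hx => ?_
        have x0 : 0 < x := hy0.trans hx.1
        have x1 : 0 < y + 1 - x := by linarith [hx.2]
        rw [enorm_mul, ← ofReal_norm (g x)]
        refine (mul_le_mul_right (ENNReal.ofReal_le_ofReal (hgb x hx)) _).trans (le_of_eq ?_)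
        rw [wt, mapB_apply, show 1 - x + y = y + 1 - x by ring, ENNReal.ofReal_mul (by norm_num),
          ENNReal.ofReal_add (by positivity) (by positivity), ENNReal.ofReal_ofNat]
        ring
    _ = 9 * (∫⁻ x in Ioo y 1, ‖v x - m‖ₑ * ENNReal.ofReal (1 / x)) +
        9 * ∫⁻ x in Ioo y 1, ‖v x - m‖ₑ * ENNReal.ofReal (1 / (y + 1 - x)) := by
        rw [lintegral_add_left (by fun_prop), lintegral_const_mul' _ _ (by norm_num),
          lintegral_const_mul' _ _ (by norm_num)]
    _ ≤ _ := by
        refine (add_le_add (mul_le_mul_right b1 9) (mul_le_mul_right b2 9)).trans (le_of_eq ?_)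
        push_cast; ring

/-! ### The flux estimate for smoothness at most one half -/

theorem measurable_lintegral_slice {α : Type*} [MeasurableSpace α] {h : α → ℝ → ℝ≥0∞} {b : α → ℝ}
    (hh : Measurable (Function.uncurry h)) (hb : Measurable b) :
    Measurable fun y => ∫⁻ x in Ioo (b y) 1, h y x := by
  have hS : MeasurableSet {p : α × ℝ | b p.1 < p.2 ∧ p.2 < 1} :=
    (measurableSet_lt (hb.comp measurable_fst) measurable_snd).inter
      (measurableSet_lt measurable_snd measurable_const)
  have := (hh.indicator hS).lintegral_prod_right' (ν := (volume : Measure ℝ))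
  convert this using 2 with y
  rw [← lintegral_indicator measurableSet_Ioo]
  rfl

theorem measurable_slobodeckijSqLine_slice {f : ℝ × ℝ → ℝ} (hf : Measurable f) (s : ℝ) :
    Measurable fun y => slobodeckijSqLine (Ioo y 1) s fun t => f (t, y) := by
  unfold slobodeckijSqLine
  refine measurable_lintegral_slice (h := fun y x => ∫⁻ t in Ioo y 1,
    ENNReal.ofReal ((f (x, y) - f (t, y)) ^ 2 / |x - t| ^ (1 + 2 * s))) ?_ measurable_id
  refine measurable_lintegral_slice (α := ℝ × ℝ) (h := fun p t =>
    ENNReal.ofReal ((f (p.2, p.1) - f (t, p.1)) ^ 2 / |p.2 - t| ^ (1 + 2 * s))) (b := fun p => p.1)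
    ?_ measurable_fst
  unfold Function.uncurry
  fun_prop

/-- Fubini for null sets; it allows a measurable representative to be used in the slice seminorm. -/
theorem ae_slice_of_ae {f g : ℝ × ℝ → ℝ} (h : f =ᵐ[volume.restrict refTriangle] g) :
    ∀ᵐ y ∂(volume.restrict (Ioo (0 : ℝ) 1)),
      (fun t => f (t, y)) =ᵐ[volume.restrict (Ioo y 1)] fun t => g (t, y) := by
  obtain ⟨N, hN, hNm, hN0⟩ := exists_measurable_superset_of_null (ae_iff.1 h)
  have h1 := lintegral_refTriangle_eq_symm (measurable_one.indicator hNm : Measurable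
    (N.indicator (1 : ℝ × ℝ → ℝ≥0∞)))
  rw [lintegral_indicator_one hNm, hN0] at h1
  have hm : Measurable fun y => ∫⁻ x in Ioo y 1, N.indicator (1 : ℝ × ℝ → ℝ≥0∞) (x, y) :=
    measurable_lintegral_slice (h := fun y x => N.indicator (1 : ℝ × ℝ → ℝ≥0∞) (x, y))
      ((measurable_one.indicator hNm).comp measurable_swap) measurable_id
  have h2 := (lintegral_eq_zero_iff hm).1 h1.symm
  filter_upwards [h2] with y hy
  have hm2 : Measurable fun x => N.indicator (1 : ℝ × ℝ → ℝ≥0∞) (x, y) :=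
    (measurable_one.indicator hNm).comp (by fun_prop)
  have h3 := (lintegral_eq_zero_iff hm2).1 hy
  filter_upwards [h3] with x hx
  by_contra hne
  have : (x, y) ∈ N := hN hne
  simp [this] at hx

theorem anisoSeminorm_congr {f g : ℝ × ℝ → ℝ} (s : ℝ) (h : f =ᵐ[volume.restrict refTriangle] g) :
    anisoSeminorm s 0 f = anisoSeminorm s 0 g := by
  unfold anisoSeminorm
  simp only [if_true]
  congr 1
  refine lintegral_congr_ae ?_
  filter_upwards [ae_slice_of_ae h] with y hy
  exact slobodeckijSqLine_congr hy

/-- A horizontal slice runs from the oblique to the vertical edge, where the bump vanishes, so its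
derivative has mean zero there. Slices above height `1/2`, where the uniform Poincaré constant is
lost, carry nothing: with `κ = 4` the derivatives vanish at these heights. Cauchy-Schwarz in `y`
combines the slices. -/
theorem exists_enorm_integral_mul_pderiv_le {s : ℝ} (h0 : 0 < s) (h1 : s < 1) :
    ∃ C : ℝ≥0, ∀ (v : ℝ × ℝ → ℝ), Measurable v → MemLp v 2 (volume.restrict refTriangle) →
      ∀ δ : ℝ, δ ≠ 0 → ‖∫ X in refTriangle, v X * pderiv 0 (edgeBump 4 δ) X‖ₑ ≤
        C * anisoSeminorm s 0 v := by
  obtain ⟨L, hL0, hL⟩ := exists_abs_pderiv_edgeBump_le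
  obtain ⟨C, hC⟩ := exists_enorm_integral_slice_le h0 h1
  have hw := lintegral_fst_rpow_lt_top (p := 2 - s / 2) (by linarith)
  set A := ∫⁻ X in refTriangle, ENNReal.ofReal (X.1 ^ (-(2 - s / 2))) with hA
  refine ⟨C * (A ^ (1 / 2 : ℝ)).toNNReal, fun v hv hvL δ hδ => ?_⟩
  have hψ := contDiff_edgeBump 4 hδ
  have hI : IntegrableOn (fun X => v X * pderiv 0 (edgeBump 4 δ) X) refTriangle :=
    integrable_mul_pderiv hvL hψ 0
  rw [integral_refTriangle_eq_symm hI]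
  refine (enorm_integral_le_lintegral_enorm _).trans ?_
  set V : ℝ → ℝ≥0∞ := fun y => slobodeckijSqLine (Ioo y 1) s fun t => v (t, y) with hV
  set B : ℝ → ℝ≥0∞ := fun y => ∫⁻ x in Ioo y 1, ENNReal.ofReal (x ^ (-(2 - s / 2))) with hB
  have hVm : Measurable V := measurable_slobodeckijSqLine_slice hv s
  have hBm : Measurable B := measurable_lintegral_slice
    (h := fun _ x => ENNReal.ofReal (x ^ (-(2 - s / 2)))) (by
      unfold Function.uncurry; fun_prop) measurable_id
  have hslice : ∀ y ∈ Ioo (0 : ℝ) 1,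
      ‖∫ x in Ioo y 1, v (x, y) * pderiv 0 (edgeBump 4 δ) (x, y)‖ₑ ≤
        C * (V y ^ (1 / 2 : ℝ) * B y ^ (1 / 2 : ℝ)) := by
    intro y hy
    have hmem : ∀ x ∈ Ioo y 1, ((x, y) : ℝ × ℝ) ∈ refTriangle := fun x hx =>
      ⟨hy.1.trans hx.1, hx.2, hy.1, hx.1⟩
    rcases le_or_gt y (1 / 2) with hy2 | hy2
    · refine hC y (fun x => v (x, y)) (fun x => pderiv 0 (edgeBump 4 δ) (x, y)) hy.1 hy2
        (by fun_prop) ?_ ?_ ?_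
      · have hc : Continuous fun x => pderiv 0 (edgeBump 4 δ) (x, y) :=
          (continuous_pderiv hψ 0).comp (by fun_prop)
        exact (hc.integrableOn_Icc).mono_set Ioo_subset_Icc_self
      · rw [setIntegral_pderiv_fst hψ hy.2.le, edgeBump_edge_one, edgeBump_edge_two, sub_zero]
      · intro x hx
        exact (hL 4 δ (by norm_num) hδ _ (hmem x hx)).1
    · rw [setIntegral_congr_fun (g := fun _ => 0) measurableSet_Ioo fun x hx => ?_]
      · simp
      · simp only
        rw [(hL 4 δ (by norm_num) hδ _ (hmem x hx)).2.2 (by simp only; linarith) 0, mul_zero]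
  refine (setLIntegral_mono' measurableSet_Ioo hslice).trans ?_
  rw [lintegral_const_mul' _ _ ENNReal.coe_ne_top]
  have hcs := lintegral_mul_le_sqrt (μ := volume.restrict (Ioo (0 : ℝ) 1))
    (f := fun y => V y ^ (1 / 2 : ℝ)) (g := fun y => B y ^ (1 / 2 : ℝ)) (by fun_prop)
    (by fun_prop)
  have hsq : ∀ a : ℝ≥0∞, (a ^ (1 / 2 : ℝ)) ^ 2 = a := fun a => by
    rw [← ENNReal.rpow_natCast, ← ENNReal.rpow_mul]; norm_num
  simp only [hsq] at hcs
  have hBA : ∫⁻ y in Ioo (0 : ℝ) 1, B y = A :=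
    (lintegral_refTriangle_eq_symm (h := fun X => ENNReal.ofReal (X.1 ^ (-(2 - s / 2))))
      (by fun_prop)).symm
  rw [hBA] at hcs
  have hVA : (∫⁻ y in Ioo (0 : ℝ) 1, V y) ^ (1 / 2 : ℝ) = anisoSeminorm s 0 v := by
    simp [anisoSeminorm, hV]
  rw [hVA] at hcs
  refine (mul_le_mul_right hcs _).trans (le_of_eq ?_)
  rw [ENNReal.coe_mul, ENNReal.coe_toNNReal
    (ENNReal.rpow_ne_top_of_nonneg (by norm_num) hw.ne)]
  ring

theorem le_sqrt_mul_of_sq_le {a b : ℝ≥0∞} {c : ℝ≥0} (h : a ^ 2 ≤ c * b) :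
    a ≤ NNReal.sqrt c * b ^ (1 / 2 : ℝ) := by
  have h4 := ENNReal.rpow_le_rpow h (by norm_num : (0:ℝ) ≤ 1 / 2)
  rw [ENNReal.mul_rpow_of_nonneg _ _ (by norm_num), ← ENNReal.coe_rpow_of_nonneg _ (by norm_num),
    ← NNReal.sqrt_eq_rpow] at h4
  refine le_trans (le_of_eq ?_) h4
  rw [← ENNReal.rpow_natCast, ← ENNReal.rpow_mul]
  norm_num

/-- The vertical component is paired by the bilinear bound with the bumps, whose `H^r`-seminorms are
bounded uniformly in the regularization. The horizontal component is treated slice by slice. -/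
theorem exists_enorm_flux_le_aniso {s : ℝ} (h0 : 0 < s) (h1 : s < 1) :
    ∃ C : ℝ≥0, ∀ (u : Fin 2 → ℝ × ℝ → ℝ) (d : ℝ × ℝ → ℝ) (F : ℝ),
      (∀ i, MemLp (u i) 2 (volume.restrict refTriangle)) →
      MemLp d 2 (volume.restrict refTriangle) → enSq s (u 1) ≠ ⊤ →
      Tendsto (fun n : ℕ => fluxInt u d (edgeBump 4 (1 / ((n : ℝ) + 1)))) atTop (𝓝 F) →
      ‖F‖ₑ ≤ C * enSq s (u 1) ^ (1 / 2 : ℝ) + C * anisoSeminorm s 0 (u 0) + l2Norm d := by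
  obtain ⟨C1, hC1⟩ := exists_enorm_integral_mul_pderiv_le h0 h1
  -- Some order below one that exceeds both `1 - s` and `1/2`.
  set r : ℝ := max (1 - s / 2) (3 / 4) with hr
  have hr0 : 1 / 2 < r := lt_of_lt_of_le (by norm_num) (le_max_right _ _)
  have hr1 : r < 1 := max_lt (by linarith) (by norm_num)
  have hrs : 1 - s < r := lt_of_lt_of_le (by linarith) (le_max_left _ _)
  obtain ⟨C2, hC2⟩ := exists_pairing_le h0 hr0 hr1 hrs
  obtain ⟨C3, hC3⟩ := exists_semiSq_edgeBump_le (by linarith : 0 < r) hr1 (κ := 4) (by norm_num)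
  refine ⟨max C1 (NNReal.sqrt (C2 * C3)), fun u d F hu hd hfin hF => ?_⟩
  obtain ⟨v, hv, hve⟩ := (hu 0).1.aemeasurable
  rw [anisoSeminorm_congr s hve]
  refine le_of_tendsto hF.enorm (Eventually.of_forall fun n => ?_)
  have hδ : (1 / ((n : ℝ) + 1)) ≠ 0 := by positivity
  refine (enorm_fluxInt_le hu hd _ hδ).trans (add_le_add ?_ le_rfl)
  rw [add_comm]
  refine add_le_add ?_ ?_
  · have h2 := hC2 (u 1) _ (hu 1) hfin (contDiff_edgeBump 4 hδ) 1
    rw [ofReal_sq_eq_enorm_sq] at h2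
    have h3 : ‖∫ X in refTriangle, u 1 X * pderiv 1 (edgeBump 4 (1 / ((n : ℝ) + 1))) X‖ₑ ^ 2 ≤
        (C2 * C3 : ℝ≥0) * enSq s (u 1) := by
      refine h2.trans ?_
      rw [ENNReal.coe_mul, mul_assoc, mul_comm (C3 : ℝ≥0∞)]
      gcongr
      exact hC3 _
    refine (le_sqrt_mul_of_sq_le h3).trans ?_
    gcongr
    exact le_max_right _ _
  · have e0 : ∫ X in refTriangle, u 0 X * pderiv 0 (edgeBump 4 (1 / ((n : ℝ) + 1))) X =
        ∫ X in refTriangle, v X * pderiv 0 (edgeBump 4 (1 / ((n : ℝ) + 1))) X := by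
      refine integral_congr_ae ?_
      filter_upwards [hve] with x hx; rw [hx]
    rw [e0]
    refine (hC1 v hv ((hu 0).ae_eq hve) _ hδ).trans ?_
    gcongr
    exact le_max_left _ _

end RTTriangle

/-! ### From the fluxes to both components of the interpolant. -/

namespace RTTriangle

/-! ### The symmetry of the triangle which swaps the first two edges -/

theorem mapJ_mapJ (X : ℝ × ℝ) : mapJ (mapJ X) = X := by
  simp only [mapJ_apply]; ext <;> simp only <;> ring

theorem measurableEmbedding_mapJ : MeasurableEmbedding mapJ :=
  contDiff_mapJ.continuous.measurableEmbedding
    (Function.LeftInverse.injective (g := mapJ) mapJ_mapJ)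

theorem integral_comp_mapJ (g : ℝ × ℝ → ℝ) :
    ∫ X in refTriangle, g (mapJ X) = ∫ X in refTriangle, g X :=
  measurePreserving_mapJ.integral_comp measurableEmbedding_mapJ g

/-- The pullback of a vector field under the symmetry `mapJ`. -/
noncomputable def fieldJ (u : Fin 2 → ℝ × ℝ → ℝ) (i : Fin 2) (X : ℝ × ℝ) : ℝ := -u (i + 1) (mapJ X)

theorem pderiv_comp_mapJ {ψ : ℝ × ℝ → ℝ} (hψ : ContDiff ℝ ∞ ψ) (i : Fin 2) (X : ℝ × ℝ) :
    pderiv i (fun X => ψ (mapJ X)) X = -pderiv (i + 1) ψ (mapJ X) := by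
  refine (pderiv_comp_affMap hψ 0 (-1) (-1) 0 1 1 i X).trans ?_
  unfold pderiv
  rw [← map_neg]
  congr 1
  rw [linMap_apply]
  fin_cases i <;> simp [basisVec]

/-- The linear part of `mapJ` is minus the exchange of coordinates, an orthogonal involution. So
`fieldJ` is the natural pullback of the field and `mapJ` preserves `u · ∇ψ`. -/
theorem fluxInt_comp_mapJ (u : Fin 2 → ℝ × ℝ → ℝ) (d : ℝ × ℝ → ℝ) {ψ : ℝ × ℝ → ℝ}
    (hψ : ContDiff ℝ ∞ ψ) :
    fluxInt u d (fun X => ψ (mapJ X)) = fluxInt (fieldJ u) (fun X => d (mapJ X)) ψ := by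
  unfold fluxInt gradInt
  congr 1
  · rw [← integral_comp_mapJ]
    congr 1; funext X
    simp only [Fin.sum_univ_two, pderiv_comp_mapJ hψ, mapJ_mapJ, fieldJ]
    simp only [zero_add, Fin.reduceAdd]
    ring
  · rw [← integral_comp_mapJ]
    simp only [mapJ_mapJ]

theorem memLp_comp_mapJ {f : ℝ × ℝ → ℝ} (hf : MemLp f 2 (volume.restrict refTriangle)) :
    MemLp (fun X => f (mapJ X)) 2 (volume.restrict refTriangle) :=
  hf.comp_measurePreserving measurePreserving_mapJ

theorem memLp_fieldJ {u : Fin 2 → ℝ × ℝ → ℝ}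
    (hu : ∀ i, MemLp (u i) 2 (volume.restrict refTriangle)) (i : Fin 2) :
    MemLp (fieldJ u i) 2 (volume.restrict refTriangle) :=
  (memLp_comp_mapJ (hu (i + 1))).neg

theorem enSq_fieldJ_le {s : ℝ} (h0 : 0 < s) (h1 : s < 1) {u : Fin 2 → ℝ × ℝ → ℝ}
    (hu : ∀ i, MemLp (u i) 2 (volume.restrict refTriangle)) (i : Fin 2) :
    enSq s (fieldJ u i) ≤ 16 * enSq s (u (i + 1)) := by
  obtain ⟨v, hv, hve⟩ := (hu (i + 1)).1.aemeasurable
  have h : (fun X => u (i + 1) (mapJ X)) =ᵐ[volume.restrict refTriangle] fun X => v (mapJ X) :=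
    measurePreserving_mapJ.quasiMeasurePreserving.ae_eq_comp hve
  rw [enSq_congr s hve]
  refine le_trans (le_of_eq ?_) (enSq_comp_le measurePreserving_mapJ norm_mapJ_sub_le hv h0 h1)
  rw [← enSq_congr s h]
  exact enSq_neg s _

theorem l2Norm_comp_mapJ {d : ℝ × ℝ → ℝ} (hd : MemLp d 2 (volume.restrict refTriangle)) :
    l2Norm (fun X => d (mapJ X)) = l2Norm d :=
  eLpNorm_comp_measurePreserving hd.1 measurePreserving_mapJ

theorem lintegral_Ioo_sub_left (a b c : ℝ) (g : ℝ → ℝ≥0∞) :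
    ∫⁻ x in Ioo (c - b) (c - a), g (c - x) = ∫⁻ x in Ioo a b, g x := by
  rw [← lintegral_indicator measurableSet_Ioo, ← lintegral_indicator measurableSet_Ioo,
    ← lintegral_sub_left_eq_self ((Ioo (c - b) (c - a)).indicator fun x => g (c - x)) c]
  refine lintegral_congr fun x => ?_
  by_cases hx : x ∈ Ioo a b
  · have hx' : c - x ∈ Ioo (c - b) (c - a) := ⟨by linarith [hx.2], by linarith [hx.1]⟩
    rw [indicator_of_mem hx', indicator_of_mem hx, sub_sub_cancel]
  · have hx' : c - x ∉ Ioo (c - b) (c - a) := fun h => hx ⟨by linarith [h.2], by linarith [h.1]⟩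
    rw [indicator_of_notMem hx', indicator_of_notMem hx]

theorem slobodeckijSqLine_sub_left (a b c s : ℝ) (v : ℝ → ℝ) :
    slobodeckijSqLine (Ioo (c - b) (c - a)) s (fun x => -v (c - x)) =
      slobodeckijSqLine (Ioo a b) s v := by
  unfold slobodeckijSqLine
  rw [← lintegral_Ioo_sub_left a b c fun x => ∫⁻ t in Ioo a b,
    ENNReal.ofReal ((v x - v t) ^ 2 / |x - t| ^ (1 + 2 * s))]
  refine lintegral_congr fun x => ?_
  rw [← lintegral_Ioo_sub_left a b c fun t =>
    ENNReal.ofReal ((v (c - x) - v t) ^ 2 / |c - x - t| ^ (1 + 2 * s))]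
  refine lintegral_congr fun t => ?_
  rw [show c - x - (c - t) = t - x by ring, abs_sub_comm,
    show -v (c - x) - -v (c - t) = -(v (c - x) - v (c - t)) by ring, neg_sq]

/-- The vertical slice `(0, x₁)` becomes the horizontal slice `(1 - x₁, 1)` at height `1 - x₁`. -/
theorem anisoSeminorm_fieldJ (s : ℝ) (u : Fin 2 → ℝ × ℝ → ℝ) :
    anisoSeminorm s 0 (fieldJ u 0) = anisoSeminorm s 1 (u 1) := by
  unfold anisoSeminorm fieldJ
  simp only [if_true, one_ne_zero, if_false, zero_add]
  congr 1
  rw [← lintegral_Ioo_reflect]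
  refine lintegral_congr fun x => ?_
  rw [← slobodeckijSqLine_sub_left 0 x 1, sub_zero]
  congr 1
  funext t
  rw [mapJ_apply]
  simp only [sub_sub_cancel]

/-! ### Bounds for the interpolant -/

theorem l2Norm_le_of_bound {f : ℝ × ℝ → ℝ} {a c : ℝ}
    (h : ∀ X ∈ refTriangle, |f X| ≤ |a| + |c|) : l2Norm f ≤ ‖a‖ₑ + ‖c‖ₑ := by
  refine (eLpNorm_le_of_ae_bound (C := |a| + |c|)
    ((ae_restrict_iff' measurableSet_refTriangle).2 (Eventually.of_forall h))).trans ?_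
  rw [ENNReal.ofReal_add (abs_nonneg _) (abs_nonneg _), ← Real.norm_eq_abs, ← Real.norm_eq_abs,
    ofReal_norm, ofReal_norm]
  refine mul_le_of_le_one_left' (ENNReal.rpow_le_one ?_ (by norm_num))
  rw [Measure.restrict_apply_univ]
  exact volume_refTriangle_le

/-- The components of the interpolant are bounded by the fluxes, which are limits of classical
integrals. -/
theorem IsRTInterpolant.exists_flux_bound {σ s : ℝ} (hσ0 : 0 < σ) (hσs : σ ≤ s)
    {u : Fin 2 → ℝ × ℝ → ℝ} {d : ℝ × ℝ → ℝ} {w : Fin 2 → ℝ × ℝ → ℝ} (hu : HasDivL2 refTriangle u d)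
    (hfin : ∀ i, enSq σ (u i) ≠ ⊤) (hw : IsRTInterpolant s u d w) :
    ∃ F0 F1 : ℝ, l2Norm (w 1) ≤ ‖F0‖ₑ + l2Norm d ∧ l2Norm (w 0) ≤ ‖F1‖ₑ + 2 * l2Norm d ∧
      ∀ κ : ℝ, 0 ≤ κ →
      Tendsto (fun n : ℕ => fluxInt u d (edgeBump κ (1 / ((n : ℝ) + 1)))) atTop (𝓝 F0) ∧
      Tendsto (fun n : ℕ => fluxInt (fieldJ u) (fun X => d (mapJ X))
        (edgeBump κ (1 / ((n : ℝ) + 1)))) atTop (𝓝 F1) := by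
  obtain ⟨⟨a, b, c, rfl⟩, hw⟩ := hw
  -- The coefficients are fixed before `κ`. Uniqueness of the flux identifies the limits for every
  -- `κ` with the same numbers, and this makes `κ → ∞` possible later.
  have key : ∀ κ : ℝ, 0 ≤ κ → c = ∫ X in refTriangle, d X ∧
      Tendsto (fun n : ℕ => fluxInt u d (edgeBump κ (1 / ((n : ℝ) + 1)))) atTop (𝓝 (-b)) ∧
      Tendsto (fun n : ℕ => fluxInt (fieldJ u) (fun X => d (mapJ X))
        (edgeBump κ (1 / ((n : ℝ) + 1)))) atTop (𝓝 (a + c)) := by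
    intro κ hκ
    obtain ⟨F, hF, hsum, h0, h1⟩ := exists_fluxes hσ0 hσs hu.1 hfin hu.2.1 hκ
    have h : ∀ e, ![-b, a + c, b - a] e = F e := fun e => by
      rw [← edgeFlux_rt]
      exact (hw e).unique hu (hF e)
    have e0 : -b = F 0 := h 0
    have e1 : a + c = F 1 := h 1
    have e2 : b - a = F 2 := h 2
    refine ⟨by rw [← hsum, ← e0, ← e1, ← e2]; ring, e0 ▸ h0, e1 ▸ h1.congr fun n => ?_⟩
    exact fluxInt_comp_mapJ u d (contDiff_edgeBump κ (by positivity))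
  have hc : ‖c‖ₑ ≤ l2Norm d := by
    rw [(key 0 le_rfl).1]
    exact (enorm_integral_le_lintegral_enorm _).trans (lintegral_enorm_le_l2Norm hu.2.1)
  have hb : ∀ {p t : ℝ}, 0 < t → t < 1 → |p + c * t| ≤ |p| + |c| := by
    intro p t t0 t1
    refine (abs_add_le _ _).trans (add_le_add le_rfl ?_)
    rw [abs_mul, abs_of_pos t0]
    exact mul_le_of_le_one_right (abs_nonneg _) t1.le
  refine ⟨-b, a + c, ?_, ?_, fun κ hκ => (key κ hκ).2⟩
  · rw [enorm_neg]
    refine (l2Norm_le_of_bound (a := b) (c := c) fun X hX => ?_).trans (add_le_add le_rfl hc)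
    exact hb hX.2.2.1 (hX.2.2.2.trans hX.2.1)
  · refine (l2Norm_le_of_bound (a := a) (c := c) fun X hX => ?_).trans ?_
    · exact hb hX.1 hX.2.1
    · have : ‖a‖ₑ ≤ ‖a + c‖ₑ + ‖c‖ₑ := by
        have := enorm_sub_le (a := a + c) (b := c)
        rwa [add_sub_cancel_right] at this
      calc _ ≤ (‖a + c‖ₑ + ‖c‖ₑ) + ‖c‖ₑ := add_le_add this le_rfl
        _ = ‖a + c‖ₑ + 2 * ‖c‖ₑ := by ring
        _ ≤ _ := by gcongr

/-- The flux bound is applied to `u` for the second component and to `fieldJ u`, whose second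
component is built from `u 0`, for the first. The constant `M` carries the energy of order `σ < 1`
over to the norm of order `s`. -/
theorem exists_l2Norm_le_of_half_lt {σ s : ℝ} (h0 : 1 / 2 < σ) (h1 : σ < 1) (hσs : σ ≤ s) (M : ℝ≥0)
    (hM : ∀ f, enSq σ f ≤ M * sobolevNorm refTriangle s f ^ 2) :
    ∃ C : ℝ≥0, ∀ (u : Fin 2 → ℝ × ℝ → ℝ) (d : ℝ × ℝ → ℝ) (w : Fin 2 → ℝ × ℝ → ℝ),
      IsAdmissible s u d → IsRTInterpolant s u d w → ∀ l : Fin 2,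
        l2Norm (w l) ≤ C * (sobolevNorm refTriangle s (u l) + l2Norm d) := by
  obtain ⟨C, hC⟩ := exists_enorm_flux_le_of_half_lt h0 h1
  refine ⟨max (C * NNReal.sqrt (16 * M)) 3, fun u d w hu hw l => ?_⟩
  have hfin : ∀ i, enSq σ (u i) ≠ ⊤ := fun i => by
    have := (hu.1 i).2
    exact ne_top_of_le_ne_top (by finiteness) (hM _)
  have hfinJ : ∀ i, enSq σ (fieldJ u i) ≠ ⊤ := fun i => by
    have := hfin (i + 1)
    exact ne_top_of_le_ne_top (by finiteness) (enSq_fieldJ_le (by linarith) h1 hu.2.1 i)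
  obtain ⟨F0, F1, b1, b0, hlim⟩ := hw.exists_flux_bound (by linarith) hσs hu.2 hfin
  have f0 := hC u d F0 hu.2.1 hu.2.2.1 hfin fun K => (hlim _ (by positivity)).1
  have f1 := hC (fieldJ u) _ F1 (memLp_fieldJ hu.2.1) (memLp_comp_mapJ hu.2.2.1) hfinJ
    fun K => (hlim _ (by positivity)).2
  rw [l2Norm_comp_mapJ hu.2.2.1] at f1
  have hroot : ∀ f g : ℝ × ℝ → ℝ, enSq σ f ≤ 16 * enSq σ g →
      enSq σ f ^ (1 / 2 : ℝ) ≤ NNReal.sqrt (16 * M) * sobolevNorm refTriangle s g := by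
    intro f g hfg
    refine (le_sqrt_mul_of_sq_le (b := sobolevNorm refTriangle s g ^ 2) (c := 16 * M) ?_).trans
      (le_of_eq ?_)
    · rw [← ENNReal.rpow_natCast, ← ENNReal.rpow_mul]
      norm_num
      rw [mul_assoc]
      exact hfg.trans (mul_le_mul_right (hM g) 16)
    · rw [← ENNReal.rpow_natCast, ← ENNReal.rpow_mul]
      norm_num
  have fin : ∀ (A B D : ℝ≥0∞), A ≤ C * (NNReal.sqrt (16 * M) * B) + 3 * D →
      A ≤ (max (C * NNReal.sqrt (16 * M)) 3 : ℝ≥0) * (B + D) := by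
    intro A B D h
    refine h.trans ?_
    rw [mul_add, ← mul_assoc, ← ENNReal.coe_mul]
    gcongr
    · exact le_max_left _ _
    · exact_mod_cast le_max_right (C * NNReal.sqrt (16 * M)) 3
  refine fin _ _ _ ?_
  fin_cases l
  · refine b0.trans ?_
    have := hroot (fieldJ u 1) (u 0) (enSq_fieldJ_le (by linarith) h1 hu.2.1 1)
    calc _ ≤ (C * (NNReal.sqrt (16 * M) * sobolevNorm refTriangle s (u 0)) + l2Norm d) +
          2 * l2Norm d := by
          refine add_le_add (f1.trans ?_) le_rfl
          gcongr
      _ = _ := by simp only [Fin.zero_eta]; ring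
  · refine b1.trans ?_
    have := hroot (u 1) (u 1) (le_mul_of_one_le_left' (by norm_num))
    calc _ ≤ (C * (NNReal.sqrt (16 * M) * sobolevNorm refTriangle s (u 1)) + l2Norm d) +
          2 * l2Norm d := by
          refine add_le_add (f0.trans ?_) (le_mul_of_one_le_left' (by norm_num))
          gcongr
      _ = _ := by simp only [Fin.mk_one]; ring

theorem exists_l2Norm_le_of_le_half {s : ℝ} (h0 : 0 < s) (h1 : s ≤ 1 / 2) :
    ∃ C : ℝ≥0, ∀ (u : Fin 2 → ℝ × ℝ → ℝ) (d : ℝ × ℝ → ℝ) (w : Fin 2 → ℝ × ℝ → ℝ),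
      IsAdmissible s u d → IsRTInterpolant s u d w → ∀ l : Fin 2,
        l2Norm (w l) ≤ C * (sobolevNorm refTriangle s (u l) +
          anisoSeminorm s (l + 1) (u (l + 1)) + l2Norm d) := by
  have hs1 : s < 1 := by linarith
  obtain ⟨C, hC⟩ := exists_enorm_flux_le_aniso h0 hs1
  refine ⟨max (8 * C) 3, fun u d w hu hw l => ?_⟩
  have hfin : ∀ i, enSq s (u i) ≠ ⊤ := fun i => enSq_ne_top h0 hs1 (hu.1 i)
  have hfinJ : enSq s (fieldJ u 1) ≠ ⊤ := by
    have := hfin (1 + 1)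
    exact ne_top_of_le_ne_top (by finiteness) (enSq_fieldJ_le h0 hs1 hu.2.1 1)
  obtain ⟨F0, F1, b1, b0, hlim⟩ := hw.exists_flux_bound h0 le_rfl hu.2 hfin
  have f0 := hC u d F0 hu.2.1 hu.2.2.1 (hfin 1) (hlim 4 (by norm_num)).1
  have f1 := hC (fieldJ u) _ F1 (memLp_fieldJ hu.2.1) (memLp_comp_mapJ hu.2.2.1) hfinJ
    (hlim 4 (by norm_num)).2
  rw [l2Norm_comp_mapJ hu.2.2.1, anisoSeminorm_fieldJ] at f1
  have hroot : ∀ f g : ℝ × ℝ → ℝ, enSq s f ≤ 16 * enSq s g →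
      enSq s f ^ (1 / 2 : ℝ) ≤ 8 * sobolevNorm refTriangle s g := by
    intro f g hfg
    have h : enSq s f ≤ (8 * sobolevNorm refTriangle s g) ^ 2 := by
      refine hfg.trans ((mul_le_mul_right (enSq_le_sobolevNorm_sq h0 hs1 g) 16).trans (le_of_eq ?_))
      ring
    refine (ENNReal.rpow_le_rpow h (by norm_num)).trans (le_of_eq ?_)
    rw [← ENNReal.rpow_natCast, ← ENNReal.rpow_mul]
    norm_num
  have fin : ∀ (A B B' D : ℝ≥0∞), A ≤ C * (8 * B) + C * B' + 3 * D →
      A ≤ (max (8 * C) 3 : ℝ≥0) * (B + B' + D) := by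
    intro A B B' D h
    refine h.trans ?_
    have c1 : C ≤ max (8 * C) 3 := (le_mul_of_one_le_left' (by norm_num)).trans (le_max_left _ _)
    have c2 : (8 : ℝ≥0∞) * C ≤ (max (8 * C) 3 : ℝ≥0) := by
      exact_mod_cast le_max_left (8 * C) 3
    have c3 : (3 : ℝ≥0∞) ≤ (max (8 * C) 3 : ℝ≥0) := by
      exact_mod_cast le_max_right (8 * C) 3
    rw [mul_add, mul_add, ← mul_assoc, mul_comm (C : ℝ≥0∞) 8]
    gcongr
  refine fin _ _ _ _ ?_
  fin_cases l
  · refine b0.trans ?_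
    have := hroot (fieldJ u 1) (u 0) (enSq_fieldJ_le h0 hs1 hu.2.1 1)
    calc _ ≤ (C * (8 * sobolevNorm refTriangle s (u 0)) + C * anisoSeminorm s 1 (u 1) +
          l2Norm d) + 2 * l2Norm d := by
          refine add_le_add (f1.trans ?_) le_rfl
          gcongr
      _ = _ := by simp only [Fin.zero_eta, zero_add]; ring
  · refine b1.trans ?_
    have := hroot (u 1) (u 1) (le_mul_of_one_le_left' (by norm_num))
    calc _ ≤ (C * (8 * sobolevNorm refTriangle s (u 1)) + C * anisoSeminorm s 0 (u 0) +
          l2Norm d) + 2 * l2Norm d := by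
          refine add_le_add (f0.trans ?_) (le_mul_of_one_le_left' (by norm_num))
          gcongr
      _ = _ := by simp only [Fin.mk_one, Fin.reduceAdd]; ring

end RTTriangle

/-! ### Embedding of orders at least one into fractional orders. -/

namespace RTTriangle

/-! ### Weakly differentiable functions have fractional smoothness -/

/-- The points of the triangle which stay in the triangle under the translation by `h`. -/
def shiftDomain (h : ℝ × ℝ) : Set (ℝ × ℝ) := {x | x ∈ refTriangle ∧ x + h ∈ refTriangle}

theorem isOpen_shiftDomain (h : ℝ × ℝ) : IsOpen (shiftDomain h) :=
  isOpen_refTriangle.inter (isOpen_refTriangle.preimage (continuous_add_const h))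

theorem add_smul_mem_of_mem_shiftDomain {h x : ℝ × ℝ} (hx : x ∈ shiftDomain h) {t : ℝ}
    (ht : t ∈ Icc (0 : ℝ) 1) : x + t • h ∈ refTriangle := by
  obtain ⟨⟨a1, a2, a3, a4⟩, b1, b2, b3, b4⟩ := hx
  obtain ⟨t0, t1⟩ := ht
  simp only [Prod.fst_add, Prod.snd_add] at b1 b2 b3 b4
  have key : ∀ a b : ℝ, 0 < a → 0 < a + b → 0 < a + t * b := by
    intro a b ha hab
    rcases t0.eq_or_lt with rfl | t0
    · simpa using ha
    · nlinarith [mul_pos t0 hab, mul_nonneg (sub_nonneg.2 t1) ha.le]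
  have k2 := key (1 - x.1) (-h.1) (by linarith) (by linarith)
  have k4 := key (x.1 - x.2) (h.1 - h.2) (by linarith) (by linarith)
  refine ⟨key _ _ a1 b1, ?_, key _ _ a3 b3, ?_⟩ <;>
    simp only [Prod.fst_add, Prod.snd_add, Prod.smul_fst, Prod.smul_snd, smul_eq_mul] <;>
    linarith

theorem isTest_shift {h : ℝ × ℝ} {ψ : ℝ × ℝ → ℝ} (hψ : IsTest (shiftDomain h) ψ) {t : ℝ}
    (ht : t ∈ Icc (0 : ℝ) 1) : IsTest refTriangle fun x => ψ (x - t • h) := by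
  refine ⟨hψ.1.comp (contDiff_id.sub contDiff_const),
    hψ.2.1.comp_homeomorph (Homeomorph.subRight (t • h)), ?_⟩
  have e := tsupport_comp_eq_preimage ψ (Homeomorph.subRight (t • h))
  intro x hx
  have hx' : x - t • h ∈ tsupport ψ := by
    have : x ∈ tsupport (ψ ∘ Homeomorph.subRight (t • h)) := hx
    rw [e] at this
    exact this
  have := add_smul_mem_of_mem_shiftDomain (hψ.2.2 hx') ht
  rwa [sub_add_cancel] at this

theorem integrable_comp_add_smul {G : ℝ × ℝ → ℝ} (hGm : Measurable G) (hG : Integrable G)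
    (h : ℝ × ℝ) : Integrable (fun p : (ℝ × ℝ) × ℝ => G (p.1 + p.2 • h))
      ((volume : Measure (ℝ × ℝ)).prod (volume.restrict (Ioc (0 : ℝ) 1))) := by
  have hm : Measurable fun p : (ℝ × ℝ) × ℝ => G (p.1 + p.2 • h) := hGm.comp (by fun_prop)
  rw [integrable_prod_iff' hm.aestronglyMeasurable]
  refine ⟨Eventually.of_forall fun t => hG.comp_add_right (t • h), ?_⟩
  have e : ∀ t : ℝ, ∫ x : ℝ × ℝ, ‖G (x + t • h)‖ = ∫ x, ‖G x‖ := fun t =>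
    integral_add_right_eq_self (fun x => ‖G x‖) (t • h)
  simp only [e]
  exact integrable_const _

/-- A weakly differentiable function satisfies the fundamental theorem of calculus on segments. -/
theorem ae_shift_sub_eq {F G : ℝ × ℝ → ℝ} {h : ℝ × ℝ} (hF : Integrable F) (hGm : Measurable G)
    (hG : Integrable G)
    (hweak : ∀ ψ, IsTest refTriangle ψ → ∫ x, F x * fderiv ℝ ψ x h = -∫ x, G x * ψ x) :
    ∀ᵐ x, x ∈ shiftDomain h → F (x + h) - F x - ∫ t in Ioc (0 : ℝ) 1, G (x + t • h) = 0 := by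
  have hGp := integrable_comp_add_smul hGm hG h
  have hI : Integrable fun x => ∫ t in Ioc (0 : ℝ) 1, G (x + t • h) := hGp.integral_prod_left
  have hFh : Integrable fun x => F (x + h) := hF.comp_add_right h
  have hW : Integrable fun x => F (x + h) - F x - ∫ t in Ioc (0 : ℝ) 1, G (x + t • h) :=
    (hFh.sub hF).sub hI
  -- By duality: the translations are moved to the test function, whose increment is an integral of
  -- derivatives along the segment. By convexity each intermediate translate is still a test
  -- function of the triangle, so the weak derivative applies under the integral in `t`.
  refine (isOpen_shiftDomain h).ae_eq_zero_of_integral_contDiff_smul_eq_zero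
    (hW.locallyIntegrable.locallyIntegrableOn _) fun ψ h1 h2 h3 => ?_
  have hψ : IsTest (shiftDomain h) ψ := ⟨h1, h2, h3⟩
  obtain ⟨K, hK⟩ := h2.exists_bound_of_continuous h1.continuous
  obtain ⟨K', hK'⟩ := (h2.fderiv ℝ).exists_bound_of_continuous (h1.continuous_fderiv (by simp))
  have hmul : ∀ {g : ℝ × ℝ → ℝ}, Integrable g → Integrable fun x => ψ x * g x := fun hg =>
    hg.bdd_mul h1.continuous.aestronglyMeasurable (Eventually.of_forall hK)
  have hdc : Continuous fun p : (ℝ × ℝ) × ℝ => fderiv ℝ ψ (p.1 - p.2 • h) h := by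
    have := h1.continuous_fderiv (by simp)
    exact (this.comp (by fun_prop)).clm_apply continuous_const
  have hdp : Integrable (fun p : (ℝ × ℝ) × ℝ => fderiv ℝ ψ (p.1 - p.2 • h) h * F p.1)
      ((volume : Measure (ℝ × ℝ)).prod (volume.restrict (Ioc (0 : ℝ) 1))) := by
    have hF1 : Integrable (fun p : (ℝ × ℝ) × ℝ => F p.1)
        ((volume : Measure (ℝ × ℝ)).prod (volume.restrict (Ioc (0 : ℝ) 1))) := hF.comp_fst _
    refine hF1.bdd_mul (c := K' * ‖h‖) hdc.aestronglyMeasurable (Eventually.of_forall fun p => ?_)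
    exact ((fderiv ℝ ψ _).le_opNorm h).trans (by gcongr; exact hK' _)
  have hftc : ∀ x, ψ (x - h) - ψ x = -∫ t in Ioc (0 : ℝ) 1, fderiv ℝ ψ (x - t • h) h := by
    intro x
    have hd : ∀ t ∈ uIcc (0 : ℝ) 1, HasDerivAt (fun t : ℝ => ψ (x - t • h))
        (-(fderiv ℝ ψ (x - t • h) h)) t := by
      intro t _
      have e1 : HasDerivAt (fun t : ℝ => x - t • h) (-h) t := by
        have := ((hasDerivAt_id t).smul_const h).const_sub x
        simpa using this
      have e2 := ((h1.differentiable (by simp)).differentiableAt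
        (x := x - t • h)).hasFDerivAt.comp_hasDerivAt t e1
      rw [map_neg] at e2
      exact e2
    have hc : Continuous fun t : ℝ => -(fderiv ℝ ψ (x - t • h) h) :=
      (hdc.comp (Continuous.prodMk_right x)).neg
    have := intervalIntegral.integral_eq_sub_of_hasDerivAt hd (hc.intervalIntegrable _ _)
    rw [intervalIntegral.integral_of_le zero_le_one, integral_neg] at this
    rw [this]; simp
  have key : ∫ x, ψ x * (F (x + h) - F x) = ∫ x, ψ x * ∫ t in Ioc (0 : ℝ) 1, G (x + t • h) := by
    have s1 : ∫ x, ψ x * (F (x + h) - F x) = ∫ x, (ψ (x - h) - ψ x) * F x := by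
      have a1 : ∫ x, ψ x * F (x + h) = ∫ x, ψ (x - h) * F x := by
        rw [← integral_add_right_eq_self (fun x => ψ (x - h) * F x) h]
        simp only [add_sub_cancel_right]
      have a2 : Integrable fun x => ψ (x - h) * F x := by
        have := (hmul hFh).comp_sub_right h
        simpa using this
      simp only [mul_sub, sub_mul]
      rw [integral_sub (hmul hFh) (hmul hF), integral_sub a2 (hmul hF), a1]
    have s2 : ∫ x, (ψ (x - h) - ψ x) * F x =
        -∫ x, ∫ t in Ioc (0 : ℝ) 1, fderiv ℝ ψ (x - t • h) h * F x := by
      rw [← integral_neg]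
      congr 1; funext x
      rw [hftc, integral_mul_const, neg_mul]
    have s3 : ∀ t ∈ Ioc (0 : ℝ) 1, ∫ x, fderiv ℝ ψ (x - t • h) h * F x =
        -∫ x, ψ x * G (x + t • h) := by
      intro t ht
      have := hweak _ (isTest_shift hψ ⟨ht.1.le, ht.2⟩)
      simp only [fderiv_comp_sub] at this
      rw [← integral_add_right_eq_self (fun x => G x * ψ (x - t • h)) (t • h)] at this
      simp only [add_sub_cancel_right] at this
      simp only [mul_comm (ψ _), ← this, mul_comm (F _)]
    rw [s1, s2, integral_integral_swap hdp, setIntegral_congr_fun measurableSet_Ioc s3,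
      integral_neg, neg_neg]
    have hψG : Integrable (fun p : (ℝ × ℝ) × ℝ => ψ p.1 * G (p.1 + p.2 • h))
        ((volume : Measure (ℝ × ℝ)).prod (volume.restrict (Ioc (0 : ℝ) 1))) :=
      hGp.bdd_mul (h1.continuous.comp continuous_fst).aestronglyMeasurable
        (Eventually.of_forall fun p => hK p.1)
    rw [← integral_integral_swap hψG]
    simp only [integral_const_mul]
  have e : ∀ x, ψ x • (F (x + h) - F x - ∫ t in Ioc (0 : ℝ) 1, G (x + t • h)) =
      ψ x * (F (x + h) - F x) - ψ x * ∫ t in Ioc (0 : ℝ) 1, G (x + t • h) := fun x => by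
    rw [smul_eq_mul, mul_sub]
  simp only [e]
  have hd : Integrable fun x => ψ x * (F (x + h) - F x) := hmul (hFh.sub hF)
  rw [integral_sub hd (hmul hI), key, sub_self]

/-- Jensen's inequality in the segment parameter and translation invariance; working on `shiftDomain
h` avoids any extension operator. -/
theorem lintegral_shift_sub_sq_le {F G : ℝ × ℝ → ℝ} {h : ℝ × ℝ} (hF : Integrable F)
    (hGm : Measurable G) (hG : Integrable G)
    (hweak : ∀ ψ, IsTest refTriangle ψ → ∫ x, F x * fderiv ℝ ψ x h = -∫ x, G x * ψ x) :
    ∫⁻ x in shiftDomain h, ENNReal.ofReal ((F (x + h) - F x) ^ 2) ≤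
      ∫⁻ x, ENNReal.ofReal (G x ^ 2) := by
  have hm : Measurable fun p : (ℝ × ℝ) × ℝ => ENNReal.ofReal (G (p.1 + p.2 • h) ^ 2) :=
    ((hGm.comp (by fun_prop : Measurable fun p : (ℝ × ℝ) × ℝ => p.1 + p.2 • h)).pow_const
      2).ennreal_ofReal
  calc _ ≤ ∫⁻ x in shiftDomain h, ∫⁻ t in Ioc (0 : ℝ) 1, ENNReal.ofReal (G (x + t • h) ^ 2) := by
        refine lintegral_mono_ae ((ae_restrict_iff' (isOpen_shiftDomain h).measurableSet).2 ?_)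
        filter_upwards [ae_shift_sub_eq hF hGm hG hweak] with x hx hxs
        rw [sub_eq_zero.1 (hx hxs)]
        exact ofReal_integral_sq_le (by simp) (hGm.comp (by fun_prop)).aemeasurable
    _ ≤ ∫⁻ x, ∫⁻ t in Ioc (0 : ℝ) 1, ENNReal.ofReal (G (x + t • h) ^ 2) :=
        setLIntegral_le_lintegral _ _
    _ = ∫⁻ t in Ioc (0 : ℝ) 1, ∫⁻ x, ENNReal.ofReal (G (x + t • h) ^ 2) :=
        lintegral_lintegral_swap hm.aemeasurable
    _ = ∫⁻ _t in Ioc (0 : ℝ) 1, ∫⁻ x, ENNReal.ofReal (G x ^ 2) := by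
        congr 1; funext t
        exact lintegral_add_right_eq_self (fun x => ENNReal.ofReal (G x ^ 2)) (t • h)
    _ = _ := by simp

theorem semiSq_eq_lintegral_shift {F : ℝ × ℝ → ℝ} (hF : Measurable F) (σ : ℝ) :
    semiSq σ F = ∫⁻ h, ∫⁻ x in shiftDomain h,
      ENNReal.ofReal ((F (x + h) - F x) ^ 2) * ENNReal.ofReal (‖h‖ ^ (2 + 2 * σ))⁻¹ := by
  have hT := measurableSet_refTriangle
  have hS : MeasurableSet {p : (ℝ × ℝ) × (ℝ × ℝ) | p.1 ∈ refTriangle ∧ p.1 + p.2 ∈ refTriangle} :=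
    (measurable_fst hT).inter ((by fun_prop : Measurable fun p : (ℝ × ℝ) × (ℝ × ℝ) =>
      p.1 + p.2) hT)
  have hm : Measurable fun p : (ℝ × ℝ) × (ℝ × ℝ) =>
      {p : (ℝ × ℝ) × (ℝ × ℝ) | p.1 ∈ refTriangle ∧ p.1 + p.2 ∈ refTriangle}.indicator
        (fun p => ENNReal.ofReal ((F (p.1 + p.2) - F p.1) ^ 2) *
          ENNReal.ofReal (‖p.2‖ ^ (2 + 2 * σ))⁻¹) p :=
    Measurable.indicator (by fun_prop) hS
  have e1 : ∀ h, ∫⁻ x in shiftDomain h,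
      ENNReal.ofReal ((F (x + h) - F x) ^ 2) * ENNReal.ofReal (‖h‖ ^ (2 + 2 * σ))⁻¹ =
      ∫⁻ x, {p : (ℝ × ℝ) × (ℝ × ℝ) | p.1 ∈ refTriangle ∧ p.1 + p.2 ∈ refTriangle}.indicator
        (fun p => ENNReal.ofReal ((F (p.1 + p.2) - F p.1) ^ 2) *
          ENNReal.ofReal (‖p.2‖ ^ (2 + 2 * σ))⁻¹) (x, h) := by
    intro h
    rw [← lintegral_indicator (isOpen_shiftDomain h).measurableSet]
    rfl
  simp only [e1]
  rw [← lintegral_lintegral_swap hm.aemeasurable, semiSq, ← lintegral_indicator hT]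
  refine lintegral_congr fun x => ?_
  by_cases hx : x ∈ refTriangle
  · rw [indicator_of_mem hx, gagliardo, ← lintegral_indicator hT,
      ← lintegral_add_left_eq_self _ x]
    refine lintegral_congr fun h => ?_
    by_cases hxh : x + h ∈ refTriangle
    · rw [indicator_of_mem hxh, indicator_of_mem (show ((x, h) : (ℝ × ℝ) × (ℝ × ℝ)) ∈
        {p : (ℝ × ℝ) × (ℝ × ℝ) | p.1 ∈ refTriangle ∧ p.1 + p.2 ∈ refTriangle} from
        ⟨hx, hxh⟩), ← ofReal_div_eq, sub_sq_comm]
      simp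
    · rw [indicator_of_notMem hxh, indicator_of_notMem fun hc => hxh hc.2]
  · rw [indicator_of_notMem hx]
    symm
    rw [← lintegral_zero]
    congr 1; funext h
    exact indicator_of_notMem (fun hc => hx hc.1) _

/-- In the variable `h = Y - X` the squared increments over `shiftDomain h` are at most `‖h‖²` times
the squared norms of the derivatives, up to a factor `2`. The remaining kernel `‖h‖^(-2σ)` is
integrable for `‖h‖ ≤ 1`, and a larger shift moves the triangle off itself. -/
theorem exists_semiSq_le_of_weakDeriv {σ : ℝ} (h0 : 0 < σ) (h1 : σ < 1) :
    ∃ C : ℝ≥0, ∀ (f : ℝ × ℝ → ℝ) (g : Fin 2 → ℝ × ℝ → ℝ),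
      MemLp f 2 (volume.restrict refTriangle) →
      (∀ i, MemLp (g i) 2 (volume.restrict refTriangle)) →
      (∀ i ψ, IsTest refTriangle ψ → ∫ x in refTriangle, f x * pderiv i ψ x =
        -∫ x in refTriangle, g i x * ψ x) →
      semiSq σ f ≤ C * (l2Sq (g 0) + l2Sq (g 1)) := by
  obtain ⟨C, hC⟩ := exists_lintegral_min_kernel_le h0 h1
  refine ⟨2 * C, fun f g hf hg hw => ?_⟩
  have hT := measurableSet_refTriangle
  obtain ⟨f', hfm, hfe⟩ := hf.1.aemeasurable
  choose g' hgm hge using fun i => (hg i).1.aemeasurable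
  rw [semiSq_congr σ hfe, l2Sq_congr (hge 0), l2Sq_congr (hge 1)]
  have hw' : ∀ i ψ, IsTest refTriangle ψ → ∫ x in refTriangle, f' x * pderiv i ψ x =
      -∫ x in refTriangle, g' i x * ψ x := by
    intro i ψ hψ
    have e1 : ∫ x in refTriangle, f' x * pderiv i ψ x = ∫ x in refTriangle, f x * pderiv i ψ x := by
      refine integral_congr_ae ?_
      filter_upwards [hfe] with x hx; rw [hx]
    have e2 : ∫ x in refTriangle, g' i x * ψ x = ∫ x in refTriangle, g i x * ψ x := by
      refine integral_congr_ae ?_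
      filter_upwards [hge i] with x hx; rw [hx]
    rw [e1, e2, hw i ψ hψ]
  have hfL : MemLp f' 2 (volume.restrict refTriangle) := hf.ae_eq hfe
  have hgL : ∀ i, MemLp (g' i) 2 (volume.restrict refTriangle) := fun i => (hg i).ae_eq (hge i)
  clear hw hf hg hfe hge f g
  set F : ℝ × ℝ → ℝ := refTriangle.indicator f' with hFdef
  have hFT : ∀ x ∈ refTriangle, F x = f' x := fun x hx => indicator_of_mem hx _
  have hF : Integrable F := (integrable_indicator_iff hT).2 (hfL.integrable (by norm_num))
  have hFm : Measurable F := hfm.indicator hT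
  have hsF : semiSq σ f' = semiSq σ F := semiSq_congr σ
    ((ae_restrict_iff' hT).2 (Eventually.of_forall fun x hx => (hFT x hx).symm))
  rw [hsF, semiSq_eq_lintegral_shift hFm]
  set N := l2Sq (g' 0) + l2Sq (g' 1) with hN
  have hshift : ∀ h : ℝ × ℝ, ∫⁻ x in shiftDomain h, ENNReal.ofReal ((F (x + h) - F x) ^ 2) ≤
      ENNReal.ofReal (‖h‖ ^ 2) * (2 * N) := by
    intro h
    set G : ℝ × ℝ → ℝ := refTriangle.indicator fun x => h.1 * g' 0 x + h.2 * g' 1 x with hG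
    have hGm : Measurable G := by
      have m0 := hgm 0
      have m1 := hgm 1
      exact Measurable.indicator (by fun_prop) hT
    have hgI : ∀ i, Integrable (g' i) (volume.restrict refTriangle) := fun i =>
      (hgL i).integrable (by norm_num)
    have hGI : Integrable G := (integrable_indicator_iff hT).2
      (((hgI 0).const_mul h.1).add ((hgI 1).const_mul h.2))
    have hweak : ∀ ψ, IsTest refTriangle ψ → ∫ x, F x * fderiv ℝ ψ x h = -∫ x, G x * ψ x := by
      intro ψ hψ
      have hh : h = h.1 • basisVec 0 + h.2 • basisVec 1 := by ext <;> simp [basisVec]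
      have d1 : ∀ x, fderiv ℝ ψ x h = h.1 * pderiv 0 ψ x + h.2 * pderiv 1 ψ x := by
        intro x
        conv_lhs => rw [hh]
        rw [map_add, map_smul, map_smul]
        rfl
      have e1 : ∫ x, F x * fderiv ℝ ψ x h = ∫ x in refTriangle, f' x * fderiv ℝ ψ x h := by
        rw [← integral_indicator hT]
        congr 1; funext x
        by_cases hx : x ∈ refTriangle <;> simp [hFdef, hx]
      have e2 : ∫ x, G x * ψ x = ∫ x in refTriangle, (h.1 * g' 0 x + h.2 * g' 1 x) * ψ x := by
        rw [← integral_indicator hT]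
        congr 1; funext x
        by_cases hx : x ∈ refTriangle <;> simp [hG, hx]
      have i1 := fun i => integrable_mul_pderiv hfL hψ.1 i
      have i2 : ∀ i, Integrable (fun x => g' i x * ψ x) (volume.restrict refTriangle) := fun i =>
        (hgL i).integrable_mul (memLp_contDiff hψ.1 2)
      have e3 : ∫ x in refTriangle, f' x * fderiv ℝ ψ x h =
          h.1 * (∫ x in refTriangle, f' x * pderiv 0 ψ x) +
          h.2 * ∫ x in refTriangle, f' x * pderiv 1 ψ x := by
        rw [← integral_const_mul, ← integral_const_mul, ← integral_add ((i1 0).const_mul _)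
          ((i1 1).const_mul _)]
        congr 1; funext x
        rw [d1]; ring
      have e4 : ∫ x in refTriangle, (h.1 * g' 0 x + h.2 * g' 1 x) * ψ x =
          h.1 * (∫ x in refTriangle, g' 0 x * ψ x) + h.2 * ∫ x in refTriangle, g' 1 x * ψ x := by
        rw [← integral_const_mul, ← integral_const_mul, ← integral_add ((i2 0).const_mul _)
          ((i2 1).const_mul _)]
        congr 1; funext x
        ring
      rw [e1, e2, e3, e4, hw' 0 ψ hψ, hw' 1 ψ hψ]
      ring
    refine (lintegral_shift_sub_sq_le hF hGm hGI hweak).trans ?_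
    have n1 : |h.1| ≤ ‖h‖ := norm_fst_le h
    have n2 : |h.2| ≤ ‖h‖ := norm_snd_le h
    calc ∫⁻ x, ENNReal.ofReal (G x ^ 2)
        = ∫⁻ x in refTriangle, ENNReal.ofReal ((h.1 * g' 0 x + h.2 * g' 1 x) ^ 2) := by
          rw [← lintegral_indicator hT]
          refine lintegral_congr fun x => ?_
          by_cases hx : x ∈ refTriangle
          · rw [indicator_of_mem hx, hG, indicator_of_mem hx]
          · rw [indicator_of_notMem hx, hG, indicator_of_notMem hx]; simp
      _ ≤ ∫⁻ x in refTriangle, (ENNReal.ofReal (‖h‖ ^ 2) * 2 * ENNReal.ofReal (g' 0 x ^ 2) +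
          ENNReal.ofReal (‖h‖ ^ 2) * 2 * ENNReal.ofReal (g' 1 x ^ 2)) := by
          refine lintegral_mono fun x => ?_
          refine (ofReal_add_sq_le _ _).trans ?_
          have hb : ∀ a b : ℝ, |a| ≤ ‖h‖ →
              2 * ENNReal.ofReal ((a * b) ^ 2) ≤
                ENNReal.ofReal (‖h‖ ^ 2) * 2 * ENNReal.ofReal (b ^ 2) := by
            intro a b hab
            rw [mul_pow, ENNReal.ofReal_mul (sq_nonneg _), mul_comm (ENNReal.ofReal (‖h‖ ^ 2)),
              mul_assoc]
            gcongr 2 * (ENNReal.ofReal ?_ * _)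
            rw [← sq_abs]
            exact pow_le_pow_left₀ (abs_nonneg _) hab 2
          exact add_le_add (hb _ _ n1) (hb _ _ n2)
      _ = ENNReal.ofReal (‖h‖ ^ 2) * (2 * N) := by
          have m0 := hgm 0
          rw [lintegral_add_left (by fun_prop), lintegral_const_mul' _ _ (by finiteness),
            lintegral_const_mul' _ _ (by finiteness)]
          change _ * l2Sq (g' 0) + _ * l2Sq (g' 1) = _
          rw [hN]; ring
  calc _ ≤ ∫⁻ h : ℝ × ℝ, ENNReal.ofReal (min 1 (‖h - 0‖ / 1) ^ 2 / ‖h - 0‖ ^ (2 + 2 * σ)) *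
        (2 * N) := by
        refine lintegral_mono fun h => ?_
        rw [lintegral_mul_const' _ _ ENNReal.ofReal_ne_top]
        rcases le_or_gt ‖h‖ 1 with hle | hgt
        · rw [sub_zero, div_one, min_eq_right hle, ofReal_div_eq]
          refine (mul_le_mul_left (hshift h) _).trans (le_of_eq ?_)
          ring
        · have : shiftDomain h = ∅ := by
            refine eq_empty_of_forall_notMem fun x hx => ?_
            have := norm_sub_le_one hx.2 hx.1
            rw [add_sub_cancel_left] at this
            linarith
          rw [this]; simp
    _ = (∫⁻ h : ℝ × ℝ, ENNReal.ofReal (min 1 (‖h - 0‖ / 1) ^ 2 / ‖h - 0‖ ^ (2 + 2 * σ))) *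
        (2 * N) := lintegral_mul_const _ (by fun_prop)
    _ ≤ (C * ENNReal.ofReal (1 ^ (-(2 * σ)))) * (2 * N) := by
        gcongr
        exact hC 0 1 one_pos
    _ = _ := by
        rw [Real.one_rpow, ENNReal.ofReal_one]
        push_cast
        ring

theorem exists_enSq_le_sobolevNorm_sq_of_one_le {σ s : ℝ} (h0 : 0 < σ) (h1 : σ < 1) (hs : 1 ≤ s) :
    ∃ C : ℝ≥0, ∀ f, enSq σ f ≤ C * sobolevNorm refTriangle s f ^ 2 := by
  obtain ⟨C, hC⟩ := exists_semiSq_le_of_weakDeriv h0 h1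
  refine ⟨C + 1, fun f => ?_⟩
  have hfl : 1 ≤ ⌊s⌋₊ := Nat.one_le_floor_iff _ |>.2 hs
  unfold sobolevNorm
  rw [← ENNReal.rpow_natCast, ← ENNReal.rpow_mul]
  norm_num
  -- The constant is moved to the left so that the bound can be checked for each family of
  -- derivatives under the infimum.
  rw [mul_comm, ← ENNReal.div_le_iff (by simp) (by finiteness)]
  refine le_iInf₂ fun D hD => ?_
  rw [ENNReal.div_le_iff (by simp) (by finiteness)]
  have hf : MemLp f 2 (volume.restrict refTriangle) := by
    have := (hD.2 (0, 0) (by simp)).1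
    rwa [hD.1] at this
  have d0 := hD.2 (1, 0) (by simpa using hfl)
  have d1 := hD.2 (0, 1) (by simpa using hfl)
  have hs := hC f ![D (1, 0), D (0, 1)] hf (fun i => by
    fin_cases i
    · exact d0.1
    · exact d1.1) (fun i ψ hψ => by
    fin_cases i
    · simpa [multiDeriv] using d0.2 ψ hψ
    · simpa [multiDeriv] using d1.2 ψ hψ)
  have hsum : l2Sq f + (l2Sq (D (1, 0)) + l2Sq (D (0, 1))) ≤
      ∑ k ∈ Finset.range (⌊s⌋₊ + 1), ∑ α ∈ Finset.HasAntidiagonal.antidiagonal k,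
        (eLpNorm (D α) 2 (volume.restrict refTriangle)) ^ 2 := by
    -- Only the orders zero and one are used; `s ≥ 1` ensures that both occur.
    have hsub : Finset.range 2 ⊆ Finset.range (⌊s⌋₊ + 1) :=
      Finset.range_subset_range.2 (by omega)
    refine le_trans (le_of_eq ?_) (Finset.sum_le_sum_of_subset hsub)
    rw [Finset.sum_range_succ, Finset.sum_range_one, Finset.Nat.antidiagonal_zero,
      Finset.sum_singleton, hD.1, l2Sq_eq, l2Sq_eq, l2Sq_eq, Finset.Nat.antidiagonal_succ]
    simp [add_comm]
  have hle := hsum.trans (le_self_add (b := if s = ⌊s⌋₊ then 0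
      else ∑ α ∈ Finset.HasAntidiagonal.antidiagonal ⌊s⌋₊,
        slobodeckijSq refTriangle (s - ⌊s⌋₊) (D α)))
  calc enSq σ f ≤ l2Sq f + C * (l2Sq (D (1, 0)) + l2Sq (D (0, 1))) := add_le_add le_rfl hs
    _ ≤ (l2Sq f + (l2Sq (D (1, 0)) + l2Sq (D (0, 1)))) * (C + 1) := by
        have key : ∀ A G c : ℝ≥0∞, A + c * G ≤ (A + G) * (c + 1) := fun A G c => by
          calc A + c * G ≤ (A + c * G) + (A * c + G) := le_self_add
            _ = _ := by ring
        exact key _ _ _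
    _ ≤ _ := by
        rw [mul_comm, mul_comm _ (C + 1 : ℝ≥0∞)]
        exact mul_le_mul_right hle _

end RTTriangle

/-! ### Reduction of all orders to fractional ones and conclusion. -/

namespace RTTriangle

/-- `H^s` is embedded in a fractional space of order less than one, which has to be of order
greater than one half if `s` is. -/
theorem exists_fractional_embedding {s : ℝ} (hs : 0 < s) :
    ∃ (σ : ℝ) (M : ℝ≥0), 0 < σ ∧ σ < 1 ∧ σ ≤ s ∧ (1 / 2 < s → 1 / 2 < σ) ∧
      ∀ f, enSq σ f ≤ M * sobolevNorm refTriangle s f ^ 2 := by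
  rcases lt_or_ge s 1 with h | h
  · exact ⟨s, 4, hs, h, le_rfl, id, fun f => by simpa using enSq_le_sobolevNorm_sq hs h f⟩
  -- Any order strictly between `1/2` and `1` would serve.
  · obtain ⟨M, hM⟩ := exists_enSq_le_sobolevNorm_sq_of_one_le (σ := 3 / 4) (by norm_num)
      (by norm_num) h
    exact ⟨3 / 4, M, by norm_num, by norm_num, by linarith, fun _ => by norm_num, hM⟩

end RTTriangle

theorem theorem5p2 (s : ℝ) (hs : 0 < s) :
    (∀ (u : Fin 2 → ℝ × ℝ → ℝ) (d : ℝ × ℝ → ℝ), RTTriangle.IsAdmissible s u d →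
      ∃! w, RTTriangle.IsRTInterpolant s u d w) ∧
    (1 / 2 < s → ∃ C : ℝ≥0, ∀ (u : Fin 2 → ℝ × ℝ → ℝ) (d : ℝ × ℝ → ℝ) (w : Fin 2 → ℝ × ℝ → ℝ),
      RTTriangle.IsAdmissible s u d → RTTriangle.IsRTInterpolant s u d w → ∀ l : Fin 2,
        RTTriangle.l2Norm (w l) ≤
          C * (RTTriangle.sobolevNorm RTTriangle.refTriangle s (u l) + RTTriangle.l2Norm d)) ∧
    (s ≤ 1 / 2 → ∃ C : ℝ≥0, ∀ (u : Fin 2 → ℝ × ℝ → ℝ) (d : ℝ × ℝ → ℝ) (w : Fin 2 → ℝ × ℝ → ℝ),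
      RTTriangle.IsAdmissible s u d → RTTriangle.IsRTInterpolant s u d w → ∀ l : Fin 2,
        RTTriangle.l2Norm (w l) ≤
          C * (RTTriangle.sobolevNorm RTTriangle.refTriangle s (u l) +
            RTTriangle.anisoSeminorm s (l + 1) (u (l + 1)) + RTTriangle.l2Norm d)) := by
  obtain ⟨σ, M, hσ0, hσ1, hσs, hhalf, hM⟩ := RTTriangle.exists_fractional_embedding hs
  refine ⟨fun u d hu => RTTriangle.existsUnique_isRTInterpolant hσ0 hσs hu.2 fun i => ?_,
    fun h => RTTriangle.exists_l2Norm_le_of_half_lt (hhalf h) hσ1 hσs M hM,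
    fun h => RTTriangle.exists_l2Norm_le_of_le_half hs h⟩
  have := (hu.1 i).2
  exact ne_top_of_le_ne_top (by finiteness) (hM _)
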